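/- Let $K$ be an oriented link, i.e. an equivalence class of (nonempty) oriented link diagrams under planar isotopy and the Reidemeister moves. For a diagram $D$ let $c(D)$ and $c_-(D)$ be the numbers of all and of negative crossings, $w(D)=c(D)-2c_-(D)$ the writhe, and $v_A(D)$ the number of circles in the all-$A$ Kauffman state. Let $\langle D\rangle\in\mathbb Z[A^{\pm1}]$ be the Kauffman bracket, $\langle D\rangle=\sum_{\sigma}A^{a(\sigma)-b(\sigma)}(-A^2-A^{-2})^{|\sigma|-1}$, where $\sigma$ runs over the Kauffman states, $a(\sigma)$ and $b(\sigma)$ are the numbers of $A$- and $B$-resolutions in $\sigma$, and $|\sigma|$ is the number of circles of $\sigma$. Put $M(D)=c(D)+2v_A(D)-2$, let $a_M(D)$ and $a_{M-1}(D)$ be the coefficients of $A^{M(D)}$ and of $A^{M(D)-4}$ in $\langle D\rangle$, and let $D^n$ be the diagram of $n$ parallel copies of $D$ (blackboard framing). Let $\mathcal D(K)$ be the set of diagrams of $K$ that minimize $(c_-(D),\,c(D),\,v_A(D)-w(D))$ lexicographically among all diagrams of $K$. For $D\in\mathcal D(K)$ and $n>2$ put $$\alpha(D,n)=|a_M(D)\,a_M(D^n)|,\qquad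 \beta(D,n)=|a_M(D)\,a_{M-1}(D^n)|,$$ where $a_M(D^n)$ and $a_{M-1}(D^n)$ are the coefficients of $A^{M(D^n)}$ and of $A^{M(D^n)-4}$ in $\langle D^n\rangle$. Then there is a unique integer $\alpha_K$ such that $\alpha(D,n)=\alpha_K$ for all $D\in\mathcal D(K)$ and all $n>2$. If, moreover, in every $D\in\mathcal D(K)$ each component of the link runs through at least one crossing of $D$ (that is, no component of $D$ is a crossing-free circle), then there is a unique integer $\beta_K$ such that $\beta(D,n)=\beta_K$ for all $D\in\mathcal D(K)$ and all $n>2$. So $\alpha(D,n)$ and $\beta(D,n)$ do not depend on $D\in\mathcal D(K)$ and on $n$, and $\alpha_K$, $\beta_K$ are invariants of $K$. -/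

import Mathlib

open scoped LaurentPolynomial

namespace LinkDiagram

/-! ## Oriented link diagrams in the plane

A link diagram in general position with respect to the height function is cut by horizontal lines
into slices, each of which contains exactly one cup (local minimum), one cap (local maximum) or one
crossing, with vertical strands to its left and to its right.  Diagrams are read from bottom to top.
A strand meeting a horizontal line carries a `Bool`: `true` if it is oriented upwards there, and
`false` if it is oriented downwards. -/

/-- The elementary pieces.
* `cup b`: a local minimum, with left leg oriented by `b` (so the right leg is oriented by `!b`).
* `cap b`: a local maximum, with left leg oriented by `b`.
* `cross o a b`: a crossing of the strand from bottom left to top right, oriented by `a`, and the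
  strand from bottom right to top left, oriented by `b`.  The former strand passes over the latter
  if `o = true`, and under it if `o = false`. -/
inductive Piece : Type
  | cup (b : Bool)
  | cap (b : Bool)
  | cross (o a b : Bool)
  deriving DecidableEq

/-- The orientations of the strands at the bottom of a piece, from left to right. -/
def Piece.source : Piece → List Bool
  | .cup _ => []
  | .cap b => [b, !b]
  | .cross _ a b => [a, b]

/-- The orientations of the strands at the top of a piece, from left to right. -/
def Piece.target : Piece → List Bool
  | .cup b => [b, !b]
  | .cap _ => []
  | .cross _ a b => [b, a]

/-- Whether a piece is a crossing. -/
def Piece.isCrossing : Piece → Bool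
  | .cross _ _ _ => true
  | _ => false

/-- Whether a piece is a negative crossing.  The crossing of two upward strands is positive if the
strand from bottom left to top right is the over strand; reversing one strand or exchanging over
and under changes the sign. -/
def Piece.isNegative : Piece → Bool
  | .cross o a b => o != (a == b)
  | _ => false

/-- A slice: one piece, with vertical strands oriented as in `left` to its left and vertical
strands oriented as in `right` to its right. -/
structure Slice : Type where
  left : List Bool
  piece : Piece
  right : List Bool
  deriving DecidableEq

/-- The strands at the bottom of a slice. -/
def Slice.source (s : Slice) : List Bool := s.left ++ s.piece.source ++ s.right

/-- The strands at the top of a slice. -/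
def Slice.target (s : Slice) : List Bool := s.left ++ s.piece.target ++ s.right

/-- A stack of slices, from bottom to top. -/
abbrev Word : Type := List Slice

/-- `IsTangle x W y`: consecutive slices of `W` fit together, the strands at the bottom of `W` are
`x`, and the strands at its top are `y`. -/
def IsTangle : List Bool → Word → List Bool → Prop
  | x, [], y => x = y
  | x, s :: W, y => x = s.source ∧ IsTangle s.target W y

/-- A (nonempty) oriented link diagram: a nonempty stack of slices that fit together, without
strands at the bottom and at the top. -/
structure Diagram : Type where
  word : Word
  nonempty : word ≠ []
  closed : IsTangle [] word []

/-! ## Links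

Links are diagrams up to planar isotopy and Reidemeister moves.  In each move below, `l` and `r`
are the strands to the left and to the right of the place where the move happens. -/

open Piece in
/-- The elementary moves, for all orientations. -/
inductive Move : Word → Word → Prop
  /-- Planar isotopy: change the order of the heights of two pieces, one of which is to the left of
  the other, with strands `m` between them. -/
  | exchange (l m r : List Bool) (g h : Piece) :
      Move [⟨l, g, m ++ h.source ++ r⟩, ⟨l ++ g.target ++ m, h, r⟩]
        [⟨l ++ g.source ++ m, h, r⟩, ⟨l, g, m ++ h.target ++ r⟩]
  /-- Planar isotopy: straighten a zigzag. -/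
  | zigzag (l r : List Bool) (a : Bool) :
      Move [⟨l ++ [a], cup (!a), r⟩, ⟨l, cap a, [a] ++ r⟩] []
  /-- Planar isotopy: straighten a zigzag in the other direction. -/
  | zagzig (l r : List Bool) (a : Bool) :
      Move [⟨l, cup a, [a] ++ r⟩, ⟨l ++ [a], cap (!a), r⟩] []
  /-- Planar isotopy: a strand `a` that crosses the left leg of a cup is made to cross the right
  leg. -/
  | cupSlide (l r : List Bool) (o a c : Bool) :
      Move [⟨l ++ [a], cup c, r⟩, ⟨l, cross o a c, [!c] ++ r⟩]
        [⟨l, cup c, [a] ++ r⟩, ⟨l ++ [c], cross (!o) (!c) a, r⟩]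
  /-- Planar isotopy: a strand `a` that crosses the left leg of a cap is made to cross the right
  leg. -/
  | capSlide (l r : List Bool) (o a c : Bool) :
      Move [⟨l, cross o c a, [!c] ++ r⟩, ⟨l ++ [a], cap c, r⟩]
        [⟨l ++ [c], cross (!o) a (!c), r⟩, ⟨l, cap c, [a] ++ r⟩]
  /-- First Reidemeister move, at a cup. -/
  | cupTwist (l r : List Bool) (o b : Bool) :
      Move [⟨l, cup b, r⟩, ⟨l, cross o b (!b), r⟩] [⟨l, cup (!b), r⟩]
  /-- First Reidemeister move, at a cap. -/
  | capTwist (l r : List Bool) (o b : Bool) :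
      Move [⟨l, cross o b (!b), r⟩, ⟨l, cap (!b), r⟩] [⟨l, cap b, r⟩]
  /-- Second Reidemeister move. -/
  | two (l r : List Bool) (o a b : Bool) :
      Move [⟨l, cross o a b, r⟩, ⟨l, cross (!o) b a, r⟩] []
  /-- Third Reidemeister move, for strands `a`, `b`, `c`.  The bits `ab`, `ac`, `bc` say whether `a`
  is over `b`, `a` is over `c`, `b` is over `c`; the hypothesis says that these relations are not
  cyclic, so that one strand is on top, one is in the middle and one is at the bottom. -/
  | three (l r : List Bool) (a b c ab ac bc : Bool) (h : ab = bc → ac = ab) :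
      Move [⟨l, cross ab a b, [c] ++ r⟩, ⟨l ++ [b], cross ac a c, r⟩, ⟨l, cross bc b c, [a] ++ r⟩]
        [⟨l ++ [a], cross bc b c, r⟩, ⟨l, cross ac a c, [b] ++ r⟩, ⟨l ++ [c], cross ab a b, r⟩]

/-- Two diagrams differ by one elementary move, performed between the slices `P` below and the
slices `Q` above. -/
def Step (D D' : Diagram) : Prop :=
  ∃ P X Y Q : Word, Move X Y ∧ D.word = P ++ X ++ Q ∧ D'.word = P ++ Y ++ Q

/-- Oriented links: the equivalence classes of diagrams for the equivalence relation generated by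
the elementary moves. -/
def Link : Type := Quot Step

/-- The set of all diagrams of a link. -/
def diagrams (K : Link) : Set Diagram := {D | Quot.mk Step D = K}

/-! ## Curves and state circles -/

/-- The number of strands on the horizontal line number `k`, which is the bottom of the slice
number `k`.  (There are no strands at the top of a diagram.) -/
def width (W : Word) (k : ℕ) : ℕ := (W[k]?.map fun s => s.source.length).getD 0

/-- The points in which a diagram meets the horizontal lines between its slices: `(k, i)` is the
point number `i`, from left to right, on the line number `k`.  Numbering starts with `0`. -/
def Point (W : Word) : Type := {x : ℕ × ℕ // x.2 < width W x.1}

/-- What is done to a crossing: it is left alone, or replaced by two vertical arcs `)(`, or replaced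
by a cap below a cup. -/
inductive Resolution : Type
  | keep
  | vertical
  | horizontal

/-- `Joins s ρ k x y`: the points `x` and `y` are the end points of an arc in the slice `s`, which
lies between the lines `k` and `k + 1`, after applying `ρ` if the slice has a crossing. -/
inductive Joins (s : Slice) (ρ : Resolution) (k : ℕ) : ℕ × ℕ → ℕ × ℕ → Prop
  | left (i : ℕ) (hi : i < s.left.length) : Joins s ρ k (k, i) (k + 1, i)
  | right (i : ℕ) (hi : i < s.right.length) :
      Joins s ρ k (k, s.left.length + s.piece.source.length + i)
        (k + 1, s.left.length + s.piece.target.length + i)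
  | cup (b : Bool) (h : s.piece = .cup b) :
      Joins s ρ k (k + 1, s.left.length) (k + 1, s.left.length + 1)
  | cap (b : Bool) (h : s.piece = .cap b) :
      Joins s ρ k (k, s.left.length) (k, s.left.length + 1)
  | keep₁ (o a b : Bool) (h : s.piece = .cross o a b) (hρ : ρ = .keep) :
      Joins s ρ k (k, s.left.length) (k + 1, s.left.length + 1)
  | keep₂ (o a b : Bool) (h : s.piece = .cross o a b) (hρ : ρ = .keep) :
      Joins s ρ k (k, s.left.length + 1) (k + 1, s.left.length)
  | vertical₁ (o a b : Bool) (h : s.piece = .cross o a b) (hρ : ρ = .vertical) :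
      Joins s ρ k (k, s.left.length) (k + 1, s.left.length)
  | vertical₂ (o a b : Bool) (h : s.piece = .cross o a b) (hρ : ρ = .vertical) :
      Joins s ρ k (k, s.left.length + 1) (k + 1, s.left.length + 1)
  | horizontal₁ (o a b : Bool) (h : s.piece = .cross o a b) (hρ : ρ = .horizontal) :
      Joins s ρ k (k, s.left.length) (k, s.left.length + 1)
  | horizontal₂ (o a b : Bool) (h : s.piece = .cross o a b) (hρ : ρ = .horizontal) :
      Joins s ρ k (k + 1, s.left.length) (k + 1, s.left.length + 1)

/-- Two points of a diagram are joined by an arc in some slice, after resolving the crossing in the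
slice number `k` (if there is one) by `ρ k`, for all `k`. -/
def Adjacent (W : Word) (ρ : ℕ → Resolution) (x y : Point W) : Prop :=
  ∃ (k : ℕ) (s : Slice), W[k]? = some s ∧ Joins s (ρ k) k x.1 y.1

/-- The closed curves that result from resolving the crossings by `ρ`. -/
def Curves (W : Word) (ρ : ℕ → Resolution) : Type := Quot (Adjacent W ρ)

/-- The set of the crossings, given by the numbers of their slices. -/
def crossings (W : Word) : Finset ℕ :=
  (Finset.range W.length).filter fun k => (W[k]?.map fun s => s.piece.isCrossing) = some true

/-- The Kauffman state in which the crossings in `H` get the `B`-resolution and all other crossings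
get the `A`-resolution.  The `A`-resolution opens the channel between the two regions that the over
strand sweeps out when it is rotated counterclockwise; for the over strand from bottom left to top
right, it consists of two vertical arcs. -/
def state (W : Word) (H : Finset ℕ) (k : ℕ) : Resolution :=
  match W[k]?.map Slice.piece with
  | some (.cross o _ _) => if (o = true ↔ k ∉ H) then .vertical else .horizontal
  | _ => .keep

/-- The number of state circles of a Kauffman state. -/
noncomputable def circles (W : Word) (H : Finset ℕ) : ℕ := Nat.card (Curves W (state W H))

/-- Every closed curve (every link component) of the diagram runs through at least one crossing;
in other words, no component of the diagram is a circle without crossings. -/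
def EveryCurveCrosses (W : Word) : Prop :=
  ∀ x : Point W, ∃ (y : Point W) (s : Slice), W[y.1.1]? = some s ∧ s.piece.isCrossing = true ∧
    (y.1.2 = s.left.length ∨ y.1.2 = s.left.length + 1) ∧
    (Quot.mk _ x : Curves W fun _ => .keep) = Quot.mk _ y

/-! ## Kauffman bracket -/

/-- The number of crossings. -/
def c (W : Word) : ℕ := (crossings W).card

/-- The number of negative crossings. -/
def cNeg (W : Word) : ℕ := W.countP fun s => s.piece.isNegative

/-- The writhe: the number of positive crossings minus the number of negative crossings. -/
def writhe (W : Word) : ℤ := ((c W : ℤ) - cNeg W) - cNeg W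

/-- The number of state circles of the all-`A` state. -/
noncomputable def vA (W : Word) : ℕ := circles W ∅

/-- The Kauffman bracket in the variable `A = T 1`, with value `1` on a circle without crossings,
as a state sum.  The state in which the crossings in `H` get the `B`-resolution contributes
`A ^ (number of A-resolutions - number of B-resolutions)` times
`(- A ^ 2 - A ^ (-2)) ^ (number of circles - 1)`. -/
noncomputable def bracket (W : Word) : ℤ[T;T⁻¹] :=
  ∑ H ∈ (crossings W).powerset,
    LaurentPolynomial.T ((c W : ℤ) - 2 * H.card) *
      (-LaurentPolynomial.T 2 - LaurentPolynomial.T (-2)) ^ (circles W H - 1)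

/-- The upper bound `M` for the degree of the Kauffman bracket: the all-`A` state graph has one edge
for each crossing and one vertex for each state circle. -/
noncomputable def M (W : Word) : ℤ := c W + 2 * vA W - 2

/-- `coeffM W j` is the coefficient `a_{M-j}`: the coefficient number `j + 1` of the Kauffman
bracket, starting from degree `M`.  As the degrees of the monomials of the bracket are congruent to
`M` modulo `4`, it belongs to `A ^ (M - 4 j)`. -/
noncomputable def coeffM (W : Word) (j : ℕ) : ℤ := (bracket W).coeff (M W - 4 * j)

/-! ## Parallels -/

/-- Replace each strand by `n` parallel strands. -/
def parallelStrands (n : ℕ) (x : List Bool) : List Bool := x.flatMap (List.replicate n)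

/-- Replace each strand of a slice by `n` parallel strands: a cup becomes `n` nested cups, a cap
becomes `n` nested caps, and a crossing becomes a grid of `n * n` crossings of the same kind. -/
def parallelSlice (n : ℕ) (s : Slice) : Word :=
  let l := parallelStrands n s.left
  let r := parallelStrands n s.right
  match s.piece with
  | .cup b => (List.range n).map fun j =>
      ⟨l ++ List.replicate j b, .cup b, List.replicate j (!b) ++ r⟩
  | .cap b => (List.range n).reverse.map fun j =>
      ⟨l ++ List.replicate j b, .cap b, List.replicate j (!b) ++ r⟩
  | .cross o a b => (List.range n).flatMap fun i => (List.range n).map fun j =>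
      ⟨l ++ List.replicate (n - 1 - i) a ++ List.replicate j b, .cross o a b,
        List.replicate (n - 1 - j) b ++ List.replicate i a ++ r⟩

/-- The diagram `D ^ n` of `n` parallel copies of `D` (with respect to the blackboard framing). -/
def parallel (W : Word) (n : ℕ) : Word := W.flatMap (parallelSlice n)

/-! ## Minimal diagrams -/

/-- The diagrams of `K` with the least number of negative crossings. -/
def minNegDiagrams (K : Link) : Set Diagram :=
  {D ∈ diagrams K | ∀ D' ∈ diagrams K, cNeg D.word ≤ cNeg D'.word}

/-- The diagrams with the least number of crossings among those with the least number of negative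
crossings. -/
def minCrossingDiagrams (K : Link) : Set Diagram :=
  {D ∈ minNegDiagrams K | ∀ D' ∈ minNegDiagrams K, c D.word ≤ c D'.word}

/-- The set `𝒟(K)` of the diagrams of `K` that minimize the complexity
`(c₋(D), c(D), v_A(D) - w(D))` in the lexicographic order. -/
def minDiagrams (K : Link) : Set Diagram :=
  {D ∈ minCrossingDiagrams K | ∀ D' ∈ minCrossingDiagrams K,
    (vA D.word : ℤ) - writhe D.word ≤ (vA D'.word : ℤ) - writhe D'.word}

/-- `α(D, n) = |a_M(D) a_M(D ^ n)|`. -/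
noncomputable def alpha (D : Diagram) (n : ℕ) : ℤ :=
  |coeffM D.word 0 * coeffM (parallel D.word n) 0|

/-- `β(D, n) = |a_M(D) a_{M-1}(D ^ n)|`. -/
noncomputable def beta (D : Diagram) (n : ℕ) : ℤ :=
  |coeffM D.word 0 * coeffM (parallel D.word n) 1|

end LinkDiagram

open scoped LaurentPolynomial

namespace LinkDiagram

/-! Call a diagram `Adequate` if no crossing joins a circle of its all-A state to itself, and let
`numPairs` count the pairs of circles joined by crossings. The theorem rests on two facts. For n >
2, α(D, n) is 1 or 0 according to whether D is adequate, and β(D, n) is |v_A(D) − 1 − numPairs(D)|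
for adequate D and 0 otherwise (`alpha_eq`, `beta_eq`). Moreover, adequacy, and `numPairs` for
adequate diagrams, agree for all D in 𝒟(K) (`adequate_iff_of_diagrams`).

The values come from counting circles by linear algebra over the field with two elements. The number
of circles of a state is the dimension of the space of labelings constant along its arcs
(`finrank_flows`). Freeing a crossing drops one linear equation, and resolving it again imposes
either the A-equation or the B-equation. Planarity enters through conservation of sums along
horizontal lines (`flow_at_last_crossing`), through `legs_not_all_connected`, and through a
checkerboard colouring of the regions (`side_const`). It follows that a crossing between different
circles merges them, that crossings joining the same two circles split circles after the first
merger, and that a chord of a single circle splits it as long as the other side of the circle is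
undisturbed. A state with B-set H reaches the top degree of the bracket only if it has v_A + |H|
circles. For adequate diagrams only H = ∅ does so, and the next coefficient is carried by H = ∅ and
by the bundles of crossings joining one pair of circles, which give v_A − 1 − numPairs up to sign.

The all-A state of the n-parallel consists of n parallel copies of each circle. Its crossings lie
between neighbouring copies of one circle, or between the two facing copies at an original crossing.
So adequacy is inherited and v_A − numPairs does not change. If D is not adequate, a self-chord in
the parallel has only neighbouring copies on its other side, so it can be toggled freely and the
first coefficient cancels. If in addition a_M(D) ≠ 0, then D has self-chords of both colours; for n
> 2 the crossings that could obstruct the two toggles are too far apart to interact, and the second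
coefficient cancels as well.

Independence of D comes from a second invariant, a state sum over nowhere zero flows with values in
an elementary abelian 2-group with z + 1/z + 2 elements, in the manner of the Yamada polynomial. A
crossing is expanded as z times its A-resolution plus 1/z times its B-resolution minus a 4-valent
vertex. The sum is invariant up to a power of z given by the writhe (`stateSum_eq_of_diagrams`), the
third Reidemeister move being the identity `hexSum_flip`. As the group grows, the count of nowhere
zero flows is governed by the dimension of the space of flows. Divided by z^(c + v_A), the state sum
tends to 1 or 0 according to adequacy (`tendsto_leading`), and for adequate diagrams the next term
is −numPairs (`tendsto_second`). Diagrams in 𝒟(K) share writhe, c and v_A, so their state sums and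
normalizations coincide, and the limits can be compared. -/

/-! ### Closed words and their points -/

/-- Consecutive slices have matching numbers of strands, and there are no strands at the bottom and
at the top. -/
structure Closed (W : Word) : Prop where
  bottom : width W 0 = 0
  next : ∀ k s, W[k]? = some s → s.target.length = width W (k + 1)

theorem width_eq {W : Word} {k : ℕ} {s : Slice} (h : W[k]? = some s) :
    width W k = s.source.length := by simp [width, h]

theorem Slice.length_source (s : Slice) :
    s.source.length = s.left.length + s.piece.source.length + s.right.length := by
  simp [Slice.source]; omega

theorem Slice.length_target (s : Slice) :
    s.target.length = s.left.length + s.piece.target.length + s.right.length := by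
  simp [Slice.target]; omega

theorem width_of_le {W : Word} {k : ℕ} (h : W.length ≤ k) : width W k = 0 := by
  simp [width, List.getElem?_eq_none h]

theorem exists_slice {W : Word} {k : ℕ} (h : k < W.length) : ∃ s, W[k]? = some s :=
  ⟨W[k], by simp [h]⟩

theorem lt_of_slice {W : Word} {k : ℕ} {s : Slice} (h : W[k]? = some s) : k < W.length := by
  by_contra h'
  simp [List.getElem?_eq_none (not_lt.1 h')] at h

theorem mem_crossings {W : Word} {k : ℕ} :
    k ∈ crossings W ↔ ∃ s o a b, W[k]? = some s ∧ s.piece = .cross o a b := by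
  simp only [crossings, Finset.mem_filter, Finset.mem_range]
  constructor
  · rintro ⟨hk, h⟩
    obtain ⟨s, hs⟩ := exists_slice hk
    rw [hs] at h
    simp only [Option.map_some, Option.some.injEq] at h
    refine ⟨s, ?_⟩
    cases hp : s.piece with
    | cup b => simp [hp, Piece.isCrossing] at h
    | cap b => simp [hp, Piece.isCrossing] at h
    | cross o a b => exact ⟨o, a, b, hs, rfl⟩
  · rintro ⟨s, o, a, b, hs, hp⟩
    exact ⟨lt_of_slice hs, by simp [hs, hp, Piece.isCrossing]⟩

theorem finite_point (W : Word) : Finite (Point W) := by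
  have : {x : ℕ × ℕ | x.2 < width W x.1}.Finite := by
    apply ((Finset.range W.length).biUnion fun k =>
      (Finset.range (width W k)).image fun i => (k, i)).finite_toSet.subset
    rintro ⟨k, i⟩ hx
    simp only [Set.mem_ofPred_eq] at hx
    have hk : k < W.length := by
      by_contra h
      rw [width_of_le (not_lt.1 h)] at hx
      omega
    simp only [Finset.coe_biUnion, Set.mem_iUnion, Finset.coe_image, Set.mem_image,
      Finset.mem_coe, Finset.mem_range]
    exact ⟨k, hk, i, hx, rfl⟩
  exact this.to_subtype

instance (W : Word) : Finite (Point W) := finite_point W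

noncomputable instance (W : Word) : Fintype (Point W) := Fintype.ofFinite _

instance (W : Word) (ρ : ℕ → Resolution) : Finite (Curves W ρ) :=
  Finite.of_surjective (Quot.mk _) Quot.mk_surjective

noncomputable instance (W : Word) (ρ : ℕ → Resolution) : Fintype (Curves W ρ) := Fintype.ofFinite _

/-- The position of the leftmost leg of the piece in the slice number `k`. -/
def pos (W : Word) (k : ℕ) : ℕ := (W[k]?.map fun s => s.left.length).getD 0

/-- Whether the `A`-resolution of the crossing number `k` consists of two vertical arcs. -/
def aVert (W : Word) (k : ℕ) : Bool :=
  match W[k]?.map Slice.piece with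
  | some (.cross o _ _) => o
  | _ => true

theorem pos_eq {W : Word} {k : ℕ} {s : Slice} (h : W[k]? = some s) : pos W k = s.left.length := by
  simp [pos, h]

theorem aVert_eq {W : Word} {k : ℕ} {s : Slice} {o a b : Bool} (h : W[k]? = some s)
    (hp : s.piece = .cross o a b) : aVert W k = o := by
  simp [aVert, h, hp]

theorem state_eq {W : Word} {k : ℕ} {H : Finset ℕ} (hk : k ∈ crossings W) :
    state W H k = if (aVert W k = true ↔ k ∉ H) then .vertical else .horizontal := by
  obtain ⟨s, o, a, b, hs, hp⟩ := mem_crossings.1 hk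
  rw [aVert_eq hs hp]
  simp [state, hs, hp]

theorem Closed.pos_lt {W : Word} {k : ℕ} (hk : k ∈ crossings W) :
    pos W k + 1 < width W k := by
  obtain ⟨s, o, a, b, hs, hp⟩ := mem_crossings.1 hk
  rw [pos_eq hs, width_eq hs, Slice.length_source, hp]
  simp [Piece.source]; omega

theorem Closed.pos_lt' {W : Word} (hW : Closed W) {k : ℕ} (hk : k ∈ crossings W) :
    pos W k + 1 < width W (k + 1) := by
  obtain ⟨s, o, a, b, hs, hp⟩ := mem_crossings.1 hk
  rw [pos_eq hs, ← hW.next k s hs, Slice.length_target, hp]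
  simp [Piece.target]; omega

/-! ### Labelings of points -/

section Labels

variable {L : Type*}

/-- The labels `u` at the bottom and `v` at the top of a slice agree along all arcs of the slice
which do not belong to a crossing. -/
structure Outer (s : Slice) (u v : ℕ → L) : Prop where
  left : ∀ i < s.left.length, u i = v i
  right : ∀ i < s.right.length,
    u (s.left.length + s.piece.source.length + i) = v (s.left.length + s.piece.target.length + i)
  cup : ∀ b, s.piece = .cup b → v s.left.length = v (s.left.length + 1)
  cap : ∀ b, s.piece = .cap b → u s.left.length = u (s.left.length + 1)

/-- The labels agree along the arcs outside of the crossings. -/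
def IsOuter (W : Word) (f : ℕ → ℕ → L) : Prop :=
  ∀ k s, W[k]? = some s → Outer s (f k) (f (k + 1))

/-- The labels agree along the two vertical arcs that may replace a crossing. -/
def VertRel (W : Word) (f : ℕ → ℕ → L) (k : ℕ) : Prop :=
  f k (pos W k) = f (k + 1) (pos W k) ∧ f k (pos W k + 1) = f (k + 1) (pos W k + 1)

/-- The labels agree along the two horizontal arcs that may replace a crossing. -/
def HorRel (W : Word) (f : ℕ → ℕ → L) (k : ℕ) : Prop :=
  f k (pos W k) = f k (pos W k + 1) ∧ f (k + 1) (pos W k) = f (k + 1) (pos W k + 1)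

/-- The labels agree along the arcs of the `A`-resolution. -/
def ARel (W : Word) (f : ℕ → ℕ → L) (k : ℕ) : Prop :=
  if aVert W k = true then VertRel W f k else HorRel W f k

/-- The labels agree along the arcs of the `B`-resolution. -/
def BRel (W : Word) (f : ℕ → ℕ → L) (k : ℕ) : Prop :=
  if aVert W k = true then HorRel W f k else VertRel W f k

/-- Extend labels of points by the label `d`. -/
def ext (W : Word) (d : L) (f : Point W → L) (k i : ℕ) : L :=
  if h : i < width W k then f ⟨(k, i), h⟩ else d

theorem ext_of_lt {W : Word} (d : L) (f : Point W → L) {k i : ℕ} (h : i < width W k) :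
    ext W d f k i = f ⟨(k, i), h⟩ := by simp [ext, h]

theorem ext_point {W : Word} (d : L) (f : Point W → L) (p : Point W) :
    ext W d f p.1.1 p.1.2 = f p := ext_of_lt d f p.2

theorem outer_ext {W : Word} (hW : Closed W) {ρ : Resolution} (d : L) {f : Point W → L} {k : ℕ}
    {s : Slice} (hs : W[k]? = some s) (hf : ∀ x y : Point W, Joins s ρ k x.1 y.1 → f x = f y) :
    Outer s (ext W d f k) (ext W d f (k + 1)) := by
  have h1 := width_eq hs
  have h2 := hW.next k s hs
  rw [Slice.length_source] at h1
  rw [Slice.length_target] at h2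
  constructor
  · intro i hi
    rw [ext_of_lt d f (by omega), ext_of_lt d f (by omega)]
    exact hf _ _ (.left i hi)
  · intro i hi
    rw [ext_of_lt d f (by omega), ext_of_lt d f (by omega)]
    exact hf _ _ (.right i hi)
  · intro b hb
    have : s.piece.target.length = 2 := by simp [hb, Piece.target]
    rw [ext_of_lt d f (by omega), ext_of_lt d f (by omega)]
    exact hf _ _ (.cup b hb)
  · intro b hb
    have : s.piece.source.length = 2 := by simp [hb, Piece.source]
    rw [ext_of_lt d f (by omega), ext_of_lt d f (by omega)]
    exact hf _ _ (.cap b hb)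

theorem vertRel_ext {W : Word} (hW : Closed W) {ρ : Resolution} (d : L) {f : Point W → L} {k : ℕ}
    {s : Slice} (hs : W[k]? = some s) (hf : ∀ x y : Point W, Joins s ρ k x.1 y.1 → f x = f y)
    (hk : k ∈ crossings W) (hρ : ρ = .vertical) : VertRel W (ext W d f) k := by
  obtain ⟨s', o, a, b, hs', hp⟩ := mem_crossings.1 hk
  obtain rfl : s = s' := Option.some.inj (hs.symm.trans hs')
  have h1 := Closed.pos_lt hk
  have h2 := hW.pos_lt' hk
  constructor
  · rw [ext_of_lt d f (by omega), ext_of_lt d f (by omega)]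
    exact hf _ _ (by simpa only [pos_eq hs] using .vertical₁ o a b hp hρ)
  · rw [ext_of_lt d f (by omega), ext_of_lt d f (by omega)]
    exact hf _ _ (by simpa only [pos_eq hs] using .vertical₂ o a b hp hρ)

theorem horRel_ext {W : Word} (hW : Closed W) {ρ : Resolution} (d : L) {f : Point W → L} {k : ℕ}
    {s : Slice} (hs : W[k]? = some s) (hf : ∀ x y : Point W, Joins s ρ k x.1 y.1 → f x = f y)
    (hk : k ∈ crossings W) (hρ : ρ = .horizontal) : HorRel W (ext W d f) k := by
  obtain ⟨s', o, a, b, hs', hp⟩ := mem_crossings.1 hk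
  obtain rfl : s = s' := Option.some.inj (hs.symm.trans hs')
  have h1 := Closed.pos_lt hk
  have h2 := hW.pos_lt' hk
  constructor
  · rw [ext_of_lt d f (by omega), ext_of_lt d f (by omega)]
    exact hf _ _ (by simpa only [pos_eq hs] using .horizontal₁ o a b hp hρ)
  · rw [ext_of_lt d f (by omega), ext_of_lt d f (by omega)]
    exact hf _ _ (by simpa only [pos_eq hs] using .horizontal₂ o a b hp hρ)

/-- Labels compatible with the pieces one by one descend to the curves of the state. With the
converse `labels_ext`, this turns questions about curves into linear equations at the crossings. -/
theorem adjacent_state {W : Word} {f : ℕ → ℕ → L} {H : Finset ℕ} (h : IsOuter W f)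
    (hA : ∀ k ∈ crossings W, k ∉ H → ARel W f k) (hB : ∀ k ∈ crossings W, k ∈ H → BRel W f k)
    {x y : Point W} (hxy : Adjacent W (state W H) x y) : f x.1.1 x.1.2 = f y.1.1 y.1.2 := by
  obtain ⟨⟨k', i'⟩, hx⟩ := x
  obtain ⟨⟨k'', i''⟩, hy⟩ := y
  obtain ⟨k, s, hs, hj⟩ := hxy
  have ho := h k s hs
  have key : ∀ o a b, s.piece = .cross o a b → k ∈ crossings W := fun o a b hp =>
    mem_crossings.2 ⟨s, o, a, b, hs, hp⟩
  have hV : ∀ o a b, s.piece = .cross o a b → state W H k = .vertical → VertRel W f k := by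
    intro o a b hp hst
    have hk := key o a b hp
    have h1 := hA k hk
    have h2 := hB k hk
    rw [state_eq hk] at hst
    simp only [ARel, BRel] at h1 h2
    by_cases hkH : k ∈ H <;> cases hov : aVert W k <;> simp_all
  have hH : ∀ o a b, s.piece = .cross o a b → state W H k = .horizontal → HorRel W f k := by
    intro o a b hp hst
    have hk := key o a b hp
    have h1 := hA k hk
    have h2 := hB k hk
    rw [state_eq hk] at hst
    simp only [ARel, BRel] at h1 h2
    by_cases hkH : k ∈ H <;> cases hov : aVert W k <;> simp_all
  have hK : ∀ o a b, s.piece = .cross o a b → state W H k ≠ .keep := by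
    intro o a b hp
    rw [state_eq (key o a b hp)]
    split_ifs <;> simp
  have hpos := pos_eq hs
  cases hj with
  | left _ hi => exact ho.left _ hi
  | right i hi => exact ho.right i hi
  | cup b hb => exact ho.cup b hb
  | cap b hb => exact ho.cap b hb
  | keep₁ o a b hp hρ => exact absurd hρ (hK o a b hp)
  | keep₂ o a b hp hρ => exact absurd hρ (hK o a b hp)
  | vertical₁ o a b hp hρ => simpa only [hpos] using (hV o a b hp hρ).1
  | vertical₂ o a b hp hρ => simpa only [hpos] using (hV o a b hp hρ).2
  | horizontal₁ o a b hp hρ => simpa only [hpos] using (hH o a b hp hρ).1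
  | horizontal₂ o a b hp hρ => simpa only [hpos] using (hH o a b hp hρ).2

theorem aRel_ext {W : Word} (hW : Closed W) {H : Finset ℕ} (d : L) {f : Point W → L} {k : ℕ}
    {s : Slice} (hs : W[k]? = some s)
    (hf : ∀ x y : Point W, Joins s (state W H k) k x.1 y.1 → f x = f y) (hk : k ∈ crossings W)
    (hkH : k ∉ H) : ARel W (ext W d f) k := by
  unfold ARel
  split_ifs with h
  · exact vertRel_ext hW d hs hf hk (by simp [state_eq hk, h, hkH])
  · exact horRel_ext hW d hs hf hk (by simp [state_eq hk, h, hkH])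

theorem bRel_ext {W : Word} (hW : Closed W) {H : Finset ℕ} (d : L) {f : Point W → L} {k : ℕ}
    {s : Slice} (hs : W[k]? = some s)
    (hf : ∀ x y : Point W, Joins s (state W H k) k x.1 y.1 → f x = f y) (hk : k ∈ crossings W)
    (hkH : k ∈ H) : BRel W (ext W d f) k := by
  unfold BRel
  split_ifs with h
  · exact horRel_ext hW d hs hf hk (by simp [state_eq hk, h, hkH])
  · exact vertRel_ext hW d hs hf hk (by simp [state_eq hk, h, hkH])

/-- Converse of `adjacent_state`. The default label `d` does not interfere, because in a closed word
the relations involve only positions of actual points. -/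
theorem labels_ext {W : Word} (hW : Closed W) {H : Finset ℕ} (d : L) {f : Point W → L}
    (hf : ∀ x y, Adjacent W (state W H) x y → f x = f y) :
    IsOuter W (ext W d f) ∧ (∀ k ∈ crossings W, k ∉ H → ARel W (ext W d f) k) ∧
      ∀ k ∈ crossings W, k ∈ H → BRel W (ext W d f) k := by
  refine ⟨fun k s hs => outer_ext hW d hs fun x y h => hf x y ⟨k, s, hs, h⟩, fun k hk hkH => ?_,
    fun k hk hkH => ?_⟩ <;> obtain ⟨s, -, -, -, hs, -⟩ := mem_crossings.1 hk
  · exact aRel_ext hW d hs (fun x y h => hf x y ⟨k, s, hs, h⟩) hk hkH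
  · exact bRel_ext hW d hs (fun x y h => hf x y ⟨k, s, hs, h⟩) hk hkH

end Labels

/-! ### Flows with values in the field with two elements -/

/-- At every crossing, the sum of the labels of the legs vanishes. -/
def IsFlow (W : Word) (f : ℕ → ℕ → ZMod 2) : Prop :=
  IsOuter W f ∧ ∀ k ∈ crossings W,
    f k (pos W k) + f k (pos W k + 1) = f (k + 1) (pos W k) + f (k + 1) (pos W k + 1)

/-- The difference of the labels of the two ends of an arc of the `A`-resolution. -/
def aDiff (W : Word) (k : ℕ) (f : ℕ → ℕ → ZMod 2) : ZMod 2 :=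
  if aVert W k = true then f k (pos W k) + f (k + 1) (pos W k)
  else f k (pos W k) + f k (pos W k + 1)

/-- The difference of the labels of the two ends of an arc of the `B`-resolution. -/
def bDiff (W : Word) (k : ℕ) (f : ℕ → ℕ → ZMod 2) : ZMod 2 :=
  if aVert W k = true then f k (pos W k) + f k (pos W k + 1)
  else f k (pos W k) + f (k + 1) (pos W k)

/-- Given the flow condition, equality along one arc of a resolution forces equality along the
other. A single scalar equation therefore expresses each resolution, and `aDiff` and `bDiff` need to
test only one arc. -/
theorem two_elements (a b c d : ZMod 2) (h : a + b = c + d) :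
    (a + c = 0 ↔ a = c ∧ b = d) ∧ (a + b = 0 ↔ a = b ∧ c = d) := by
  revert a b c d; decide

theorem IsFlow.aRel_iff {W : Word} {f : ℕ → ℕ → ZMod 2} (hf : IsFlow W f) {k : ℕ}
    (hk : k ∈ crossings W) : ARel W f k ↔ aDiff W k f = 0 := by
  have h := two_elements _ _ _ _ (hf.2 k hk)
  unfold ARel aDiff VertRel HorRel
  split_ifs
  · exact h.1.symm
  · exact h.2.symm

theorem IsFlow.bRel_iff {W : Word} {f : ℕ → ℕ → ZMod 2} (hf : IsFlow W f) {k : ℕ}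
    (hk : k ∈ crossings W) : BRel W f k ↔ bDiff W k f = 0 := by
  have h := two_elements _ _ _ _ (hf.2 k hk)
  unfold BRel bDiff VertRel HorRel
  split_ifs
  · exact h.2.symm
  · exact h.1.symm

theorem sum_eq_of_rel {W : Word} {f : ℕ → ℕ → ZMod 2} {k : ℕ} (h : ARel W f k ∨ BRel W f k) :
    f k (pos W k) + f k (pos W k + 1) = f (k + 1) (pos W k) + f (k + 1) (pos W k + 1) := by
  have e (a b : ZMod 2) : a + a = b + b := by revert a b; decide
  unfold ARel BRel VertRel HorRel at h
  split_ifs at h <;> rcases h with ⟨h1, h2⟩ | ⟨h1, h2⟩ <;> rw [h1, h2] <;> apply e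

/-- Extension by zero. -/
def ext₀ (W : Word) : (Point W → ZMod 2) →ₗ[ZMod 2] (ℕ → ℕ → ZMod 2) where
  toFun f := ext W 0 f
  map_add' f g := by
    funext k i
    by_cases h : i < width W k
    · simp only [ext, Pi.add_apply, dif_pos h]; rfl
    · simp only [ext, Pi.add_apply, dif_neg h, add_zero]
  map_smul' c f := by
    funext k i
    by_cases h : i < width W k
    · simp only [ext, Pi.smul_apply, RingHom.id_apply, dif_pos h]; rfl
    · simp only [ext, Pi.smul_apply, RingHom.id_apply, dif_neg h, smul_zero]

theorem ext₀_apply (W : Word) (f : Point W → ZMod 2) : ext₀ W f = ext W 0 f := rfl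

theorem IsFlow.add {W : Word} {f g : ℕ → ℕ → ZMod 2} (hf : IsFlow W f) (hg : IsFlow W g) :
    IsFlow W (f + g) := by
  refine ⟨fun k s hs => ?_, fun k hk => ?_⟩
  · have h1 := hf.1 k s hs
    have h2 := hg.1 k s hs
    constructor
    · intro i hi; simp [h1.left i hi, h2.left i hi]
    · intro i hi; simp [h1.right i hi, h2.right i hi]
    · intro b hb; simp [h1.cup b hb, h2.cup b hb]
    · intro b hb; simp [h1.cap b hb, h2.cap b hb]
  · have h1 := hf.2 k hk
    have h2 := hg.2 k hk
    simp only [Pi.add_apply]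
    linear_combination h1 + h2

theorem isFlow_zero (W : Word) : IsFlow W 0 :=
  ⟨fun _ _ _ => ⟨by simp, by simp, by simp, by simp⟩, by simp⟩

theorem aDiff_add (W : Word) (k : ℕ) (f g : ℕ → ℕ → ZMod 2) :
    aDiff W k (f + g) = aDiff W k f + aDiff W k g := by
  unfold aDiff; split_ifs <;> simp only [Pi.add_apply] <;> ring

theorem bDiff_add (W : Word) (k : ℕ) (f g : ℕ → ℕ → ZMod 2) :
    bDiff W k (f + g) = bDiff W k f + bDiff W k g := by
  unfold bDiff; split_ifs <;> simp only [Pi.add_apply] <;> ring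

theorem aDiff_smul (W : Word) (k : ℕ) (c : ZMod 2) (f : ℕ → ℕ → ZMod 2) :
    aDiff W k (c • f) = c • aDiff W k f := by
  unfold aDiff; split_ifs <;> simp only [Pi.smul_apply, smul_eq_mul] <;> ring

theorem bDiff_smul (W : Word) (k : ℕ) (c : ZMod 2) (f : ℕ → ℕ → ZMod 2) :
    bDiff W k (c • f) = c • bDiff W k f := by
  unfold bDiff; split_ifs <;> simp only [Pi.smul_apply, smul_eq_mul] <;> ring

/-- `aDiff` as a linear functional. -/
def aDiffₗ (W : Word) (k : ℕ) : (Point W → ZMod 2) →ₗ[ZMod 2] ZMod 2 where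
  toFun f := aDiff W k (ext₀ W f)
  map_add' f g := by rw [map_add, aDiff_add]
  map_smul' c f := by rw [map_smul, aDiff_smul, RingHom.id_apply]

/-- `bDiff` as a linear functional. -/
def bDiffₗ (W : Word) (k : ℕ) : (Point W → ZMod 2) →ₗ[ZMod 2] ZMod 2 where
  toFun f := bDiff W k (ext₀ W f)
  map_add' f g := by rw [map_add, bDiff_add]
  map_smul' c f := by rw [map_smul, bDiff_smul, RingHom.id_apply]

/-- The flows which respect the `A`-resolution of the crossings outside of `B` and `X`, and the
`B`-resolution of the crossings in `B` outside of `X`. -/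
def flows (W : Word) (B X : Finset ℕ) : Submodule (ZMod 2) (Point W → ZMod 2) where
  carrier := {f | IsFlow W (ext₀ W f) ∧ ∀ k ∈ crossings W, k ∉ X →
    (k ∉ B → aDiffₗ W k f = 0) ∧ (k ∈ B → bDiffₗ W k f = 0)}
  add_mem' := by
    rintro f g ⟨hf, hf'⟩ ⟨hg, hg'⟩
    refine ⟨by rw [map_add]; exact hf.add hg, fun k hk hX => ⟨fun h => ?_, fun h => ?_⟩⟩
    · rw [map_add, (hf' k hk hX).1 h, (hg' k hk hX).1 h, add_zero]
    · rw [map_add, (hf' k hk hX).2 h, (hg' k hk hX).2 h, add_zero]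
  zero_mem' := ⟨by rw [map_zero]; exact isFlow_zero W, fun k hk hX => by simp⟩
  smul_mem' := by
    rintro c f ⟨hf, hf'⟩
    refine ⟨?_, fun k hk hX => ⟨fun h => ?_, fun h => ?_⟩⟩
    · have : c = 0 ∨ c = 1 := by revert c; decide
      rcases this with rfl | rfl
      · rw [zero_smul, map_zero]; exact isFlow_zero W
      · rwa [one_smul]
    · rw [map_smul, (hf' k hk hX).1 h, smul_zero]
    · rw [map_smul, (hf' k hk hX).2 h, smul_zero]

theorem mem_flows {W : Word} {B X : Finset ℕ} {f : Point W → ZMod 2} :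
    f ∈ flows W B X ↔ IsFlow W (ext₀ W f) ∧ ∀ k ∈ crossings W, k ∉ X →
      (k ∉ B → aDiffₗ W k f = 0) ∧ (k ∈ B → bDiffₗ W k f = 0) := Iff.rfl

/-- With no crossing freed, the flow condition is a consequence of the arcs, since every resolution
pairs the four legs of a crossing. -/
theorem mem_flows_empty {W : Word} (hW : Closed W) {H : Finset ℕ} {f : Point W → ZMod 2} :
    f ∈ flows W H ∅ ↔ ∀ x y, Adjacent W (state W H) x y → f x = f y := by
  constructor
  · rintro ⟨h, h'⟩ x y hxy
    have := adjacent_state (f := ext W 0 f) h.1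
      (fun k hk hkH => (h.aRel_iff hk).2 ((h' k hk (by simp)).1 hkH))
      (fun k hk hkH => (h.bRel_iff hk).2 ((h' k hk (by simp)).2 hkH)) hxy
    rwa [ext_point, ext_point] at this
  · intro h
    obtain ⟨hO, hA, hB⟩ := labels_ext hW 0 h
    have hf : IsFlow W (ext₀ W f) := ⟨hO, fun k hk => sum_eq_of_rel (by
      by_cases hkH : k ∈ H
      · exact .inr (hB k hk hkH)
      · exact .inl (hA k hk hkH))⟩
    exact ⟨hf, fun k hk _ => ⟨fun hkH => (hf.aRel_iff hk).1 (hA k hk hkH),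
      fun hkH => (hf.bRel_iff hk).1 (hB k hk hkH)⟩⟩

/-- A function constant along the arcs is a function on the set of curves, so a number of circles
becomes a dimension. -/
theorem finrank_flows {W : Word} (hW : Closed W) (H : Finset ℕ) :
    Module.finrank (ZMod 2) (flows W H ∅) = circles W H := by
  let e : (Curves W (state W H) → ZMod 2) ≃ₗ[ZMod 2] flows W H ∅ :=
    { toFun := fun φ => ⟨fun p => φ (Quot.mk _ p), (mem_flows_empty hW).2 fun x y h => by
        rw [Quot.sound h]⟩
      map_add' := fun _ _ => rfl
      map_smul' := fun _ _ => rfl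
      invFun := fun f => Quot.lift f.1 ((mem_flows_empty hW).1 f.2)
      left_inv := fun φ => by funext q; induction q using Quot.ind; rfl
      right_inv := fun f => rfl }
  rw [← e.finrank_eq, Module.finrank_pi, circles, Nat.card_eq_fintype_card]

/-! ### Conservation of sums along lines -/

theorem sum_range_left {s : Slice} {u v : ℕ → ZMod 2} (h : Outer s u v) {i : ℕ}
    (hi : i ≤ s.left.length) : ∑ j ∈ Finset.range i, u j = ∑ j ∈ Finset.range i, v j :=
  Finset.sum_congr rfl fun j hj => h.left j ((Finset.mem_range.1 hj).trans_le hi)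

/-- A cup or cap creates or removes two equal labels, which cancel modulo 2, and at a crossing `hc`
preserves the sum. -/
theorem sum_range_right {s : Slice} {u v : ℕ → ZMod 2} (h : Outer s u v)
    (hc : s.piece.isCrossing = true → u s.left.length + u (s.left.length + 1) =
      v s.left.length + v (s.left.length + 1)) {i : ℕ} (hi : i ≤ s.right.length) :
    ∑ j ∈ Finset.range (s.left.length + s.piece.source.length + i), u j =
      ∑ j ∈ Finset.range (s.left.length + s.piece.target.length + i), v j := by
  have e (a : ZMod 2) : a + a = 0 := by revert a; decide
  have hR := Finset.sum_congr (rfl : Finset.range i = _)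
    fun j hj => h.right j ((Finset.mem_range.1 hj).trans_le hi)
  rw [Finset.sum_range_add, Finset.sum_range_add, Finset.sum_range_add, Finset.sum_range_add,
    sum_range_left h le_rfl, hR]
  congr 2
  cases hp : s.piece with
  | cup b => simp [Piece.source, Piece.target, Finset.sum_range_succ, ← h.cup b hp, e]
  | cap b => simp [Piece.source, Piece.target, Finset.sum_range_succ, ← h.cap b hp, e]
  | cross o a b =>
    simpa [Piece.source, Piece.target, Finset.sum_range_succ] using hc (by simp [hp, Piece.isCrossing])

theorem sum_range_outer {s : Slice} {u v : ℕ → ZMod 2} (h : Outer s u v)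
    (hc : s.piece.isCrossing = true → u s.left.length + u (s.left.length + 1) =
      v s.left.length + v (s.left.length + 1)) :
    ∑ i ∈ Finset.range s.source.length, u i = ∑ i ∈ Finset.range s.target.length, v i := by
  rw [Slice.length_source, Slice.length_target]
  exact sum_range_right h hc le_rfl

/-- If the flow condition holds at all crossings but one, it holds at this crossing, too. -/
theorem flow_at_last_crossing {W : Word} (hW : Closed W) {f : ℕ → ℕ → ZMod 2} (hf : IsOuter W f)
    {x : ℕ} (hx : x ∈ crossings W) (h : ∀ k ∈ crossings W, k ≠ x →
      f k (pos W k) + f k (pos W k + 1) = f (k + 1) (pos W k) + f (k + 1) (pos W k + 1)) :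
    f x (pos W x) + f x (pos W x + 1) = f (x + 1) (pos W x) + f (x + 1) (pos W x + 1) := by
  -- The sum of the labels on a line is zero below and above the diagram, and every slice except `x`
  -- preserves it. Hence slice `x` preserves it as well.
  have step : ∀ k, k < W.length → k ≠ x → ∑ i ∈ Finset.range (width W k), f k i =
      ∑ i ∈ Finset.range (width W (k + 1)), f (k + 1) i := by
    intro k hk hkx
    obtain ⟨s, hs⟩ := exists_slice hk
    rw [width_eq hs, ← hW.next k s hs]
    apply sum_range_outer (hf k s hs)
    intro hc
    have : k ∈ crossings W := by
      simp only [crossings, Finset.mem_filter, Finset.mem_range]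
      exact ⟨hk, by rw [hs, Option.map_some, hc]⟩
    simpa [pos_eq hs] using h k this hkx
  have below : ∀ k, k ≤ x → ∑ i ∈ Finset.range (width W k), f k i = 0 := by
    intro k
    induction k with
    | zero => intro _; simp [hW.bottom]
    | succ k ih =>
      intro hk
      have := lt_of_slice (mem_crossings.1 hx).choose_spec.choose_spec.choose_spec.choose_spec.1
      rw [← step k (by omega) (by omega), ih (by omega)]
  have above : ∀ j k, k + j = W.length → x < k → ∑ i ∈ Finset.range (width W k), f k i = 0 := by
    intro j
    induction j with
    | zero => intro k hk _; rw [width_of_le (by omega)]; simp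
    | succ j ih =>
      intro k hk hxk
      rw [step k (by omega) (by omega), ih (k + 1) (by omega) (by omega)]
  obtain ⟨s, o, a, b, hs, hp⟩ := mem_crossings.1 hx
  have hxl := lt_of_slice hs
  have h1 := below x le_rfl
  have h2 := above (W.length - (x + 1)) (x + 1) (by omega) (by omega)
  have ho := hf x s hs
  have hL : ∑ i ∈ Finset.range s.left.length, f x i =
      ∑ i ∈ Finset.range s.left.length, f (x + 1) i :=
    Finset.sum_congr rfl fun i hi => ho.left i (Finset.mem_range.1 hi)
  have hR := Finset.sum_congr (rfl : Finset.range s.right.length = _)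
    fun i hi => ho.right i (Finset.mem_range.1 hi)
  rw [width_eq hs, Slice.length_source, Finset.sum_range_add, Finset.sum_range_add, hL, hR] at h1
  rw [← hW.next x s hs, Slice.length_target, Finset.sum_range_add, Finset.sum_range_add, ← h1] at h2
  rw [pos_eq hs]
  simp only [hp, Piece.source, Piece.target, List.length_cons, List.length_nil,
    Finset.sum_range_succ, Finset.sum_range_zero] at h2
  simp only [zero_add, add_zero] at h2
  linear_combination -h2

/-! ### The curve through the legs of a crossing -/

/-- A number for the way in which the legs of the piece are joined. -/
def Slice.mode (s : Slice) (ρ : Resolution) : ℕ :=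
  match s.piece with
  | .cup _ => 0
  | .cap _ => 1
  | .cross _ _ _ => match ρ with
    | .keep => 2
    | .vertical => 3
    | .horizontal => 4

/-- Encodes the arcs of a slice by linear relations, with the mode `m` telling how the legs are
joined, so that statements about end points of arcs become decidable by `omega`. -/
theorem Joins.arith {s : Slice} {ρ : Resolution} {k : ℕ} {p q : ℕ × ℕ} (h : Joins s ρ k p q) :
    ∃ S T m : ℕ, S = s.piece.source.length ∧ T = s.piece.target.length ∧
    m = s.mode ρ ∧
    ((m = 0 ∧ S = 0 ∧ T = 2) ∨ (m = 1 ∧ S = 2 ∧ T = 0) ∨ (2 ≤ m ∧ S = 2 ∧ T = 2)) ∧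
    ((p.1 = k ∧ q.1 = k + 1 ∧ p.2 = q.2 ∧ p.2 < s.left.length) ∨
    (p.1 = k ∧ q.1 = k + 1 ∧ s.left.length + S ≤ p.2 ∧ p.2 + T = q.2 + S) ∨
    (m = 0 ∧ p.1 = k + 1 ∧ q.1 = k + 1 ∧ p.2 = s.left.length ∧ q.2 = s.left.length + 1) ∨
    (m = 1 ∧ p.1 = k ∧ q.1 = k ∧ p.2 = s.left.length ∧ q.2 = s.left.length + 1) ∨
    (m = 2 ∧ p.1 = k ∧ q.1 = k + 1 ∧ p.2 = s.left.length ∧ q.2 = s.left.length + 1) ∨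
    (m = 2 ∧ p.1 = k ∧ q.1 = k + 1 ∧ p.2 = s.left.length + 1 ∧ q.2 = s.left.length) ∨
    (m = 3 ∧ p.1 = k ∧ q.1 = k + 1 ∧ p.2 = s.left.length ∧ q.2 = s.left.length) ∨
    (m = 3 ∧ p.1 = k ∧ q.1 = k + 1 ∧ p.2 = s.left.length + 1 ∧ q.2 = s.left.length + 1) ∨
    (m = 4 ∧ p.1 = k ∧ q.1 = k ∧ p.2 = s.left.length ∧ q.2 = s.left.length + 1) ∨
    (m = 4 ∧ p.1 = k + 1 ∧ q.1 = k + 1 ∧ p.2 = s.left.length ∧ q.2 = s.left.length + 1)) := by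
  refine ⟨_, _, _, rfl, rfl, rfl, ?_, ?_⟩
  · cases hp : s.piece <;> cases ρ <;> simp [Piece.source, Piece.target, Slice.mode, hp]
  · cases h with
    | left i hi => simp [hi]
    | right i hi => right; left; simp; omega
    | cup b hp => simp [Slice.mode, hp]
    | cap b hp => simp [Slice.mode, hp]
    | keep₁ o a b hp hρ => simp [Slice.mode, hp, hρ]
    | keep₂ o a b hp hρ => simp [Slice.mode, hp, hρ]
    | vertical₁ o a b hp hρ => simp [Slice.mode, hp, hρ]
    | vertical₂ o a b hp hρ => simp [Slice.mode, hp, hρ]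
    | horizontal₁ o a b hp hρ => simp [Slice.mode, hp, hρ]
    | horizontal₂ o a b hp hρ => simp [Slice.mode, hp, hρ]

/-- Within one slice a point lies on one arc only. Hence a point has at most two neighbours, one
through the slice below and one through the slice above. -/
theorem Joins.unique {s : Slice} {ρ : Resolution} {k : ℕ} {p q q' : ℕ × ℕ}
    (h : Joins s ρ k p q ∨ Joins s ρ k q p) (h' : Joins s ρ k p q' ∨ Joins s ρ k q' p) :
    q = q' := by
  obtain ⟨q1, q2⟩ := q
  obtain ⟨q1', q2'⟩ := q'
  rcases h with h | h <;> rcases h' with h' | h' <;>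
  · obtain ⟨S, T, m, hS, hT, hm, h0, h⟩ := h.arith
    obtain ⟨S', T', m', hS', hT', hm', h0', h'⟩ := h'.arith
    rw [← hS] at hS'
    rw [← hT] at hT'
    rw [← hm] at hm'
    subst hS' hT' hm'
    clear hS hT hm
    simp only at h h'
    apply Prod.ext <;> simp only <;> omega

theorem Joins.line {s : Slice} {ρ : Resolution} {k : ℕ} {p q : ℕ × ℕ} (h : Joins s ρ k p q) :
    (p.1 = k ∨ p.1 = k + 1) ∧ (q.1 = k ∨ q.1 = k + 1) := by
  obtain ⟨S, T, m, hS, hT, hm, h0, h⟩ := h.arith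
  omega

/-- Two points are joined by an arc which does not belong to the crossing number `x`. -/
def OutAdj (W : Word) (ρ : ℕ → Resolution) (x k : ℕ) (p q : Point W) : Prop :=
  ∃ s : Slice, W[k]? = some s ∧ Joins s (ρ k) k p.1 q.1 ∧
    ¬ (k = x ∧ ((p.1.2 = pos W x ∨ p.1.2 = pos W x + 1) ∨ (q.1.2 = pos W x ∨ q.1.2 = pos W x + 1)))

/-- The graph of the points, with the crossing number `x` removed. -/
def outGraph (W : Word) (ρ : ℕ → Resolution) (x : ℕ) : SimpleGraph (Point W) :=
  SimpleGraph.fromRel fun p q => ∃ k, OutAdj W ρ x k p q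

theorem card_le_of_subsingleton {α : Type*} {s : Finset α} {A B : α → Prop}
    (h : ∀ q ∈ s, A q ∨ B q) (hA : ∀ q q', A q → A q' → q = q') (hB : ∀ q q', B q → B q' → q = q') :
    s.card ≤ 2 := by
  classical
  have : s = s.filter A ∪ s.filter B := by
    ext q; simp only [Finset.mem_union, Finset.mem_filter]; have := h q; tauto
  rw [this]
  refine (Finset.card_union_le _ _).trans (Nat.add_le_add (b := 1) (d := 1) ?_ ?_) <;>
    rw [Finset.card_le_one] <;> simp only [Finset.mem_filter]
  · exact fun a ha b hb => hA _ _ ha.2 hb.2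
  · exact fun a ha b hb => hB _ _ ha.2 hb.2

theorem card_le_one_of_subsingleton {α : Type*} {s : Finset α} {A : α → Prop}
    (h : ∀ q ∈ s, A q) (hA : ∀ q q', A q → A q' → q = q') : s.card ≤ 1 := by
  rw [Finset.card_le_one]
  exact fun a ha b hb => hA _ _ (h a ha) (h b hb)

theorem outGraph_adj {W : Word} {ρ : ℕ → Resolution} {x : ℕ} {p q : Point W}
    (h : (outGraph W ρ x).Adj p q) : ∃ k, (k = p.1.1 ∨ k + 1 = p.1.1) ∧
      (OutAdj W ρ x k p q ∨ OutAdj W ρ x k q p) := by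
  rw [outGraph, SimpleGraph.fromRel_adj] at h
  rcases h with ⟨-, ⟨k, h⟩ | ⟨k, h⟩⟩
  · refine ⟨k, ?_, .inl h⟩
    obtain ⟨s, -, hj, -⟩ := h
    have := hj.line.1
    omega
  · refine ⟨k, ?_, .inr h⟩
    obtain ⟨s, -, hj, -⟩ := h
    have := hj.line.2
    omega

theorem OutAdj.unique {W : Word} {ρ : ℕ → Resolution} {x k : ℕ} {p q q' : Point W}
    (h : OutAdj W ρ x k p q ∨ OutAdj W ρ x k q p)
    (h' : OutAdj W ρ x k p q' ∨ OutAdj W ρ x k q' p) : q = q' := by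
  apply Subtype.ext
  have e : ∀ {s s' : Slice}, W[k]? = some s → W[k]? = some s' → s = s' := fun h h' =>
    Option.some.inj (h.symm.trans h')
  rcases h with ⟨s, hs, hj, -⟩ | ⟨s, hs, hj, -⟩ <;>
    rcases h' with ⟨s', hs', hj', -⟩ | ⟨s', hs', hj', -⟩ <;> obtain rfl := e hs hs'
  · exact Joins.unique (.inl hj) (.inl hj')
  · exact Joins.unique (.inl hj) (.inr hj')
  · exact Joins.unique (.inr hj) (.inl hj')
  · exact Joins.unique (.inr hj) (.inr hj')

open Classical in
/-- The legs of a crossing do not all belong to the same component of the rest of the diagram. -/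
theorem legs_not_all_connected {W : Word} (ρ : ℕ → Resolution) {x : ℕ} {a b c d : Point W}
    (ha : a.1 = (x, pos W x)) (hb : b.1 = (x, pos W x + 1)) (hc : c.1 = (x + 1, pos W x))
    (hd : d.1 = (x + 1, pos W x + 1)) (hab : (outGraph W ρ x).Reachable a b)
    (hac : (outGraph W ρ x).Reachable a c) (had : (outGraph W ρ x).Reachable a d) : False := by
  set G := outGraph W ρ x with hG
  set Y := G.connectedComponentMk a with hY
  have hYc := Y.connected_toSimpleGraph
  have mem : ∀ p, G.Reachable a p → p ∈ Y := fun p hp =>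
    (SimpleGraph.ConnectedComponent.eq.2 hp.symm)
  -- A connected graph with V vertices has at least V − 1 edges. Degrees at most two, and at most
  -- one at the four legs, bound twice the number of edges by 2V − 4, a contradiction.
  have h1 := hYc.card_vert_le_card_edgeSet_add_one
  have h2 := Y.toSimpleGraph.sum_degrees_eq_twice_card_edges
  rw [Nat.card_eq_fintype_card, Nat.card_eq_fintype_card, ← SimpleGraph.edgeFinset_card] at h1
  have adj : ∀ p q : Y, q ∈ Y.toSimpleGraph.neighborFinset p → ∃ k, (k = p.1.1.1 ∨ k + 1 = p.1.1.1) ∧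
      (OutAdj W ρ x k p.1 q.1 ∨ OutAdj W ρ x k q.1 p.1) := by
    intro p q hq
    rw [SimpleGraph.mem_neighborFinset] at hq
    exact outGraph_adj (hG ▸ hq)
  have uniq : ∀ (k : ℕ) (p : Y) (q q' : Y), (OutAdj W ρ x k p.1 q.1 ∨ OutAdj W ρ x k q.1 p.1) →
      (OutAdj W ρ x k p.1 q'.1 ∨ OutAdj W ρ x k q'.1 p.1) → q = q' := fun k p q q' h h' =>
    Subtype.ext (OutAdj.unique h h')
  have deg2 : ∀ p : Y, Y.toSimpleGraph.degree p ≤ 2 := by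
    intro p
    apply card_le_of_subsingleton (A := fun q : Y =>
      OutAdj W ρ x p.1.1.1 p.1 q.1 ∨ OutAdj W ρ x p.1.1.1 q.1 p.1) (B := fun q : Y =>
      OutAdj W ρ x (p.1.1.1 - 1) p.1 q.1 ∨ OutAdj W ρ x (p.1.1.1 - 1) q.1 p.1) _ (uniq _ p) (uniq _ p)
    intro q hq
    obtain ⟨k, hk | hk, h⟩ := adj p q hq
    · subst hk; exact .inl h
    · right; rw [← hk]; exact h
  let legs : Finset Y := {⟨a, mem a (.refl a)⟩, ⟨b, mem b hab⟩, ⟨c, mem c hac⟩, ⟨d, mem d had⟩}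
  have hlegs : legs.card = 4 := by
    have ne : ∀ (p q : Point W) (hp : p ∈ Y) (hq : q ∈ Y), p.1 ≠ q.1 → (⟨p, hp⟩ : Y) ≠ ⟨q, hq⟩ := by
      intro p q hp hq h h'
      exact h (congrArg (fun z : Y => z.1.1) h')
    rw [Finset.card_eq_succ]
    refine ⟨⟨a, mem a (.refl a)⟩, _, ?_, rfl, ?_⟩
    · simp only [Finset.mem_insert, Finset.mem_singleton, not_or]
      exact ⟨ne _ _ _ _ (by simp [ha, hb]), ne _ _ _ _ (by simp [ha, hc]),
        ne _ _ _ _ (by simp [ha, hd])⟩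
    · rw [Finset.card_eq_three]
      exact ⟨_, _, _, ne _ _ _ _ (by simp [hb, hc]), ne _ _ _ _ (by simp [hb, hd]),
        ne _ _ _ _ (by simp [hc, hd]), rfl⟩
  have deg1 : ∀ p ∈ legs, Y.toSimpleGraph.degree p ≤ 1 := by
    intro p hp
    have hp' : (p.1.1.1 = x ∨ p.1.1.1 = x + 1) ∧ (p.1.1.2 = pos W x ∨ p.1.1.2 = pos W x + 1) := by
      simp only [legs, Finset.mem_insert, Finset.mem_singleton] at hp
      rcases hp with rfl | rfl | rfl | rfl <;> simp [ha, hb, hc, hd]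
    -- A leg has lost its arc through the crossing `x`, so only the slice on the other side can give
    -- it a neighbour.
    have hx : ∀ q : Point W, ¬ (OutAdj W ρ x x p.1 q ∨ OutAdj W ρ x x q p.1) := by
      rintro q (⟨s, hs, -, h⟩ | ⟨s, hs, -, h⟩)
      · exact h ⟨rfl, .inl hp'.2⟩
      · exact h ⟨rfl, .inr hp'.2⟩
    rcases hp'.1 with h | h
    · refine card_le_one_of_subsingleton (A := fun q : Y =>
        OutAdj W ρ x (x - 1) p.1 q.1 ∨ OutAdj W ρ x (x - 1) q.1 p.1) (fun q hq => ?_) (uniq _ p)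
      obtain ⟨k, hk | hk, h'⟩ := adj p q hq
      · rw [hk, h] at h'; exact absurd h' (hx _)
      · obtain rfl : k = x - 1 := by omega
        exact h'
    · refine card_le_one_of_subsingleton (A := fun q : Y =>
        OutAdj W ρ x (x + 1) p.1 q.1 ∨ OutAdj W ρ x (x + 1) q.1 p.1) (fun q hq => ?_) (uniq _ p)
      obtain ⟨k, hk | hk, h'⟩ := adj p q hq
      · rw [hk, h] at h'; exact h'
      · rw [h] at hk; obtain rfl : k = x := by omega
        exact absurd h' (hx _)
  have hsum : ∑ p : Y, Y.toSimpleGraph.degree p + legs.card ≤ ∑ _p : Y, 2 := by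
    have e : legs.card = ∑ p : Y, if p ∈ legs then 1 else 0 := by simp
    rw [e, ← Finset.sum_add_distrib]
    refine Finset.sum_le_sum fun p _ => ?_
    split_ifs with h
    · have := deg1 p h; omega
    · have := deg2 p; omega
  simp only [Finset.sum_const, Finset.card_univ, smul_eq_mul] at hsum
  have e : Fintype.card (Y : Set (Point W)) = Fintype.card Y := rfl
  omega

/-! ### Numbers of circles of Kauffman states -/

/-- If the crossing number `x` is removed, then not all of its legs are connected. -/
theorem exists_flow {W : Word} (hW : Closed W) (H : Finset ℕ) {x : ℕ} (hx : x ∈ crossings W) :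
    ∃ f ∈ flows W H {x}, aDiffₗ W x f ≠ 0 ∨ bDiffₗ W x f ≠ 0 := by
  classical
  have hl := Closed.pos_lt hx
  have hl' := hW.pos_lt' hx
  let a : Point W := ⟨(x, pos W x), by simp only; omega⟩
  let b : Point W := ⟨(x, pos W x + 1), hl⟩
  let c : Point W := ⟨(x + 1, pos W x), by simp only; omega⟩
  let d : Point W := ⟨(x + 1, pos W x + 1), hl'⟩
  set G := outGraph W (state W H) x with hG
  -- The indicator of the component of one leg, once `x` is removed. The flow condition holds at the
  -- other crossings, hence at `x`; if both differences vanished at `x`, all four legs would lie in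
  -- this component.
  let f : Point W → ZMod 2 := fun p => if G.Reachable a p then 1 else 0
  have hadj : ∀ k p q, OutAdj W (state W H) x k p q → f p = f q := by
    intro k p q h
    by_cases hpq : p = q
    · rw [hpq]
    have : G.Adj p q := by
      rw [hG, outGraph, SimpleGraph.fromRel_adj]
      exact ⟨hpq, .inl ⟨k, h⟩⟩
    have : G.Reachable a p ↔ G.Reachable a q :=
      ⟨fun h => h.trans this.reachable, fun h => h.trans this.symm.reachable⟩
    simp only [f, this]
  have hj : ∀ k s, W[k]? = some s → k ≠ x → ∀ p q : Point W,
      Joins s (state W H k) k p.1 q.1 → f p = f q := fun k s hs hk p q h =>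
    hadj k p q ⟨s, hs, h, fun h => hk h.1⟩
  have hO : IsOuter W (ext W 0 f) := by
    intro k s hs
    by_cases hk : k = x
    · subst hk
      obtain ⟨s', o, a', b', hs', hp⟩ := mem_crossings.1 hx
      obtain rfl : s = s' := Option.some.inj (hs.symm.trans hs')
      have h1 := width_eq hs
      have h2 := hW.next k s hs
      have hpos := pos_eq hs
      rw [Slice.length_source] at h1
      rw [Slice.length_target] at h2
      have hS : s.piece.source.length = 2 := by simp [hp, Piece.source]
      have hT : s.piece.target.length = 2 := by simp [hp, Piece.target]
      constructor
      · intro i hi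
        rw [ext_of_lt 0 f (by omega), ext_of_lt 0 f (by omega)]
        exact hadj k _ _ ⟨s, hs, .left i hi, by simp only; omega⟩
      · intro i hi
        rw [ext_of_lt 0 f (by omega), ext_of_lt 0 f (by omega)]
        exact hadj k _ _ ⟨s, hs, .right i hi, by simp only; omega⟩
      · intro b hb; simp [hp] at hb
      · intro b hb; simp [hp] at hb
    · exact outer_ext hW 0 hs (hj k s hs hk)
  have hA : ∀ k ∈ crossings W, k ≠ x → k ∉ H → ARel W (ext W 0 f) k := by
    intro k hk hkx hkH
    obtain ⟨s, -, -, -, hs, -⟩ := mem_crossings.1 hk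
    exact aRel_ext hW 0 hs (hj k s hs hkx) hk hkH
  have hB : ∀ k ∈ crossings W, k ≠ x → k ∈ H → BRel W (ext W 0 f) k := by
    intro k hk hkx hkH
    obtain ⟨s, -, -, -, hs, -⟩ := mem_crossings.1 hk
    exact bRel_ext hW 0 hs (hj k s hs hkx) hk hkH
  have hsum : ∀ k ∈ crossings W, k ≠ x → _ := fun k hk hkx => sum_eq_of_rel (W := W) (k := k)
    (f := ext W 0 f) (by
      by_cases hkH : k ∈ H
      · exact .inr (hB k hk hkx hkH)
      · exact .inl (hA k hk hkx hkH))
  have hx' := flow_at_last_crossing hW hO hx hsum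
  have hf : IsFlow W (ext W 0 f) := ⟨hO, fun k hk => by
    by_cases hkx : k = x
    · subst hkx; exact hx'
    · exact hsum k hk hkx⟩
  refine ⟨f, ⟨hf, fun k hk hkx => ?_⟩, ?_⟩
  · rw [Finset.mem_singleton] at hkx
    exact ⟨fun hkH => (hf.aRel_iff hk).1 (hA k hk hkx hkH),
      fun hkH => (hf.bRel_iff hk).1 (hB k hk hkx hkH)⟩
  · by_contra hcon
    push Not at hcon
    obtain ⟨hc1, hc2⟩ := hcon
    have e1 := (hf.aRel_iff hx).2 hc1
    have e2 := (hf.bRel_iff hx).2 hc2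
    have e3 : VertRel W (ext W 0 f) x ∧ HorRel W (ext W 0 f) x := by
      unfold ARel at e1
      unfold BRel at e2
      split_ifs at e1 e2
      · exact ⟨e1, e2⟩
      · exact ⟨e2, e1⟩
    have fa : ext W 0 f x (pos W x) = f a := ext_of_lt 0 f _
    have fb : ext W 0 f x (pos W x + 1) = f b := ext_of_lt 0 f _
    have fc : ext W 0 f (x + 1) (pos W x) = f c := ext_of_lt 0 f _
    have fd : ext W 0 f (x + 1) (pos W x + 1) = f d := ext_of_lt 0 f _
    obtain ⟨⟨h1, h2⟩, h3, h4⟩ := e3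
    rw [fa, fc] at h1
    rw [fa, fb] at h3
    rw [fc, fd] at h4
    have ha1 : f a = 1 := by simp [f]
    have reach : ∀ p, f p = 1 → G.Reachable a p := by
      intro p hp
      by_contra h
      simp [f, h] at hp
    exact legs_not_all_connected (state W H) (x := x) (a := a) (b := b) (c := c) (d := d) rfl rfl rfl
      rfl (reach b (h3 ▸ ha1)) (reach c (h1 ▸ ha1)) (reach d (h4 ▸ h1 ▸ ha1))

/-! ### Subspaces cut out by one linear functional. -/

section Finrank

variable {K V : Type*} [Field K] [AddCommGroup V] [Module K V] [FiniteDimensional K V]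

theorem finrank_inf_ker (P : Submodule K V) (φ : V →ₗ[K] K) (h : ∃ f ∈ P, φ f ≠ 0) :
    Module.finrank K (P ⊓ LinearMap.ker φ : Submodule K V) + 1 = Module.finrank K P := by
  have h1 := (φ.domRestrict P).finrank_range_add_finrank_ker
  have h2 : LinearMap.range (φ.domRestrict P) = ⊤ := by
    obtain ⟨f, hf, hφ⟩ := h
    rw [LinearMap.range_eq_top]
    intro c
    exact ⟨⟨(c / φ f) • f, P.smul_mem _ hf⟩, by simp [hφ]⟩
  have h3 : (LinearMap.ker (φ.domRestrict P)).map P.subtype = P ⊓ LinearMap.ker φ := by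
    ext f
    simp [LinearMap.domRestrict_apply]
    tauto
  rw [h2, finrank_top, Module.finrank_self] at h1
  rw [← h3, Submodule.finrank_map_subtype_eq]
  omega

theorem finrank_le_inf_ker (P : Submodule K V) (φ : V →ₗ[K] K) :
    Module.finrank K P ≤ Module.finrank K (P ⊓ LinearMap.ker φ : Submodule K V) + 1 := by
  by_cases h : ∃ f ∈ P, φ f ≠ 0
  · exact (finrank_inf_ker P φ h).ge
  · push Not at h
    rw [inf_eq_left.2 fun f hf => LinearMap.mem_ker.2 (h f hf)]
    exact Nat.le_succ _

end Finrank

/-- Resolving a freed crossing imposes exactly one linear equation: the A-equation here, the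
B-equation in `flows_inf_bDiff`. The two resolutions are thus compared inside the common space in
which the crossing is free. -/
theorem flows_inf_aDiff {W : Word} {B X : Finset ℕ} {x : ℕ} (hx : x ∈ crossings W) (hB : x ∉ B)
    (hX : x ∉ X) : flows W B X = flows W B (insert x X) ⊓ LinearMap.ker (aDiffₗ W x) := by
  ext f
  simp only [Submodule.mem_inf, mem_flows, LinearMap.mem_ker, Finset.mem_insert, not_or]
  constructor
  · rintro ⟨h1, h2⟩
    exact ⟨⟨h1, fun k hk hkX => h2 k hk hkX.2⟩, (h2 x hx hX).1 hB⟩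
  · rintro ⟨⟨h1, h2⟩, h3⟩
    refine ⟨h1, fun k hk hkX => ?_⟩
    by_cases hkx : k = x
    · subst hkx; exact ⟨fun _ => h3, fun h => absurd h hB⟩
    · exact h2 k hk ⟨hkx, hkX⟩

theorem flows_inf_bDiff {W : Word} {B X : Finset ℕ} {x : ℕ} (hx : x ∈ crossings W) (hB : x ∉ B)
    (hX : x ∉ X) :
    flows W (insert x B) X = flows W B (insert x X) ⊓ LinearMap.ker (bDiffₗ W x) := by
  ext f
  simp only [Submodule.mem_inf, mem_flows, LinearMap.mem_ker, Finset.mem_insert, not_or]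
  constructor
  · rintro ⟨h1, h2⟩
    refine ⟨⟨h1, fun k hk hkX => ⟨fun h => ?_, fun h => ?_⟩⟩, (h2 x hx hX).2 (.inl rfl)⟩
    · exact (h2 k hk hkX.2).1 ⟨hkX.1, h⟩
    · exact (h2 k hk hkX.2).2 (.inr h)
  · rintro ⟨⟨h1, h2⟩, h3⟩
    refine ⟨h1, fun k hk hkX => ?_⟩
    by_cases hkx : k = x
    · subst hkx; exact ⟨fun h => absurd rfl h.1, fun _ => h3⟩
    · exact ⟨fun h => (h2 k hk ⟨hkx, hkX⟩).1 h.2,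
        fun h => (h2 k hk ⟨hkx, hkX⟩).2 (h.resolve_left hkx)⟩

/-- The dimension of the space of flows. -/
noncomputable def flowDim (W : Word) (B X : Finset ℕ) : ℕ := Module.finrank (ZMod 2) (flows W B X)

theorem flowDim_empty {W : Word} (hW : Closed W) (H : Finset ℕ) : flowDim W H ∅ = circles W H :=
  finrank_flows hW H

theorem flowDim_insert_le {W : Word} {B X : Finset ℕ} {x : ℕ} (hx : x ∈ crossings W) (hB : x ∉ B)
    (hX : x ∉ X) : flowDim W B (insert x X) ≤ flowDim W B X + 1 := by
  rw [flowDim, flowDim, flows_inf_aDiff hx hB hX]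
  exact finrank_le_inf_ker _ _

theorem flowDim_insert {W : Word} {B X : Finset ℕ} {x : ℕ} (hx : x ∈ crossings W) (hB : x ∉ B)
    (hX : x ∉ X) (h : ∃ f ∈ flows W B (insert x X), aDiffₗ W x f ≠ 0) :
    flowDim W B (insert x X) = flowDim W B X + 1 := by
  rw [flowDim, flowDim, flows_inf_aDiff hx hB hX]
  exact (finrank_inf_ker _ _ h).symm

theorem flows_mono {W : Word} {B X Y : Finset ℕ} (h : X ⊆ Y) : flows W B X ≤ flows W B Y :=
  fun _ hf => ⟨hf.1, fun k hk hkY => hf.2 k hk fun hkX => hkY (h hkX)⟩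

theorem flowDim_union_le {W : Word} {B X T : Finset ℕ} (hT : T ⊆ crossings W)
    (hB : Disjoint T B) (hX : Disjoint T X) : flowDim W B (X ∪ T) ≤ flowDim W B X + T.card := by
  induction T using Finset.induction_on with
  | empty => simp
  | insert x T hxT ih =>
    rw [Finset.insert_subset_iff] at hT
    rw [Finset.disjoint_insert_left] at hB hX
    rw [Finset.union_insert, Finset.card_insert_of_notMem hxT]
    have := flowDim_insert_le (W := W) (B := B) (X := X ∪ T) hT.1 hB.1
      (by simp [hX.1, hxT])
    have := ih hT.2 hB.2 hX.2
    omega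

/-- Both states are subspaces of the flows with `x` freed, and the one with the A-resolution has
codimension at most one there. -/
theorem circles_insert_le {W : Word} (hW : Closed W) {H : Finset ℕ} {x : ℕ} (hx : x ∈ crossings W)
    (hH : x ∉ H) : circles W (insert x H) ≤ circles W H + 1 := by
  rw [← flowDim_empty hW, ← flowDim_empty hW]
  refine le_trans ?_ (flowDim_insert_le hx hH (Finset.notMem_empty x))
  rw [flowDim, flowDim, flows_inf_bDiff hx hH (Finset.notMem_empty x)]
  exact Submodule.finrank_mono inf_le_left

/-- If changing the resolution of a crossing does not merge two circles, it splits a circle. -/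
theorem circles_insert {W : Word} (hW : Closed W) {H : Finset ℕ} {x : ℕ} (hx : x ∈ crossings W)
    (hH : x ∉ H) (h : ∀ f ∈ flows W H {x}, bDiffₗ W x f = 0) :
    circles W (insert x H) = circles W H + 1 ∧ ∃ f ∈ flows W H {x}, aDiffₗ W x f ≠ 0 := by
  obtain ⟨f, hf, hf'⟩ := exists_flow hW H hx
  have ha : aDiffₗ W x f ≠ 0 := hf'.resolve_right (not_not.2 (h f hf))
  refine ⟨?_, f, hf, ha⟩
  -- The B-equation holds on all flows with `x` freed, so the new state is this whole space, while
  -- the nonzero A-equation cuts out the old state as a hyperplane.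
  rw [← flowDim_empty hW, ← flowDim_empty hW,
    ← flowDim_insert hx hH (Finset.notMem_empty x) ⟨f, hf, ha⟩]
  rw [flowDim, flowDim, flows_inf_bDiff hx hH (Finset.notMem_empty x), insert_empty_eq,
    inf_eq_left.2 fun f hf => LinearMap.mem_ker.2 (h f hf)]

theorem circles_union_le {W : Word} (hW : Closed W) {H T : Finset ℕ} (hT : T ⊆ crossings W)
    (hH : Disjoint T H) : circles W (H ∪ T) ≤ circles W H + T.card := by
  induction T using Finset.induction_on with
  | empty => simp
  | insert x T hxT ih =>
    rw [Finset.insert_subset_iff] at hT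
    rw [Finset.disjoint_insert_left] at hH
    rw [Finset.union_insert, Finset.card_insert_of_notMem hxT]
    have := circles_insert_le hW (H := H ∪ T) hT.1 (by simp [hH.1, hxT])
    have := ih hT.2 hH.2
    omega

/-- Equivalently, the deficiency v_A + |H| − (number of circles of H) is monotone in H. A costly
subset of crossings thus penalizes every state that contains it. -/
theorem circles_le_of_subset {W : Word} (hW : Closed W) {K H : Finset ℕ} (hH : H ⊆ crossings W)
    (hK : K ⊆ H) : circles W H + K.card ≤ circles W K + H.card := by
  have := circles_union_le hW (H := K) (T := H \ K) (Finset.sdiff_subset.trans hH)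
    Finset.sdiff_disjoint
  rw [Finset.union_sdiff_of_subset hK, Finset.card_sdiff_of_subset hK] at this
  have := Finset.card_le_card hK
  omega

theorem circles_le {W : Word} (hW : Closed W) {H : Finset ℕ} (hH : H ⊆ crossings W) :
    circles W H ≤ vA W + H.card := by
  simpa [vA] using circles_le_of_subset hW hH (Finset.empty_subset H)

/-! ### Curves of the all-`A` state -/

/-- The curve of the all-`A` state through a point. -/
noncomputable def lab (W : Word) : ℕ → ℕ → Option (Curves W (state W ∅)) :=
  ext W none fun p => some (Quot.mk _ p)

/-- The first of the two arcs of the `A`-resolution of a crossing. -/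
noncomputable def end₁ (W : Word) (x : ℕ) : Option (Curves W (state W ∅)) := lab W x (pos W x)

/-- The line of a point of the second arc. -/
def line₂ (W : Word) (x : ℕ) : ℕ := if aVert W x = true then x else x + 1

/-- The position of a point of the second arc. -/
def pos₂ (W : Word) (x : ℕ) : ℕ := if aVert W x = true then pos W x + 1 else pos W x

/-- The second of the two arcs of the `A`-resolution of a crossing. -/
noncomputable def end₂ (W : Word) (x : ℕ) : Option (Curves W (state W ∅)) :=
  lab W (line₂ W x) (pos₂ W x)

/-- The colour, in a checkerboard colouring of the complement of the all-`A` state, of the region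
in which the crossing lies. -/
def colour (W : Word) (x : ℕ) : ℕ := if aVert W x = true then (pos W x + 1) % 2 else pos W x % 2

theorem lab_point {W : Word} (p : Point W) : lab W p.1.1 p.1.2 = some (Quot.mk _ p) :=
  ext_point none _ p

theorem lab_isOuter {W : Word} (hW : Closed W) :
    IsOuter W (lab W) ∧ ∀ k ∈ crossings W, ARel W (lab W) k := by
  obtain ⟨h1, h2, -⟩ := labels_ext hW (H := ∅) none
    (f := fun p => (some (Quot.mk _ p) : Option (Curves W (state W ∅))))
    (fun x y h => congrArg some (Quot.sound h))
  exact ⟨h1, fun k hk => h2 k hk (Finset.notMem_empty k)⟩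

theorem Closed.pos₂_lt {W : Word} (hW : Closed W) {x : ℕ} (hx : x ∈ crossings W) :
    pos₂ W x < width W (line₂ W x) := by
  have h1 := Closed.pos_lt hx
  have h2 := hW.pos_lt' hx
  unfold pos₂ line₂
  split_ifs <;> omega

theorem lab_eq_some {W : Word} {k i : ℕ} (h : i < width W k) : lab W k i = some (Quot.mk _ ⟨(k, i), h⟩) :=
  ext_of_lt none _ h

/-- In both cases the second summand is the label of the second A-arc: the B-resolution identifies
the labels of the two A-arcs. -/
theorem bDiff_eq {W : Word} (x : ℕ) (f : ℕ → ℕ → ZMod 2) :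
    bDiff W x f = f x (pos W x) + f (line₂ W x) (pos₂ W x) := by
  unfold bDiff line₂ pos₂; split_ifs <;> rfl

/-! ### Region colourings -/

/-- The colouring of the regions by the field with two elements which changes across a point by the
value of `f`; the region number `i` on a line is to the left of the point number `i`. -/
def region (f : ℕ → ℕ → ZMod 2) (k i : ℕ) : ZMod 2 := ∑ j ∈ Finset.range i, f k j

/-- The value of the region next to a point which is on the side of colour `c`. -/
def side (c : ℕ) (f : ℕ → ℕ → ZMod 2) (k i : ℕ) : ZMod 2 :=
  if i % 2 = c then region f k i else region f k (i + 1)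

theorem region_succ (f : ℕ → ℕ → ZMod 2) (k i : ℕ) : region f k (i + 1) = region f k i + f k i :=
  Finset.sum_range_succ _ _

theorem IsFlow.region_left {W : Word} {f : ℕ → ℕ → ZMod 2} (hf : IsFlow W f) {k : ℕ} {s : Slice}
    (hs : W[k]? = some s) {i : ℕ} (hi : i ≤ s.left.length) : region f k i = region f (k + 1) i :=
  sum_range_left (hf.1 k s hs) hi

theorem IsFlow.region_right {W : Word} {f : ℕ → ℕ → ZMod 2} (hf : IsFlow W f) {k : ℕ} {s : Slice}
    (hs : W[k]? = some s) {i : ℕ} (hi : i ≤ s.right.length) :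
    region f k (s.left.length + s.piece.source.length + i) =
      region f (k + 1) (s.left.length + s.piece.target.length + i) := by
  refine sum_range_right (hf.1 k s hs) (fun hc => ?_) hi
  have : k ∈ crossings W := by
    simp only [crossings, Finset.mem_filter, Finset.mem_range]
    exact ⟨lt_of_slice hs, by rw [hs, Option.map_some, hc]⟩
  simpa [pos_eq hs] using hf.2 k this

theorem IsFlow.region_crossing {W : Word} {f : ℕ → ℕ → ZMod 2} (hf : IsFlow W f) {k : ℕ}
    (hk : k ∈ crossings W) : region f k (pos W k) = region f (k + 1) (pos W k) ∧
      region f k (pos W k + 2) = region f (k + 1) (pos W k + 2) := by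
  obtain ⟨s, o, a, b, hs, hp⟩ := mem_crossings.1 hk
  rw [pos_eq hs]
  refine ⟨hf.region_left hs le_rfl, ?_⟩
  simpa [hp, Piece.source, Piece.target] using hf.region_right hs (Nat.zero_le _)

/-- Away from crossings the region of a given colour next to a strand is carried along with the
strand. The legs of a cup or cap share the inner region, and their outer regions have equal values
because two equal labels cancel. -/
theorem IsFlow.side_isOuter {W : Word} {f : ℕ → ℕ → ZMod 2} (hf : IsFlow W f) {c : ℕ} (hc : c < 2) :
    IsOuter W (side c f) := by
  intro k s hs
  have hpar : s.piece.source.length % 2 = s.piece.target.length % 2 := by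
    cases s.piece <;> simp [Piece.source, Piece.target]
  have e (a b : ZMod 2) : a + b + b = a := by revert a b; decide
  constructor
  · intro i hi
    unfold side
    rw [hf.region_left hs hi.le, hf.region_left hs (Nat.succ_le_of_lt hi)]
  · intro i hi
    unfold side
    have h1 := hf.region_right hs hi.le
    have h2 := hf.region_right hs (Nat.succ_le_of_lt hi)
    rw [Nat.succ_eq_add_one, ← Nat.add_assoc, ← Nat.add_assoc] at h2
    have h3 : (s.left.length + s.piece.source.length + i) % 2 =
      (s.left.length + s.piece.target.length + i) % 2 := by omega
    rw [h1, h2, h3]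
  · intro b hb
    unfold side
    have h0 := (hf.1 k s hs).cup b hb
    by_cases h : s.left.length % 2 = c
    · rw [if_pos h, if_neg (by omega), region_succ, region_succ, h0, e]
    · rw [if_neg h, if_pos (by omega)]
  · intro b hb
    unfold side
    have h0 := (hf.1 k s hs).cap b hb
    by_cases h : s.left.length % 2 = c
    · rw [if_pos h, if_neg (by omega), region_succ, region_succ, h0, e]
    · rw [if_neg h, if_pos (by omega)]

/-- On the side away from the crossing, each A-arc borders a single region and nothing is needed. On
the side of the crossing's colour the flow may separate the two ends of the channel, and the
vanishing of `aDiff` excludes this. -/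
theorem IsFlow.side_aRel {W : Word} {f : ℕ → ℕ → ZMod 2} (hf : IsFlow W f) {c : ℕ} (hc : c < 2)
    {k : ℕ} (hk : k ∈ crossings W) (h : colour W k = c → aDiff W k f = 0) : ARel W (side c f) k := by
  obtain ⟨h0, h2⟩ := hf.region_crossing hk
  have hs := hf.2 k hk
  have e1 (a b : ZMod 2) : a + b = 0 → a = b := by revert a b; decide
  have e2 (a b : ZMod 2) : a + b + b = a := by revert a b; decide
  unfold ARel
  unfold colour aDiff at h
  split_ifs at h ⊢ with ho
  · unfold VertRel side
    by_cases hl : pos W k % 2 = c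
    · rw [if_pos hl, if_pos hl, if_neg (by omega), if_neg (by omega)]
      exact ⟨h0, h2⟩
    · rw [if_neg hl, if_neg hl, if_pos (by omega), if_pos (by omega), region_succ, region_succ, h0,
        e1 _ _ (h (by omega))]
      exact ⟨rfl, rfl⟩
  · unfold HorRel side
    by_cases hl : pos W k % 2 = c
    · have h3 := h hl
      have h4 := e1 _ _ h3
      rw [h3] at hs
      have h5 := e1 _ _ hs.symm
      rw [if_pos hl, if_pos hl, if_neg (by omega), if_neg (by omega), region_succ, region_succ,
        region_succ, region_succ, h4, h5, e2, e2]
      exact ⟨rfl, rfl⟩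
    · rw [if_neg hl, if_neg hl, if_pos (by omega), if_pos (by omega)]
      exact ⟨rfl, rfl⟩

/-- The two arcs of the `A`-resolution of a crossing have the crossing on the side of its colour. -/
theorem side_colour {W : Word} {f : ℕ → ℕ → ZMod 2} (hf : IsFlow W f) {x : ℕ}
    (hx : x ∈ crossings W) :
    side (colour W x) f x (pos W x) = side (colour W x) f (line₂ W x) (pos₂ W x) := by
  obtain ⟨h0, h2⟩ := hf.region_crossing hx
  unfold side colour line₂ pos₂
  by_cases h : aVert W x = true
  · simp only [if_pos h]
    rw [if_neg (by omega), if_pos trivial]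
  · simp only [if_neg h]
    rw [if_pos trivial, if_pos trivial, h0]

/-- On their sides of the other colour, they are separated by the `B`-resolution. -/
theorem side_other_colour {W : Word} {f : ℕ → ℕ → ZMod 2} (hf : IsFlow W f) {x : ℕ}
    (hx : x ∈ crossings W) {c : ℕ} (hc : c < 2) (hcx : colour W x ≠ c) :
    side c f x (pos W x) = side c f (line₂ W x) (pos₂ W x) ↔ bDiff W x f = 0 := by
  obtain ⟨h0, h2⟩ := hf.region_crossing hx
  have e1 (a b d : ZMod 2) : d = d + a + b ↔ a + b = 0 := by revert a b d; decide
  have e2 (a b d : ZMod 2) : d + a = d + b ↔ a + b = 0 := by revert a b d; decide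
  unfold side bDiff line₂ pos₂
  unfold colour at hcx
  by_cases h : aVert W x = true
  · simp only [if_pos h] at hcx ⊢
    rw [if_pos (by omega), if_neg hcx, region_succ, region_succ]
    exact e1 _ _ _
  · simp only [if_neg h] at hcx ⊢
    rw [if_neg hcx, if_neg hcx, region_succ, region_succ, h0]
    exact e2 _ _ _

theorem colour_lt (W : Word) (x : ℕ) : colour W x < 2 := by
  unfold colour; split_ifs <;> omega

/-- The points `p` and `q` have the same label if they are on the same curve. -/
theorem eq_of_lab_eq {W : Word} {L : Type*} {φ : ℕ → ℕ → L} (h : IsOuter W φ)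
    (hA : ∀ k ∈ crossings W, ARel W φ k) {p q : Point W}
    (hpq : lab W p.1.1 p.1.2 = lab W q.1.1 q.1.2) : φ p.1.1 p.1.2 = φ q.1.1 q.1.2 := by
  rw [lab_point, lab_point] at hpq
  exact congrArg (Quot.lift (fun p : Point W => φ p.1.1 p.1.2) fun x y hxy =>
    adjacent_state h (fun k hk _ => hA k hk) (fun k _ hk => absurd hk (Finset.notMem_empty k)) hxy)
    (Option.some.inj hpq)

open Classical in
/-- Restriction of a labeling to a curve. -/
noncomputable def restrict (W : Word) (C : Option (Curves W (state W ∅))) (φ : ℕ → ℕ → ZMod 2)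
    (k i : ℕ) : ZMod 2 := if lab W k i = C then φ k i else 0

theorem restrict_isOuter {W : Word} (hW : Closed W) (C : Option (Curves W (state W ∅)))
    {φ : ℕ → ℕ → ZMod 2} (h : IsOuter W φ) : IsOuter W (restrict W C φ) := by
  intro k s hs
  have h1 := h k s hs
  have h2 := (lab_isOuter hW).1 k s hs
  constructor <;> unfold restrict
  · intro i hi; rw [h1.left i hi, h2.left i hi]
  · intro i hi; rw [h1.right i hi, h2.right i hi]
  · intro b hb; rw [h1.cup b hb, h2.cup b hb]
  · intro b hb; rw [h1.cap b hb, h2.cap b hb]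

theorem restrict_aRel {W : Word} (hW : Closed W) (C : Option (Curves W (state W ∅)))
    {φ : ℕ → ℕ → ZMod 2} {k : ℕ} (hk : k ∈ crossings W)
    (h : ARel W φ k ∨ (end₁ W k ≠ C ∧ end₂ W k ≠ C)) : ARel W (restrict W C φ) k := by
  have hl := (lab_isOuter hW).2 k hk
  unfold ARel VertRel HorRel end₁ end₂ line₂ pos₂ at *
  split_ifs at * with ho
  all_goals
    obtain ⟨h1, h2⟩ := hl
    unfold restrict
    rcases h with ⟨h3, h4⟩ | ⟨h3, h4⟩
    · rw [← h1, ← h2, h3, h4]; exact ⟨rfl, rfl⟩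
    · rw [← h1, ← h2, if_neg h3, if_neg h3, if_neg h4, if_neg h4]; exact ⟨rfl, rfl⟩

/-- If a labeling is compatible with the all-`A` state except at one place of the curve `C`, then
it is compatible with it on all of `C`. -/
theorem restrict_aRel_all {W : Word} (hW : Closed W) {C : Option (Curves W (state W ∅))}
    {φ : ℕ → ℕ → ZMod 2} (hφ : IsOuter W φ) {e : ℕ}
    (h : ∀ k ∈ crossings W, ARel W φ k ∨ (end₁ W k ≠ C ∧ end₂ W k ≠ C) ∨
      (k = e ∧ ¬ (end₁ W k = C ∧ end₂ W k = C))) :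
    ∀ k ∈ crossings W, ARel W (restrict W C φ) k := by
  intro k hk
  have hR := restrict_isOuter hW C hφ
  rcases h k hk with h' | h' | ⟨rfl, h'⟩
  · exact restrict_aRel hW C hk (.inl h')
  · exact restrict_aRel hW C hk (.inr h')
  -- Restricted to `C`, the labels satisfy the flow condition at all crossings but `k`, hence at
  -- `k`. Since at most one arc at `k` belongs to `C`, the remaining labels vanish and the condition
  -- is compatibility along that arc.
  have hsum := flow_at_last_crossing hW hR hk fun j hj hjk => sum_eq_of_rel (.inl (by
    rcases h j hj with h' | h' | h'
    · exact restrict_aRel hW C hj (.inl h')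
    · exact restrict_aRel hW C hj (.inr h')
    · exact absurd h'.1 hjk))
  have hl := (lab_isOuter hW).2 k hk
  unfold end₁ end₂ line₂ pos₂ at h'
  unfold ARel VertRel HorRel at hl ⊢
  have hz : ∀ k i, lab W k i ≠ C → restrict W C φ k i = 0 := fun k i h => if_neg h
  split_ifs at * with ho
  · by_cases h1 : lab W k (pos W k) = C
    · have h2 : lab W k (pos W k + 1) ≠ C := fun h2 => h' ⟨h1, h2⟩
      have e1 := hz _ _ h2
      have e2 := hz _ _ (hl.2 ▸ h2)
      rw [e1, e2, add_zero, add_zero] at hsum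
      exact ⟨hsum, e1.trans e2.symm⟩
    · have e1 := hz _ _ h1
      have e2 := hz _ _ (hl.1 ▸ h1)
      rw [e1, e2, zero_add, zero_add] at hsum
      exact ⟨e1.trans e2.symm, hsum⟩
  · have e (a b : ZMod 2) : (a + b = 0 → a = b) ∧ (0 = a + b → a = b) := by revert a b; decide
    by_cases h1 : lab W k (pos W k) = C
    · have h2 : lab W (k + 1) (pos W k) ≠ C := fun h2 => h' ⟨h1, h2⟩
      have e1 := hz _ _ h2
      have e2 := hz _ _ (hl.2 ▸ h2)
      rw [e1, e2, add_zero] at hsum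
      exact ⟨(e _ _).1 hsum, e1.trans e2.symm⟩
    · have e1 := hz _ _ h1
      have e2 := hz _ _ (hl.1 ▸ h1)
      rw [e1, e2, zero_add] at hsum
      exact ⟨e1.trans e2.symm, (e _ _).2 hsum⟩

/-- A region next to a curve on one of its two sides is not cut if the resolution of at most one
crossing is changed on this side. -/
theorem side_const {W : Word} (hW : Closed W) {f : ℕ → ℕ → ZMod 2} (hf : IsFlow W f) {c : ℕ}
    (hc : c < 2) {C : Option (Curves W (state W ∅))} {e : ℕ}
    (h : ∀ k ∈ crossings W, colour W k = c → aDiff W k f ≠ 0 →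
      (end₁ W k ≠ C ∧ end₂ W k ≠ C) ∨ (k = e ∧ ¬ (end₁ W k = C ∧ end₂ W k = C)))
    {p q : Point W} (hp : lab W p.1.1 p.1.2 = C) (hq : lab W q.1.1 q.1.2 = C) :
    side c f p.1.1 p.1.2 = side c f q.1.1 q.1.2 := by
  have hO := hf.side_isOuter hc
  have hR := restrict_aRel_all hW (C := C) (e := e) hO fun k hk => by
    by_cases hck : colour W k = c → aDiff W k f = 0
    · exact .inl (hf.side_aRel hc hk hck)
    · push Not at hck
      exact .inr (h k hk hck.1 hck.2)
  have := eq_of_lab_eq (restrict_isOuter hW C hO) hR (hp.trans hq.symm)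
  rwa [restrict, restrict, if_pos hp, if_pos hq] at this

/-- If the curve `C` meets only one of the crossings whose resolution is changed, and meets it only
once, then a flow does not change there. -/
theorem aDiff_eq_zero {W : Word} (hW : Closed W) {f : ℕ → ℕ → ZMod 2} (hf : IsFlow W f)
    {C : Option (Curves W (state W ∅))} {e : ℕ} (he : e ∈ crossings W)
    (hC : (end₁ W e = C ∧ end₂ W e ≠ C) ∨ (end₁ W e ≠ C ∧ end₂ W e = C))
    (h : ∀ k ∈ crossings W, k ≠ e → aDiff W k f ≠ 0 → end₁ W k ≠ C ∧ end₂ W k ≠ C) :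
    aDiff W e f = 0 := by
  have hR := restrict_aRel_all hW (C := C) (e := e) hf.1 (fun k hk => by
    by_cases hk0 : aDiff W k f = 0
    · exact .inl ((hf.aRel_iff hk).2 hk0)
    · by_cases hke : k = e
      · subst hke
        exact .inr (.inr ⟨rfl, by tauto⟩)
      · exact .inr (.inl (h k hk hke hk0))) e he
  have hl := (lab_isOuter hW).2 e he
  rw [← hf.aRel_iff he]
  have hsum := hf.2 e he
  have e1 (a b c d : ZMod 2) : a + b = c + d → (a = c → b = d) ∧ (b = d → a = c) ∧
    (a = b → c = d) ∧ (c = d → a = b) := by revert a b c d; decide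
  obtain ⟨i1, i2, i3, i4⟩ := e1 _ _ _ _ hsum
  unfold end₁ end₂ line₂ pos₂ at hC
  unfold ARel VertRel HorRel at *
  split_ifs at hC hR hl ⊢ with ho
  all_goals
    unfold restrict at hR
    rcases hC with hC | hC
  · have := hR.1; rw [← hl.1, if_pos hC.1, if_pos hC.1] at this; exact ⟨this, i1 this⟩
  · have := hR.2; rw [← hl.2, if_pos hC.2, if_pos hC.2] at this; exact ⟨i2 this, this⟩
  · have := hR.1; rw [← hl.1, if_pos hC.1, if_pos hC.1] at this; exact ⟨this, i3 this⟩
  · have := hR.2; rw [← hl.2, if_pos hC.2, if_pos hC.2] at this; exact ⟨i4 this, this⟩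

/-! ### Chords of the all-`A` state -/

/-- A crossing which meets the curve `C` twice splits a circle in a state in which at most one
crossing of the other colour on `C` has the `B`-resolution. -/
theorem circles_insert_chord {W : Word} (hW : Closed W) {K : Finset ℕ} {x e : ℕ}
    (hx : x ∈ crossings W) (hK : x ∉ K) (hxx : end₁ W x = end₂ W x)
    (h : ∀ k ∈ K, colour W k ≠ colour W x → (end₁ W k ≠ end₁ W x ∧ end₂ W k ≠ end₁ W x) ∨
      (k = e ∧ ¬ (end₁ W k = end₁ W x ∧ end₂ W k = end₁ W x))) :
    circles W (insert x K) = circles W K + 1 ∧ ∃ f ∈ flows W K {x}, aDiffₗ W x f ≠ 0 := by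
  refine circles_insert hW hx hK fun f hf => ?_
  -- On the side away from the chord `x` the region along the curve is not cut, so the region values
  -- at the two ends of `x` agree there. By `side_other_colour` this is the B-equation.
  have hc : 1 - colour W x < 2 := by omega
  have hcx : colour W x ≠ 1 - colour W x := by have := colour_lt W x; omega
  refine (side_other_colour hf.1 hx hc hcx).1 ?_
  have hl := Closed.pos_lt hx
  refine side_const hW hf.1 hc (C := end₁ W x) (e := e) (fun k hk hkc hkf => ?_)
    (p := ⟨(x, pos W x), by simp only; omega⟩) (q := ⟨(line₂ W x, pos₂ W x), hW.pos₂_lt hx⟩) rfl hxx.symm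
  have hkx : k ≠ x := by rintro rfl; exact hcx hkc
  have hkK : k ∈ K := by
    by_contra hkK
    exact hkf ((hf.2 k hk (by simpa using hkx)).1 hkK)
  exact h k hkK (by omega)

/-- The two curves that a crossing joins. -/
noncomputable def ends (W : Word) (x : ℕ) : Sym2 (Option (Curves W (state W ∅))) :=
  s(end₁ W x, end₂ W x)

/-- Freeing the crossings of `B` as well forgets their resolutions, so bounds on dimensions reduce
to the case of an empty B-set. -/
theorem mem_flows_union {W : Word} {B X : Finset ℕ} : flows W B X ≤ flows W ∅ (X ∪ B) := by
  intro f hf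
  refine ⟨hf.1, fun k hk hkX => ?_⟩
  rw [Finset.mem_union, not_or] at hkX
  exact ⟨fun _ => (hf.2 k hk hkX.1).1 hkX.2, fun h => absurd h (Finset.notMem_empty k)⟩

/-- Among the altered crossings only `e` touches `C`, and only once. A flow that could change at a
single place of a closed curve cannot change at all. -/
theorem aDiff_of_mem_flows {W : Word} (hW : Closed W) {B X : Finset ℕ} {f : Point W → ZMod 2}
    (hf : f ∈ flows W B X) {e : ℕ} (he : e ∈ crossings W) (hee : end₁ W e ≠ end₂ W e)
    {C : Option (Curves W (state W ∅))} (hC : C ∈ ends W e)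
    (h : ∀ k ∈ X ∪ B, k ≠ e → C ∉ ends W k) : aDiffₗ W e f = 0 := by
  refine aDiff_eq_zero hW hf.1 he (C := C) ?_ fun k hk hke hkf => ?_
  · rw [ends, Sym2.mem_iff] at hC
    rcases hC with rfl | rfl
    · exact .inl ⟨rfl, hee.symm⟩
    · exact .inr ⟨hee, rfl⟩
  · have hkX : k ∈ X ∪ B := by
      by_contra h'
      exact hkf (((mem_flows_union hf).2 k hk h').1 (Finset.notMem_empty k))
    have := h k hkX hke
    rw [ends, Sym2.mem_iff, not_or] at this
    exact ⟨Ne.symm this.1, Ne.symm this.2⟩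

theorem flows_eq_of_aDiff {W : Word} {X : Finset ℕ} (h : ∀ f ∈ flows W ∅ X, ∀ x ∈ X, aDiffₗ W x f = 0) :
    flows W ∅ X = flows W ∅ ∅ := by
  apply le_antisymm
  · intro f hf
    refine ⟨hf.1, fun k hk _ => ⟨fun _ => ?_, fun h => absurd h (Finset.notMem_empty k)⟩⟩
    by_cases hkX : k ∈ X
    · exact h f hf k hkX
    · exact (hf.2 k hk hkX).1 (Finset.notMem_empty k)
  · exact flows_mono (Finset.empty_subset X)

open Classical in
/-- The indicator function of a curve. -/
noncomputable def indicator (W : Word) (C : Option (Curves W (state W ∅))) (p : Point W) : ZMod 2 :=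
  if lab W p.1.1 p.1.2 = C then 1 else 0

theorem indicator_mem {W : Word} (hW : Closed W) (C : Option (Curves W (state W ∅))) :
    indicator W C ∈ flows W ∅ ∅ := by
  rw [mem_flows_empty hW]
  intro x y h
  have := Quot.sound h
  unfold indicator
  rw [lab_point, lab_point, this]

open Classical in
theorem ext_indicator {W : Word} (C : Option (Curves W (state W ∅))) {k i : ℕ}
    (h : i < width W k) : ext₀ W (indicator W C) k i = if lab W k i = C then 1 else 0 := by
  rw [ext₀_apply, ext_of_lt 0 _ h]; rfl

open Classical in
theorem bDiff_indicator {W : Word} (hW : Closed W) (C : Option (Curves W (state W ∅))) {e : ℕ}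
    (he : e ∈ crossings W) : bDiffₗ W e (indicator W C) =
      (if end₁ W e = C then 1 else 0) + (if end₂ W e = C then 1 else 0) := by
  have hl := Closed.pos_lt he
  change bDiff W e (ext₀ W (indicator W C)) = _
  rw [bDiff_eq, ext_indicator C (by omega), ext_indicator C (hW.pos₂_lt he)]
  rfl

/-- A crossing between different curves merges them. Freeing it adds no flow, since it meets each of
its curves once, and its B-equation is violated by the indicator of one of the curves. -/
theorem flowDim_single {W : Word} (hW : Closed W) {e : ℕ} (he : e ∈ crossings W)
    (hee : end₁ W e ≠ end₂ W e) : flowDim W ∅ {e} = vA W ∧ circles W {e} + 1 = vA W := by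
  have h1 : flows W ∅ {e} = flows W ∅ ∅ := flows_eq_of_aDiff fun f hf x hx => by
    obtain rfl := Finset.mem_singleton.1 hx
    exact aDiff_of_mem_flows hW hf he hee (Sym2.mem_mk_left _ _) (by simp)
  have h2 : flows W {e} ∅ = flows W ∅ ∅ ⊓ LinearMap.ker (bDiffₗ W e) := by
    rw [← h1]
    exact flows_inf_bDiff he (Finset.notMem_empty e) (Finset.notMem_empty e)
  constructor
  · rw [flowDim, h1, finrank_flows hW, vA]
  · rw [← finrank_flows hW, h2, finrank_inf_ker, finrank_flows hW, vA]
    refine ⟨indicator W (end₁ W e), indicator_mem hW _, ?_⟩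
    rw [bDiff_indicator hW _ he, if_pos rfl, if_neg hee.symm]
    decide

theorem exists_not_mem_of_ne {α : Type*} {a b : α} (h : a ≠ b) {z : Sym2 α} (hz : s(a, b) ≠ z) :
    ∃ c ∈ s(a, b), c ∉ z := by
  by_contra hcon
  push Not at hcon
  exact hz ((Sym2.mem_and_mem_iff h).1
    ⟨hcon a (Sym2.mem_mk_left _ _), hcon b (Sym2.mem_mk_right _ _)⟩).symm

/-- Each crossing has an end which the other misses. Hence freeing both adds no flow, and the two
B-equations are independent: the indicator of `C` satisfies that of `e'` and violates that of `e`.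
-/
theorem flowDim_pair {W : Word} (hW : Closed W) {e e' : ℕ} (he : e ∈ crossings W)
    (he' : e' ∈ crossings W) (hee : end₁ W e ≠ end₂ W e) (hee' : end₁ W e' ≠ end₂ W e')
    (hne : ends W e ≠ ends W e') : flowDim W ∅ {e, e'} = vA W ∧ circles W {e, e'} + 2 = vA W := by
  obtain ⟨C, hC, hC'⟩ := exists_not_mem_of_ne hee hne
  obtain ⟨D, hD, hD'⟩ := exists_not_mem_of_ne hee' hne.symm
  have hee2 : e ≠ e' := by rintro rfl; exact hne rfl
  have h1 : flows W ∅ {e, e'} = flows W ∅ ∅ := flows_eq_of_aDiff fun f hf x hx => by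
    rw [Finset.mem_insert, Finset.mem_singleton] at hx
    rcases hx with rfl | rfl
    · refine aDiff_of_mem_flows hW hf he hee hC fun k hk hke => ?_
      simp only [Finset.union_empty, Finset.mem_insert, Finset.mem_singleton] at hk
      rw [hk.resolve_left hke]; exact hC'
    · refine aDiff_of_mem_flows hW hf he' hee' hD fun k hk hke => ?_
      simp only [Finset.union_empty, Finset.mem_insert, Finset.mem_singleton] at hk
      rw [hk.resolve_right hke]; exact hD'
  have h2 : flows W {e'} {e} = flows W ∅ ∅ ⊓ LinearMap.ker (bDiffₗ W e') := by
    rw [← h1, Finset.pair_comm]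
    exact flows_inf_bDiff he' (Finset.notMem_empty e') (by simpa using hee2.symm)
  have h3 : flows W {e, e'} ∅ = flows W ∅ ∅ ⊓ LinearMap.ker (bDiffₗ W e') ⊓
      LinearMap.ker (bDiffₗ W e) := by
    rw [← h2]
    exact flows_inf_bDiff he (by simpa using hee2) (Finset.notMem_empty e)
  constructor
  · rw [flowDim, h1, finrank_flows hW, vA]
  have h4 := finrank_inf_ker (flows W ∅ ∅) (bDiffₗ W e') ⟨indicator W (end₁ W e'), indicator_mem hW _, by
    rw [bDiff_indicator hW _ he', if_pos rfl, if_neg hee'.symm]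
    decide⟩
  have h5 : ∃ f ∈ flows W ∅ ∅ ⊓ LinearMap.ker (bDiffₗ W e'), bDiffₗ W e f ≠ 0 := by
    refine ⟨indicator W C, ⟨indicator_mem hW _, ?_⟩, ?_⟩
    · rw [SetLike.mem_coe, LinearMap.mem_ker, bDiff_indicator hW _ he']
      rw [ends, Sym2.mem_iff, not_or] at hC'
      rw [if_neg (Ne.symm hC'.1), if_neg (Ne.symm hC'.2), add_zero]
    · rw [bDiff_indicator hW _ he]
      rw [Sym2.mem_iff] at hC
      rcases hC with rfl | rfl
      · rw [if_pos rfl, if_neg hee.symm]; decide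
      · rw [if_pos rfl, if_neg hee]; decide
  have h6 := finrank_inf_ker _ (bDiffₗ W e) h5
  rw [← h3] at h6
  have h7 := finrank_flows hW {e, e'}
  have h8 := finrank_flows hW ∅
  rw [vA]
  omega

/-- Crossings which join the same two curves have the same colour. -/
theorem colour_eq_of_ends_eq {W : Word} (hW : Closed W) {e e' : ℕ} (he : e ∈ crossings W)
    (he' : e' ∈ crossings W) (hee : end₁ W e ≠ end₂ W e) (h : ends W e = ends W e') :
    colour W e = colour W e' := by
  by_contra hne
  set C := end₁ W e with hC
  set D := end₂ W e with hD
  -- The indicator of `C`, regarded as a flow. If the colours differed, the region values next to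
  -- `C` and `D` would agree on both sides. But the sum of the values on the two sides of a point is
  -- the label itself, which is 1 on `C` and 0 on `D`.
  have hf := indicator_mem hW C
  set f := ext₀ W (indicator W C) with hfdef
  have hflow : IsFlow W f := hf.1
  have hA : ∀ k ∈ crossings W, aDiff W k f = 0 := fun k hk =>
    (hf.2 k hk (Finset.notMem_empty k)).1 (Finset.notMem_empty k)
  have hconst : ∀ c < 2, ∀ E, ∀ p q : Point W, lab W p.1.1 p.1.2 = E → lab W q.1.1 q.1.2 = E →
      side c f p.1.1 p.1.2 = side c f q.1.1 q.1.2 := fun c hc E p q hp hq =>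
    side_const hW hflow hc (C := E) (e := 0) (fun k hk _ h => absurd (hA k hk) h) hp hq
  let p₁ : Point W := ⟨(e, pos W e), by have := Closed.pos_lt he; simp only; omega⟩
  let p₂ : Point W := ⟨(line₂ W e, pos₂ W e), hW.pos₂_lt he⟩
  let q₁ : Point W := ⟨(e', pos W e'), by have := Closed.pos_lt he'; simp only; omega⟩
  let q₂ : Point W := ⟨(line₂ W e', pos₂ W e'), hW.pos₂_lt he'⟩
  have hp := side_colour hflow he
  have hq := side_colour hflow he'
  have hq' : side (colour W e') f p₁.1.1 p₁.1.2 = side (colour W e') f p₂.1.1 p₂.1.2 := by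
    have hc := colour_lt W e'
    rw [ends, ends, Sym2.eq_iff] at h
    rcases h with h | h
    · rw [hconst _ hc C p₁ q₁ rfl h.1.symm, hconst _ hc D p₂ q₂ rfl h.2.symm]; exact hq
    · rw [hconst _ hc C p₁ q₂ rfl h.1.symm, hconst _ hc D p₂ q₁ rfl h.2.symm]; exact hq.symm
  have hall : ∀ c < 2, side c f p₁.1.1 p₁.1.2 = side c f p₂.1.1 p₂.1.2 := by
    intro c hc
    have h1 := colour_lt W e
    have h2 := colour_lt W e'
    rcases (by omega : c = colour W e ∨ c = colour W e') with rfl | rfl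
    · exact hp
    · exact hq'
  have key : ∀ p : Point W, side 0 f p.1.1 p.1.2 + side 1 f p.1.1 p.1.2 = f p.1.1 p.1.2 := by
    intro p
    have e1 (a b : ZMod 2) : a + (a + b) = b ∧ (a + b) + a = b := by revert a b; decide
    unfold side
    rw [region_succ]
    rcases Nat.mod_two_eq_zero_or_one p.1.2 with h | h
    · rw [if_pos h, if_neg (by omega)]; exact (e1 _ _).1
    · rw [if_neg (by omega), if_pos h]; exact (e1 _ _).2
  have h1 := key p₁
  have h2 := key p₂
  rw [hall 0 (by omega), hall 1 (by omega), h2, hfdef, ext_indicator C p₂.2, ext_indicator C p₁.2,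
    if_neg (show ¬ lab W p₂.1.1 p₂.1.2 = C from hee.symm),
    if_pos (show lab W p₁.1.1 p₁.1.2 = C from rfl)] at h1
  exact absurd h1 (by decide)

/-- A set of crossings which join the same two curves. -/
theorem circles_parallel {W : Word} (hW : Closed W) {H : Finset ℕ} (hH : H ⊆ crossings W)
    {e : ℕ} (heH : e ∈ H) (hee : end₁ W e ≠ end₂ W e) (h : ∀ x ∈ H, ends W x = ends W e) :
    circles W H + 2 = vA W + H.card ∧ flowDim W ∅ H + 1 = vA W + H.card := by
  have he := hH heH
  suffices ∀ T : Finset ℕ, e ∉ T → T ⊆ crossings W → (∀ x ∈ T, ends W x = ends W e) →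
      circles W (insert e T) + 2 = vA W + (T.card + 1) ∧
      flowDim W ∅ (insert e T) + 1 = vA W + (T.card + 1) by
    have := this (H.erase e) (Finset.notMem_erase e H) ((Finset.erase_subset e H).trans hH)
      fun x hx => h x (Finset.mem_of_mem_erase hx)
    rwa [Finset.insert_erase heH, Finset.card_erase_add_one heH] at this
  intro T heT
  induction T using Finset.induction_on with
  | empty =>
    intro _ _
    have := flowDim_single hW he hee
    simp only [insert_empty_eq, Finset.card_empty]
    omega
  | insert x T hxT ih =>
    intro hT hends
    rw [Finset.insert_subset_iff] at hT
    simp only [Finset.mem_insert, not_or] at heT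
    obtain ⟨ih1, ih2⟩ := ih heT.2 hT.2 fun y hy => hends y (Finset.mem_insert_of_mem hy)
    have hx := hT.1
    have hxe : x ∉ insert e T := by
      simp only [Finset.mem_insert, not_or]; exact ⟨Ne.symm heT.1, hxT⟩
    have hxends := hends x (Finset.mem_insert_self x T)
    have hcol : ∀ y ∈ insert e T, colour W y = colour W x := by
      have h1 := colour_eq_of_ends_eq hW he hx hee hxends.symm
      intro y hy
      rcases Finset.mem_insert.1 hy with rfl | hy
      · exact h1
      · rw [← h1]
        exact (colour_eq_of_ends_eq hW he (hT.2 hy) hee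
          (hends y (Finset.mem_insert_of_mem hy)).symm).symm
    -- All crossings in question have one colour, so the regions of the other colour are uncut along
    -- both curves. The crossing `e` already equates the values of these regions along the two
    -- curves; hence the B-equation of `x` is automatic, and `x` splits a circle.
    obtain ⟨h1, f, hf, hfa⟩ := circles_insert hW hx hxe fun f hf => by
      have hc : 1 - colour W x < 2 := by omega
      have hcx : colour W x ≠ 1 - colour W x := by have := colour_lt W x; omega
      refine (side_other_colour hf.1 hx hc hcx).1 ?_
      have hconst : ∀ E, ∀ p q : Point W, lab W p.1.1 p.1.2 = E → lab W q.1.1 q.1.2 = E →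
          side (1 - colour W x) (ext₀ W f) p.1.1 p.1.2 =
          side (1 - colour W x) (ext₀ W f) q.1.1 q.1.2 := by
        intro E p q hp hq
        refine side_const hW hf.1 hc (C := E) (e := 0) (fun k hk hkc hkf => ?_) hp hq
        have hkx : k ≠ x := by rintro rfl; exact hcx hkc
        by_cases hkK : k ∈ insert e T
        · exact absurd ((hcol k hkK).symm.trans hkc) hcx
        · exact absurd ((hf.2 k hk (by simpa using hkx)).1 hkK) hkf
      let p₁ : Point W := ⟨(e, pos W e), by have := Closed.pos_lt he; simp only; omega⟩
      let p₂ : Point W := ⟨(line₂ W e, pos₂ W e), hW.pos₂_lt he⟩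
      let q₁ : Point W := ⟨(x, pos W x), by have := Closed.pos_lt hx; simp only; omega⟩
      let q₂ : Point W := ⟨(line₂ W x, pos₂ W x), hW.pos₂_lt hx⟩
      have hp : side (1 - colour W x) (ext₀ W f) p₁.1.1 p₁.1.2 =
          side (1 - colour W x) (ext₀ W f) p₂.1.1 p₂.1.2 := by
        refine (side_other_colour hf.1 he hc ?_).2 ((hf.2 e he ?_).2 (Finset.mem_insert_self e T))
        · rw [hcol e (Finset.mem_insert_self e T)]; exact hcx
        · simpa using heT.1
      change side (1 - colour W x) (ext₀ W f) q₁.1.1 q₁.1.2 =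
          side (1 - colour W x) (ext₀ W f) q₂.1.1 q₂.1.2
      rw [ends, ends, Sym2.eq_iff] at hxends
      rcases hxends with h | h
      · rw [hconst _ q₁ p₁ rfl h.1.symm, hconst _ q₂ p₂ rfl h.2.symm, hp]
      · rw [hconst _ q₁ p₂ rfl h.1.symm, hconst _ q₂ p₁ rfl h.2.symm, hp]
    have h2 := flowDim_insert (X := insert e T) hx (Finset.notMem_empty x) hxe
      ⟨f, by simpa [Finset.insert_comm] using mem_flows_union hf, hfa⟩
    rw [Finset.insert_comm, Finset.card_insert_of_notMem hxT]
    omega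

/-- No crossing meets a curve of the all-`A` state twice. -/
def Adequate (W : Word) : Prop := ∀ x ∈ crossings W, end₁ W x ≠ end₂ W x

/-- The crossings in `H` join the same two curves. -/
def Parallel (W : Word) (H : Finset ℕ) : Prop := ∃ e ∈ H, ∀ x ∈ H, ends W x = ends W e

/-- In terms of the deficiency: one crossing costs 2 and two crossings joining different pairs cost
4, by `flowDim_single` and `flowDim_pair`; further crossings of the same bundle cost nothing, by
`circles_parallel`. Monotonicity excludes everything else. -/
theorem Adequate.circles_eq_iff {W : Word} (hW : Closed W) (h : Adequate W) {H : Finset ℕ}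
    (hH : H ⊆ crossings W) : (circles W H = vA W + H.card ↔ H = ∅) ∧
      (circles W H + 2 = vA W + H.card ↔ Parallel W H) := by
  have h1 : ∀ e ∈ H, circles W H + 2 ≤ vA W + H.card := by
    intro e he
    have h1 := circles_le_of_subset hW hH (Finset.singleton_subset_iff.2 he)
    have h2 := flowDim_single hW (hH he) (h e (hH he))
    rw [Finset.card_singleton] at h1
    omega
  have h0 : circles W ∅ = vA W := rfl
  refine ⟨⟨fun h' => ?_, ?_⟩, fun h' => ?_, ?_⟩
  · by_contra hne
    obtain ⟨e, he⟩ := Finset.nonempty_iff_ne_empty.2 hne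
    have := h1 e he
    omega
  · rintro rfl; simp [h0]
  · obtain ⟨e, he⟩ : H.Nonempty := by
      rw [Finset.nonempty_iff_ne_empty]
      rintro rfl
      simp [h0] at h'
    refine ⟨e, he, fun x hx => ?_⟩
    by_contra hne
    have h2 := circles_le_of_subset hW hH
      (Finset.insert_subset hx (Finset.singleton_subset_iff.2 he))
    have h3 := flowDim_pair hW (hH hx) (hH he) (h x (hH hx)) (h e (hH he)) hne
    rw [Finset.card_pair (by rintro rfl; exact hne rfl)] at h2
    omega
  · rintro ⟨e, he, h'⟩
    exact (circles_parallel hW hH he (h e (hH he)) h').1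

/-- The analogue for freed crossings. A single one costs 1, two crossings with different ends cost
2, and further members of a bundle are free. -/
theorem Adequate.flowDim_eq_iff {W : Word} (hW : Closed W) (h : Adequate W) {X : Finset ℕ}
    (hX : X ⊆ crossings W) : (flowDim W ∅ X = vA W + X.card ↔ X = ∅) ∧
      (flowDim W ∅ X + 1 = vA W + X.card ↔ Parallel W X) := by
  have h1 : ∀ Y ⊆ X, flowDim W ∅ X + Y.card ≤ flowDim W ∅ Y + X.card := by
    intro Y hY
    have := flowDim_union_le (W := W) (B := ∅) (X := Y) (T := X \ Y)
      (Finset.sdiff_subset.trans hX) (Finset.disjoint_empty_right _) Finset.sdiff_disjoint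
    rw [Finset.union_sdiff_of_subset hY, Finset.card_sdiff_of_subset hY] at this
    have := Finset.card_le_card hY
    omega
  have h0 : flowDim W ∅ ∅ = vA W := flowDim_empty hW ∅
  refine ⟨⟨fun h' => ?_, ?_⟩, fun h' => ?_, ?_⟩
  · by_contra hne
    obtain ⟨e, he⟩ := Finset.nonempty_iff_ne_empty.2 hne
    have h2 := h1 {e} (Finset.singleton_subset_iff.2 he)
    have h3 := flowDim_single hW (hX he) (h e (hX he))
    rw [Finset.card_singleton] at h2
    omega
  · rintro rfl; simp [h0]
  · obtain ⟨e, he⟩ : X.Nonempty := by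
      rw [Finset.nonempty_iff_ne_empty]
      rintro rfl
      simp [h0] at h'
    refine ⟨e, he, fun x hx => ?_⟩
    by_contra hne
    have h2 := h1 {x, e} (Finset.insert_subset hx (Finset.singleton_subset_iff.2 he))
    have h3 := flowDim_pair hW (hX hx) (hX he) (h x (hX hx)) (h e (hX he)) hne
    rw [Finset.card_pair (by rintro rfl; exact hne rfl)] at h2
    omega
  · rintro ⟨e, he, h'⟩
    exact (circles_parallel hW hX he (h e (hX he)) h').2

/-- Changing a self-chord in the all-A state splits a circle, so some flow violates its A-equation.
This flow survives when further crossings are freed. -/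
theorem flowDim_insert_chord {W : Word} (hW : Closed W) {X : Finset ℕ} {x : ℕ}
    (hx : x ∈ crossings W) (hX : x ∉ X) (hxx : end₁ W x = end₂ W x) :
    flowDim W ∅ (insert x X) = flowDim W ∅ X + 1 := by
  obtain ⟨-, f, hf, hfa⟩ := circles_insert_chord hW (K := ∅) (e := 0) hx (Finset.notMem_empty x) hxx
    (by simp)
  exact flowDim_insert hx (Finset.notMem_empty x) hX
    ⟨f, flows_mono (Finset.singleton_subset_iff.2 (Finset.mem_insert_self x X)) hf, hfa⟩

/-! ### Bundles of crossings joining the same pair of circles. -/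

open Classical in
/-- The number of pairs of curves of the all-`A` state which are joined by crossings. -/
noncomputable def numPairs (W : Word) : ℕ := ((crossings W).image (ends W)).card

-- The sets in question are the nonempty subsets of the bundles, and for each bundle the alternating
-- sum over its nonempty subsets is −1.
open Classical in
theorem sum_parallel (W : Word) :
    ∑ H ∈ (crossings W).powerset with Parallel W H, (-1 : ℤ) ^ H.card = -numPairs W := by
  have h : (crossings W).powerset.filter (Parallel W) = ((crossings W).image (ends W)).biUnion
      fun z => ((crossings W).filter (fun x => ends W x = z)).powerset.erase ∅ := by
    ext H
    simp only [Finset.mem_filter, Finset.mem_powerset, Finset.mem_biUnion, Finset.mem_image,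
      Finset.mem_erase]
    constructor
    · rintro ⟨hH, e, he, h⟩
      refine ⟨_, ⟨e, hH he, rfl⟩, Finset.nonempty_iff_ne_empty.1 ⟨e, he⟩, fun x hx => ?_⟩
      exact Finset.mem_filter.2 ⟨hH hx, h x hx⟩
    · rintro ⟨z, -, hne, hH⟩
      obtain ⟨e, he⟩ := Finset.nonempty_iff_ne_empty.2 hne
      exact ⟨fun x hx => (Finset.mem_filter.1 (hH hx)).1, e, he, fun x hx =>
        (Finset.mem_filter.1 (hH hx)).2.trans (Finset.mem_filter.1 (hH he)).2.symm⟩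
  rw [h, Finset.sum_biUnion]
  · rw [Finset.sum_congr rfl (g := fun _ => (-1 : ℤ)), Finset.sum_const, numPairs]
    · simp
    · intro z hz
      obtain ⟨e, he, rfl⟩ := Finset.mem_image.1 hz
      have h1 := Finset.sum_powerset_neg_one_pow_card_of_nonempty
        (x := (crossings W).filter (fun x => ends W x = ends W e)) ⟨e, by simp [he]⟩
      rw [← Finset.add_sum_erase _ _ (Finset.empty_mem_powerset _)] at h1
      simp only [Finset.card_empty, pow_zero] at h1
      linarith
  · intro z _ z' _ hzz'
    rw [Function.onFun, Finset.disjoint_left]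
    intro H hH hH'
    rw [Finset.mem_erase, Finset.mem_powerset] at hH hH'
    obtain ⟨e, he⟩ := Finset.nonempty_iff_ne_empty.2 hH.1
    exact hzz' ((Finset.mem_filter.1 (hH.2 he)).2.symm.trans (Finset.mem_filter.1 (hH'.2 he)).2)

/-! ### The first two coefficients of the bracket -/

theorem coeff_T_mul (a n : ℤ) (f : ℤ[T;T⁻¹]) :
    (LaurentPolynomial.T a * f).coeff n = f.coeff (n - a) := by
  rw [LaurentPolynomial.T, AddMonoidAlgebra.coeff_single_mul_eq_mul_coeff (n - a), one_mul]
  intro m _; omega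

theorem coeff_loop_succ (m : ℕ) (n : ℤ) :
    ((-LaurentPolynomial.T 2 - LaurentPolynomial.T (-2) : ℤ[T;T⁻¹]) ^ (m + 1)).coeff n =
      -((-LaurentPolynomial.T 2 - LaurentPolynomial.T (-2) : ℤ[T;T⁻¹]) ^ m).coeff (n - 2)
      -((-LaurentPolynomial.T 2 - LaurentPolynomial.T (-2) : ℤ[T;T⁻¹]) ^ m).coeff (n + 2) := by
  set P := (-LaurentPolynomial.T 2 - LaurentPolynomial.T (-2) : ℤ[T;T⁻¹]) ^ m with hP
  have : (-LaurentPolynomial.T 2 - LaurentPolynomial.T (-2) : ℤ[T;T⁻¹]) ^ (m + 1) =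
      -(LaurentPolynomial.T 2 * P) - LaurentPolynomial.T (-2) * P := by
    rw [pow_succ, ← hP]; ring
  rw [this, AddMonoidAlgebra.coeff_sub, AddMonoidAlgebra.coeff_neg, Finsupp.sub_apply,
    Finsupp.neg_apply, coeff_T_mul, coeff_T_mul]
  simp

/-- By the binomial theorem the exponents descend in steps of four, and the first two binomial
coefficients are 1 and m. -/
theorem coeff_loop (m : ℕ) : (∀ n : ℤ, 2 * m < n →
      ((-LaurentPolynomial.T 2 - LaurentPolynomial.T (-2) : ℤ[T;T⁻¹]) ^ m).coeff n = 0) ∧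
    ((-LaurentPolynomial.T 2 - LaurentPolynomial.T (-2) : ℤ[T;T⁻¹]) ^ m).coeff (2 * m) = (-1) ^ m ∧
    ((-LaurentPolynomial.T 2 - LaurentPolynomial.T (-2) : ℤ[T;T⁻¹]) ^ m).coeff (2 * m - 2) = 0 ∧
    ((-LaurentPolynomial.T 2 - LaurentPolynomial.T (-2) : ℤ[T;T⁻¹]) ^ m).coeff (2 * m - 4) =
      (-1) ^ m * m := by
  induction m with
  | zero =>
    have h1 : (1 : ℤ[T;T⁻¹]) = LaurentPolynomial.T 0 := by simp
    simp only [pow_zero, h1, LaurentPolynomial.T_apply]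
    refine ⟨fun n hn => if_neg ?_, ?_, ?_, ?_⟩ <;> (simp at *; try omega)
  | succ m ih =>
    obtain ⟨h1, h2, h3, h4⟩ := ih
    refine ⟨fun n hn => ?_, ?_, ?_, ?_⟩
    · push_cast at hn
      rw [coeff_loop_succ, h1 _ (by omega), h1 _ (by omega)]; simp
    · rw [coeff_loop_succ, h1 (_ + 2) (by push_cast; omega)]
      have : (2 * ((m + 1 : ℕ) : ℤ) - 2) = 2 * m := by push_cast; ring
      rw [this, h2, pow_succ]; ring
    · rw [coeff_loop_succ, h1 (_ + 2) (by push_cast; omega)]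
      have : (2 * ((m + 1 : ℕ) : ℤ) - 2 - 2) = 2 * m - 2 := by push_cast; ring
      rw [this, h3]; ring
    · rw [coeff_loop_succ]
      have e1 : (2 * ((m + 1 : ℕ) : ℤ) - 4 - 2) = 2 * m - 4 := by push_cast; ring
      have e2 : (2 * ((m + 1 : ℕ) : ℤ) - 4 + 2) = 2 * m := by push_cast; ring
      rw [e1, e2, h2, h4, pow_succ]; push_cast; ring

theorem coeffM_eq (W : Word) (j : ℕ) : coeffM W j = ∑ H ∈ (crossings W).powerset,
    ((-LaurentPolynomial.T 2 - LaurentPolynomial.T (-2) : ℤ[T;T⁻¹]) ^ (circles W H - 1)).coeff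
      (2 * (vA W + H.card) - 2 - 4 * j) := by
  rw [coeffM, bracket, AddMonoidAlgebra.coeff_sum, Finsupp.finsetSum_apply]
  refine Finset.sum_congr rfl fun H _ => ?_
  rw [coeff_T_mul]
  congr 1
  rw [M]; ring

-- A state attains degree M only if its deficiency is zero, and then it contributes the leading
-- coefficient of its loop factor.
open Classical in
theorem coeffM_zero {W : Word} (hW : Closed W) (hpos : ∀ H, 0 < circles W H) :
    coeffM W 0 = ∑ H ∈ (crossings W).powerset,
      if circles W H = vA W + H.card then (-1) ^ (circles W H - 1) else 0 := by
  rw [coeffM_eq]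
  refine Finset.sum_congr rfl fun H hH => ?_
  have h1 := circles_le hW (Finset.mem_powerset.1 hH)
  have h2 := hpos H
  obtain ⟨g1, g2, g3, g4⟩ := coeff_loop (circles W H - 1)
  split_ifs with h
  · rw [← g2]; congr 1; push_cast [Nat.sub_add_cancel h2]; omega
  · exact g1 _ (by omega)

-- Deficiency zero contributes the second coefficient of the loop factor, deficiency two its leading
-- coefficient. Deficiency one would hit an exponent that does not occur, so no separate parity
-- argument is needed.
open Classical in
theorem coeffM_one {W : Word} (hW : Closed W) (hpos : ∀ H, 0 < circles W H) :
    coeffM W 1 = ∑ H ∈ (crossings W).powerset,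
      ((if circles W H = vA W + H.card then (-1) ^ (circles W H - 1) * ((circles W H : ℤ) - 1) else 0) +
        (if circles W H + 2 = vA W + H.card then (-1) ^ (circles W H - 1) else 0)) := by
  rw [coeffM_eq]
  refine Finset.sum_congr rfl fun H hH => ?_
  have h1 := circles_le hW (Finset.mem_powerset.1 hH)
  have h2 := hpos H
  obtain ⟨g1, g2, g3, g4⟩ := coeff_loop (circles W H - 1)
  have hc : ((circles W H - 1 : ℕ) : ℤ) = (circles W H : ℤ) - 1 := by omega
  rcases (by omega : circles W H = vA W + H.card ∨ circles W H + 1 = vA W + H.card ∨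
    circles W H + 2 = vA W + H.card ∨ circles W H + 2 < vA W + H.card) with h | h | h | h
  · rw [if_pos h, if_neg (by omega), add_zero, ← hc, ← g4]; congr 1; omega
  · rw [if_neg (by omega), if_neg (by omega), add_zero, ← g3]; congr 1; omega
  · rw [if_neg (by omega), if_pos h, zero_add, ← g2]; congr 1; omega
  · rw [if_neg (by omega), if_neg (by omega), add_zero]; exact g1 _ (by omega)

/-- Every word which is not empty has points, so that every state has circles. -/
theorem circles_pos {W : Word} (hW : Closed W) (hne : W ≠ []) (H : Finset ℕ) : 0 < circles W H := by
  obtain ⟨s, hs⟩ := exists_slice (List.length_pos_iff.2 hne)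
  have h0 := hW.bottom
  have h1 := hW.next 0 s hs
  rw [width_eq hs, Slice.length_source] at h0
  rw [Slice.length_target] at h1
  have hT : s.piece.target.length = 2 := by
    cases hp : s.piece <;> simp [hp, Piece.source, Piece.target] at h0 ⊢
  have : Nonempty (Curves W (state W H)) := ⟨Quot.mk _ ⟨(1, 0), by simp only; simp at h1; omega⟩⟩
  rw [circles, Nat.card_eq_fintype_card]
  exact Fintype.card_pos

theorem Adequate.coeffM_zero {W : Word} (hW : Closed W) (hne : W ≠ []) (h : Adequate W) :
    |coeffM W 0| = 1 := by
  classical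
  rw [LinkDiagram.coeffM_zero hW (circles_pos hW hne), Finset.sum_eq_single ∅]
  · rw [if_pos (by simp [vA]), abs_pow, abs_neg, abs_one, one_pow]
  · intro H hH hne'
    exact if_neg fun h' => hne' ((h.circles_eq_iff hW (Finset.mem_powerset.1 hH)).1.1 h')
  · intro h'; exact absurd (Finset.empty_mem_powerset _) h'

/-- The all-A state contributes v_A − 1, and the bundles contribute −`numPairs` by `sum_parallel`,
both with the sign (−1)^(v_A − 1). -/
theorem Adequate.coeffM_one {W : Word} (hW : Closed W) (hne : W ≠ []) (h : Adequate W) :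
    |coeffM W 1| = |(vA W : ℤ) - 1 - numPairs W| := by
  classical
  have hv : 0 < vA W := circles_pos hW hne ∅
  rw [LinkDiagram.coeffM_one hW (circles_pos hW hne), Finset.sum_add_distrib]
  have e1 : (∑ H ∈ (crossings W).powerset, if circles W H = vA W + H.card then
      (-1 : ℤ) ^ (circles W H - 1) * ((circles W H : ℤ) - 1) else 0) =
      (-1) ^ (vA W - 1) * ((vA W : ℤ) - 1) := by
    rw [Finset.sum_eq_single ∅]
    · rw [if_pos (by simp [vA])]; rfl
    · intro H hH hne'
      exact if_neg fun h' => hne' ((h.circles_eq_iff hW (Finset.mem_powerset.1 hH)).1.1 h')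
    · intro h'; exact absurd (Finset.empty_mem_powerset _) h'
  have e2 : (∑ H ∈ (crossings W).powerset, if circles W H + 2 = vA W + H.card then
      (-1 : ℤ) ^ (circles W H - 1) else 0) = (-1) ^ (vA W - 1) * -numPairs W := by
    rw [← sum_parallel, Finset.mul_sum, Finset.sum_filter]
    refine Finset.sum_congr rfl fun H hH => ?_
    have h1 := (h.circles_eq_iff hW (Finset.mem_powerset.1 hH)).2
    have h2 := circles_pos hW hne H
    by_cases h' : Parallel W H
    · have h3 := h1.2 h'
      rw [if_pos h', if_pos h3, ← pow_add]
      have : vA W - 1 + H.card = (circles W H - 1) + 2 := by omega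
      rw [this, pow_add]; simp
    · rw [if_neg h', if_neg fun h3 => h' (h1.1 h3)]
  rw [e1, e2, ← mul_add, abs_mul, abs_pow, abs_neg, abs_one, one_pow, one_mul]
  rfl

/-! ### Cancellation of states by toggling chords. -/

theorem circles_of_not_self {W : Word} (hW : Closed W) {K : Finset ℕ} (hK : K ⊆ crossings W) {k : ℕ}
    (hk : k ∈ K) (hkk : end₁ W k ≠ end₂ W k) : circles W K + 2 ≤ vA W + K.card := by
  have h1 := circles_le_of_subset hW hK (Finset.singleton_subset_iff.2 hk)
  have h2 := (flowDim_single hW (hK hk) hkk).2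
  have h3 := Finset.card_pos.2 ⟨k, hk⟩
  rw [Finset.card_singleton] at h1
  omega

/-- A chord whose resolution may be changed freely makes the first coefficient vanish. -/
theorem coeffM_zero_eq_zero {W : Word} (hW : Closed W) (hne : W ≠ []) {x : ℕ} (hx : x ∈ crossings W)
    (hxx : end₁ W x = end₂ W x)
    (h : ∀ k ∈ crossings W, end₁ W k = end₂ W k → colour W k ≠ colour W x → end₁ W k ≠ end₁ W x) :
    coeffM W 0 = 0 := by
  classical
  rw [coeffM_zero hW (circles_pos hW hne), ← Finset.insert_erase hx,
    Finset.sum_powerset_insert (Finset.notMem_erase x _), ← Finset.sum_add_distrib]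
  -- States are paired by toggling `x`. A state without deficiency contains only self-chords, and
  -- those of the other colour avoid the curve of `x`. So toggling splits a circle: the deficiency
  -- stays zero and the sign changes.
  refine Finset.sum_eq_zero fun K hK => ?_
  have hxK : x ∉ K := fun h' => Finset.notMem_erase x _ (Finset.mem_powerset.1 hK h')
  have hKc : K ⊆ crossings W := (Finset.mem_powerset.1 hK).trans (Finset.erase_subset _ _)
  have h1 := circles_le hW hKc
  have h2 := circles_insert_le hW hx hxK
  have h3 := circles_pos hW hne K
  rw [Finset.card_insert_of_notMem hxK]
  by_cases hd : circles W K = vA W + K.card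
  · have hself : ∀ k ∈ K, end₁ W k = end₂ W k := fun k hk => by
      by_contra hkk
      have := circles_of_not_self hW hKc hk hkk
      omega
    have hf := (circles_insert_chord hW (e := x) hx hxK hxx fun k hk hc => Or.inl
      ⟨h k (hKc hk) (hself k hk) hc, hself k hk ▸ h k (hKc hk) (hself k hk) hc⟩).1
    rw [if_pos hd, if_pos (by omega), hf]
    have : circles W K + 1 - 1 = circles W K - 1 + 1 := by omega
    rw [this, pow_succ]; ring
  · rw [if_neg hd, if_neg (by omega), add_zero]

/-- If all self-chords had the colour of `x`, toggling `x` would never be obstructed and the first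
coefficient would vanish. -/
theorem exists_other_colour {W : Word} (hW : Closed W) (hne : W ≠ []) (h0 : coeffM W 0 ≠ 0)
    {x : ℕ} (hx : x ∈ crossings W) (hxx : end₁ W x = end₂ W x) :
    ∃ y ∈ crossings W, end₁ W y = end₂ W y ∧ colour W y ≠ colour W x := by
  by_contra hcon
  push Not at hcon
  exact h0 (coeffM_zero_eq_zero hW hne hx hxx fun k hk hkk hc => absurd (hcon k hk hkk) hc)

open Classical in
/-- The contribution of a state to the second coefficient. -/
noncomputable def secondTerm (W : Word) (H : Finset ℕ) : ℤ :=
  (if circles W H = vA W + H.card then (-1) ^ (circles W H - 1) * ((circles W H : ℤ) - 1) else 0) +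
    (if circles W H + 2 = vA W + H.card then (-1) ^ (circles W H - 1) else 0)

/-- From deficiency two on, `secondTerm` is zero or a sign. A chord that splits a circle preserves
the deficiency and reverses the sign. -/
theorem secondTerm_insert {W : Word} (hW : Closed W) (hne : W ≠ []) {K : Finset ℕ}
    (hd : circles W K + 2 ≤ vA W + K.card) {x : ℕ} (hxK : x ∉ K)
    (h : circles W (insert x K) = circles W K + 1) : secondTerm W K + secondTerm W (insert x K) = 0 := by
  have h3 := circles_pos hW hne K
  unfold secondTerm
  rw [Finset.card_insert_of_notMem hxK, h]
  have : circles W K + 1 - 1 = circles W K - 1 + 1 := by omega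
  rw [this, pow_succ]
  split_ifs <;> omega

/-- All four states have the same deficiency. In deficiency zero the alternating sum is the second
difference of a linear function of the number of circles; in deficiency two it is an alternating sum
of signs. -/
theorem secondTerm_block {W : Word} (hW : Closed W) (hne : W ≠ []) {K : Finset ℕ} {s t : ℕ}
    (hst : s ≠ t) (hsK : s ∉ K) (htK : t ∉ K)
    (h1 : circles W (insert s K) = circles W K + 1) (h2 : circles W (insert t K) = circles W K + 1)
    (h3 : circles W (insert s (insert t K)) = circles W K + 2) :
    secondTerm W K + secondTerm W (insert s K) +
      (secondTerm W (insert t K) + secondTerm W (insert s (insert t K))) = 0 := by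
  have hp := circles_pos hW hne K
  have hs' : s ∉ insert t K := by simp [hst, hsK]
  unfold secondTerm
  rw [Finset.card_insert_of_notMem hs', Finset.card_insert_of_notMem hsK,
    Finset.card_insert_of_notMem htK, h1, h2, h3]
  have e1 : circles W K + 1 - 1 = circles W K - 1 + 1 := by omega
  have e2 : circles W K + 2 - 1 = circles W K - 1 + 2 := by omega
  rw [e1, e2, pow_add, pow_add]
  split_ifs <;> first | omega | (push_cast; ring)

/-- Two chords, at least one of which may be changed freely in each state that matters, make the
second coefficient vanish. -/
theorem coeffM_one_eq_zero {W : Word} (hW : Closed W) (hne : W ≠ []) {s t : ℕ}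
    (hs : s ∈ crossings W) (ht : t ∈ crossings W) (hst : s ≠ t)
    (hss : end₁ W s = end₂ W s) (htt : end₁ W t = end₂ W t)
    (hs' : ∀ k ∈ crossings W, colour W k ≠ colour W s → end₁ W s ∈ ends W k →
      end₁ W k ≠ end₂ W k)
    (ht' : ∀ k ∈ crossings W, colour W k ≠ colour W t → end₁ W t ∈ ends W k →
      end₁ W k ≠ end₂ W k)
    (h : ∀ k ∈ crossings W, ∀ l ∈ crossings W, colour W k ≠ colour W s → end₁ W s ∈ ends W k →
      colour W l ≠ colour W t → end₁ W t ∈ ends W l → ends W k ≠ ends W l) :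
    coeffM W 1 = 0 := by
  classical
  have ht1 : t ∈ (crossings W).erase s := Finset.mem_erase.2 ⟨hst.symm, ht⟩
  rw [coeffM_one hW (circles_pos hW hne)]
  change ∑ H ∈ (crossings W).powerset, secondTerm W H = 0
  rw [← Finset.insert_erase hs, Finset.sum_powerset_insert (Finset.notMem_erase s _),
    ← Finset.sum_add_distrib, ← Finset.insert_erase ht1,
    Finset.sum_powerset_insert (Finset.notMem_erase t _), ← Finset.sum_add_distrib]
  -- States are grouped in fours, according to the presence of `s` and `t`.
  refine Finset.sum_eq_zero fun K hK => ?_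
  have hK' := Finset.mem_powerset.1 hK
  have htK : t ∉ K := fun h' => Finset.notMem_erase t _ (hK' h')
  have hsK : s ∉ K := fun h' => Finset.notMem_erase s _ (Finset.erase_subset _ _ (hK' h'))
  have hKc : K ⊆ crossings W := hK'.trans ((Finset.erase_subset _ _).trans (Finset.erase_subset _ _))
  have hsK' : s ∉ insert t K := by simp [hst, hsK]
  have htK' : t ∉ insert s K := by simp [hst.symm, htK]
  have hcs : insert s K ⊆ crossings W := Finset.insert_subset hs hKc
  have hct : insert t K ⊆ crossings W := Finset.insert_subset ht hKc
  have free : ∀ {x : ℕ} {L : Finset ℕ}, x ∈ crossings W → x ∉ L → end₁ W x = end₂ W x →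
      (∀ k ∈ L, colour W k ≠ colour W x → end₁ W x ∉ ends W k) →
      circles W (insert x L) = circles W L + 1 := fun {x L} hx hxL hxx hL =>
    (circles_insert_chord hW (e := x) hx hxL hxx fun k hk hc => Or.inl (by
      have := hL k hk hc
      unfold ends at this
      rw [Sym2.mem_iff, not_or] at this
      exact ⟨Ne.symm this.1, Ne.symm this.2⟩)).1
  have ht_s : colour W t ≠ colour W s → end₁ W s ∉ ends W t := fun hc hm => hs' t ht hc hm htt
  have hs_t : colour W s ≠ colour W t → end₁ W t ∉ ends W s := fun hc hm => ht' s hs hc hm hss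
  -- If K consists of self-chords, both toggles are free and the block of four cancels. If K
  -- contains crossings joining two different pairs of circles, the deficiency is at least four and
  -- every term is zero. In the remaining case the crossings between different circles form one
  -- bundle.
  by_cases hself : ∃ k ∈ K, end₁ W k ≠ end₂ W k
  · obtain ⟨k, hk, hkk⟩ := hself
    by_cases hall : ∃ l ∈ K, end₁ W l ≠ end₂ W l ∧ ends W k ≠ ends W l
    · obtain ⟨l, hl, hll, hkl⟩ := hall
      have hp := (flowDim_pair hW (hKc hk) (hKc hl) hkk hll hkl).2
      have hkl' : k ≠ l := fun h' => hkl (by rw [h'])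
      have hsub : {k, l} ⊆ K := Finset.insert_subset hk (Finset.singleton_subset_iff.2 hl)
      have hcard : ({k, l} : Finset ℕ).card = 2 := Finset.card_pair hkl'
      have key : ∀ H ⊆ crossings W, K ⊆ H → secondTerm W H = 0 := fun H hH hKH => by
        have h1 := circles_le_of_subset hW hH (hsub.trans hKH)
        have h2 := Finset.card_le_card (hsub.trans hKH)
        unfold secondTerm
        rw [if_neg (by omega), if_neg (by omega), add_zero]
      have hcst : insert s (insert t K) ⊆ crossings W := Finset.insert_subset hs hct
      rw [key K hKc subset_rfl, key _ hcs (Finset.subset_insert _ _),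
        key _ hct (Finset.subset_insert _ _),
        key _ hcst ((Finset.subset_insert _ _).trans (Finset.subset_insert _ _))]
      rfl
    · push Not at hall
      -- A crossing that obstructs `s` joins different circles by `hs'`, so it belongs to the
      -- bundle. By `h` no member of the same bundle obstructs `t`, so `t` can be toggled; if
      -- nothing obstructs `s`, then `s` is toggled.
      by_cases hN : ∃ l ∈ K, colour W l ≠ colour W s ∧ end₁ W s ∈ ends W l
      · obtain ⟨l, hl, hlc, hlm⟩ := hN
        have hlk := hall l hl (hs' l (hKc hl) hlc hlm)
        have hKt : ∀ k ∈ K, colour W k ≠ colour W t → end₁ W t ∉ ends W k := fun m hm hc hmem =>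
          h l (hKc hl) m (hKc hm) hlc hlm hc hmem
            (hlk.symm.trans (hall m hm (ht' m (hKc hm) hc hmem)))
        have f1 := free ht htK htt hKt
        have f2 := free ht htK' htt (by
          intro m hm
          rcases Finset.mem_insert.1 hm with rfl | hm
          exacts [hs_t, hKt m hm])
        have g1 := secondTerm_insert hW hne (circles_of_not_self hW hKc hk hkk) htK f1
        have g2 := secondTerm_insert hW hne
          (circles_of_not_self hW hcs (Finset.mem_insert_of_mem hk) hkk) htK' f2
        rw [Finset.insert_comm t s] at g2
        linarith
      · push Not at hN
        have f1 := free hs hsK hss hN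
        have f2 := free hs hsK' hss (by
          intro m hm
          rcases Finset.mem_insert.1 hm with rfl | hm
          exacts [ht_s, hN m hm])
        have g1 := secondTerm_insert hW hne (circles_of_not_self hW hKc hk hkk) hsK f1
        have g2 := secondTerm_insert hW hne
          (circles_of_not_self hW hct (Finset.mem_insert_of_mem hk) hkk) hsK' f2
        linarith
  · push Not at hself
    have hN : ∀ k ∈ K, colour W k ≠ colour W s → end₁ W s ∉ ends W k := fun k hk hc hm =>
      hs' k (hKc hk) hc hm (hself k hk)
    have hN' : ∀ k ∈ K, colour W k ≠ colour W t → end₁ W t ∉ ends W k := fun k hk hc hm =>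
      ht' k (hKc hk) hc hm (hself k hk)
    have f2 := free hs hsK' hss (by
      intro m hm
      rcases Finset.mem_insert.1 hm with rfl | hm
      exacts [ht_s, hN m hm])
    have f1 := free ht htK htt hN'
    exact secondTerm_block hW hne hst hsK htK (free hs hsK hss hN) f1 (by rw [f2, f1])

/-! ### Labels of a block of parallel strands -/

section Blocks

variable {L : Type*} {f : ℕ → ℕ → L} {n l R : ℕ}

/-- The level, in the all-`A` state of a grid with horizontal arcs, of the point number `p` on the line
below the crossing number `j` in the row number `i`. -/
def level (n i j p : ℕ) : ℕ :=
  if p + i + 1 < n then n - 1 - p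
  else if p + i + 1 < n + j then p + 2 * i + 2 - n
  else if p + i + 1 = n + j then i + j
  else if p + i < 2 * n then p + 2 * i - n
  else 3 * n - 1 - p

/-- The all-A state of a grid with horizontal arcs is a stack of n nested caps below n nested cups.
Levels count these arcs upwards along the axis: 0 is the innermost cap, n − 1 and n are the
outermost cap and cup, 2n − 1 is the innermost cup. Crossing (i, j) lies between levels i + j and i
+ j + 1, and all other strands pass it unchanged. -/
theorem level_next {i j p : ℕ} (hi : i < n) (hj : j < n) (h1 : p ≠ n - 1 - i + j)
    (h2 : p ≠ n - 1 - i + j + 1) : level n i (j + 1) p = level n i j p := by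
  unfold level; split_ifs <;> omega

theorem level_below {i j : ℕ} (hi : i < n) (hj : j < n) :
    level n i j (n - 1 - i + j) = i + j ∧ level n i j (n - 1 - i + j + 1) = i + j := by
  unfold level; constructor <;> split_ifs <;> omega

theorem level_above {i j : ℕ} (hi : i < n) :
    level n i (j + 1) (n - 1 - i + j) = i + j + 1 ∧
      level n i (j + 1) (n - 1 - i + j + 1) = i + j + 1 := by
  unfold level; constructor <;> split_ifs <;> omega

theorem level_row {i p : ℕ} (hi : i < n) (hp : p < 2 * n) : level n (i + 1) 0 p = level n i n p := by
  unfold level; split_ifs <;> omega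

/-- The level of the point number `p` on the line number `t`. -/
def levelAt (n t p : ℕ) : ℕ := level n (t / n) (t % n) p

theorem levelAt_succ {t p : ℕ} (ht : t < n * n) (hp : p < 2 * n) :
    levelAt n (t + 1) p = level n (t / n) (t % n + 1) p := by
  have hn : 0 < n := Nat.pos_of_mul_pos_left (by omega : 0 < n * n)
  have hi : t / n < n := Nat.div_lt_of_lt_mul ht
  have hj : t % n < n := Nat.mod_lt _ hn
  unfold levelAt
  by_cases h : t % n + 1 < n
  · have h1 : t + 1 = t % n + 1 + n * (t / n) := by have := Nat.mod_add_div t n; omega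
    have h2 : (t + 1) / n = t / n := by
      rw [h1, Nat.add_mul_div_left _ _ hn, Nat.div_eq_of_lt h, zero_add]
    have h3 : (t + 1) % n = t % n + 1 := by
      rw [h1, Nat.add_mul_mod_self_left, Nat.mod_eq_of_lt h]
    rw [h2, h3]
  · have h0 : t % n + 1 = n := by omega
    have h1 : t + 1 = n * (t / n + 1) := by
      have := Nat.mod_add_div t n; rw [mul_add]; omega
    rw [h0, h1, Nat.mul_div_cancel_left _ hn, Nat.mul_mod_right]
    exact level_row hi hp

/-- Each further cup opens inside the earlier ones. Points left of the middle keep their position up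
to the top line, and points to the right are shifted by two for every cup still to come; the
induction descends from the top. -/
theorem cup_block (h1 : ∀ t < n, ∀ p < l + t, f t p = f (t + 1) p)
    (h2 : ∀ t < n, ∀ i < t + R, f t (l + t + i) = f (t + 1) (l + t + 2 + i))
    (h3 : ∀ t < n, f (t + 1) (l + t) = f (t + 1) (l + t + 1)) :
    (∀ t ≤ n, ∀ p < l + 2 * t + R, f t p = if p < l + t then f n p else f n (p + 2 * (n - t))) ∧
      ∀ p < n, f n (l + p) = f n (l + (2 * n - 1 - p)) := by
  have key : ∀ t ≤ n, ∀ p < l + 2 * t + R,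
      f t p = if p < l + t then f n p else f n (p + 2 * (n - t)) := by
    intro t ht
    induction ht using Nat.decreasingInduction with
    | self => intro p hp; simp
    | of_succ t ht ih =>
      intro p hp
      split_ifs with h
      · rw [h1 t ht p h, ih p (by omega), if_pos (by omega)]
      · obtain ⟨i, rfl⟩ : ∃ i, p = l + t + i := ⟨p - (l + t), by omega⟩
        rw [h2 t ht i (by omega), ih _ (by omega), if_neg (by omega)]
        congr 1; omega
  refine ⟨key, fun p hp => ?_⟩
  have e := h3 p hp
  rw [key (p + 1) hp _ (by omega), key (p + 1) hp _ (by omega), if_pos (by omega),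
    if_neg (by omega)] at e
  rw [e]; congr 1; omega

theorem cap_block (h1 : ∀ t < n, ∀ p < l + (n - 1 - t), f t p = f (t + 1) p)
    (h2 : ∀ t < n, ∀ i < n - 1 - t + R,
      f t (l + (n - 1 - t) + 2 + i) = f (t + 1) (l + (n - 1 - t) + i))
    (h3 : ∀ t < n, f t (l + (n - 1 - t)) = f t (l + (n - 1 - t) + 1)) :
    (∀ t ≤ n, ∀ p < l + 2 * (n - t) + R,
      f t p = if p < l + (n - t) then f 0 p else f 0 (p + 2 * t)) ∧
      ∀ p < n, f 0 (l + p) = f 0 (l + (2 * n - 1 - p)) := by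
  have key : ∀ t ≤ n, ∀ p < l + 2 * (n - t) + R,
      f t p = if p < l + (n - t) then f 0 p else f 0 (p + 2 * t) := by
    intro t
    induction t with
    | zero => intro _ p hp; simp
    | succ t ih =>
      intro ht p hp
      split_ifs with h
      · rw [← h1 t ht p (by omega), ih (by omega) p (by omega), if_pos (by omega)]
      · obtain ⟨i, rfl⟩ : ∃ i, p = l + (n - 1 - t) + i := ⟨p - (l + (n - 1 - t)), by omega⟩
        rw [← h2 t ht i (by omega), ih (by omega) _ (by omega), if_neg (by omega)]
        congr 1; omega
  refine ⟨key, fun p hp => ?_⟩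
  have e := h3 (n - 1 - p) (by omega)
  have e1 : l + (n - 1 - (n - 1 - p)) = l + p := by omega
  rw [e1, key (n - 1 - p) (by omega) (l + p) (by omega),
    key (n - 1 - p) (by omega) (l + p + 1) (by omega), if_pos (by omega), if_neg (by omega)] at e
  rw [e]; congr 1; omega

theorem grid_outside (h1 : ∀ t < n * n, ∀ p < l + (n - 1 - t / n + t % n), f t p = f (t + 1) p)
    (h2 : ∀ t < n * n, ∀ i < n - 1 - t % n + t / n + R, f t (l + (n - 1 - t / n + t % n) + 2 + i) =
      f (t + 1) (l + (n - 1 - t / n + t % n) + 2 + i)) {t : ℕ} (ht : t < n * n) {p : ℕ}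
    (hp : p < l + 2 * n + R) (hq : p ≠ l + (n - 1 - t / n + t % n))
    (hq' : p ≠ l + (n - 1 - t / n + t % n) + 1) : f t p = f (t + 1) p := by
  have hn : 0 < n := Nat.pos_of_mul_pos_left (by omega : 0 < n * n)
  have hi : t / n < n := Nat.div_lt_of_lt_mul ht
  have hj : t % n < n := Nat.mod_lt _ hn
  by_cases h : p < l + (n - 1 - t / n + t % n)
  · exact h1 t ht p h
  · obtain ⟨i, rfl⟩ : ∃ i, p = l + (n - 1 - t / n + t % n) + 2 + i :=
      ⟨p - (l + (n - 1 - t / n + t % n) + 2), by omega⟩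
    exact h2 t ht i (by omega)

/-- An arc of level below n can be followed to the bottom line and any other arc to the top line.
Along an arc the level is constant, which gives the position of its end. -/
theorem horizontal_block
    (h : ∀ t < n * n, ∀ p < 2 * n, p ≠ n - 1 - t / n + t % n → p ≠ n - 1 - t / n + t % n + 1 →
      f t (l + p) = f (t + 1) (l + p))
    (h3 : ∀ t < n * n, f t (l + (n - 1 - t / n + t % n)) = f t (l + (n - 1 - t / n + t % n + 1)))
    (h4 : ∀ t < n * n, f (t + 1) (l + (n - 1 - t / n + t % n)) =
      f (t + 1) (l + (n - 1 - t / n + t % n + 1))) {t : ℕ} (ht : t ≤ n * n) {p : ℕ}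
    (hp : p < 2 * n) : f t (l + p) = if levelAt n t p < n then f 0 (l + (n - 1 - levelAt n t p))
      else f (n * n) (l + (3 * n - 1 - levelAt n t p)) := by
  have hn : 0 < n := by omega
  -- Row i touches only the positions from n − 1 − i to 2n − 1 − i. So position p keeps its bottom
  -- label until row n − 1 − p begins, and for p ≥ n it has its top label once row 2n − 1 − p is
  -- finished.
  have low : ∀ t p, p < n → t ≤ (n - 1 - p) * n → f t (l + p) = f 0 (l + p) := by
    intro t
    induction t with
    | zero => intros; rfl
    | succ t ih =>
      intro p hp ht
      have hi : t / n < n - 1 - p := (Nat.div_lt_iff_lt_mul hn).2 ht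
      have ht' : t < n * n := lt_of_lt_of_le ht (Nat.mul_le_mul_right n (by omega))
      rw [← h t ht' p (by omega) (by omega) (by omega), ih p hp (by omega)]
  have high : ∀ t, t ≤ n * n → ∀ p, n ≤ p → p < 2 * n → (2 * n - p) * n ≤ t →
      f t (l + p) = f (n * n) (l + p) := by
    intro t ht
    induction ht using Nat.decreasingInduction with
    | self => intros; rfl
    | of_succ t ht ih =>
      intro p hp hp' htp
      have hi : 2 * n - p ≤ t / n := (Nat.le_div_iff_mul_le hn).2 htp
      have hi' : t / n < n := Nat.div_lt_of_lt_mul ht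
      have hj : t % n < n := Nat.mod_lt _ hn
      rw [h t ht p hp' (by omega) (by omega), ih p hp hp' (by omega)]
  split_ifs with hlev
  · suffices ∀ p < 2 * n, levelAt n t p < n → f t (l + p) = f 0 (l + (n - 1 - levelAt n t p)) from
      this p hp hlev
    clear hlev hp p
    induction ht using Nat.decreasingInduction with
    | self =>
      intro p hp hlev
      exfalso
      unfold levelAt level at hlev
      rw [Nat.mul_div_cancel _ hn, Nat.mul_mod_left] at hlev
      split_ifs at hlev <;> omega
    | of_succ t ht ih =>
      have hi : t / n < n := Nat.div_lt_of_lt_mul ht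
      have hj : t % n < n := Nat.mod_lt _ hn
      have hb := level_below hi hj
      -- At the start of a row, the bottom left leg of the crossing still carries its bottom label.
      -- Otherwise this leg is the top right leg of the previous crossing in the row, and its label
      -- equals that of the top left leg, to which the induction hypothesis applies on the next
      -- line.
      have base : t / n + t % n < n →
          f t (l + (n - 1 - t / n + t % n)) = f 0 (l + (n - 1 - (t / n + t % n))) := by
        intro hlt
        rcases Nat.eq_zero_or_pos (t % n) with h0 | h0
        · rw [h0, add_zero, add_zero]
          refine low t _ (by omega) ?_
          have := Nat.mod_add_div t n
          have e : n - 1 - (n - 1 - t / n) = t / n := by omega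
          rw [e, mul_comm]; omega
        · obtain ⟨t, rfl⟩ : ∃ t', t = t' + 1 := ⟨t - 1, by
            have := Nat.mod_le t n; omega⟩
          have hd : (t + 1) / n = t / n ∧ (t + 1) % n = t % n + 1 := by
            have h5 := Nat.mod_add_div (t + 1) n
            have h6 : t = ((t + 1) % n - 1) + n * ((t + 1) / n) := by omega
            have h7 : t / n = (t + 1) / n := by
              conv_lhs => rw [h6]
              rw [Nat.add_mul_div_left _ _ hn, Nat.div_eq_of_lt (by omega), zero_add]
            have h8 : t % n = (t + 1) % n - 1 := by
              conv_lhs => rw [h6]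
              rw [Nat.add_mul_mod_self_left, Nat.mod_eq_of_lt (by omega)]
            omega
          have e4 := h4 t (by omega)
          obtain ⟨hd1, hd2⟩ := hd
          rw [← hd1] at e4
          have e5 : n - 1 - (t + 1) / n + t % n + 1 = n - 1 - (t + 1) / n + (t + 1) % n := by omega
          rw [e5] at e4
          have hl1 : level n ((t + 1) / n) ((t + 1) % n + 1) (n - 1 - (t + 1) / n + t % n) =
              (t + 1) / n + (t + 1) % n := by
            rw [hd2] at *
            unfold level; split_ifs <;> omega
          have hlt' : n - 1 - (t + 1) / n + t % n < 2 * n := by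
            generalize (t + 1) / n = i at *
            omega
          have hl2 : levelAt n (t + 1 + 1) (n - 1 - (t + 1) / n + t % n) =
              (t + 1) / n + (t + 1) % n := by rw [levelAt_succ ht hlt', hl1]
          rw [← e4, h (t + 1) ht (n - 1 - (t + 1) / n + t % n) hlt' (by omega) (by omega),
            ih _ hlt' (by rw [hl2]; exact hlt), hl2]
      intro p hp hlev
      by_cases hq : p = n - 1 - t / n + t % n
      · subst hq
        have hl : levelAt n t (n - 1 - t / n + t % n) = t / n + t % n := hb.1
        rw [hl] at hlev ⊢
        exact base hlev
      by_cases hq' : p = n - 1 - t / n + t % n + 1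
      · subst hq'
        have hl : levelAt n t (n - 1 - t / n + t % n + 1) = t / n + t % n := hb.2
        rw [hl] at hlev ⊢
        rw [← h3 t ht]
        exact base hlev
      · have e : levelAt n (t + 1) p = levelAt n t p := by
          rw [levelAt_succ ht hp, level_next hi hj hq hq']; rfl
        rw [h t ht p hp hq hq', ih p hp (by rw [e]; exact hlev), e]
  · suffices ∀ p < 2 * n, n ≤ levelAt n t p →
      f t (l + p) = f (n * n) (l + (3 * n - 1 - levelAt n t p)) from this p hp (by omega)
    clear hlev hp p
    induction t with
    | zero =>
      intro p hp hlev
      exfalso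
      unfold levelAt level at hlev
      rw [Nat.zero_div, Nat.zero_mod] at hlev
      split_ifs at hlev <;> omega
    | succ t ih =>
      have ht' : t < n * n := ht
      have hi : t / n < n := Nat.div_lt_of_lt_mul ht
      have hj : t % n < n := Nat.mod_lt _ hn
      have ha := level_above (j := t % n) hi
      have base : n ≤ t / n + t % n + 1 → f (t + 1) (l + (n - 1 - t / n + t % n + 1)) =
          f (n * n) (l + (3 * n - 1 - (t / n + t % n + 1))) := by
        intro hle
        rcases Nat.lt_or_ge (t % n + 1) n with h0 | h0
        · have h1 : t + 1 = t % n + 1 + n * (t / n) := by have := Nat.mod_add_div t n; omega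
          have hd1 : (t + 1) / n = t / n := by
            rw [h1, Nat.add_mul_div_left _ _ hn, Nat.div_eq_of_lt h0, zero_add]
          have hd2 : (t + 1) % n = t % n + 1 := by
            rw [h1, Nat.add_mul_mod_self_left, Nat.mod_eq_of_lt h0]
          have htn : t + 1 < n * n := by
            have : n * (t / n) + n ≤ n * n := by
              rw [← Nat.mul_succ]; exact Nat.mul_le_mul_left n hi
            omega
          have e3 := h3 (t + 1) htn
          rw [hd1, hd2] at e3
          have hl1 : level n (t / n) (t % n) (n - 1 - t / n + (t % n + 1) + 1) =
              t / n + t % n + 1 := by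
            unfold level; split_ifs <;> omega
          have e6 : n - 1 - t / n + (t % n + 1) = n - 1 - t / n + t % n + 1 := by omega
          rw [← e6, e3, ← h t ht' _ (by omega) (by omega) (by omega), ih (by omega) _ (by omega)
            (by unfold levelAt; rw [hl1]; exact hle)]
          unfold levelAt
          rw [hl1]
        · have e : n - 1 - t / n + t % n + 1 = 3 * n - 1 - (t / n + t % n + 1) := by omega
          rw [e]
          refine high (t + 1) ht _ (by omega) (by omega) ?_
          have e' : 2 * n - (3 * n - 1 - (t / n + t % n + 1)) = t / n + 1 := by omega
          have := Nat.mod_add_div t n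
          rw [e', mul_comm, mul_add]; omega
      intro p hp hlev
      rw [levelAt_succ ht' hp] at hlev ⊢
      by_cases hq : p = n - 1 - t / n + t % n
      · subst hq
        rw [ha.1] at hlev ⊢
        rw [h4 t ht']
        exact base hlev
      by_cases hq' : p = n - 1 - t / n + t % n + 1
      · subst hq'
        rw [ha.2] at hlev ⊢
        exact base hlev
      · rw [level_next hi hj hq hq'] at hlev ⊢
        rw [← h t ht' p hp hq hq', ih (by omega) p hp hlev]; rfl

end Blocks

/-! ### The slices of a parallel -/

theorem length_parallelStrands (n : ℕ) (x : List Bool) : (parallelStrands n x).length = n * x.length := by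
  induction x with
  | nil => simp [parallelStrands]
  | cons a x ih =>
    rw [parallelStrands] at ih ⊢
    rw [List.flatMap_cons, List.length_append, ih, List.length_replicate, List.length_cons]; ring

theorem grid_getElem? {α : Type*} (m n : ℕ) (g : ℕ → ℕ → α) {t : ℕ} (ht : t < m * n) :
    ((List.range m).flatMap fun i => (List.range n).map (g i))[t]? = some (g (t / n) (t % n)) := by
  have hn : 0 < n := Nat.pos_of_mul_pos_left (by omega : 0 < m * n)
  induction m with
  | zero => simp at ht
  | succ m ih =>
    have hlen : ((List.range m).flatMap fun i => (List.range n).map (g i)).length = m * n := by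
      simp [List.length_flatMap]
    rw [List.range_succ, List.flatMap_append, List.flatMap_singleton]
    by_cases h : t < m * n
    · rw [List.getElem?_append_left (by omega), ih h]
    · rw [List.getElem?_append_right (by omega), hlen]
      rw [add_mul, one_mul] at ht
      obtain ⟨r, rfl⟩ : ∃ r, t = r + n * m := ⟨t - n * m, by rw [mul_comm n m]; omega⟩
      have hr : r < n := by rw [mul_comm n m] at ht; omega
      have e : r + n * m - m * n = r := by rw [mul_comm n m]; omega
      rw [e, Nat.add_mul_div_left _ _ hn, Nat.add_mul_mod_self_left, Nat.div_eq_of_lt hr,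
        Nat.mod_eq_of_lt hr]
      simp [hr]

theorem length_grid {α : Type*} (m n : ℕ) (g : ℕ → ℕ → α) :
    ((List.range m).flatMap fun i => (List.range n).map (g i)).length = m * n := by
  simp [List.length_flatMap]

/-- The number of slices of the block which replaces a slice. -/
def blockLength (n : ℕ) (s : Slice) : ℕ :=
  match s.piece with
  | .cross _ _ _ => n * n
  | _ => n

/-- The number of strands to the left of the piece number `t` of a block. -/
def blockLeft (n : ℕ) (s : Slice) (t : ℕ) : ℕ :=
  match s.piece with
  | .cup _ => n * s.left.length + t
  | .cap _ => n * s.left.length + (n - 1 - t)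
  | .cross _ _ _ => n * s.left.length + (n - 1 - t / n + t % n)

/-- The number of strands to the right of the piece number `t` of a block. -/
def blockRight (n : ℕ) (s : Slice) (t : ℕ) : ℕ :=
  match s.piece with
  | .cup _ => t + n * s.right.length
  | .cap _ => n - 1 - t + n * s.right.length
  | .cross _ _ _ => n - 1 - t % n + t / n + n * s.right.length

/-- The number of strands at the bottom of the slice number `t` of a block. -/
def blockWidth (n : ℕ) (s : Slice) (t : ℕ) : ℕ :=
  match s.piece with
  | .cup _ => n * s.left.length + 2 * t + n * s.right.length
  | .cap _ => n * s.left.length + 2 * (n - t) + n * s.right.length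
  | .cross _ _ _ => n * s.left.length + 2 * n + n * s.right.length

theorem length_parallelSlice (n : ℕ) (s : Slice) : (parallelSlice n s).length = blockLength n s := by
  unfold parallelSlice blockLength
  cases s.piece with
  | cup b => simp
  | cap b => simp
  | cross o a b => exact length_grid n n _

theorem blockLength_pos {n : ℕ} (hn : 0 < n) (s : Slice) : 0 < blockLength n s := by
  unfold blockLength; split <;> positivity

theorem parallelSlice_getElem? {n : ℕ} {s : Slice} {t : ℕ} (ht : t < blockLength n s) :
    ∃ s', (parallelSlice n s)[t]? = some s' ∧ s'.piece = s.piece ∧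
      s'.left.length = blockLeft n s t ∧ s'.right.length = blockRight n s t := by
  unfold parallelSlice blockLeft blockRight
  unfold blockLength at ht
  cases hp : s.piece with
  | cup b =>
    simp only [hp] at ht
    refine ⟨_, by simp [ht]; rfl, rfl, ?_, ?_⟩ <;> simp [length_parallelStrands]
  | cap b =>
    simp only [hp] at ht
    refine ⟨_, by
      simp only [List.getElem?_map]
      rw [List.getElem?_reverse (by simpa using ht)]
      simp [show n - 1 - t < n by omega]; rfl, rfl, ?_, ?_⟩ <;> simp [length_parallelStrands]
  | cross o a b =>
    simp only [hp] at ht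
    refine ⟨_, grid_getElem? n n _ ht, rfl, ?_, ?_⟩ <;> simp [length_parallelStrands]; omega

theorem blockWidth_source {n : ℕ} {s s' : Slice} {t : ℕ} (ht : t < blockLength n s)
    (hp : s'.piece = s.piece) (hl : s'.left.length = blockLeft n s t)
    (hr : s'.right.length = blockRight n s t) :
    s'.source.length = blockWidth n s t ∧ s'.target.length = blockWidth n s (t + 1) := by
  rw [Slice.length_source, Slice.length_target, hl, hr, hp]
  unfold blockLeft blockRight blockWidth
  unfold blockLength at ht
  cases hp' : s.piece with
  | cup b => simp only [Piece.source, Piece.target, List.length_nil, List.length_cons]; omega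
  | cap b =>
    simp only [hp', Piece.source, Piece.target, List.length_nil, List.length_cons] at ht ⊢; omega
  | cross o a b =>
    simp only [hp', Piece.source, Piece.target, List.length_nil, List.length_cons] at ht ⊢
    have hn : 0 < n := Nat.pos_of_mul_pos_left (by omega : 0 < n * n)
    have hi : t / n < n := Nat.div_lt_of_lt_mul ht
    have hj : t % n < n := Nat.mod_lt _ hn
    generalize t / n = i at *
    generalize t % n = j at *
    omega

theorem blockWidth_zero (n : ℕ) (s : Slice) : blockWidth n s 0 = n * s.source.length := by
  rw [Slice.length_source]
  unfold blockWidth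
  cases s.piece <;> simp [Piece.source] <;> ring

theorem blockWidth_last (n : ℕ) (s : Slice) :
    blockWidth n s (blockLength n s) = n * s.target.length := by
  rw [Slice.length_target]
  unfold blockWidth blockLength
  cases s.piece <;> simp [Piece.target] <;> ring

/-- The number of the first slice of the block number `k` of the parallel. -/
def offset (n : ℕ) (W : Word) (k : ℕ) : ℕ := ((W.take k).flatMap (parallelSlice n)).length

@[simp] theorem offset_zero (n : ℕ) (W : Word) : offset n W 0 = 0 := by simp [offset]

theorem offset_succ {n : ℕ} {W : Word} {k : ℕ} {s : Slice} (hs : W[k]? = some s) :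
    offset n W (k + 1) = offset n W k + blockLength n s := by
  unfold offset
  rw [List.take_add_one, hs, ← length_parallelSlice]
  simp [List.length_flatMap]

theorem offset_cons (n : ℕ) (s : Slice) (W : Word) (k : ℕ) :
    offset n (s :: W) (k + 1) = blockLength n s + offset n W k := by
  unfold offset
  rw [List.take_succ_cons, List.flatMap_cons, List.length_append, length_parallelSlice]

theorem parallel_getElem? {n : ℕ} {W : Word} {k t : ℕ} {s : Slice} (hs : W[k]? = some s)
    (ht : t < blockLength n s) : (parallel W n)[offset n W k + t]? = (parallelSlice n s)[t]? := by
  have h : W = W.take k ++ s :: W.drop (k + 1) := by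
    conv_lhs => rw [← List.take_append_drop k W]
    rw [List.drop_eq_getElem?_toList_append, hs]; rfl
  have h2 : parallel W n = (W.take k).flatMap (parallelSlice n) ++
      (parallelSlice n s ++ (W.drop (k + 1)).flatMap (parallelSlice n)) := by
    conv_lhs => rw [h]
    rw [parallel, List.flatMap_append, List.flatMap_cons]
  unfold offset
  rw [h2, List.getElem?_append_right (Nat.le_add_right _ _), Nat.add_sub_cancel_left,
    List.getElem?_append_left (by rwa [length_parallelSlice])]

theorem exists_offset {n : ℕ} {W : Word} {k' : ℕ} (h : k' < (parallel W n).length) :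
    ∃ k s t, W[k]? = some s ∧ t < blockLength n s ∧ k' = offset n W k + t := by
  induction W generalizing k' with
  | nil => simp [parallel] at h
  | cons s W ih =>
    rw [parallel, List.flatMap_cons, List.length_append, length_parallelSlice] at h
    by_cases hk : k' < blockLength n s
    · exact ⟨0, s, k', rfl, hk, by simp⟩
    · obtain ⟨k, s', t, hs, ht, he⟩ := ih (k' := k' - blockLength n s)
        (by unfold parallel; omega)
      exact ⟨k + 1, s', t, by simpa using hs, ht, by rw [offset_cons]; omega⟩

/-- The slices of a parallel, by their numerical properties. -/
theorem parallel_slice {n : ℕ} {W : Word} {k t : ℕ} {s : Slice} (hs : W[k]? = some s)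
    (ht : t < blockLength n s) : ∃ s', (parallel W n)[offset n W k + t]? = some s' ∧
      s'.piece = s.piece ∧ s'.left.length = blockLeft n s t ∧ s'.right.length = blockRight n s t := by
  rw [parallel_getElem? hs ht]
  exact parallelSlice_getElem? ht

theorem offset_length (n : ℕ) (W : Word) : offset n W W.length = (parallel W n).length := by
  simp [offset, parallel]

theorem width_offset {n : ℕ} (hn : 0 < n) (W : Word) {k : ℕ} (hk : k ≤ W.length) :
    width (parallel W n) (offset n W k) = n * width W k := by
  rcases hk.lt_or_eq with h | rfl
  · obtain ⟨s, hs⟩ := exists_slice h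
    obtain ⟨s', hs', hp, hl, hr⟩ := parallel_slice hs (blockLength_pos hn s)
    rw [add_zero] at hs'
    rw [width_eq hs', (blockWidth_source (blockLength_pos hn s) hp hl hr).1, blockWidth_zero,
      width_eq hs]
  · rw [offset_length, width_of_le le_rfl, width_of_le le_rfl, mul_zero]

theorem width_block {n : ℕ} (hn : 0 < n) {W : Word} (hW : Closed W) {k t : ℕ} {s : Slice}
    (hs : W[k]? = some s) (ht : t ≤ blockLength n s) :
    width (parallel W n) (offset n W k + t) = blockWidth n s t := by
  rcases ht.lt_or_eq with h | rfl
  · obtain ⟨s', hs', hp, hl, hr⟩ := parallel_slice hs h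
    rw [width_eq hs', (blockWidth_source h hp hl hr).1]
  · rw [← offset_succ hs, width_offset hn W (lt_of_slice hs), ← hW.next k s hs, blockWidth_last]

theorem Closed.parallel {n : ℕ} (hn : 0 < n) {W : Word} (hW : Closed W) : Closed (parallel W n) where
  bottom := by
    have := width_offset hn W (Nat.zero_le _)
    rwa [offset_zero, hW.bottom, mul_zero] at this
  next k' s' hs' := by
    obtain ⟨k, s, t, hs, ht, rfl⟩ := exists_offset (lt_of_slice hs')
    obtain ⟨s'', hs'', hp, hl, hr⟩ := parallel_slice hs ht
    obtain rfl := Option.some.inj (hs'.symm.trans hs'')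
    rw [add_assoc, width_block hn hW hs ht, (blockWidth_source ht hp hl hr).2]

theorem parallel_ne_nil {n : ℕ} (hn : 0 < n) {W : Word} (h : W ≠ []) : LinkDiagram.parallel W n ≠ [] := by
  obtain ⟨s, hs⟩ := exists_slice (List.length_pos_iff.2 h)
  obtain ⟨s', hs', -⟩ := parallel_slice hs (blockLength_pos hn s)
  intro h'
  simp [h'] at hs'

theorem mem_crossings_parallel {n : ℕ} {W : Word} {k t : ℕ} {s : Slice} (hs : W[k]? = some s)
    (ht : t < blockLength n s) :
    (offset n W k + t ∈ crossings (LinkDiagram.parallel W n) ↔ k ∈ crossings W) ∧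
    pos (LinkDiagram.parallel W n) (offset n W k + t) = blockLeft n s t ∧
    aVert (LinkDiagram.parallel W n) (offset n W k + t) = aVert W k := by
  obtain ⟨s', hs', hp, hl, hr⟩ := parallel_slice hs ht
  refine ⟨?_, by rw [pos_eq hs', hl], by simp [aVert, hs', hs, hp]⟩
  rw [mem_crossings, mem_crossings]
  constructor
  · rintro ⟨s'', o, a, b, h1, h2⟩
    obtain rfl := Option.some.inj (hs'.symm.trans h1)
    exact ⟨s, o, a, b, hs, hp ▸ h2⟩
  · rintro ⟨s'', o, a, b, h1, h2⟩
    obtain rfl := Option.some.inj (hs.symm.trans h1)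
    exact ⟨s', o, a, b, hs', hp.trans h2⟩

/-! ### Labels of a block -/

section

variable {L : Type*}

/-- The labels at the bottom and at the top of a slice agree along the arcs of the `A`-resolution. -/
structure ALabels (s : Slice) (u v : ℕ → L) : Prop extends Outer s u v where
  vert : ∀ a b, s.piece = .cross true a b →
    u s.left.length = v s.left.length ∧ u (s.left.length + 1) = v (s.left.length + 1)
  hor : ∀ a b, s.piece = .cross false a b →
    u s.left.length = u (s.left.length + 1) ∧ v s.left.length = v (s.left.length + 1)

theorem aLabels_iff {W : Word} {f : ℕ → ℕ → L} :
    (∀ k s, W[k]? = some s → ALabels s (f k) (f (k + 1))) ↔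
      IsOuter W f ∧ ∀ k ∈ crossings W, ARel W f k := by
  constructor
  · refine fun h => ⟨fun k s hs => (h k s hs).toOuter, fun k hk => ?_⟩
    obtain ⟨s, o, a, b, hs, hp⟩ := mem_crossings.1 hk
    unfold ARel
    rw [aVert_eq hs hp]
    cases o
    · simpa [HorRel, pos_eq hs] using (h k s hs).hor a b hp
    · simpa [VertRel, pos_eq hs] using (h k s hs).vert a b hp
  · rintro ⟨h1, h2⟩ k s hs
    refine ⟨h1 k s hs, fun a b hp => ?_, fun a b hp => ?_⟩
    all_goals
      have := h2 k (mem_crossings.2 ⟨s, _, a, b, hs, hp⟩)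
      unfold ARel at this
      rw [aVert_eq hs hp] at this
      simpa [HorRel, VertRel, pos_eq hs] using this

theorem ALabels.congr {s : Slice} {u v u' v' : ℕ → L} (h : ALabels s u v)
    (hu : ∀ p < s.source.length, u p = u' p) (hv : ∀ p < s.target.length, v p = v' p) :
    ALabels s u' v' := by
  rw [Slice.length_source] at hu
  rw [Slice.length_target] at hv
  refine ⟨⟨fun i hi => ?_, fun i hi => ?_, fun b hb => ?_, fun b hb => ?_⟩, fun a b hp => ?_,
    fun a b hp => ?_⟩
  · rw [← hu _ (by omega), ← hv _ (by omega)]; exact h.left i hi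
  · rw [← hu _ (by omega), ← hv _ (by omega)]; exact h.right i hi
  · have : s.piece.target.length = 2 := by simp [hb, Piece.target]
    rw [← hv _ (by omega), ← hv _ (by omega)]; exact h.cup b hb
  · have : s.piece.source.length = 2 := by simp [hb, Piece.source]
    rw [← hu _ (by omega), ← hu _ (by omega)]; exact h.cap b hb
  · have h1 : s.piece.source.length = 2 := by simp [hp, Piece.source]
    have h2 : s.piece.target.length = 2 := by simp [hp, Piece.target]
    rw [← hu _ (by omega), ← hu _ (by omega), ← hv _ (by omega), ← hv _ (by omega)]
    exact h.vert a b hp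
  · have h1 : s.piece.source.length = 2 := by simp [hp, Piece.source]
    have h2 : s.piece.target.length = 2 := by simp [hp, Piece.target]
    rw [← hu _ (by omega), ← hu _ (by omega), ← hv _ (by omega), ← hv _ (by omega)]
    exact h.hor a b hp

/-- The labels `u` at the bottom and `v` at the top of a block agree along the arcs of the all-`A`
state of the block. -/
structure BlockRel (n : ℕ) (s : Slice) (u v : ℕ → L) : Prop where
  left : ∀ p < n * s.left.length, u p = v p
  right : ∀ p < n * s.right.length, u (n * s.left.length + n * s.piece.source.length + p) =
    v (n * s.left.length + n * s.piece.target.length + p)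
  cup : ∀ b, s.piece = .cup b → ∀ p < n,
    v (n * s.left.length + p) = v (n * s.left.length + (2 * n - 1 - p))
  cap : ∀ b, s.piece = .cap b → ∀ p < n,
    u (n * s.left.length + p) = u (n * s.left.length + (2 * n - 1 - p))
  vert : ∀ a b, s.piece = .cross true a b → ∀ p < 2 * n,
    u (n * s.left.length + p) = v (n * s.left.length + p)
  hor : ∀ a b, s.piece = .cross false a b → ∀ p < n,
    u (n * s.left.length + p) = u (n * s.left.length + (2 * n - 1 - p)) ∧
    v (n * s.left.length + p) = v (n * s.left.length + (2 * n - 1 - p))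

/-- The labels of a block, in terms of the labels `u` at its bottom and `v` at its top. -/
def blockLab (n : ℕ) (s : Slice) (u v : ℕ → L) (t p : ℕ) : L :=
  match s.piece with
  | .cup _ => if p < n * s.left.length + t then v p else v (p + 2 * (n - t))
  | .cap _ => if p < n * s.left.length + (n - t) then u p else u (p + 2 * t)
  | .cross true _ _ => u p
  | .cross false _ _ =>
    if p < n * s.left.length ∨ n * s.left.length + 2 * n ≤ p then u p
    else if levelAt n t (p - n * s.left.length) < n then
      u (n * s.left.length + (n - 1 - levelAt n t (p - n * s.left.length)))
    else v (n * s.left.length + (3 * n - 1 - levelAt n t (p - n * s.left.length)))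

/-- A compatible labeling of a block is determined by its boundary, and `block_exists` is the
converse. Afterwards a block can be replaced by the relation `BlockRel` between its bottom and its
top. -/
theorem block_unique {n : ℕ} {s : Slice} {f : ℕ → ℕ → L}
    (h : ∀ t < blockLength n s, ∃ s', s'.piece = s.piece ∧ s'.left.length = blockLeft n s t ∧
      s'.right.length = blockRight n s t ∧ ALabels s' (f t) (f (t + 1))) :
    BlockRel n s (f 0) (f (blockLength n s)) ∧ ∀ t ≤ blockLength n s, ∀ p < blockWidth n s t,
      f t p = blockLab n s (f 0) (f (blockLength n s)) t p := by
  have h1 : ∀ t < blockLength n s, ∀ p < blockLeft n s t, f t p = f (t + 1) p := fun t ht p hp => by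
    obtain ⟨s', hp', hl, hr, hA⟩ := h t ht
    exact hA.left p (by omega)
  have h2 : ∀ t < blockLength n s, ∀ i < blockRight n s t,
      f t (blockLeft n s t + s.piece.source.length + i) =
        f (t + 1) (blockLeft n s t + s.piece.target.length + i) := fun t ht p hp => by
    obtain ⟨s', hp', hl, hr, hA⟩ := h t ht
    rw [← hl, ← hp']
    exact hA.right p (by omega)
  generalize hl : n * s.left.length = l at *
  generalize hR : n * s.right.length = R at *
  cases hp : s.piece with
  | cup b =>
    have eL : blockLength n s = n := by simp [blockLength, hp]
    simp only [eL] at *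
    simp only [blockLeft, blockRight, blockWidth, hp, hl, hR, Piece.source, Piece.target,
      List.length_nil, List.length_cons] at h1 h2 ⊢
    have h3 : ∀ t < n, f (t + 1) (l + t) = f (t + 1) (l + t + 1) := fun t ht => by
      obtain ⟨s', hp', hl', hr, hA⟩ := h t ht
      have := hA.cup b (hp'.trans hp)
      simpa [hl', blockLeft, hp, hl] using this
    obtain ⟨k1, k2⟩ := cup_block (l := l) (R := R) (f := f) (n := n) h1
      (fun t ht i hi => h2 t ht i (by omega)) h3
    refine ⟨⟨fun p hpl => ?_, fun p hpr => ?_, fun b hb p hpn => ?_, fun b hb => ?_, fun a b hb => ?_,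
      fun a b hb => ?_⟩, fun t ht p hpp => ?_⟩
    · rw [k1 0 (by omega) p (by omega), if_pos (by omega)]
    · rw [hp, hl, k1 0 (by omega) _ (by simp [Piece.source]; omega), if_neg (by omega)]
      simp [Piece.source, Piece.target]; congr 1; omega
    · rw [hl]; exact k2 p hpn
    iterate 3 (rw [hp] at hb; simp at hb)
    · simp only [blockLab, hp, hl]; exact k1 t ht p (by omega)
  | cap b =>
    have eL : blockLength n s = n := by simp [blockLength, hp]
    simp only [eL] at *
    simp only [blockLeft, blockRight, blockWidth, hp, hl, hR, Piece.source, Piece.target,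
      List.length_nil, List.length_cons] at h1 h2 ⊢
    have h3 : ∀ t < n, f t (l + (n - 1 - t)) = f t (l + (n - 1 - t) + 1) := fun t ht => by
      obtain ⟨s', hp', hl', hr, hA⟩ := h t ht
      have := hA.cap b (hp'.trans hp)
      simpa [hl', blockLeft, hp, hl] using this
    obtain ⟨k1, k2⟩ := cap_block (l := l) (R := R) (f := f) (n := n) h1
      (fun t ht i hi => h2 t ht i (by omega)) h3
    refine ⟨⟨fun p hpl => ?_, fun p hpr => ?_, fun b hb => ?_, fun b hb p hpn => ?_, fun a b hb => ?_,
      fun a b hb => ?_⟩, fun t ht p hpp => ?_⟩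
    · rw [k1 n le_rfl p (by omega), if_pos (by omega)]
    · rw [hp, hl, k1 n le_rfl _ (by simp [Piece.target]; omega),
        if_neg (by omega)]
      simp [Piece.source, Piece.target]; congr 1; omega
    · rw [hp] at hb; simp at hb
    · rw [hl]; exact k2 p hpn
    iterate 2 (rw [hp] at hb; simp at hb)
    · simp only [blockLab, hp, hl]; exact k1 t ht p (by omega)
  | cross o a b =>
    have eL : blockLength n s = n * n := by simp [blockLength, hp]
    simp only [eL] at *
    simp only [blockLeft, blockRight, blockWidth, hp, hl, hR, Piece.source, Piece.target,
      List.length_nil, List.length_cons] at h1 h2 ⊢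
    have ho : ∀ {t : ℕ}, t < n * n → ∀ {p : ℕ}, p < l + 2 * n + R →
        p ≠ l + (n - 1 - t / n + t % n) → p ≠ l + (n - 1 - t / n + t % n) + 1 →
        f t p = f (t + 1) p := grid_outside (fun t ht p hp => h1 t ht p hp)
      (fun t ht i hi => h2 t ht i hi)
    have hout : ∀ t ≤ n * n, ∀ p < l + 2 * n + R, p < l ∨ l + 2 * n ≤ p → f t p = f 0 p := by
      intro t ht p hp hpl
      induction t with
      | zero => rfl
      | succ t ih =>
        rw [← ih (by omega)]
        have hn : 0 < n := Nat.pos_of_mul_pos_left (by omega : 0 < n * n)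
        have hi : t / n < n := Nat.div_lt_of_lt_mul ht
        have hj : t % n < n := Nat.mod_lt _ hn
        have hle : n - 1 - t / n + t % n + 2 ≤ 2 * n := by
          generalize t / n = i at hi ⊢
          omega
        exact (ho ht hp (by omega) (by omega)).symm
    have hlr : (∀ p < n * s.left.length, f 0 p = f (n * n) p) ∧ ∀ p < n * s.right.length,
        f 0 (n * s.left.length + n * s.piece.source.length + p) =
          f (n * n) (n * s.left.length + n * s.piece.target.length + p) := by
      refine ⟨fun p hp => (hout _ le_rfl p (by omega) (by omega)).symm, fun p hpr => ?_⟩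
      have e1 : n * s.piece.source.length = 2 * n := by rw [hp]; simp [Piece.source]; ring
      have e2 : n * s.piece.target.length = 2 * n := by rw [hp]; simp [Piece.target]; ring
      rw [e1, e2]
      exact (hout _ le_rfl _ (by omega) (by omega)).symm
    cases o with
    | true =>
      have h3 : ∀ t ≤ n * n, ∀ p < l + 2 * n + R, f t p = f 0 p := by
        intro t ht p hp'
        induction t with
        | zero => rfl
        | succ t ih =>
          rw [← ih (by omega)]
          obtain ⟨s', hps, hl', hr, hA⟩ := h t ht
          have := hA.vert a b (hps.trans hp)
          simp only [hl', blockLeft, hp, hl] at this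
          by_cases hq : p = l + (n - 1 - t / n + t % n)
          · rw [hq]; exact this.1.symm
          by_cases hq' : p = l + (n - 1 - t / n + t % n) + 1
          · rw [hq']; exact this.2.symm
          · exact (ho ht hp' hq hq').symm
      refine ⟨⟨hlr.1, hlr.2, fun b hb => ?_, fun b hb => ?_, fun a b hb p hpp => ?_,
        fun a b hb => ?_⟩, fun t ht p hpp => ?_⟩
      iterate 2 (rw [hp] at hb; simp at hb)
      · exact (h3 _ le_rfl _ (by omega)).symm
      · rw [hp] at hb; simp at hb
      · simp only [blockLab, hp]; exact h3 t ht p hpp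
    | false =>
      have h3 : ∀ t ≤ n * n, ∀ p < 2 * n, f t (l + p) = if levelAt n t p < n then
          f 0 (l + (n - 1 - levelAt n t p)) else f (n * n) (l + (3 * n - 1 - levelAt n t p)) := by
        intro t ht p hpp
        refine horizontal_block (fun t ht p hp h1 h2 => ho ht (by omega) (by omega) (by omega))
          (fun t ht => ?_) (fun t ht => ?_) ht hpp
        all_goals
          obtain ⟨s', hps, hl', hr, hA⟩ := h t ht
          have := hA.hor a b (hps.trans hp)
          simp only [hl', blockLeft, hp, hl] at this
        exacts [this.1, this.2]
      refine ⟨⟨hlr.1, hlr.2, fun b hb => ?_, fun b hb => ?_, fun a b hb => ?_,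
        fun a b hb p hpp => ?_⟩, fun t ht p hpp => ?_⟩
      iterate 3 (rw [hp] at hb; simp at hb)
      · rw [hl]
        have hn : 0 < n := by omega
        have e1 := h3 0 (Nat.zero_le _) (2 * n - 1 - p) (by omega)
        have e2 := h3 (n * n) le_rfl p (by omega)
        have l1 : levelAt n 0 (2 * n - 1 - p) = n - 1 - p := by
          unfold levelAt level
          rw [Nat.zero_div, Nat.zero_mod]
          split_ifs <;> omega
        have l2 : levelAt n (n * n) p = n + p := by
          unfold levelAt level
          rw [Nat.mul_div_cancel _ hn, Nat.mul_mod_left]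
          split_ifs <;> omega
        rw [l1, if_pos (by omega)] at e1
        rw [l2, if_neg (by omega)] at e2
        rw [e1, e2]
        constructor <;> (congr 2; omega)
      · simp only [blockLab, hp, hl]
        split_ifs with hc1 hc2
        · exact hout t ht p hpp hc1
        · have := h3 t ht (p - l) (by omega)
          rw [if_pos hc2] at this
          rw [← this]; congr 1; omega
        · have := h3 t ht (p - l) (by omega)
          rw [if_neg hc2] at this
          rw [← this]; congr 1; omega

end

/-! ### Extension of labels over the blocks, and the copies of a strand. -/

section

variable {L : Type*}

theorem blockLab_bottom {n : ℕ} {s : Slice} {u v : ℕ → L} (h : BlockRel n s u v) {p : ℕ}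
    (hp : p < blockWidth n s 0) : blockLab n s u v 0 p = u p := by
  have hr := h.right
  unfold blockLab
  unfold blockWidth at hp
  cases hs : s.piece with
  | cup b =>
    simp only [hs, Piece.source, Piece.target, List.length_nil, List.length_cons] at hp hr ⊢
    split_ifs with hc
    · exact (h.left p hc).symm
    · have := hr (p - n * s.left.length) (by omega)
      rw [(by omega : n * s.left.length + n * 0 + (p - n * s.left.length) = p)] at this
      rw [this]; congr 1; omega
  | cap b => simp
  | cross o a b =>
    cases o with
    | true => rfl
    | false =>
      simp only [hs] at hp ⊢
      split_ifs with hc1 hc2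
      · rfl
      all_goals
        have hl : levelAt n 0 (p - n * s.left.length) = if p - n * s.left.length < n then
            n - 1 - (p - n * s.left.length) else p - n * s.left.length - n := by
          unfold levelAt level
          rw [Nat.zero_div, Nat.zero_mod]
          split_ifs <;> omega
        rw [hl] at hc2 ⊢
        split_ifs with hc3
      · congr 1; omega
      · have := (h.hor a b hs (n - 1 - (p - n * s.left.length - n)) (by omega)).1
        rw [this]; congr 1; omega
      · rw [if_pos hc3] at hc2; omega
      · rw [if_neg hc3] at hc2; omega

theorem blockLab_top {n : ℕ} {s : Slice} {u v : ℕ → L} (h : BlockRel n s u v) {p : ℕ}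
    (hp : p < blockWidth n s (blockLength n s)) : blockLab n s u v (blockLength n s) p = v p := by
  have hr := h.right
  unfold blockLab
  unfold blockWidth blockLength at hp
  unfold blockLength
  cases hs : s.piece with
  | cup b => simp
  | cap b =>
    simp only [hs, Piece.source, Piece.target, List.length_nil, List.length_cons] at hp hr ⊢
    split_ifs with hc
    · exact h.left p (by omega)
    · have := hr (p - n * s.left.length) (by omega)
      rw [(by omega : n * s.left.length + n * 0 + (p - n * s.left.length) = p)] at this
      rw [← this]; congr 1; omega
  | cross o a b =>
    simp only [hs, Piece.source, Piece.target, List.length_nil, List.length_cons] at hp hr ⊢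
    have hside : p < n * s.left.length ∨ n * s.left.length + 2 * n ≤ p → u p = v p := by
      rintro (hc | hc)
      · exact h.left p hc
      · have := hr (p - (n * s.left.length + 2 * n)) (by omega)
        rwa [(by omega : n * s.left.length + n * (0 + 1 + 1) + (p - (n * s.left.length + 2 * n)) = p)]
          at this
    cases o with
    | true =>
      by_cases hc : p < n * s.left.length ∨ n * s.left.length + 2 * n ≤ p
      · exact hside hc
      · have := h.vert a b hs (p - n * s.left.length) (by omega)
        rwa [(by omega : n * s.left.length + (p - n * s.left.length) = p)] at this
    | false =>
      simp only
      split_ifs with hc1 hc2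
      · exact hside hc1
      all_goals
        have hn : 0 < n := by omega
        have hl : levelAt n (n * n) (p - n * s.left.length) = if p - n * s.left.length < n then
            n + (p - n * s.left.length) else 3 * n - 1 - (p - n * s.left.length) := by
          unfold levelAt level
          rw [Nat.mul_div_cancel _ hn, Nat.mul_mod_left]
          split_ifs <;> omega
        rw [hl] at hc2 ⊢
        split_ifs with hc3
      · rw [if_pos hc3] at hc2; omega
      · rw [if_neg hc3] at hc2; omega
      · have := (h.hor a b hs (p - n * s.left.length) (by omega)).2
        rw [(by omega : n * s.left.length + (p - n * s.left.length) = p)] at this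
        rw [this]; congr 1; omega
      · congr 1; omega

/-- In a horizontal grid the label is a function of the level, and the arcs of each resolved
crossing join points of equal level. For the other blocks the explicit formula follows the strands.
-/
theorem block_exists {n : ℕ} {s : Slice} {u v : ℕ → L} (h : BlockRel n s u v) {t : ℕ}
    (ht : t < blockLength n s) {s' : Slice} (hp : s'.piece = s.piece)
    (hl : s'.left.length = blockLeft n s t) (hr : s'.right.length = blockRight n s t) :
    ALabels s' (blockLab n s u v t) (blockLab n s u v (t + 1)) := by
  have hR := h.right
  cases hs : s.piece with
  | cup b =>
    simp only [hs, blockLeft, blockRight, blockLength, Piece.source, Piece.target,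
      List.length_nil, List.length_cons] at hp hl hr hR ht
    have e : ∀ t, blockLab n s u v t = fun p => if p < n * s.left.length + t then v p
        else v (p + 2 * (n - t)) := fun t => by funext p; simp only [blockLab, hs]
    simp only [e]
    refine ⟨⟨fun p hpp => ?_, fun p hpp => ?_, fun b hb => ?_, fun b hb => ?_⟩, fun a b hb => ?_,
      fun a b hb => ?_⟩
    · rw [if_pos (by omega), if_pos (by omega)]
    · simp only [hp, Piece.source, Piece.target, List.length_nil, List.length_cons]
      rw [if_neg (by omega), if_neg (by omega)]
      congr 1; omega
    · rw [if_pos (by omega), if_neg (by omega), hl]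
      have := h.cup _ hs t ht
      rw [this]; congr 1; omega
    iterate 3 (rw [hp] at hb; simp at hb)
  | cap b =>
    simp only [hs, blockLeft, blockRight, blockLength, Piece.source, Piece.target,
      List.length_nil, List.length_cons] at hp hl hr hR ht
    have e : ∀ t, blockLab n s u v t = fun p => if p < n * s.left.length + (n - t) then u p
        else u (p + 2 * t) := fun t => by funext p; simp only [blockLab, hs]
    simp only [e]
    refine ⟨⟨fun p hpp => ?_, fun p hpp => ?_, fun b hb => ?_, fun b hb => ?_⟩, fun a b hb => ?_,
      fun a b hb => ?_⟩
    · rw [if_pos (by omega), if_pos (by omega)]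
    · simp only [hp, Piece.source, Piece.target, List.length_nil, List.length_cons]
      rw [if_neg (by omega), if_neg (by omega)]
      congr 1; omega
    · rw [hp] at hb; simp at hb
    · rw [if_pos (by omega), if_neg (by omega), hl]
      have := h.cap _ hs (n - 1 - t) (by omega)
      rw [this]; congr 1; omega
    iterate 2 (rw [hp] at hb; simp at hb)
  | cross o a b =>
    simp only [hs, blockLeft, blockRight, blockLength, Piece.source, Piece.target,
      List.length_nil, List.length_cons] at hp hl hr hR ht
    have hn : 0 < n := Nat.pos_of_mul_pos_left (by omega : 0 < n * n)
    have hi : t / n < n := Nat.div_lt_of_lt_mul ht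
    have hj : t % n < n := Nat.mod_lt _ hn
    cases o with
    | true =>
      have e : ∀ t, blockLab n s u v t = u := fun t => by funext p; simp only [blockLab, hs]
      simp only [e]
      refine ⟨⟨fun p hpp => rfl, fun p hpp => ?_, fun b hb => ?_, fun b hb => ?_⟩,
        fun a b hb => ⟨rfl, rfl⟩, fun a b hb => ?_⟩
      · simp [hp, Piece.source, Piece.target]
      iterate 3 (rw [hp] at hb; simp at hb)
    | false =>
      set G : ℕ → L := fun τ => if τ < n then u (n * s.left.length + (n - 1 - τ))
        else v (n * s.left.length + (3 * n - 1 - τ)) with hG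
      have e : ∀ t, blockLab n s u v t = fun p => if p < n * s.left.length ∨
          n * s.left.length + 2 * n ≤ p then u p else G (levelAt n t (p - n * s.left.length)) :=
        fun t => by funext p; simp only [blockLab, hs, hG]
      simp only [e]
      have hbel := level_below hi hj
      have ha := level_above (j := t % n) hi
      have l0 : levelAt n t = level n (t / n) (t % n) := rfl
      have l1 : ∀ p, p < 2 * n → levelAt n (t + 1) p = level n (t / n) (t % n + 1) p :=
        fun p hp => levelAt_succ ht hp
      rw [l0]
      generalize t / n = i at *
      generalize t % n = j at *
      have hsame : ∀ p, p ≠ n * s.left.length + (n - 1 - i + j) →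
          p ≠ n * s.left.length + (n - 1 - i + j) + 1 →
          (if p < n * s.left.length ∨ n * s.left.length + 2 * n ≤ p then u p
            else G (level n i j (p - n * s.left.length))) =
          if p < n * s.left.length ∨ n * s.left.length + 2 * n ≤ p then u p
            else G (levelAt n (t + 1) (p - n * s.left.length)) := by
        intro p h1 h2
        split_ifs with hc
        · rfl
        · rw [l1 _ (by omega), level_next hi hj (by omega) (by omega)]
      refine ⟨⟨fun p hpp => hsame p (by omega) (by omega), fun p hpp => ?_, fun b hb => ?_,
        fun b hb => ?_⟩, fun a b hb => ?_, fun a b hb => ?_⟩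
      · simp only [hp, Piece.source, Piece.target, List.length_nil, List.length_cons]
        exact hsame _ (by omega) (by omega)
      iterate 3 (rw [hp] at hb; simp at hb)
      · rw [hl, if_neg (by omega), if_neg (by omega), if_neg (by omega), if_neg (by omega),
          add_assoc (n * s.left.length), Nat.add_sub_cancel_left, Nat.add_sub_cancel_left,
          hbel.1, hbel.2, l1 _ (by omega), l1 _ (by omega), ha.1, ha.2]
        exact ⟨rfl, rfl⟩

/-- Labels of the horizontal lines between the blocks of a parallel, extended to all lines. -/
def liftLab (n : ℕ) : Word → (ℕ → ℕ → L) → ℕ → ℕ → L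
  | [], f, _ => f 0
  | s :: W, f, k => if k < blockLength n s then blockLab n s (f 0) (f 1) k
      else liftLab n W (fun k => f (k + 1)) (k - blockLength n s)

theorem liftLab_offset {n : ℕ} {W : Word} {f : ℕ → ℕ → L} {k t : ℕ} {s : Slice}
    (hs : W[k]? = some s) (ht : t < blockLength n s) :
    liftLab n W f (offset n W k + t) = blockLab n s (f k) (f (k + 1)) t := by
  induction W generalizing f k with
  | nil => simp at hs
  | cons s₀ W ih =>
    cases k with
    | zero =>
      obtain rfl : s₀ = s := by simpa using hs
      rw [offset_zero, zero_add, liftLab, if_pos ht]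
    | succ k =>
      rw [offset_cons, liftLab, if_neg (by omega), ← ih (f := fun k => f (k + 1)) (by simpa using hs)]
      congr 1; omega

theorem liftLab_line {n : ℕ} (hn : 0 < n) {W : Word} {f : ℕ → ℕ → L}
    (h : ∀ k s, W[k]? = some s → BlockRel n s (f k) (f (k + 1))) {k p : ℕ}
    (hp : p < n * width W k) : liftLab n W f (offset n W k) p = f k p := by
  have hk : k < W.length := by
    by_contra hk
    rw [width_of_le (not_lt.1 hk)] at hp; omega
  obtain ⟨s, hs⟩ := exists_slice hk
  have := liftLab_offset (f := f) hs (blockLength_pos hn s)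
  rw [add_zero] at this
  rw [this]
  exact blockLab_bottom (h k s hs) (by rw [blockWidth_zero, ← width_eq hs]; exact hp)

theorem liftLab_labels {n : ℕ} (hn : 0 < n) {W : Word} (hW : Closed W) {f : ℕ → ℕ → L}
    (h : ∀ k s, W[k]? = some s → BlockRel n s (f k) (f (k + 1))) :
    ∀ k s, (parallel W n)[k]? = some s → ALabels s (liftLab n W f k) (liftLab n W f (k + 1)) := by
  intro k' s' hs'
  obtain ⟨k, s, t, hs, ht, rfl⟩ := exists_offset (lt_of_slice hs')
  obtain ⟨s'', hs'', hp, hl, hr⟩ := parallel_slice hs ht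
  obtain rfl := Option.some.inj (hs'.symm.trans hs'')
  rw [liftLab_offset hs ht]
  refine (block_exists (h k s hs) ht hp hl hr).congr (fun _ _ => rfl) fun p hpp => ?_
  rw [(blockWidth_source ht hp hl hr).2] at hpp
  rcases (Nat.succ_le_of_lt ht).lt_or_eq with ht' | ht'
  · rw [add_assoc, liftLab_offset hs ht']
  · rw [Nat.succ_eq_add_one] at ht'
    rw [ht'] at hpp
    rw [add_assoc, ht', ← offset_succ hs, blockLab_top (h k s hs) hpp]
    rw [blockWidth_last, hW.next k s hs] at hpp
    exact (liftLab_line hn h hpp).symm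

/-- The number of the copy of a strand, if the parallel strands which replace the strand number `i`
are numbered from left to right for even `i`, and from right to left for odd `i`. -/
def copy (n i o : ℕ) : ℕ := if i % 2 = 0 then o else n - 1 - o

theorem copy_lt {n i o : ℕ} (ho : o < n) : copy n i o < n := by unfold copy; split_ifs <;> omega

theorem copy_copy {n i o : ℕ} (ho : o < n) : copy n i (copy n i o) = o := by
  unfold copy; split_ifs <;> omega

/-- Labels of parallel strands. -/
def copyLab (n : ℕ) (g : ℕ → ℕ → L) (k p : ℕ) : L × ℕ := (g k (p / n), copy n (p / n) (p % n))

theorem copyLab_apply {n : ℕ} (g : ℕ → ℕ → L) (k i : ℕ) {o : ℕ} (ho : o < n) :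
    copyLab n g k (n * i + o) = (g k i, copy n i o) := by
  have hn : 0 < n := by omega
  unfold copyLab
  rw [Nat.mul_add_div hn, Nat.div_eq_of_lt ho, Nat.mul_add_mod, Nat.mod_eq_of_lt ho, add_zero]

/-- Alternating the direction of numbering keeps the copy number constant along nested cups and
caps, whose legs at neighbouring positions appear in mirrored order. As a result copy 0 faces the
regions of colour 0 and copy n − 1 those of colour 1. -/
theorem copyLab_block {n : ℕ} (hn : 0 < n) {s : Slice} {g : ℕ → ℕ → L} {k : ℕ}
    (h : ALabels s (g k) (g (k + 1))) : BlockRel n s (copyLab n g k) (copyLab n g (k + 1)) := by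
  have hd : ∀ p, ∃ i o, o < n ∧ p = n * i + o := fun p =>
    ⟨p / n, p % n, Nat.mod_lt _ hn, (Nat.div_add_mod p n).symm⟩
  have hflip : ∀ k p, p < n → g k s.left.length = g k (s.left.length + 1) →
      copyLab n g k (n * s.left.length + p) =
        copyLab n g k (n * s.left.length + (2 * n - 1 - p)) := by
    intro k p hp e
    have e1 : n * s.left.length + (2 * n - 1 - p) = n * (s.left.length + 1) + (n - 1 - p) := by
      rw [mul_add]; omega
    rw [e1, copyLab_apply g k _ hp, copyLab_apply g k _ (by omega), e]
    congr 1
    unfold copy; split_ifs <;> omega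
  refine ⟨fun p hp => ?_, fun p hp => ?_, fun b hb p hp => hflip _ _ hp (h.cup b hb),
    fun b hb p hp => hflip _ _ hp (h.cap b hb), fun a b hb p hp => ?_, fun a b hb p hp =>
    ⟨hflip _ _ hp (h.hor a b hb).1, hflip _ _ hp (h.hor a b hb).2⟩⟩
  · obtain ⟨i, o, ho, rfl⟩ := hd p
    rw [copyLab_apply g k _ ho, copyLab_apply g _ _ ho, h.left i (by
      by_contra hc
      have := Nat.mul_le_mul_left n (not_lt.1 hc); omega)]
  · obtain ⟨i, o, ho, rfl⟩ := hd p
    have hi : i < s.right.length := by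
      by_contra hc
      have := Nat.mul_le_mul_left n (not_lt.1 hc); omega
    rw [← add_assoc, ← add_assoc, ← mul_add, ← mul_add, ← mul_add, ← mul_add,
      copyLab_apply g k _ ho, copyLab_apply g _ _ ho, h.right i hi]
    congr 1
    have : s.piece.source.length % 2 = s.piece.target.length % 2 := by
      cases s.piece <;> simp [Piece.source, Piece.target]
    unfold copy
    rw [show (s.left.length + s.piece.source.length + i) % 2 =
      (s.left.length + s.piece.target.length + i) % 2 by omega]
  · by_cases hpn : p < n
    · rw [copyLab_apply g k _ hpn, copyLab_apply g _ _ hpn, (h.vert a b hb).1]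
    · have e1 : n * s.left.length + p = n * (s.left.length + 1) + (p - n) := by
        rw [mul_add]; omega
      rw [e1, copyLab_apply g k _ (by omega), copyLab_apply g _ _ (by omega), (h.vert a b hb).2]

/-- The labels of one copy of the diagram in its parallel. -/
def rowLab (n : ℕ) (W : Word) (f : ℕ → ℕ → L) (j k i : ℕ) : L :=
  f (offset n W k) (n * i + copy n i j)

/-- The converse direction: a compatible labeling of the parallel, read along one copy only, is a
compatible labeling of the diagram. -/
theorem rowLab_labels {n : ℕ} {W : Word} {f : ℕ → ℕ → L} {j : ℕ} (hj : j < n) {k : ℕ} {s : Slice}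
    (h : BlockRel n s (f (offset n W k)) (f (offset n W (k + 1)))) :
    ALabels s (rowLab n W f j k) (rowLab n W f j (k + 1)) := by
  have hc : ∀ i, copy n i j < n := fun i => copy_lt hj
  have hmul : ∀ i m, i < m → n * i + copy n i j < n * m := fun i m him => by
    have := Nat.mul_le_mul_left n (Nat.succ_le_of_lt him)
    rw [Nat.succ_eq_add_one, mul_add] at this
    have := hc i; omega
  have hflip : n * (s.left.length + 1) + copy n (s.left.length + 1) j =
      n * s.left.length + (2 * n - 1 - copy n s.left.length j) := by
    rw [mul_add]; unfold copy; split_ifs <;> omega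
  unfold rowLab
  refine ⟨⟨fun i hi => h.left _ (hmul i _ hi), fun i hi => ?_, fun b hb => ?_, fun b hb => ?_⟩,
    fun a b hb => ?_, fun a b hb => ?_⟩
  · have := h.right (n * i + copy n (s.left.length + s.piece.source.length + i) j) (by
      have := Nat.mul_le_mul_left n (Nat.succ_le_of_lt hi)
      rw [Nat.succ_eq_add_one, mul_add] at this
      have := hc (s.left.length + s.piece.source.length + i); omega)
    have hpar : s.piece.source.length % 2 = s.piece.target.length % 2 := by
      cases s.piece <;> simp [Piece.source, Piece.target]
    have e : copy n (s.left.length + s.piece.source.length + i) j =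
        copy n (s.left.length + s.piece.target.length + i) j := by
      unfold copy
      rw [show (s.left.length + s.piece.source.length + i) % 2 =
        (s.left.length + s.piece.target.length + i) % 2 by omega]
    rw [← add_assoc, ← add_assoc, ← mul_add, ← mul_add, ← mul_add, ← mul_add] at this
    rw [this, e]
  · rw [hflip]; exact h.cup b hb _ (hc _)
  · rw [hflip]; exact h.cap b hb _ (hc _)
  · rw [hflip]
    have := hc s.left.length
    exact ⟨h.vert a b hb _ (by omega), h.vert a b hb _ (by omega)⟩
  · rw [hflip]
    exact h.hor a b hb _ (hc _)

theorem parallel_block {n : ℕ} {W : Word} {f : ℕ → ℕ → L}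
    (h : ∀ k s, (parallel W n)[k]? = some s → ALabels s (f k) (f (k + 1))) {k : ℕ} {s : Slice}
    (hs : W[k]? = some s) :
    BlockRel n s (f (offset n W k)) (f (offset n W (k + 1))) ∧
      ∀ t ≤ blockLength n s, ∀ p < blockWidth n s t, f (offset n W k + t) p =
        blockLab n s (f (offset n W k)) (f (offset n W (k + 1))) t p := by
  rw [offset_succ hs]
  refine block_unique (f := fun t => f (offset n W k + t)) fun t ht => ?_
  obtain ⟨s', hs', hp, hl, hr⟩ := parallel_slice hs ht
  exact ⟨s', hp, hl, hr, h _ _ hs'⟩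

end

/-! ### The curves of the all-`A` state of a parallel -/

/-- The boundary point is chosen before the labels. Hence one and the same point serves for all
labelings at once, which allows `plab` to be compared with the curves of the parallel. -/
theorem blockLab_form {n : ℕ} {s : Slice} {t p : ℕ} (ht : t ≤ blockLength n s)
    (hp : p < blockWidth n s t) :
    (∃ q < n * s.source.length, ∀ (L : Type) (u v : ℕ → L), blockLab n s u v t p = u q) ∨
      ∃ q < n * s.target.length, ∀ (L : Type) (u v : ℕ → L), blockLab n s u v t p = v q := by
  rw [← blockWidth_zero, ← blockWidth_last]
  unfold blockWidth blockLength at *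
  cases hs : s.piece with
  | cup b =>
    simp only [hs, blockLab] at *
    right
    split_ifs
    · exact ⟨p, by omega, fun _ _ _ => rfl⟩
    · exact ⟨_, by omega, fun _ _ _ => rfl⟩
  | cap b =>
    simp only [hs, blockLab] at *
    left
    split_ifs
    · exact ⟨p, by omega, fun _ _ _ => rfl⟩
    · exact ⟨_, by omega, fun _ _ _ => rfl⟩
  | cross o a b =>
    cases o with
    | true =>
      simp only [hs, blockLab] at *
      exact .inl ⟨p, hp, fun _ _ _ => rfl⟩
    | false =>
      simp only [hs, blockLab] at *
      split_ifs
      · exact .inl ⟨p, hp, fun _ _ _ => rfl⟩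
      · exact .inl ⟨_, by omega, fun _ _ _ => rfl⟩
      · exact .inr ⟨_, by omega, fun _ _ _ => rfl⟩

/-- Each point of a parallel is on the same state circles as a point between two blocks. -/
theorem exists_line {n : ℕ} (hn : 0 < n) {W : Word} (hW : Closed W) {k' p' : ℕ}
    (hp : p' < width (parallel W n) k') : ∃ k i j, i < width W k ∧ j < n ∧
      ∀ (L : Type) (f : ℕ → ℕ → L),
        (∀ k s, (parallel W n)[k]? = some s → ALabels s (f k) (f (k + 1))) →
        f k' p' = rowLab n W f j k i := by
  have hk' : k' < (parallel W n).length := by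
    by_contra h
    rw [width_of_le (not_lt.1 h)] at hp; omega
  have fin : ∀ {m q : ℕ}, q < n * m → ∃ i j, i < m ∧ j < n ∧ q = n * i + copy n i j := by
    intro m q hq
    have hlt : q % n < n := Nat.mod_lt _ hn
    exact ⟨q / n, copy n (q / n) (q % n), Nat.div_lt_of_lt_mul hq, copy_lt hlt, by
      rw [copy_copy hlt]; exact (Nat.div_add_mod q n).symm⟩
  obtain ⟨k, s, t, hs, ht, rfl⟩ := exists_offset hk'
  rw [width_block hn hW hs ht.le] at hp
  rcases blockLab_form ht.le hp with ⟨q, hq, h⟩ | ⟨q, hq, h⟩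
  · obtain ⟨i, j, hi, hj, rfl⟩ := fin hq
    refine ⟨k, i, j, by rwa [width_eq hs], hj, fun L f hf => ?_⟩
    rw [(parallel_block hf hs).2 t ht.le _ hp, h]; rfl
  · obtain ⟨i, j, hi, hj, rfl⟩ := fin hq
    refine ⟨k + 1, i, j, by rwa [← hW.next k s hs], hj, fun L f hf => ?_⟩
    rw [(parallel_block hf hs).2 t ht.le _ hp, h]; rfl

/-- Labels of the points of a parallel, by a state circle of the diagram and the number of a copy. -/
noncomputable def plab (n : ℕ) (W : Word) : ℕ → ℕ → Option (Curves W (state W ∅)) × ℕ :=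
  liftLab n W (copyLab n (lab W))

theorem copyLab_lab_block {n : ℕ} (hn : 0 < n) {W : Word} (hW : Closed W) (k : ℕ) (s : Slice)
    (hs : W[k]? = some s) : BlockRel n s (copyLab n (lab W) k) (copyLab n (lab W) (k + 1)) :=
  copyLab_block hn (aLabels_iff.2 (lab_isOuter hW) k s hs)

theorem plab_labels {n : ℕ} (hn : 0 < n) {W : Word} (hW : Closed W) :
    ∀ k s, (parallel W n)[k]? = some s → ALabels s (plab n W k) (plab n W (k + 1)) :=
  liftLab_labels hn hW (copyLab_lab_block hn hW)

theorem plab_line {n : ℕ} (hn : 0 < n) {W : Word} (hW : Closed W) {k i o : ℕ} (hi : i < width W k)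
    (ho : o < n) : plab n W (offset n W k) (n * i + o) = (lab W k i, copy n i o) := by
  rw [plab, liftLab_line hn (copyLab_lab_block hn hW), copyLab_apply _ _ _ ho]
  have := Nat.mul_le_mul_left n (Nat.succ_le_of_lt hi)
  rw [Nat.succ_eq_add_one, mul_add] at this
  omega

/-- The label `plab` is constant on state circles. Conversely, two points with the same label move
to the same copy on lines between blocks; the curves of the parallel, read along this copy, are
labels of the diagram, hence constant on its state circles. -/
theorem lab_parallel_iff {n : ℕ} (hn : 0 < n) {W : Word} (hW : Closed W) {x y : Point (parallel W n)} :
    lab (parallel W n) x.1.1 x.1.2 = lab (parallel W n) y.1.1 y.1.2 ↔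
      plab n W x.1.1 x.1.2 = plab n W y.1.1 y.1.2 := by
  have hlab := aLabels_iff.2 (lab_isOuter (Closed.parallel hn hW))
  constructor
  · obtain ⟨h1, h2⟩ := aLabels_iff.1 (plab_labels hn hW)
    exact eq_of_lab_eq h1 h2
  · intro h
    obtain ⟨k, i, j, hi, hj, hx⟩ := exists_line hn hW x.2
    obtain ⟨k', i', j', hi', hj', hy⟩ := exists_line hn hW y.2
    rw [hx _ _ (plab_labels hn hW), hy _ _ (plab_labels hn hW), rowLab, rowLab,
      plab_line hn hW hi (copy_lt hj), plab_line hn hW hi' (copy_lt hj'), copy_copy hj,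
      copy_copy hj', Prod.mk.injEq] at h
    obtain ⟨h1, rfl⟩ := h
    rw [hx _ _ hlab, hy _ _ hlab]
    obtain ⟨h3, h4⟩ := aLabels_iff.1 fun k s (hs : W[k]? = some s) =>
      rowLab_labels (f := lab (parallel W n)) (j := j) (k := k) hj (parallel_block hlab hs).1
    exact eq_of_lab_eq h3 h4 (p := ⟨(k, i), hi⟩) (q := ⟨(k', i'), hi'⟩) h1

/-- The labels of the state circles of a parallel. -/
theorem exists_curveLabel {n : ℕ} (hn : 0 < n) {W : Word} (hW : Closed W) :
    ∃ ψ : Option (Curves (parallel W n) (state (parallel W n) ∅)) →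
        Option (Option (Curves W (state W ∅)) × ℕ), Function.Injective ψ ∧
      (∀ k i, i < width (parallel W n) k →
        ψ (lab (parallel W n) k i) = some (plab n W k i)) := by
  have hw : ∀ x y : Point (parallel W n), Adjacent _ (state (parallel W n) ∅) x y →
      plab n W x.1.1 x.1.2 = plab n W y.1.1 y.1.2 := fun x y h =>
    (lab_parallel_iff hn hW).1 (by rw [lab_point, lab_point, Quot.sound h])
  refine ⟨Option.map (Quot.lift (fun x => plab n W x.1.1 x.1.2) hw), Option.map_injective ?_,
    fun k i hi => by rw [lab_eq_some hi]; rfl⟩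
  intro a b
  induction a using Quot.ind
  induction b using Quot.ind
  rename_i x y
  intro h
  have := (lab_parallel_iff hn hW).2 h
  rw [lab_point, lab_point] at this
  exact Option.some.inj this

/-- The all-A state of the parallel consists of n parallel copies of each state circle, and `plab`
realizes the bijection. -/
theorem vA_parallel {n : ℕ} (hn : 0 < n) {W : Word} (hW : Closed W) :
    vA (parallel W n) = n * vA W := by
  classical
  have hw : ∀ x y : Point (parallel W n), Adjacent _ (state (parallel W n) ∅) x y →
      plab n W x.1.1 x.1.2 = plab n W y.1.1 y.1.2 := fun x y h =>
    (lab_parallel_iff hn hW).1 (by rw [lab_point, lab_point, Quot.sound h])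
  have hform : ∀ x : Point (parallel W n), ∃ (C : Curves W (state W ∅)) (j : Fin n),
      plab n W x.1.1 x.1.2 = (some C, (j : ℕ)) := fun x => by
    obtain ⟨k, i, j, hi, hj, hx⟩ := exists_line hn hW x.2
    rw [hx _ _ (plab_labels hn hW), rowLab, plab_line hn hW hi (copy_lt hj), copy_copy hj,
      lab_eq_some hi]
    exact ⟨_, ⟨j, hj⟩, rfl⟩
  choose C j hCj using hform
  let ψ : Curves (parallel W n) (state (parallel W n) ∅) → Curves W (state W ∅) × Fin n :=
    Quot.lift (fun x => (C x, j x)) fun x y h => by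
      have := hw x y h
      rw [hCj, hCj, Prod.mk.injEq] at this
      rw [Option.some.inj this.1, Fin.ext this.2]
  have hψ : Function.Bijective ψ := by
    constructor
    · intro a b
      induction a using Quot.ind
      induction b using Quot.ind
      rename_i x y
      intro h
      have h1 : (C x, j x) = (C y, j y) := h
      have := (lab_parallel_iff hn hW (x := x) (y := y)).2 (by
        rw [hCj, hCj, (Prod.mk.inj h1).1, (Prod.mk.inj h1).2])
      rw [lab_point, lab_point] at this
      exact Option.some.inj this
    · rintro ⟨D, m⟩
      induction D using Quot.ind
      rename_i y
      have hk : y.1.1 < W.length := by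
        by_contra h
        have := y.2
        rw [width_of_le (not_lt.1 h)] at this; omega
      have hlt : n * y.1.2 + copy n y.1.2 m < width (parallel W n) (offset n W y.1.1) := by
        rw [width_offset hn W hk.le]
        have := Nat.mul_le_mul_left n (Nat.succ_le_of_lt y.2)
        rw [Nat.succ_eq_add_one, mul_add] at this
        have := copy_lt (i := y.1.2) m.2
        omega
      obtain ⟨z, hz⟩ : ∃ z : Point (parallel W n),
        z.1 = (offset n W y.1.1, n * y.1.2 + copy n y.1.2 m) := ⟨⟨(_, _), hlt⟩, rfl⟩
      refine ⟨Quot.mk _ z, ?_⟩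
      have h := hCj z
      rw [hz, plab_line hn hW y.2 (copy_lt m.2), copy_copy m.2, lab_point] at h
      have h' := Prod.mk.inj h
      change (C z, j z) = _
      rw [← Option.some.inj h'.1, Fin.ext h'.2]
  rw [vA, vA, circles, circles, Nat.card_congr (Equiv.ofBijective ψ hψ), Nat.card_prod,
    Nat.card_fin, mul_comm]

/-! ### The crossings of a parallel -/

/-- The labels of the arcs of the all-`A` state of a grid, from one side to the other. -/
noncomputable def gridLab (n : ℕ) (W : Word) (x m : ℕ) : Option (Curves W (state W ∅)) × ℕ :=
  if m < n then (end₁ W x, copy n (colour W x + 1) m) else (end₂ W x, copy n (colour W x) (m - n))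

/-- The label of the first arc of the `A`-resolution of a crossing of a parallel. -/
noncomputable def pend₁ (n : ℕ) (W : Word) (x : ℕ) : Option (Curves W (state W ∅)) × ℕ :=
  plab n W x (pos (parallel W n) x)

/-- The label of the second arc of the `A`-resolution of a crossing of a parallel. -/
noncomputable def pend₂ (n : ℕ) (W : Word) (x : ℕ) : Option (Curves W (state W ∅)) × ℕ :=
  plab n W (line₂ (parallel W n) x) (pos₂ (parallel W n) x)

/-- The number, in its grid, of the first arc of a crossing. -/
def gridPos (n : ℕ) (W : Word) (k t : ℕ) : ℕ :=
  if aVert W k = true then n - 1 - t / n + t % n else t / n + t % n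

theorem gridPos_lt {n : ℕ} {t : ℕ} (W : Word) (k : ℕ) (ht : t < n * n) :
    gridPos n W k t < 2 * n - 1 := by
  have hn : 0 < n := Nat.pos_of_mul_pos_left (by omega : 0 < n * n)
  have hi : t / n < n := Nat.div_lt_of_lt_mul ht
  have hj : t % n < n := Nat.mod_lt _ hn
  unfold gridPos
  generalize t / n = i at *
  generalize t % n = j at *
  split_ifs <;> omega

/-- Every diagonal of the grid meets its first or its last row, or its first column, which supplies
the witness. -/
theorem exists_gridPos {n : ℕ} (W : Word) (k : ℕ) {m : ℕ} (hm : m < 2 * n - 1) :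
    ∃ t < n * n, gridPos n W k t = m := by
  have hn : 0 < n := by omega
  have key : ∀ i j, i < n → j < n → i * n + j < n * n ∧ (i * n + j) / n = i ∧ (i * n + j) % n = j := by
    intro i j hi hj
    refine ⟨?_, ?_, ?_⟩
    · have := Nat.mul_le_mul_right n (Nat.succ_le_of_lt hi)
      rw [Nat.succ_eq_add_one, add_mul, one_mul] at this
      omega
    · rw [mul_comm, Nat.mul_add_div hn, Nat.div_eq_of_lt hj, add_zero]
    · rw [mul_comm, Nat.mul_add_mod, Nat.mod_eq_of_lt hj]
  unfold gridPos
  by_cases hmn : m < n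
  · split_ifs
    · obtain ⟨h1, h2, h3⟩ := key (n - 1 - m) 0 (by omega) hn
      exact ⟨_, h1, by rw [h2, h3]; omega⟩
    · obtain ⟨h1, h2, h3⟩ := key 0 m hn hmn
      exact ⟨_, h1, by rw [h2, h3]; omega⟩
  · split_ifs
    · obtain ⟨h1, h2, h3⟩ := key 0 (m - (n - 1)) hn (by omega)
      exact ⟨_, h1, by rw [h2, h3]; omega⟩
    · obtain ⟨h1, h2, h3⟩ := key (n - 1) (m - (n - 1)) (by omega) (by omega)
      exact ⟨_, h1, by rw [h2, h3]; omega⟩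

/-- Across the grid, in the direction from the first A-arc to the second, lie 2n arcs: n copies of
`end₁` followed by n copies of `end₂`. A crossing on diagonal m joins the arcs number m and m + 1,
and its colour alternates with m. -/
theorem pend_eq {n : ℕ} (hn : 0 < n) {W : Word} (hW : Closed W) {k t : ℕ} (hk : k ∈ crossings W)
    (ht : t < n * n) :
    offset n W k + t ∈ crossings (parallel W n) ∧
    pend₁ n W (offset n W k + t) = gridLab n W k (gridPos n W k t) ∧
    pend₂ n W (offset n W k + t) = gridLab n W k (gridPos n W k t + 1) ∧
    colour (parallel W n) (offset n W k + t) = (n * (colour W k + 1) + gridPos n W k t + 1) % 2 := by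
  obtain ⟨s, o, a, b, hs, hp⟩ := mem_crossings.1 hk
  have hbl : blockLength n s = n * n := by simp [blockLength, hp]
  rw [← hbl] at ht
  obtain ⟨h1, h2, h3⟩ := mem_crossings_parallel hs ht
  have hlen := gridPos_lt W k (hbl ▸ ht)
  have hi : t / n < n := Nat.div_lt_of_lt_mul (hbl ▸ ht)
  have hj : t % n < n := Nat.mod_lt _ hn
  obtain ⟨hbr, hB⟩ := parallel_block (plab_labels hn hW) hs
  have hB0 := hB t ht.le
  have hB1 := hB (t + 1) ht
  have hpos : blockLeft n s t = n * s.left.length + (n - 1 - t / n + t % n) := by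
    simp [blockLeft, hp]
  have hwid : ∀ t, blockWidth n s t = n * s.left.length + 2 * n + n * s.right.length := fun t => by
    simp [blockWidth, hp]
  rw [hwid] at hB0 hB1
  have hla := (lab_isOuter hW).2 k hk
  have hl1 := Closed.pos_lt hk
  have hl2 := hW.pos_lt' hk
  rw [pos_eq hs] at hl1 hl2
  have hu : ∀ q < n, plab n W (offset n W k) (n * s.left.length + q) =
      (lab W k s.left.length, copy n s.left.length q) := fun q hq =>
    plab_line hn hW (by omega) hq
  have hu' : ∀ K, s.left.length + 1 < width W K → ∀ q, n ≤ q → q < 2 * n →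
      plab n W (offset n W K) (n * s.left.length + q) =
      (lab W K (s.left.length + 1), copy n (s.left.length + 1) (q - n)) := fun K hK q hq hq' => by
    rw [← plab_line hn hW hK (by omega)]
    congr 1; rw [mul_add]; omega
  refine ⟨h1.2 hk, ?_⟩
  unfold pend₁ pend₂ gridLab line₂ pos₂ colour end₁ end₂ line₂ pos₂
  unfold ARel VertRel HorRel at hla
  rw [h2, h3, hpos, pos_eq hs]
  rw [pos_eq hs] at hla
  rw [aVert_eq hs hp] at *
  have hmod : ∀ a b, a % 2 = b % 2 → ∀ o, copy n a o = copy n b o := fun a b hab o => by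
    unfold copy; rw [hab]
  cases o with
  | true =>
    have hg : gridPos n W k t = n - 1 - t / n + t % n := by
      unfold gridPos; rw [aVert_eq hs hp]; rfl
    rw [hg] at hlen ⊢
    simp only [if_true]
    generalize hq : n - 1 - t / n + t % n = q at *
    have hbu : ∀ p, blockLab n s (plab n W (offset n W k)) (plab n W (offset n W (k + 1))) t p =
        plab n W (offset n W k) p := fun p => by simp [blockLab, hp]
    have hU : ∀ q < 2 * n, plab n W (offset n W k + t) (n * s.left.length + q) =
        if q < n then (lab W k s.left.length, copy n ((s.left.length + 1) % 2 + 1) q)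
        else (lab W k (s.left.length + 1), copy n ((s.left.length + 1) % 2) (q - n)) := by
      intro q hq
      rw [hB0 _ (by omega), hbu]
      split_ifs with hqn
      · rw [hu q hqn, hmod s.left.length ((s.left.length + 1) % 2 + 1) (by omega)]
      · rw [hu' k (by omega) q (by omega) hq, hmod (s.left.length + 1) ((s.left.length + 1) % 2) (by omega)]
    refine ⟨hU q (by omega), hU (q + 1) (by omega), ?_⟩
    -- Only the parity matters, so the position may be replaced by its residue modulo 2.
    have hns : n * s.left.length = n * (s.left.length % 2) + 2 * (n * (s.left.length / 2)) := by
      conv_lhs => rw [← Nat.mod_add_div s.left.length 2]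
      ring
    rw [hns]
    rcases Nat.mod_two_eq_zero_or_one s.left.length with h' | h'
    · rw [h', (by omega : (s.left.length + 1) % 2 = 1)]; omega
    · rw [h', (by omega : (s.left.length + 1) % 2 = 0)]; omega
  | false =>
    have hg : gridPos n W k t = t / n + t % n := by
      unfold gridPos; rw [aVert_eq hs hp]; rfl
    rw [hg] at hlen ⊢
    simp only [if_false, Bool.false_eq_true] at hla ⊢
    have hG : ∀ t' q, q < 2 * n → levelAt n t' q < 2 * n →
        blockLab n s (plab n W (offset n W k)) (plab n W (offset n W (k + 1))) t'
          (n * s.left.length + q) = if levelAt n t' q < n then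
            (lab W k s.left.length, copy n (s.left.length % 2 + 1) (levelAt n t' q))
          else (lab W (k + 1) s.left.length,
            copy n (s.left.length % 2) (levelAt n t' q - n)) := by
      intro t' q hq hl
      simp only [blockLab, hp]
      rw [if_neg (by omega), Nat.add_sub_cancel_left]
      split_ifs with hc
      · rw [hu _ (by omega)]
        congr 1
        unfold copy; split_ifs <;> omega
      · rw [hu' (k + 1) (by omega) _ (by omega) (by omega), hla.2]
        congr 1
        unfold copy; split_ifs <;> omega
    have hb := (level_below hi hj).1
    have ha := (level_above (j := t % n) hi).1
    have e0 : levelAt n t (n - 1 - t / n + t % n) = t / n + t % n := hb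
    have hqlt : n - 1 - t / n + t % n < 2 * n := by
      generalize t / n = i at *
      generalize t % n = j at *
      omega
    have e1 : levelAt n (t + 1) (n - 1 - t / n + t % n) = t / n + t % n + 1 := by
      rw [levelAt_succ (hbl ▸ ht) hqlt, ha]
    have f0 := hG t _ hqlt (by rw [e0]; omega)
    have f1 := hG (t + 1) _ hqlt (by rw [e1]; omega)
    rw [e0] at f0
    rw [e1] at f1
    refine ⟨?_, ?_, ?_⟩
    · rw [hB0 _ (by omega), f0]
    · rw [add_assoc, hB1 _ (by omega), f1]
    · have hpar : (n - 1 - t / n + t % n) % 2 = (n + (t / n + t % n) + 1) % 2 := by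
        generalize t / n = i at *
        generalize t % n = j at *
        omega
      rw [Nat.add_mod, hpar]
      generalize t / n + t % n = q at *
      have hns : n * s.left.length = n * (s.left.length % 2) + 2 * (n * (s.left.length / 2)) := by
        conv_lhs => rw [← Nat.mod_add_div s.left.length 2]
        ring
      rw [hns]
      rcases Nat.mod_two_eq_zero_or_one s.left.length with h' | h' <;> rw [h'] <;> omega

/-- The two ends of a crossing of a parallel. -/
noncomputable def pends (n : ℕ) (W : Word) (x : ℕ) : Sym2 (Option (Curves W (state W ∅)) × ℕ) :=
  s(pend₁ n W x, pend₂ n W x)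

theorem ends_parallel {n : ℕ} (hn : 0 < n) {W : Word} (hW : Closed W) :
    (∀ x ∈ crossings (parallel W n), end₁ (parallel W n) x = end₂ (parallel W n) x ↔
      pend₁ n W x = pend₂ n W x) ∧
    (∀ x ∈ crossings (parallel W n), ∀ y ∈ crossings (parallel W n),
      (ends (parallel W n) x = ends (parallel W n) y ↔ pends n W x = pends n W y) ∧
      (end₁ (parallel W n) x ∈ ends (parallel W n) y ↔ pend₁ n W x ∈ pends n W y)) := by
  obtain ⟨ψ, hψ, h⟩ := exists_curveLabel hn hW
  have h1 : ∀ x ∈ crossings (parallel W n), ψ (end₁ (parallel W n) x) = some (pend₁ n W x) :=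
    fun x hx => h _ _ (by have := Closed.pos_lt hx; omega)
  have h2 : ∀ x ∈ crossings (parallel W n), ψ (end₂ (parallel W n) x) = some (pend₂ n W x) :=
    fun x hx => h _ _ ((Closed.parallel hn hW).pos₂_lt hx)
  have h3 : ∀ x ∈ crossings (parallel W n), Sym2.map ψ (ends (parallel W n) x) =
      Sym2.map some (pends n W x) := fun x hx => by
    rw [ends, pends, Sym2.map_mk, Sym2.map_mk, h1 x hx, h2 x hx]
  have hs : Function.Injective (some : Option (Curves W (state W ∅)) × ℕ → _) :=
    Option.some_injective _
  refine ⟨fun x hx => ?_, fun x hx y hy => ⟨?_, ?_⟩⟩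
  · rw [← hψ.eq_iff, h1 x hx, h2 x hx, hs.eq_iff]
  · rw [← (Sym2.map.injective hψ).eq_iff, h3 x hx, h3 y hy, (Sym2.map.injective hs).eq_iff]
  · unfold ends pends
    rw [Sym2.mem_iff, Sym2.mem_iff, ← hψ.eq_iff, ← hψ.eq_iff (a := end₁ _ x) (b := end₂ _ y),
      h1 x hx, h1 y hy, h2 y hy, hs.eq_iff, hs.eq_iff]

/-- The number of the copy which is next to the other side of a crossing. -/
def midCopy (n : ℕ) (W : Word) (x : ℕ) : ℕ := if colour W x = 1 then n - 1 else 0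

/-- The colour of the crossings of a parallel between two strands on different sides of a crossing. -/
def midColour (n : ℕ) (W : Word) (x : ℕ) : ℕ := if colour W x = 1 then n % 2 else 0

theorem gridLab_mid {n : ℕ} (hn : 0 < n) (W : Word) (x : ℕ) :
    gridLab n W x (n - 1) = (end₁ W x, midCopy n W x) ∧
    gridLab n W x (n - 1 + 1) = (end₂ W x, midCopy n W x) ∧
    (n * (colour W x + 1) + (n - 1) + 1) % 2 = midColour n W x := by
  have hc := colour_lt W x
  have : colour W x = 0 ∨ colour W x = 1 := by omega
  unfold gridLab midCopy midColour copy
  rcases this with h | h <;> simp [h, hn] <;> omega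

theorem gridLab_zero {W : Word} {x : ℕ} (h : colour W x = 0) (n m : ℕ) : gridLab n W x m =
    if m < n then (end₁ W x, n - 1 - m) else (end₂ W x, m - n) := by
  unfold gridLab; rw [h]; rfl

theorem gridLab_one {W : Word} {x : ℕ} (h : colour W x = 1) (n m : ℕ) : gridLab n W x m =
    if m < n then (end₁ W x, m) else (end₂ W x, n - 1 - (m - n)) := by
  unfold gridLab; rw [h]; rfl

/-- Off the middle diagonal, neighbouring arcs are neighbouring copies of one curve. The region
beyond copy 0 has colour 0 and colours alternate across the copies, so the crossings between copies
j and j + 1 have the colour of j + 1. -/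
theorem gridLab_side {n : ℕ} {W : Word} {x m : ℕ} (hm : m < 2 * n - 1) (hm' : m ≠ n - 1) :
    ∃ C ∈ ends W x, ∃ j, j + 1 < n ∧
      s(gridLab n W x m, gridLab n W x (m + 1)) = s((C, j), (C, j + 1)) ∧
      (n * (colour W x + 1) + m + 1) % 2 = (j + 1) % 2 := by
  have hc := colour_lt W x
  have : colour W x = 0 ∨ colour W x = 1 := by omega
  by_cases hmn : m < n
  · have hmn' : m + 1 < n := by omega
    refine ⟨end₁ W x, Sym2.mem_mk_left _ _, ?_⟩
    rcases this with h | h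
    · refine ⟨n - 1 - (m + 1), by omega, ?_, by rw [h]; omega⟩
      rw [gridLab_zero h, gridLab_zero h, if_pos hmn, if_pos hmn', Sym2.eq_swap,
        (by omega : n - 1 - (m + 1) + 1 = n - 1 - m)]
    · refine ⟨m, by omega, ?_, by rw [h]; omega⟩
      rw [gridLab_one h, gridLab_one h, if_pos hmn, if_pos hmn']
  · have hmn' : ¬ m + 1 < n := by omega
    refine ⟨end₂ W x, Sym2.mem_mk_right _ _, ?_⟩
    rcases this with h | h
    · refine ⟨m - n, by omega, ?_, by rw [h]; omega⟩
      rw [gridLab_zero h, gridLab_zero h, if_neg hmn, if_neg hmn', (by omega : m + 1 - n = m - n + 1)]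
    · refine ⟨n - 1 - (m + 1 - n), by omega, ?_, by rw [h]; omega⟩
      rw [gridLab_one h, gridLab_one h, if_neg hmn, if_neg hmn', Sym2.eq_swap,
        (by omega : n - 1 - (m + 1 - n) + 1 = n - 1 - (m - n))]

theorem exists_gridLab_side {n : ℕ} {W : Word} {x j : ℕ} {C : Option (Curves W (state W ∅))}
    (hC : C ∈ ends W x) (hj : j + 1 < n) : ∃ m < 2 * n - 1,
      s(gridLab n W x m, gridLab n W x (m + 1)) = s((C, j), (C, j + 1)) := by
  have hc := colour_lt W x
  have : colour W x = 0 ∨ colour W x = 1 := by omega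
  have h1 : n - 1 - (j + 1) < n := by omega
  have h2 : n - 1 - (j + 1) + 1 < n := by omega
  have h3 : ¬ n + j < n := by omega
  have h4 : ¬ n + j + 1 < n := by omega
  have h5 : ¬ 2 * n - 1 - (j + 1) < n := by omega
  have h6 : ¬ 2 * n - 1 - (j + 1) + 1 < n := by omega
  rcases Sym2.mem_iff.1 hC with rfl | rfl
  · rcases this with h | h
    · refine ⟨n - 1 - (j + 1), by omega, ?_⟩
      rw [gridLab_zero h, gridLab_zero h, if_pos h1, if_pos h2, Sym2.eq_swap,
        (by omega : n - 1 - (n - 1 - (j + 1) + 1) = j), (by omega : n - 1 - (n - 1 - (j + 1)) = j + 1)]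
    · refine ⟨j, by omega, ?_⟩
      rw [gridLab_one h, gridLab_one h, if_pos hj, if_pos (by omega)]
  · rcases this with h | h
    · refine ⟨n + j, by omega, ?_⟩
      rw [gridLab_zero h, gridLab_zero h, if_neg h3, if_neg h4,
        (by omega : n + j - n = j), (by omega : n + j + 1 - n = j + 1)]
    · refine ⟨2 * n - 1 - (j + 1), by omega, ?_⟩
      rw [gridLab_one h, gridLab_one h, if_neg h5, if_neg h6, Sym2.eq_swap,
        (by omega : n - 1 - (2 * n - 1 - (j + 1) + 1 - n) = j),
        (by omega : n - 1 - (2 * n - 1 - (j + 1) - n) = j + 1)]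

/-- The middle diagonal of a grid joins the two copies that face each other at the original
crossing; all other diagonals join neighbouring copies of one curve. The combinatorics of the
parallel is derived from this dichotomy. -/
theorem crossing_cases {n : ℕ} (hn : 0 < n) {W : Word} (hW : Closed W) {x' : ℕ}
    (hx' : x' ∈ crossings (parallel W n)) : ∃ x ∈ crossings W,
      (∃ C ∈ ends W x, ∃ j, j + 1 < n ∧ pends n W x' = s((C, j), (C, j + 1)) ∧
        colour (parallel W n) x' = (j + 1) % 2) ∨
      (pend₁ n W x' = (end₁ W x, midCopy n W x) ∧ pend₂ n W x' = (end₂ W x, midCopy n W x) ∧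
        colour (parallel W n) x' = midColour n W x) := by
  obtain ⟨s', o, a, b, hs', -⟩ := mem_crossings.1 hx'
  obtain ⟨k, s, t, hs, ht, rfl⟩ := exists_offset (lt_of_slice hs')
  have hk := (mem_crossings_parallel hs ht).1.1 hx'
  obtain ⟨s₂, o, a, b, hs₂, hp⟩ := mem_crossings.1 hk
  obtain rfl := Option.some.inj (hs.symm.trans hs₂)
  have ht' : t < n * n := by simpa [blockLength, hp] using ht
  obtain ⟨-, h1, h2, h3⟩ := pend_eq hn hW hk ht'
  refine ⟨k, hk, ?_⟩
  rw [pends, h1, h2, h3]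
  by_cases hm : gridPos n W k t = n - 1
  · rw [hm]; exact .inr (gridLab_mid hn W k)
  · exact .inl (gridLab_side (gridPos_lt W k ht') hm)

theorem exists_mid {n : ℕ} (hn : 0 < n) {W : Word} (hW : Closed W) {x : ℕ} (hx : x ∈ crossings W) :
    ∃ x' ∈ crossings (parallel W n), pend₁ n W x' = (end₁ W x, midCopy n W x) ∧
      pend₂ n W x' = (end₂ W x, midCopy n W x) ∧ colour (parallel W n) x' = midColour n W x := by
  obtain ⟨t, ht, htm⟩ := exists_gridPos W x (n := n) (m := n - 1) (by omega)
  obtain ⟨h0, h1, h2, h3⟩ := pend_eq hn hW hx ht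
  rw [htm] at h1 h2 h3
  obtain ⟨g1, g2, g3⟩ := gridLab_mid hn W x
  exact ⟨_, h0, h1.trans g1, h2.trans g2, h3.trans g3⟩

theorem exists_side {n : ℕ} (hn : 0 < n) {W : Word} (hW : Closed W) {x j : ℕ} (hx : x ∈ crossings W)
    {C : Option (Curves W (state W ∅))} (hC : C ∈ ends W x) (hj : j + 1 < n) :
    ∃ x' ∈ crossings (parallel W n), pends n W x' = s((C, j), (C, j + 1)) := by
  obtain ⟨m, hm, h⟩ := exists_gridLab_side hC hj
  obtain ⟨t, ht, htm⟩ := exists_gridPos W x hm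
  obtain ⟨h0, h1, h2, h3⟩ := pend_eq hn hW hx ht
  rw [htm] at h1 h2 h3
  exact ⟨_, h0, by rw [pends, h1, h2, h]⟩

theorem pend_ne_of_side {n : ℕ} {W : Word} {x' j : ℕ} {C : Option (Curves W (state W ∅))}
    (h : pends n W x' = s((C, j), (C, j + 1))) : pend₁ n W x' ≠ pend₂ n W x' := by
  intro he
  rw [pends, he, Sym2.eq_iff] at h
  rcases h with ⟨h1, h2⟩ | ⟨h1, h2⟩ <;> simp [h1] at h2

theorem Adequate.parallel {n : ℕ} (hn : 0 < n) {W : Word} (hW : Closed W) (h : Adequate W) :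
    Adequate (parallel W n) := by
  intro x' hx'
  rw [Ne, (ends_parallel hn hW).1 x' hx']
  obtain ⟨x, hx, ⟨C, hC, j, hj, h1, h2⟩ | ⟨h1, h2, h3⟩⟩ := crossing_cases hn hW hx'
  · exact pend_ne_of_side h1
  · rw [h1, h2, Prod.mk.injEq, not_and_or]
    exact .inl (h x hx)

theorem card_image_eq {α β γ : Type*} [DecidableEq β] [DecidableEq γ] {s : Finset α} {f : α → β}
    {g : α → γ} (h : ∀ x ∈ s, ∀ y ∈ s, f x = f y → g x = g y) :
    (s.image g).card ≤ (s.image f).card := by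
  refine Finset.card_le_card_of_forall_subsingleton (fun b c => ∃ x ∈ s, f x = c ∧ g x = b) ?_ ?_
  · intro b hb
    obtain ⟨x, hx, rfl⟩ := Finset.mem_image.1 hb
    exact ⟨f x, Finset.mem_image_of_mem f hx, x, hx, rfl, rfl⟩
  · rintro c - b ⟨-, x, hx, hxc, rfl⟩ b' ⟨-, y, hy, hyc, rfl⟩
    exact h x hx y hy (hxc.trans hyc.symm)

/-- Every state circle of the all-`A` state touches a crossing. -/
def Touched (W : Word) : Prop :=
  ∀ C : Curves W (state W ∅), ∃ x ∈ crossings W, some C ∈ ends W x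

/-- A circle that touches a crossing yields n − 1 pairs of neighbouring copies, and every pair of
circles of the diagram yields one pair of facing copies. The latter is well defined because
crossings joining the same circles have equal colour. -/
theorem numPairs_parallel {n : ℕ} (hn : 0 < n) {W : Word} (hW : Closed W) (h : Adequate W)
    (hT : Touched W) : numPairs (parallel W n) = (n - 1) * vA W + numPairs W := by
  classical
  have h1 : numPairs (parallel W n) = ((crossings (parallel W n)).image (pends n W)).card :=
    le_antisymm
      (card_image_eq fun x hx y hy => (((ends_parallel hn hW).2 x hx y hy).1).2)
      (card_image_eq fun x hx y hy => (((ends_parallel hn hW).2 x hx y hy).1).1)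
  set S₁ : Finset (Sym2 (Option (Curves W (state W ∅)) × ℕ)) :=
    ((Finset.univ : Finset (Curves W (state W ∅))) ×ˢ Finset.range (n - 1)).image
      fun q => s((some q.1, q.2), (some q.1, q.2 + 1)) with hS₁
  set S₂ : Finset (Sym2 (Option (Curves W (state W ∅)) × ℕ)) :=
    (crossings W).image fun x => s((end₁ W x, midCopy n W x), (end₂ W x, midCopy n W x)) with hS₂
  have h2 : (crossings (parallel W n)).image (pends n W) = S₁ ∪ S₂ := by
    ext z
    rw [Finset.mem_image, Finset.mem_union, hS₁, hS₂, Finset.mem_image, Finset.mem_image]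
    constructor
    · rintro ⟨x', hx', rfl⟩
      obtain ⟨x, hx, ⟨C, hC, j, hj, h1, h2⟩ | ⟨h1, h2, h3⟩⟩ := crossing_cases hn hW hx'
      · left
        have hl1 := Closed.pos_lt hx
        have hl2 := hW.pos₂_lt hx
        obtain ⟨D, rfl⟩ : ∃ D, C = some D := by
          rcases Sym2.mem_iff.1 hC with rfl | rfl
          · exact ⟨_, lab_eq_some (by omega)⟩
          · exact ⟨_, lab_eq_some hl2⟩
        exact ⟨(D, j), Finset.mem_product.2 ⟨Finset.mem_univ _, Finset.mem_range.2 (by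
          simp only; omega)⟩, h1.symm⟩
      · right
        exact ⟨x, hx, by rw [pends, h1, h2]⟩
    · rintro (⟨⟨D, j⟩, hq, rfl⟩ | ⟨x, hx, rfl⟩)
      · have hj := Finset.mem_range.1 (Finset.mem_product.1 hq).2
        obtain ⟨x, hx, hxD⟩ := hT D
        exact exists_side hn hW hx hxD (by simp only at hj; omega)
      · obtain ⟨x', hx', h1, h2, -⟩ := exists_mid hn hW hx
        exact ⟨x', hx', by rw [pends, h1, h2]⟩
  have h3 : S₁.card = (n - 1) * vA W := by
    rw [hS₁, Finset.card_image_of_injective, Finset.card_product, Finset.card_univ,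
      Finset.card_range, vA, circles, Nat.card_eq_fintype_card, mul_comm]
    rintro ⟨C, j⟩ ⟨C', j'⟩ hq
    simp only [Sym2.eq_iff, Prod.mk.injEq, Option.some.injEq] at hq ⊢
    rcases hq with ⟨⟨e1, e2⟩, -⟩ | ⟨⟨-, e2⟩, -, e3⟩
    · exact ⟨e1, e2⟩
    · omega
  have h4 : S₂.card = numPairs W := by
    refine le_antisymm (card_image_eq fun x hx y hy hxy => ?_) (card_image_eq fun x hx y hy hxy => ?_)
    · have hcol := colour_eq_of_ends_eq hW hx hy (h x hx) hxy
      have hm : midCopy n W x = midCopy n W y := by unfold midCopy; rw [hcol]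
      simp only [hm]
      unfold ends at hxy
      rcases Sym2.eq_iff.1 hxy with ⟨e1, e2⟩ | ⟨e1, e2⟩
      · rw [e1, e2]
      · rw [e1, e2, Sym2.eq_swap]
    · have := congrArg (Sym2.map Prod.fst) hxy
      simpa [ends] using this
  have h5 : Disjoint S₁ S₂ := by
    rw [Finset.disjoint_left]
    intro z hz hz'
    obtain ⟨⟨D, j⟩, -, rfl⟩ := Finset.mem_image.1 hz
    obtain ⟨x, -, hx⟩ := Finset.mem_image.1 hz'
    rcases Sym2.eq_iff.1 hx with ⟨e1, e2⟩ | ⟨e1, e2⟩ <;>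
      simp only [Prod.mk.injEq] at e1 e2 <;> omega
  rw [h1, h2, Finset.card_union_of_disjoint h5, h3, h4]

/-- Cabling leaves v_A − `numPairs` unchanged: n v_A circles, minus (n − 1) v_A new pairs, minus the
old pairs. -/
theorem coeffM_parallel_one {n : ℕ} (hn : 0 < n) {W : Word} (hW : Closed W) (hne : W ≠ [])
    (h : Adequate W) (hT : Touched W) :
    |coeffM (parallel W n) 1| = |(vA W : ℤ) - 1 - numPairs W| := by
  rw [(h.parallel hn hW).coeffM_one (Closed.parallel hn hW) (parallel_ne_nil hn hne),
    vA_parallel hn hW, numPairs_parallel hn hW h hT]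
  congr 1
  obtain ⟨m, rfl⟩ : ∃ m, n = m + 1 := ⟨n - 1, by omega⟩
  push_cast [Nat.add_sub_cancel]; ring

/-- The properties of the chords of a parallel which come from a chord of the diagram with both ends
on the same curve. -/
theorem exists_selfchord {n : ℕ} (hn : 2 ≤ n) {W : Word} (hW : Closed W) {x : ℕ}
    (hx : x ∈ crossings W) (hxx : end₁ W x = end₂ W x) :
    ∃ s ∈ crossings (parallel W n), end₁ (parallel W n) s = end₂ (parallel W n) s ∧
      pend₁ n W s = (end₁ W x, midCopy n W x) ∧
      ∀ k ∈ crossings (parallel W n), colour (parallel W n) k ≠ colour (parallel W n) s →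
        end₁ (parallel W n) s ∈ ends (parallel W n) k →
        end₁ (parallel W n) k ≠ end₂ (parallel W n) k ∧
        ∃ C j, pends n W k = s((C, j), (C, j + 1)) ∧
          (colour W x = 1 → j + 1 = n - 1) ∧ (colour W x = 0 → j = 0) := by
  have hn' : 0 < n := by omega
  obtain ⟨s, hs, h1, h2, h3⟩ := exists_mid hn' hW hx
  refine ⟨s, hs, ((ends_parallel hn' hW).1 s hs).2 (by rw [h1, h2, hxx]), h1, ?_⟩
  intro k hk hkc hks
  rw [((ends_parallel hn' hW).2 s hs k hk).2, h1] at hks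
  rw [h3] at hkc
  have hcx : colour W x = 0 ∨ colour W x = 1 := by have := colour_lt W x; omega
  obtain ⟨y, hy, ⟨C, hC, j, hj, g1, g2⟩ | ⟨g1, g2, g3⟩⟩ := crossing_cases hn' hW hk
  · refine ⟨mt ((ends_parallel hn' hW).1 k hk).1 (pend_ne_of_side g1), C, j, g1, ?_, ?_⟩
    · intro hc
      unfold midCopy midColour at *
      rw [g1, Sym2.mem_iff, Prod.mk.injEq, Prod.mk.injEq] at hks
      rw [if_pos hc] at hks hkc
      omega
    · intro hc
      unfold midCopy midColour at *
      rw [g1, Sym2.mem_iff, Prod.mk.injEq, Prod.mk.injEq] at hks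
      rw [if_neg (by omega)] at hks hkc
      omega
  · exfalso
    rw [g3] at hkc
    rw [pends, g1, g2, Sym2.mem_iff, Prod.mk.injEq, Prod.mk.injEq] at hks
    unfold midCopy midColour at *
    have hcy : colour W y = 0 ∨ colour W y = 1 := by have := colour_lt W y; omega
    rcases hcx with hcx | hcx <;> rcases hcy with hcy | hcy <;> simp [hcx, hcy] at hks hkc <;> omega

/-- In the parallel, the other side of a curve carrying a self-chord faces a neighbouring copy. The
crossings there join different curves, so no self-chord of the other colour obstructs the toggle. -/
theorem coeffM_parallel_zero_eq_zero {n : ℕ} (hn : 2 ≤ n) {W : Word} (hW : Closed W) (hne : W ≠ [])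
    (h : ¬ Adequate W) : coeffM (parallel W n) 0 = 0 := by
  have hn' : 0 < n := by omega
  unfold Adequate at h
  push Not at h
  obtain ⟨x, hx, hxx⟩ := h
  obtain ⟨s, hs, hss, -, hk⟩ := exists_selfchord hn hW hx hxx
  refine coeffM_zero_eq_zero (Closed.parallel hn' hW) (parallel_ne_nil hn' hne) hs hss
    fun k hkc hkk hc he => ?_
  exact (hk k hkc hc (by rw [← he]; exact Sym2.mem_mk_left _ _)).1 hkk

/-- Since a_M(D) is not zero, there are self-chords of both colours. In the parallel they lie on
copies n − 1 and 0, and the crossings that may obstruct them join copies n − 2, n − 1 and copies 0,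
1. For n > 2 these never form a common bundle. -/
theorem coeffM_parallel_one_eq_zero {n : ℕ} (hn : 2 < n) {W : Word} (hW : Closed W) (hne : W ≠ [])
    (h : ¬ Adequate W) (h0 : coeffM W 0 ≠ 0) : coeffM (parallel W n) 1 = 0 := by
  have hn' : 0 < n := by omega
  unfold Adequate at h
  push Not at h
  obtain ⟨x₁, hx₁, hxx₁⟩ := h
  obtain ⟨x₂, hx₂, hxx₂, hc⟩ := exists_other_colour hW hne h0 hx₁ hxx₁
  obtain ⟨x, hx, hxx, hcx, y, hy, hyy, hcy⟩ : ∃ x ∈ crossings W, end₁ W x = end₂ W x ∧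
      colour W x = 1 ∧ ∃ y ∈ crossings W, end₁ W y = end₂ W y ∧ colour W y = 0 := by
    have l1 := colour_lt W x₁
    have l2 := colour_lt W x₂
    rcases (by omega : colour W x₁ = 0 ∨ colour W x₁ = 1) with e | e
    · exact ⟨x₂, hx₂, hxx₂, by omega, x₁, hx₁, hxx₁, e⟩
    · exact ⟨x₁, hx₁, hxx₁, e, x₂, hx₂, hxx₂, by omega⟩
  obtain ⟨s, hs, hss, hs1, hsk⟩ := exists_selfchord hn.le hW hx hxx
  obtain ⟨t, ht, htt, ht1, htk⟩ := exists_selfchord hn.le hW hy hyy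
  have hst : s ≠ t := by
    rintro rfl
    have := (Prod.mk.inj (hs1.symm.trans ht1)).2
    unfold midCopy at this
    rw [if_pos hcx, if_neg (by omega)] at this
    omega
  refine coeffM_one_eq_zero (Closed.parallel hn' hW) (parallel_ne_nil hn' hne) hs ht hst hss htt
    (fun k hk hc hm => (hsk k hk hc hm).1) (fun k hk hc hm => (htk k hk hc hm).1)
    fun k hk l hl hkc hkm hlc hlm he => ?_
  obtain ⟨-, C, j, hk1, hk2, -⟩ := hsk k hk hkc hkm
  obtain ⟨-, C', j', hl1, -, hl2⟩ := htk l hl hlc hlm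
  have e := ((ends_parallel hn' hW).2 k hk l hl).1.1 he
  have hj := hk2 hcx
  have hj' := hl2 hcy
  rw [hk1, hl1, Sym2.eq_iff, Prod.mk.injEq, Prod.mk.injEq, Prod.mk.injEq, Prod.mk.injEq] at e
  omega

/-! ### Diagrams are closed words -/

theorem IsTangle.width_zero {x : List Bool} {W : Word} (h : IsTangle x W []) :
    width W 0 = x.length := by
  cases W with
  | nil => simp [show x = [] from h, width]
  | cons s W => rw [show x = s.source from h.1]; exact width_eq rfl

theorem IsTangle.closed_aux {x : List Bool} {W : Word} (h : IsTangle x W []) :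
    ∀ k s, W[k]? = some s → s.target.length = width W (k + 1) := by
  induction W generalizing x with
  | nil => simp
  | cons s W ih =>
    intro k s' hs'
    have hw : ∀ k, width (s :: W) (k + 1) = width W k := fun k => by simp [width]
    rw [hw]
    cases k with
    | zero =>
      obtain rfl : s = s' := by simpa using hs'
      exact h.2.width_zero.symm
    | succ k => exact ih h.2 k s' (by simpa using hs')

theorem Diagram.isClosed (D : Diagram) : Closed D.word :=
  ⟨D.closed.width_zero, D.closed.closed_aux⟩

/-- A state circle that touches no crossing contains no leg of a crossing. Its indicator is
therefore constant along the strands of the unresolved diagram, so it is a crossing-free component.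
-/
theorem touched_of_everyCurveCrosses {W : Word} (hW : Closed W) (h : EveryCurveCrosses W) :
    Touched W := by
  intro C
  by_contra hcon
  push Not at hcon
  have hne : ∀ x ∈ crossings W, end₁ W x ≠ some C ∧ end₂ W x ≠ some C := fun x hx => by
    have := hcon x hx
    rw [ends, Sym2.mem_iff, not_or] at this
    exact ⟨Ne.symm this.1, Ne.symm this.2⟩
  obtain ⟨hO, hA⟩ := lab_isOuter hW
  have legs : ∀ x ∈ crossings W, lab W x (pos W x) ≠ some C ∧ lab W x (pos W x + 1) ≠ some C ∧
      lab W (x + 1) (pos W x) ≠ some C ∧ lab W (x + 1) (pos W x + 1) ≠ some C := fun x hx => by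
    have h1 := hne x hx
    have h2 := hA x hx
    unfold end₁ end₂ line₂ pos₂ at h1
    unfold ARel VertRel HorRel at h2
    split_ifs at h1 h2
    · rw [← h2.1, ← h2.2]; exact ⟨h1.1, h1.2, h1.1, h1.2⟩
    · rw [← h2.1, ← h2.2]; exact ⟨h1.1, h1.1, h1.2, h1.2⟩
  have adj : ∀ x y : Point W, Adjacent W (fun _ => .keep) x y →
      (lab W x.1.1 x.1.2 = some C ↔ lab W y.1.1 y.1.2 = some C) := by
    rintro ⟨⟨k₁, i₁⟩, hx⟩ ⟨⟨k₂, i₂⟩, hy⟩ ⟨k, s, hs, hJ⟩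
    have ho := hO k s hs
    have hl : ∀ o a b, s.piece = .cross o a b → _ := fun o a b hp =>
      legs k (mem_crossings.2 ⟨s, o, a, b, hs, hp⟩)
    rw [pos_eq hs] at hl
    simp only at hJ ⊢
    cases hJ with
    | left i hi => rw [ho.left _ hi]
    | right i hi => rw [ho.right _ hi]
    | cup b hb => rw [ho.cup b hb]
    | cap b hb => rw [ho.cap b hb]
    | keep₁ o a b hp _ => exact iff_of_false (hl o a b hp).1 (hl o a b hp).2.2.2
    | keep₂ o a b hp _ => exact iff_of_false (hl o a b hp).2.1 (hl o a b hp).2.2.1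
    | vertical₁ o a b hp hρ => simp at hρ
    | vertical₂ o a b hp hρ => simp at hρ
    | horizontal₁ o a b hp hρ => simp at hρ
    | horizontal₂ o a b hp hρ => simp at hρ
  induction C using Quot.ind
  rename_i p
  obtain ⟨y, s, hs, hsc, hpos, hy⟩ := h p
  have h1 := congrArg (Quot.lift (fun x : Point W => lab W x.1.1 x.1.2 = some (Quot.mk _ p))
    fun x y hxy => propext (adj x y hxy)) hy
  have h2 : lab W y.1.1 y.1.2 = some (Quot.mk _ p) := h1.mp (lab_point p)
  cases hp : s.piece with
  | cup b => simp [hp, Piece.isCrossing] at hsc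
  | cap b => simp [hp, Piece.isCrossing] at hsc
  | cross o a b =>
    have := legs y.1.1 (mem_crossings.2 ⟨s, o, a, b, hs, hp⟩)
    rw [pos_eq hs] at this
    rcases hpos with e | e
    · exact this.1 (e ▸ h2)
    · exact this.2.1 (e ▸ h2)

/-! ### The values of α and β. -/

open Classical in
theorem alpha_eq (D : Diagram) {n : ℕ} (hn : 2 < n) :
    alpha D n = if Adequate D.word then 1 else 0 := by
  unfold alpha
  split_ifs with h
  · rw [abs_mul, h.coeffM_zero D.isClosed D.nonempty,
      (h.parallel (by omega) D.isClosed).coeffM_zero (Closed.parallel (by omega) D.isClosed)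
        (parallel_ne_nil (by omega) D.nonempty), one_mul]
  · rw [coeffM_parallel_zero_eq_zero hn.le D.isClosed D.nonempty h, mul_zero, abs_zero]

-- The factor a_M(D) handles the non-adequate diagrams: either it vanishes, or it forces self-chords
-- of both colours, and then the second coefficient of the parallel vanishes.
open Classical in
theorem beta_eq (D : Diagram) (hD : EveryCurveCrosses D.word) {n : ℕ} (hn : 2 < n) :
    beta D n = if Adequate D.word then |(vA D.word : ℤ) - 1 - numPairs D.word| else 0 := by
  unfold beta
  split_ifs with h
  · rw [abs_mul, h.coeffM_zero D.isClosed D.nonempty, one_mul]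
    exact coeffM_parallel_one (by omega) D.isClosed D.nonempty h
      (touched_of_everyCurveCrosses D.isClosed hD)
  · by_cases h0 : coeffM D.word 0 = 0
    · rw [h0, zero_mul, abs_zero]
    · rw [coeffM_parallel_one_eq_zero hn D.isClosed D.nonempty h h0, mul_zero, abs_zero]

/-! ### A sum over the labels of a hexagon -/

section
variable {α : Type*} [Fintype α] [DecidableEq α]

/-- The sum of the weights of a triangle of crossings over the label `x` of the region in the middle, for
the labels `u₁`, `y₁`, `u₂`, `y₂`, `u₃`, `y₃` of the regions around it. -/
noncomputable def hexSum (z : ℝ) (u₁ y₁ u₂ y₂ u₃ y₃ : α) : ℝ :=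
  ∑ x, if x = u₁ ∨ x = u₂ ∨ x = u₃ then 0 else
    (z * (if x = y₁ then 1 else 0) + z⁻¹ * (if u₁ = u₂ then 1 else 0) - 1) *
    (z * (if u₂ = u₃ then 1 else 0) + z⁻¹ * (if x = y₂ then 1 else 0) - 1) *
    (z * (if x = y₃ then 1 else 0) + z⁻¹ * (if u₁ = u₃ then 1 else 0) - 1)

/-- Here k₁, k₂, k₃ are the parts of the weights that do not involve x. Expanding in the conditions
x = yᵢ leaves the number of x distinct from the uᵢ, counted by inclusion and exclusion, and
correction terms at the yᵢ. -/
theorem hexSum_eq (z : ℝ) (hz : z ≠ 0) {u₁ y₁ u₂ y₂ u₃ y₃ : α} (h1 : u₁ ≠ y₁) (h2 : y₁ ≠ u₂) (h3 : u₂ ≠ y₂)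
    (h4 : y₂ ≠ u₃) (h5 : u₃ ≠ y₃) (h6 : y₃ ≠ u₁) (k₁ k₂ k₃ : ℝ)
    (e₁ : k₁ = z⁻¹ * (if u₁ = u₂ then 1 else 0) - 1) (e₂ : k₂ = z * (if u₂ = u₃ then 1 else 0) - 1)
    (e₃ : k₃ = z⁻¹ * (if u₁ = u₃ then 1 else 0) - 1)  :
    hexSum z u₁ y₁ u₂ y₂ u₃ y₃ = k₁ * k₂ * k₃ * (Fintype.card α - 3 + (if u₁ = u₂ then 1 else 0) + (if u₂ = u₃ then 1 else 0) +
      (if u₁ = u₃ then 1 else 0) - (if u₁ = u₂ ∧ u₂ = u₃ then 1 else 0)) +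
     z * k₂ * k₃ * (if y₁ = u₃ then 0 else 1) + z⁻¹ * k₁ * k₃ * (if y₂ = u₁ then 0 else 1) +
     z * k₁ * k₂ * (if y₃ = u₂ then 0 else 1) + k₃ * (if y₁ = y₂ then 1 else 0) + z ^ 2 * k₂ * (if y₁ = y₃ then 1 else 0)
     + k₁ * (if y₂ = y₃ then 1 else 0) + z * (if y₁ = y₂ ∧ y₂ = y₃ then 1 else 0) := by
  have key : ∀ x, (if x = u₁ ∨ x = u₂ ∨ x = u₃ then 0 else
    (z * (if x = y₁ then 1 else 0) + z⁻¹ * (if u₁ = u₂ then 1 else 0) - 1) *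
    (z * (if u₂ = u₃ then 1 else 0) + z⁻¹ * (if x = y₂ then 1 else 0) - 1) *
    (z * (if x = y₃ then 1 else 0) + z⁻¹ * (if u₁ = u₃ then 1 else 0) - 1)) =
    k₁ * k₂ * k₃ * (1 - (if x = u₁ then 1 else 0) - (if x = u₂ then 1 else 0) - (if x = u₃ then 1 else 0)
      + (if x = u₁ then (if u₁ = u₂ then 1 else 0) else 0) + (if x = u₂ then (if u₂ = u₃ then 1 else 0) else 0) +
      (if x = u₁ then (if u₁ = u₃ then 1 else 0) else 0) - (if x = u₁ then (if u₁ = u₂ ∧ u₂ = u₃ then 1 else 0) else 0)) +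
     z * k₂ * k₃ * (if x = y₁ then (if y₁ = u₃ then 0 else 1) else 0) +
      z⁻¹ * k₁ * k₃ * (if x = y₂ then (if y₂ = u₁ then 0 else 1) else 0) +
     z * k₁ * k₂ * (if x = y₃ then (if y₃ = u₂ then 0 else 1) else 0) +
      k₃ * (if x = y₁ then (if y₁ = y₂ then 1 else 0) else 0) + z ^ 2 * k₂ * (if x = y₁ then (if y₁ = y₃ then 1 else 0) else 0)
     + k₁ * (if x = y₂ then (if y₂ = y₃ then 1 else 0) else 0) + z * (if x = y₁ then (if y₁ = y₂ ∧ y₂ = y₃ then 1 else 0) else 0) := by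
    intro x
    have hzz : z * z⁻¹ = 1 := mul_inv_cancel₀ hz
    by_cases a1 : x = u₁
    · clear e₁ e₂ e₃ hzz hz
      subst a1
      simp only [h1, h6.symm, true_or, if_true, if_false]
      split_ifs <;> first | ring1 | (exfalso; grind)
    by_cases a2 : x = u₂
    · clear e₁ e₂ e₃ hzz hz
      subst a2
      simp only [h3, h2.symm, true_or, or_true, if_true, if_false, a1]
      split_ifs <;> first | ring1 | (exfalso; grind)
    by_cases a3 : x = u₃
    · clear e₁ e₂ e₃ hzz hz
      subst a3
      simp only [h5, h4.symm, or_true, if_true, if_false, a1, a2]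
      split_ifs <;> first | ring1 | (exfalso; grind)
    simp only [a1, a2, a3, or_self, if_false]
    have a1' := Ne.symm a1
    have a2' := Ne.symm a2
    have a3' := Ne.symm a3
    by_cases b1 : x = y₁
    · subst b1
      by_cases b2 : x = y₂
      · subst b2
        by_cases b3 : x = y₃
        · subst b3; simp [*]; field_simp; ring
        · simp [*]; field_simp; ring
      · by_cases b3 : x = y₃
        · subst b3; simp [*]; field_simp; ring
        · simp [*]; field_simp; ring
    · by_cases b2 : x = y₂
      · subst b2
        by_cases b3 : x = y₃
        · subst b3; simp [*]; field_simp; ring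
        · simp [*]; field_simp; ring
      · by_cases b3 : x = y₃
        · subst b3; simp [*]; field_simp; ring
        · simp [*]
  rw [hexSum, Finset.sum_congr rfl fun x _ => key x]
  simp only [Finset.sum_add_distrib, Finset.sum_sub_distrib, ← Finset.mul_sum, Finset.sum_ite_eq',
    Finset.mem_univ, if_true, Finset.sum_const, Finset.card_univ, nsmul_eq_mul, mul_one]
  ring

/-- Both sides depend only on which of the six labels coincide. The Booleans record the
coincidences, and `h` excludes certain patterns violating transitivity or the inequality of adjacent
regions; the remaining patterns are checked one by one, with z + 1/z + 2 as the number of labels. -/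
theorem hex_identity (z : ℝ) (hz : z ≠ 0) (i j k o p q l m n : Bool)
    (h : (!(i && j && !k) && !(i && k && !j) && !(j && k && !i) && !(o && p && !q) && !(o && q && !p) &&
      !(p && q && !o) && !(i && m) && !(i && n) && !(j && n) && !(j && l) && !(k && l) && !(k && m) &&
      !(o && m) && !(o && l) && !(p && n) && !(p && l) && !(q && m) && !(q && n)) = true)
    (f : Bool → ℝ) (h0 : f false = 0) (h1 : f true = 1) :
    (z⁻¹ * f i - 1) * (z * f j - 1) * (z⁻¹ * f k - 1) *
      (z + z⁻¹ + 2 - 3 + f i + f j + f k - f (i && j)) +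
      z * (z * f j - 1) * (z⁻¹ * f k - 1) * f (!l) + z⁻¹ * (z⁻¹ * f i - 1) * (z⁻¹ * f k - 1) * f (!m) +
      z * (z⁻¹ * f i - 1) * (z * f j - 1) * f (!n) + (z⁻¹ * f k - 1) * f o +
      z ^ 2 * (z * f j - 1) * f p + (z⁻¹ * f i - 1) * f q + z * f (o && q) =
    (z⁻¹ * f o - 1) * (z * f p - 1) * (z⁻¹ * f q - 1) *
      (z + z⁻¹ + 2 - 3 + f o + f p + f q - f (o && p)) +
      z * (z * f p - 1) * (z⁻¹ * f q - 1) * f (!n) + z⁻¹ * (z⁻¹ * f o - 1) * (z⁻¹ * f q - 1) * f (!m) +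
      z * (z⁻¹ * f o - 1) * (z * f p - 1) * f (!l) + (z⁻¹ * f q - 1) * f i +
      z ^ 2 * (z * f p - 1) * f j + (z⁻¹ * f o - 1) * f k + z * f (i && k) := by
  have hzz : z * z⁻¹ = 1 := mul_inv_cancel₀ hz
  revert hzz
  generalize z⁻¹ = y
  intro hzz
  cases i <;> cases j <;> cases k <;> (try (exfalso; simp at h; done)) <;>
  cases o <;> cases p <;> cases q <;> (try (exfalso; simp at h; done)) <;>
  cases l <;> cases m <;> cases n <;> first
    | (exfalso; simp at h; done)
    | (simp only [Bool.and_true, Bool.and_false, Bool.not_true,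
        Bool.not_false, h0, h1] <;> grind)

/-- The third Reidemeister move in terms of region labels: the triangle shares edges with the
regions u before the move and with the regions y after it. The six inequalities say that the strands
between neighbouring outer regions carry nonzero labels. -/
theorem hexSum_flip (z : ℝ) (hz : z ≠ 0) (hc : (Fintype.card α : ℝ) = z + z⁻¹ + 2)
    {u₁ y₁ u₂ y₂ u₃ y₃ : α} (h1 : u₁ ≠ y₁) (h2 : y₁ ≠ u₂) (h3 : u₂ ≠ y₂)
    (h4 : y₂ ≠ u₃) (h5 : u₃ ≠ y₃) (h6 : y₃ ≠ u₁) :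
    hexSum z u₁ y₁ u₂ y₂ u₃ y₃ = hexSum z y₂ u₂ y₁ u₁ y₃ u₃ := by
  rw [hexSum_eq z hz h1 h2 h3 h4 h5 h6 _ _ _ rfl rfl rfl,
    hexSum_eq z hz h3.symm h2.symm h1.symm h6.symm h5.symm h4.symm _ _ _ rfl rfl rfl, hc]
  have e := hex_identity z hz (decide (u₁ = u₂)) (decide (u₂ = u₃)) (decide (u₁ = u₃))
    (decide (y₁ = y₂)) (decide (y₁ = y₃)) (decide (y₂ = y₃)) (decide (y₁ = u₃)) (decide (y₂ = u₁))
    (decide (y₃ = u₂)) (by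
      simp only [Bool.and_eq_true, Bool.not_eq_true', Bool.and_eq_false_iff, decide_eq_true_eq, decide_eq_false_iff_not, Bool.not_eq_false']
      clear hz hc
      refine ⟨⟨⟨⟨⟨⟨⟨⟨⟨⟨⟨⟨⟨⟨⟨⟨⟨?_, ?_⟩, ?_⟩, ?_⟩, ?_⟩, ?_⟩, ?_⟩, ?_⟩, ?_⟩, ?_⟩, ?_⟩, ?_⟩, ?_⟩, ?_⟩, ?_⟩, ?_⟩, ?_⟩, ?_⟩ <;> grind) (fun b => if b = true then 1 else 0) rfl rfl
  simp only [Bool.and_eq_true, Bool.not_eq_true', decide_eq_true_eq, decide_eq_false_iff_not, ite_not] at e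
  simp only [eq_comm (a := y₂) (b := y₁), eq_comm (a := u₃) (b := y₁), eq_comm (a := u₂) (b := y₃),
    eq_comm (a := u₁) (b := y₂), eq_comm (a := u₂) (b := u₁)]
  convert e using 2
end

/-! ### A state sum -/

section StateSum

variable {Γ : Type*} [CommRing Γ] [Fintype Γ] [DecidableEq Γ]

/-- The weight of a crossing with the labels `a`, `b` at the bottom legs and the label `x` at the top
left leg. -/
noncomputable def crossWeight (z : ℝ) (a b x : Γ) : ℝ :=
  z * (if x = a then 1 else 0) + z⁻¹ * (if a = b then 1 else 0) - 1

/-- The operator on functions of the labels of the strands which belongs to a piece. -/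
noncomputable def pieceOp (z : ℝ) : Piece → (List Γ → ℝ) → List Γ → ℝ
  | .cup _, φ, u => ∑ a : Γ, if a = 0 then 0 else φ (a :: a :: u)
  | .cap _, φ, a :: b :: u => if a = b then φ u else 0
  | .cross o _ _, φ, a :: b :: u => ∑ x : Γ, if x = 0 ∨ x = a + b then 0 else
      crossWeight (if o = true then z else z⁻¹) a b x * φ (x :: (a + b + x) :: u)
  | _, _, _ => 0

/-- The operator which belongs to a piece with `n` strands to its left. -/
noncomputable def opAt (z : ℝ) (n : ℕ) (p : Piece) (φ : List Γ → ℝ) (u : List Γ) : ℝ :=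
  pieceOp z p (fun w => φ (u.take n ++ w)) (u.drop n)

/-- The operator which belongs to a word. -/
noncomputable def wordOp (z : ℝ) : Word → (List Γ → ℝ) → List Γ → ℝ
  | [], φ => φ
  | s :: W, φ => opAt z s.left.length s.piece (wordOp z W φ)

/-- The list `u` consists of `n` nonzero labels. -/
def Good (n : ℕ) (u : List Γ) : Prop := u.length = n ∧ ∀ a ∈ u, a ≠ 0

theorem opAt_one (z : ℝ) (p : Piece) (φ : List Γ → ℝ) (x : Γ) (u : List Γ) :
    opAt z 1 p φ (x :: u) = pieceOp z p (fun w => φ (x :: w)) u := rfl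

theorem opAt_append (z : ℝ) {n : ℕ} (k : ℕ) (p : Piece) (φ : List Γ → ℝ) {u₁ : List Γ}
    (h : u₁.length = n) (u₂ : List Γ) :
    opAt z (n + k) p φ (u₁ ++ u₂) = opAt z k p (fun w => φ (u₁ ++ w)) u₂ := by
  subst h
  simp [opAt, List.take_append, List.drop_append, List.take_of_length_le, List.drop_of_length_le]

theorem opAt_append_zero (z : ℝ) {n : ℕ} (p : Piece) (φ : List Γ → ℝ) {u₁ : List Γ}
    (h : u₁.length = n) (u₂ : List Γ) :
    opAt z n p φ (u₁ ++ u₂) = pieceOp z p (fun w => φ (u₁ ++ w)) u₂ := opAt_append z 0 p φ h u₂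

theorem wordOp_append (z : ℝ) (V W : Word) (φ : List Γ → ℝ) :
    wordOp z (V ++ W) φ = wordOp z V (wordOp z W φ) := by
  induction V with
  | nil => rfl
  | cons s V ih => simp only [List.cons_append, wordOp, ih]

variable [CharP Γ 2]

/-- The operator of a piece is given by a kernel. -/
theorem exists_kernel (z : ℝ) (p : Piece) {v : List Γ} (hv : v.length = p.source.length) :
    ∃ (F : Γ → ℝ) (τ : Γ → List Γ), (∀ x, (τ x).length = p.target.length) ∧
      (∀ x, F x ≠ 0 → ∀ a ∈ τ x, a ≠ 0) ∧
      ∀ φ u, pieceOp z p φ (v ++ u) = ∑ x, F x * φ (τ x ++ u) := by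
  cases p with
  | cup b =>
    obtain rfl : v = [] := List.length_eq_zero_iff.1 hv
    refine ⟨fun a => if a = 0 then 0 else 1, fun a => [a, a], fun _ => rfl, fun x => by simp, fun φ u => ?_⟩
    simp [pieceOp]
  | cap b =>
    obtain ⟨a, c, rfl⟩ := List.length_eq_two.1 hv
    refine ⟨fun x => if x = 0 then (if a = c then 1 else 0) else 0, fun x => [], fun _ => rfl,
      fun x => by simp, fun φ u => ?_⟩
    simp [pieceOp]
  | cross o b b' =>
    obtain ⟨a, c, rfl⟩ := List.length_eq_two.1 hv
    refine ⟨fun x => if x = 0 ∨ x = a + c then 0 else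
      crossWeight (if o = true then z else z⁻¹) a c x, fun x => [x, a + c + x], fun _ => rfl,
      fun x => ?_, fun φ u => ?_⟩
    · simp only [List.mem_cons, List.not_mem_nil, or_false]
      split_ifs <;> grind
    · simp [pieceOp, ite_mul]

theorem exists_kernel_of_good (z : ℝ) (s : Slice) {u : List Γ} (hu : Good s.source.length u) :
    ∃ (F : Γ → ℝ) (τ : Γ → List Γ), (∀ x, F x ≠ 0 → Good s.target.length (τ x)) ∧
      ∀ φ, opAt z s.left.length s.piece φ u = ∑ x, F x * φ (τ x) := by
  obtain ⟨hl, hu⟩ := hu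
  rw [s.length_source] at hl
  obtain ⟨u₁, v, h1, rfl⟩ : ∃ u₁ v, u₁.length = s.left.length ∧ u = u₁ ++ v :=
    ⟨u.take s.left.length, u.drop s.left.length, by simp; omega, by simp⟩
  obtain ⟨v, u₂, h2, rfl⟩ : ∃ v' u₂, v'.length = s.piece.source.length ∧ v = v' ++ u₂ :=
    ⟨v.take s.piece.source.length, v.drop s.piece.source.length, by
      simp at hl ⊢; omega, by simp⟩
  obtain ⟨F, τ, hτ, hF, h⟩ := exists_kernel z s.piece h2
  refine ⟨F, fun x => u₁ ++ (τ x ++ u₂), fun x hx => ⟨?_, fun a ha => ?_⟩, fun φ => ?_⟩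
  · rw [s.length_target]
    simp only [List.length_append, hτ] at hl ⊢
    omega
  · simp only [List.mem_append] at ha hu
    have := hF x hx a
    have := hu a
    tauto
  · rw [opAt_append_zero z _ _ h1, h]

/-- Operators only evaluate functions at lists of nonzero labels, so an identity for such lists can
be transported through the slices below a move. -/
theorem wordOp_smul (z : ℝ) {x y : List Bool} {W : Word} (h : IsTangle x W y) (t : ℝ) {φ ψ : List Γ → ℝ}
    (hφ : ∀ u, Good y.length u → φ u = t * ψ u) {u : List Γ} (hu : Good x.length u) :
    wordOp z W φ u = t * wordOp z W ψ u := by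
  induction W generalizing x u with
  | nil => obtain rfl : x = y := h; exact hφ u hu
  | cons s W ih =>
    obtain ⟨rfl, h⟩ := h
    obtain ⟨F, τ, hF, h'⟩ := exists_kernel_of_good z s hu
    simp only [wordOp, h', Finset.mul_sum]
    refine Finset.sum_congr rfl fun a _ => ?_
    by_cases ha : F a = 0
    · simp [ha]
    · rw [ih h (hF a ha)]; ring

/-! ### Invariance under the elementary moves -/

/-- The second Reidemeister move, x being the label of one edge of the bigon. The excluded values
are those giving an edge of the bigon label zero, and the prescribed cardinality makes all terms
except the identity cancel. -/
theorem sum_two (z : ℝ) (hz : z ≠ 0) (hc : (Fintype.card Γ : ℝ) = z + z⁻¹ + 2) {a b y : Γ}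
    (ha : a ≠ 0) (hb : b ≠ 0) (hy : y ≠ 0) (hab : y ≠ a + b) :
    ∑ x : Γ, (if x = 0 ∨ x = a + b then 0 else crossWeight z a b x *
      crossWeight z⁻¹ x (a + b + x) y) = if y = a then 1 else 0 := by
  have h1 : a ≠ a + b := by simpa using hb
  have key : ∀ x : Γ, (if x = 0 ∨ x = a + b then 0 else crossWeight z a b x *
      crossWeight z⁻¹ x (a + b + x) y) =
      (z⁻¹ * (if a = b then 1 else 0) - 1) * (z * (if a = b then 1 else 0) - 1) * (1 - (if x = 0 then 1 else 0) -
        (if x = a + b then 1 else 0) + (if x = 0 then (if a = b then 1 else 0) else 0))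
      + (if x = a then z * (z * (if a = b then 1 else 0) - 1) else 0)
      + (if x = y then z⁻¹ * (z⁻¹ * (if a = b then 1 else 0) - 1) else 0) +
      (if x = a then (if y = a then 1 else 0) else 0) := by
    intro x
    have e1 : (x = a + b + x) = (a = b) := by apply propext; grind
    have e2 : (0 = a + b) = (a = b) := by apply propext; grind
    simp only [crossWeight, e1, inv_inv]
    by_cases x0 : x = 0
    · subst x0
      simp only [e2, true_or, if_true, ha.symm, hy.symm, if_false]; ring
    by_cases x1 : x = a + b
    · subst x1
      have e3 : a ≠ b := by grind
      simp only [h1.symm, hab.symm, x0, or_true, if_true, if_false]; ring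
    simp only [x0, x1, or_self, if_false]
    by_cases xa : x = a
    · subst xa
      by_cases xy : x = y
      · subst xy; simp; field_simp; ring
      · simp [xy, Ne.symm xy]; field_simp; ring
    · by_cases xy : x = y
      · subst xy; simp [xa]; field_simp; ring
      · simp [xa, xy, Ne.symm xy]
  rw [Finset.sum_congr rfl fun x _ => key x]
  simp only [Finset.sum_add_distrib, Finset.sum_sub_distrib, ← Finset.mul_sum, Finset.sum_ite_eq',
    Finset.mem_univ, if_true, Finset.sum_const, Finset.card_univ, nsmul_eq_mul, mul_one, hc]
  split_ifs <;> field_simp <;> ring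

-- The first Reidemeister move. A kink contributes the square of 1/z, which the writhe later
-- compensates.
omit [CharP Γ 2] in
theorem sum_twist (z : ℝ) (hz : z ≠ 0) (hc : (Fintype.card Γ : ℝ) = z + z⁻¹ + 2) {x : Γ}
    (hx : x ≠ 0) : ∑ a : Γ, (if a = 0 then 0 else crossWeight z a a x) = z⁻¹ ^ 2 ∧
      ∑ a : Γ, (if a = 0 then 0 else crossWeight z x x a) = z⁻¹ ^ 2 := by
  have key : ∀ a : Γ, (if a = 0 then 0 else crossWeight z a a x) = (z⁻¹ - 1) * (1 - (if a = 0 then 1 else 0)) +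
      (if a = x then z else 0) := by
    intro a
    by_cases a0 : a = 0
    · subst a0; simp [hx.symm]
    · by_cases ax : a = x
      · subst ax; simp [a0, crossWeight]; ring
      · simp [a0, crossWeight, ax, Ne.symm ax]
  have key' : ∀ a : Γ, (if a = 0 then 0 else crossWeight z x x a) = (if a = 0 then 0 else crossWeight z a a x) := by
    intro a; simp [crossWeight, eq_comm]
  rw [Finset.sum_congr rfl fun a _ => key' a, Finset.sum_congr rfl fun a _ => key a]
  simp only [Finset.sum_add_distrib, Finset.sum_sub_distrib, ← Finset.mul_sum, Finset.sum_ite_eq',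
    Finset.mem_univ, if_true, Finset.sum_const, Finset.card_univ, nsmul_eq_mul, mul_one, hc]
  have : z⁻¹ ^ 2 = (z⁻¹ - 1) * (z + z⁻¹ + 2 - 1) + z := by field_simp; ring
  exact ⟨this.symm, this.symm⟩

end StateSum

/-! ### The third Reidemeister move -/

section Braid

variable {Γ : Type*} [CommRing Γ] [Fintype Γ] [DecidableEq Γ]

/-- Restriction to triples of nonzero labels. -/
def nonzero₃ (f : Γ → Γ → Γ → ℝ) (a b c : Γ) : ℝ := if a = 0 ∨ b = 0 ∨ c = 0 then 0 else f a b c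

/-- A crossing of the first two of three strands. -/
noncomputable def twist₁ (z : ℝ) (f : Γ → Γ → Γ → ℝ) : Γ → Γ → Γ → ℝ :=
  nonzero₃ fun a b c => ∑ x, if x = 0 ∨ x = a + b then 0 else crossWeight z a b x * f x (a + b + x) c

/-- A crossing of the last two of three strands. -/
noncomputable def twist₂ (z : ℝ) (f : Γ → Γ → Γ → ℝ) : Γ → Γ → Γ → ℝ :=
  nonzero₃ fun a b c => ∑ x, if x = 0 ∨ x = b + c then 0 else crossWeight z b c x * f a x (b + c + x)

omit [Fintype Γ] in
theorem nonzero₃_nonzero₃ (f : Γ → Γ → Γ → ℝ) : nonzero₃ (nonzero₃ f) = nonzero₃ f := by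
  funext a b c; simp only [nonzero₃]; split_ifs <;> rfl

variable [CharP Γ 2]

theorem twist₁_nonzero₃ (z : ℝ) (f : Γ → Γ → Γ → ℝ) : twist₁ z (nonzero₃ f) = twist₁ z f := by
  funext a b c
  simp only [twist₁, nonzero₃]
  split_ifs with h
  · rfl
  · refine Finset.sum_congr rfl fun x _ => ?_
    have : ∀ h' : ¬(x = 0 ∨ x = a + b), ¬(x = 0 ∨ a + b + x = 0 ∨ c = 0) := by grind
    split_ifs with h' <;> simp_all

theorem twist₂_nonzero₃ (z : ℝ) (f : Γ → Γ → Γ → ℝ) : twist₂ z (nonzero₃ f) = twist₂ z f := by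
  funext a b c
  simp only [twist₂, nonzero₃]
  split_ifs with h
  · rfl
  · refine Finset.sum_congr rfl fun x _ => ?_
    have : ∀ h' : ¬(x = 0 ∨ x = b + c), ¬(a = 0 ∨ x = 0 ∨ b + c + x = 0) := by grind
    split_ifs with h' <;> simp_all

/-- Two opposite crossings cancel. -/
theorem sum_sum_two (z : ℝ) (hz : z ≠ 0) (hc : (Fintype.card Γ : ℝ) = z + z⁻¹ + 2) {a b : Γ}
    (ha : a ≠ 0) (hb : b ≠ 0) (g : Γ → Γ → ℝ) :
    ∑ x : Γ, (if x = 0 ∨ x = a + b then 0 else crossWeight z a b x *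
      ∑ y : Γ, if y = 0 ∨ y = x + (a + b + x) then 0 else crossWeight z⁻¹ x (a + b + x) y *
        g y (x + (a + b + x) + y)) = g a b := by
  have e : ∀ x, x + (a + b + x) = a + b := by intro x; grind
  have h : ∀ y : Γ, ∑ x : Γ, (if x = 0 ∨ x = a + b then 0 else crossWeight z a b x *
      (if y = 0 ∨ y = a + b then 0 else crossWeight z⁻¹ x (a + b + x) y * g y (a + b + y))) =
      if y = a then g a b else 0 := by
    intro y
    by_cases hy : y = 0 ∨ y = a + b
    · have : y ≠ a := by grind
      simp [hy, this]
    · have e' : g y (a + b + y) * (if y = a then 1 else 0) = if y = a then g a b else 0 := by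
        split_ifs with h
        · subst h
          rw [mul_one]; congr 1; grind
        · simp
      simp only [if_neg hy]
      rw [← e']
      push Not at hy
      rw [← sum_two z hz hc ha hb hy.1 hy.2, Finset.mul_sum]
      refine Finset.sum_congr rfl fun x _ => ?_
      split_ifs
      · simp
      · ring
  have h' : ∀ x : Γ, (if x = 0 ∨ x = a + b then 0 else crossWeight z a b x *
      ∑ y : Γ, if y = 0 ∨ y = a + b then 0 else crossWeight z⁻¹ x (a + b + x) y * g y (a + b + y)) =
      ∑ y : Γ, (if x = 0 ∨ x = a + b then 0 else crossWeight z a b x *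
      (if y = 0 ∨ y = a + b then 0 else crossWeight z⁻¹ x (a + b + x) y * g y (a + b + y))) := by
    intro x
    split_ifs
    · simp
    · rw [Finset.mul_sum]
  simp only [e]
  rw [Finset.sum_congr rfl fun x _ => h' x, Finset.sum_comm, Finset.sum_congr rfl fun y _ => h y]
  simp

theorem twist₁_twist₁ (z : ℝ) (hz : z ≠ 0) (hc : (Fintype.card Γ : ℝ) = z + z⁻¹ + 2)
    (f : Γ → Γ → Γ → ℝ) : twist₁ z (twist₁ z⁻¹ f) = nonzero₃ f := by
  conv_lhs => rw [twist₁.eq_def z⁻¹, twist₁_nonzero₃]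
  funext a b c
  simp only [twist₁, nonzero₃]
  split_ifs with h
  · rfl
  · push Not at h
    exact sum_sum_two z hz hc h.1 h.2.1 fun x y => f x y c

theorem twist₂_twist₂ (z : ℝ) (hz : z ≠ 0) (hc : (Fintype.card Γ : ℝ) = z + z⁻¹ + 2)
    (f : Γ → Γ → Γ → ℝ) : twist₂ z (twist₂ z⁻¹ f) = nonzero₃ f := by
  conv_lhs => rw [twist₂.eq_def z⁻¹, twist₂_nonzero₃]
  funext a b c
  simp only [twist₂, nonzero₃]
  split_ifs with h
  · rfl
  · push Not at h
    exact sum_sum_two z hz hc h.2.1 h.2.2 fun x y => f a x y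

omit [DecidableEq Γ] [CharP Γ 2] in
theorem sum_add_left (k : Γ) (g : Γ → ℝ) : ∑ x, g x = ∑ x, g (k + x) :=
  (Equiv.sum_comp (Equiv.addLeft k) g).symm

/-- Passes from strand labels to region labels. With label 0 at the far left, the outer regions are
the partial sums a, a + b, a + b + c at the bottom and t, t + s at the top; the remaining sum runs
over the label of the triangle. -/
theorem braid_left (z : ℝ) (f : Γ → Γ → Γ → ℝ) {a b c : Γ} (ha : a ≠ 0) (hb : b ≠ 0) (hc : c ≠ 0) :
    twist₁ z (twist₂ z (twist₁ z f)) a b c = ∑ t : Γ, ∑ s : Γ,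
      if t = 0 ∨ s = 0 ∨ a + b + c + t + s = 0 then 0 else
        hexSum z 0 a (a + b) (a + b + c) (t + s) t * f t s (a + b + c + t + s) := by
  have e : twist₁ z (twist₂ z (twist₁ z f)) a b c = ∑ x : Γ, ∑ y : Γ, ∑ t : Γ,
    if x = 0 ∨ x = a + b ∨ y = 0 ∨ y = a + b + x + c ∨ t = 0 ∨ t = x + y then 0 else
      crossWeight z a b x * crossWeight z (a + b + x) c y * crossWeight z x y t *
        f t (x + y + t) (a + b + x + c + y) := by
    conv_lhs => rw [twist₁.eq_def z f, twist₂_nonzero₃, twist₂.eq_def z, twist₁_nonzero₃]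
    simp only [twist₁, nonzero₃]
    rw [if_neg (by grind)]
    refine Finset.sum_congr rfl fun x _ => ?_
    by_cases h : x = 0 ∨ x = a + b
    · rw [if_pos h]
      symm
      refine Finset.sum_eq_zero fun y _ => Finset.sum_eq_zero fun t _ => if_pos (by tauto)
    · rw [if_neg h, Finset.mul_sum]
      refine Finset.sum_congr rfl fun y _ => ?_
      by_cases h' : y = 0 ∨ y = a + b + x + c
      · rw [if_pos h', mul_zero]
        symm
        refine Finset.sum_eq_zero fun t _ => if_pos (by tauto)
      · rw [if_neg h', Finset.mul_sum, Finset.mul_sum]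
        refine Finset.sum_congr rfl fun t _ => ?_
        by_cases h'' : t = 0 ∨ t = x + y
        · rw [if_pos h'', if_pos (by tauto), mul_zero, mul_zero]
        · rw [if_neg h'', if_neg (by tauto)]; ring
  rw [e, Finset.sum_congr rfl fun x _ => Finset.sum_comm, Finset.sum_comm]
  refine Finset.sum_congr rfl fun t _ => ?_
  -- This substitution makes s the label of the middle strand at the top.
  rw [Finset.sum_congr rfl fun x _ => sum_add_left (x + t) _, Finset.sum_comm]
  refine Finset.sum_congr rfl fun s _ => ?_
  by_cases h : t = 0 ∨ s = 0 ∨ a + b + c + t + s = 0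
  · rw [if_pos h]
    refine Finset.sum_eq_zero fun x _ => if_pos ?_
    rcases h with h | h | h
    · tauto
    · have : t = x + (x + t + s) := by grind
      tauto
    · have : x + t + s = a + b + x + c := by grind
      tauto
  · rw [if_neg h, hexSum, Finset.sum_mul]
    refine Finset.sum_congr rfl fun x _ => ?_
    by_cases hx : x = 0 ∨ x = a + b ∨ x = t + s
    · rw [if_pos hx, zero_mul, if_pos]
      rcases hx with hx | hx | hx
      · tauto
      · tauto
      · have : x + t + s = 0 := by grind
        tauto
    · rw [if_neg hx, if_neg (by grind)]
      have e1 : (a = b) = (0 = a + b) := by apply propext; grind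
      have e2 : (x + t + s = a + b + x) = (a + b = t + s) := by apply propext; grind
      have e3 : (a + b + x = c) = (x = a + b + c) := by apply propext; grind
      have e4 : (x = x + t + s) = (0 = t + s) := by apply propext; grind
      have e5 : x + (x + t + s) + t = s := by grind
      have e6 : a + b + x + c + (x + t + s) = a + b + c + t + s := by grind
      simp only [crossWeight, e1, e2, e3, e4, e5, e6, eq_comm (a := t) (b := x)]

theorem braid_right (z : ℝ) (f : Γ → Γ → Γ → ℝ) {a b c : Γ} (ha : a ≠ 0) (hb : b ≠ 0) (hc : c ≠ 0) :
    twist₂ z (twist₁ z (twist₂ z f)) a b c = ∑ t : Γ, ∑ s : Γ,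
      if t = 0 ∨ s = 0 ∨ a + b + c + t + s = 0 then 0 else
        hexSum z (a + b + c) (a + b) a 0 t (t + s) * f t s (a + b + c + t + s) := by
  have e : twist₂ z (twist₁ z (twist₂ z f)) a b c = ∑ x : Γ, ∑ t : Γ, ∑ s : Γ,
    if x = 0 ∨ x = b + c ∨ t = 0 ∨ t = a + x ∨ s = 0 ∨ s = a + x + t + (b + c + x) then 0 else
      crossWeight z b c x * crossWeight z a x t * crossWeight z (a + x + t) (b + c + x) s *
        f t s (a + x + t + (b + c + x) + s) := by
    conv_lhs => rw [twist₂.eq_def z f, twist₁_nonzero₃, twist₁.eq_def z, twist₂_nonzero₃]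
    simp only [twist₂, nonzero₃]
    rw [if_neg (by grind)]
    refine Finset.sum_congr rfl fun x _ => ?_
    by_cases h : x = 0 ∨ x = b + c
    · rw [if_pos h]
      symm
      refine Finset.sum_eq_zero fun y _ => Finset.sum_eq_zero fun t _ => if_pos (by tauto)
    · rw [if_neg h, Finset.mul_sum]
      refine Finset.sum_congr rfl fun y _ => ?_
      by_cases h' : y = 0 ∨ y = a + x
      · rw [if_pos h', mul_zero]
        symm
        refine Finset.sum_eq_zero fun t _ => if_pos (by tauto)
      · rw [if_neg h', Finset.mul_sum, Finset.mul_sum]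
        refine Finset.sum_congr rfl fun t _ => ?_
        by_cases h'' : t = 0 ∨ t = a + x + y + (b + c + x)
        · rw [if_pos h'', if_pos (by tauto), mul_zero, mul_zero]
        · rw [if_neg h'', if_neg (by tauto)]; ring
  rw [e, Finset.sum_comm]
  refine Finset.sum_congr rfl fun t _ => ?_
  rw [Finset.sum_comm]
  refine Finset.sum_congr rfl fun s _ => ?_
  -- The shift by a turns the strand label into the label of the triangle.
  rw [sum_add_left a]
  by_cases h : t = 0 ∨ s = 0 ∨ a + b + c + t + s = 0
  · rw [if_pos h]
    refine Finset.sum_eq_zero fun x _ => if_pos ?_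
    rcases h with h | h | h
    · tauto
    · tauto
    · have : s = a + (a + x) + t + (b + c + (a + x)) := by grind
      tauto
  · rw [if_neg h, hexSum, Finset.sum_mul]
    refine Finset.sum_congr rfl fun x _ => ?_
    by_cases hx : x = a + b + c ∨ x = a ∨ x = t
    · rw [if_pos hx, zero_mul, if_pos]
      rcases hx with hx | hx | hx
      · have : a + x = b + c := by grind
        tauto
      · have : a + x = 0 := by grind
        tauto
      · have : t = a + (a + x) := by grind
        tauto
    · rw [if_neg hx, if_neg (by grind)]
      have e1 : (b = c) = (a + b + c = a) := by apply propext; grind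
      have e2 : (a + x = b) = (x = a + b) := by apply propext; clear e; grind
      have e3 : (t = a) = (a = t) := propext eq_comm
      have e4 : (a = a + x) = (x = 0) := by apply propext; grind
      have e5 : (s = a + (a + x) + t) = (x = t + s) := by apply propext; grind
      have e6 : (a + (a + x) + t = b + c + (a + x)) = (a + b + c = t) := by apply propext; grind
      have e7 : a + (a + x) + t + (b + c + (a + x)) + s = a + b + c + t + s := by grind
      simp only [crossWeight, e1, e2, e3, e4, e5, e6, e7]

theorem braid (z : ℝ) (hz : z ≠ 0) (hc : (Fintype.card Γ : ℝ) = z + z⁻¹ + 2) (f : Γ → Γ → Γ → ℝ) :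
    twist₁ z (twist₂ z (twist₁ z f)) = twist₂ z (twist₁ z (twist₂ z f)) := by
  funext a b c
  by_cases h : a = 0 ∨ b = 0 ∨ c = 0
  · exact (if_pos h).trans (if_pos h).symm
  · push Not at h
    rw [braid_left z f h.1 h.2.1 h.2.2, braid_right z f h.1 h.2.1 h.2.2]
    refine Finset.sum_congr rfl fun t _ => Finset.sum_congr rfl fun s _ => ?_
    split_ifs with hts
    · rfl
    · rw [hexSum_flip z hz hc] <;> grind

/-- The third Reidemeister move in a monoid. -/
theorem braid_mixed {α : Type*} {e : α → α} {s₁ s₂ : Bool → α → α} (h1 : ∀ o f, s₁ o (e f) = s₁ o f)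
    (h2 : ∀ o f, s₂ o (e f) = s₂ o f) (h3 : ∀ o f, e (s₁ o f) = s₁ o f) (h4 : ∀ o f, e (s₂ o f) = s₂ o f)
    (h5 : ∀ o f, s₁ o (s₁ (!o) f) = e f) (h6 : ∀ o f, s₂ o (s₂ (!o) f) = e f)
    (h7 : ∀ o f, s₁ o (s₂ o (s₁ o f)) = s₂ o (s₁ o (s₂ o f))) (p q r : Bool) (h : p = r → q = p) (f : α) :
    s₁ p (s₂ q (s₁ r f)) = s₂ r (s₁ q (s₂ p f)) := by
  by_cases hpr : p = r
  · subst hpr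
    rw [h rfl, h7]
  · obtain rfl : r = !p := by revert hpr; cases p <;> cases r <;> simp
    -- The mixed cases follow from the relation with equal signs by cancelling a crossing against
    -- its inverse at one end. The cyclic case, with p = r different from q, is excluded by `h`.
    by_cases hqp : q = p
    · subst hqp
      have := h7 q (s₁ (!q) f)
      rw [h5, h2] at this
      have h' := congrArg (s₂ (!q)) this
      have h6' := h6 (!q)
      rw [Bool.not_not] at h6'
      rw [h6', h3] at h'
      exact h'.symm ▸ rfl
    · obtain rfl : q = !p := by revert hqp; cases p <;> cases q <;> simp
      have := h7 (!p) (s₂ p f)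
      have h6' := h6 (!p)
      rw [Bool.not_not] at h6'
      rw [h6', h1] at this
      have h' := congrArg (s₁ p) this
      rw [h5, h4] at h'
      exact h'.symm

end Braid

/-! ### The writhe, and the operators of the elementary moves. -/

theorem c_eq_countP (W : Word) : c W = W.countP fun s => s.piece.isCrossing := by
  induction W using List.reverseRecOn with
  | nil => rfl
  | append_singleton W s ih =>
    have h : crossings (W ++ [s]) = if s.piece.isCrossing = true then insert W.length (crossings W)
        else crossings W := by
      ext k
      have e : ∀ k, k < W.length → (W ++ [s])[k]? = W[k]? := fun k hk => List.getElem?_append_left hk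
      by_cases hk : k = W.length
      · subst hk
        split_ifs with h <;> simp [crossings, h]
      · have : k < W.length + 1 ↔ k < W.length := by omega
        split_ifs with h <;> simp only [crossings, Finset.mem_filter, Finset.mem_range, List.length_append,
          List.length_singleton, this, Finset.mem_insert, hk, false_or] <;>
        exact and_congr_right fun h' => by rw [e k h']
    rw [List.countP_append, ← ih, c, h]
    split_ifs with h
    · rw [Finset.card_insert_of_notMem (by simp [crossings]), c]; simp [h]
    · simp [h, c]

theorem writhe_append (V W : Word) : writhe (V ++ W) = writhe V + writhe W := by
  simp only [writhe, c_eq_countP, cNeg, List.countP_append]; push_cast; ring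

section StateSum

variable {Γ : Type*} [CommRing Γ] [Fintype Γ] [DecidableEq Γ] [CharP Γ 2]

omit [CommRing Γ] [Fintype Γ] [DecidableEq Γ] [CharP Γ 2] in
theorem exists_split {n : ℕ} (k : ℕ) {l : List Γ} (h : l.length = n + k) :
    ∃ u v, u.length = n ∧ v.length = k ∧ l = u ++ v :=
  ⟨l.take n, l.drop n, by simp; omega, by simp; omega, by simp⟩

/-- The two kernels act on disjoint parts of the list, so the sums can be interchanged. -/
theorem op_exchange (z : ℝ) {l m r : List Bool} (g h : Piece) (φ : List Γ → ℝ) {u : List Γ}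
    (hu : u.length = l.length + (g.source.length + (m.length + (h.source.length + r.length)))) :
    opAt z l.length g (opAt z (l.length + (g.target.length + m.length)) h φ) u =
      opAt z (l.length + (g.source.length + m.length)) h (opAt z l.length g φ) u := by
  obtain ⟨u₁, w₁, h1, k1, rfl⟩ := exists_split _ hu
  obtain ⟨v₁, w₂, h2, k2, rfl⟩ := exists_split _ k1
  obtain ⟨u₂, w₃, h3, k3, rfl⟩ := exists_split _ k2
  obtain ⟨v₂, u₃, h4, -, rfl⟩ := exists_split _ k3
  obtain ⟨F, τ, hτ, -, hF⟩ := exists_kernel z g h2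
  obtain ⟨F', τ', -, -, hF'⟩ := exists_kernel z h h4
  rw [opAt_append_zero z _ _ h1, hF, opAt_append z _ _ _ h1,
    ← List.append_assoc v₁ u₂, opAt_append_zero z _ _ (by simp [h2, h3]), hF']
  have e1 : ∀ x, opAt z (l.length + (g.target.length + m.length)) h φ (u₁ ++ (τ x ++ (u₂ ++ (v₂ ++ u₃)))) =
      ∑ y, F' y * φ (u₁ ++ (τ x ++ (u₂ ++ (τ' y ++ u₃)))) := by
    intro x
    rw [opAt_append z _ _ _ h1, ← List.append_assoc, opAt_append_zero z _ _ (by simp [hτ, h3]), hF']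
    simp
  have e2 : ∀ y, opAt z l.length g φ (u₁ ++ (v₁ ++ u₂ ++ (τ' y ++ u₃))) =
      ∑ x, F x * φ (u₁ ++ (τ x ++ (u₂ ++ (τ' y ++ u₃)))) := by
    intro y
    rw [opAt_append_zero z _ _ h1, List.append_assoc, hF]
  simp only [e1, e2, Finset.mul_sum]
  rw [Finset.sum_comm]
  refine Finset.sum_congr rfl fun y _ => Finset.sum_congr rfl fun x _ => by ring

omit [CharP Γ 2] in
theorem pieceOp_cup (z : ℝ) (b : Bool) (φ : List Γ → ℝ) (u : List Γ) :
    pieceOp z (.cup b) φ u = ∑ a : Γ, if a = 0 then 0 else φ (a :: a :: u) := rfl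

omit [CharP Γ 2] in
theorem pieceOp_cap (z : ℝ) (b : Bool) (φ : List Γ → ℝ) (x y : Γ) (u : List Γ) :
    pieceOp z (.cap b) φ (x :: y :: u) = if x = y then φ u else 0 := rfl

omit [CharP Γ 2] in
theorem pieceOp_cross (z : ℝ) (o b b' : Bool) (φ : List Γ → ℝ) (x y : Γ) (u : List Γ) :
    pieceOp z (.cross o b b') φ (x :: y :: u) = ∑ t : Γ, if t = 0 ∨ t = x + y then 0 else
      crossWeight (if o = true then z else z⁻¹) x y t * φ (t :: (x + y + t) :: u) := rfl

omit [CharP Γ 2] in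
theorem op_zigzag (z : ℝ) {n : ℕ} (a b : Bool) (φ : List Γ → ℝ) {u₁ : List Γ} (h : u₁.length = n)
    {x : Γ} (hx : x ≠ 0) (u : List Γ) :
    opAt z (n + 1) (.cup a) (opAt z n (.cap b) φ) (u₁ ++ x :: u) = φ (u₁ ++ x :: u) := by
  simp only [opAt_append z _ _ _ h, opAt_append_zero z _ _ h, opAt_one, pieceOp_cup, pieceOp_cap]
  rw [Finset.sum_eq_single x] <;> grind

omit [CharP Γ 2] in
theorem op_zagzig (z : ℝ) {n : ℕ} (a b : Bool) (φ : List Γ → ℝ) {u₁ : List Γ} (h : u₁.length = n)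
    {x : Γ} (hx : x ≠ 0) (u : List Γ) :
    opAt z n (.cup a) (opAt z (n + 1) (.cap b) φ) (u₁ ++ x :: u) = φ (u₁ ++ x :: u) := by
  simp only [opAt_append z _ _ _ h, opAt_append_zero z _ _ h, opAt_one, pieceOp_cup, pieceOp_cap]
  rw [Finset.sum_eq_single x] <;> grind

theorem op_cupSlide (z : ℝ) {n : ℕ} (o a b c d a' b' : Bool) (φ : List Γ → ℝ) {u₁ : List Γ} (h : u₁.length = n)
    (x : Γ) (u : List Γ) :
    opAt z (n + 1) (.cup a) (opAt z n (.cross o b c) φ) (u₁ ++ x :: u) =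
    opAt z n (.cup d) (opAt z (n + 1) (.cross (!o) a' b') φ) (u₁ ++ x :: u) := by
  simp only [opAt_append z _ _ _ h, opAt_append_zero z _ _ h, opAt_one, pieceOp_cup, pieceOp_cross]
  have e1 : ∀ t : Γ, (if t = 0 then 0 else ∑ y : Γ, if y = 0 ∨ y = x + t then 0 else
      crossWeight (if o = true then z else z⁻¹) x t y * φ (u₁ ++ y :: (x + t + y) :: t :: u)) =
    ∑ y : Γ, if t = 0 ∨ y = 0 ∨ y = x + t then 0 else
      crossWeight (if o = true then z else z⁻¹) x t y * φ (u₁ ++ y :: (x + t + y) :: t :: u) := by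
    intro t; by_cases h : t = 0 <;> simp [h]
  have e2 : ∀ y : Γ, (if y = 0 then 0 else ∑ t : Γ, if t = 0 ∨ t = y + x then 0 else
      crossWeight (if (!o) = true then z else z⁻¹) y x t * φ (u₁ ++ y :: t :: (y + x + t) :: u)) =
    ∑ t : Γ, if y = 0 ∨ t = 0 ∨ t = y + x then 0 else
      crossWeight (if (!o) = true then z else z⁻¹) y x t * φ (u₁ ++ y :: t :: (y + x + t) :: u) := by
    intro t; by_cases h : t = 0 <;> simp [h]
  rw [Finset.sum_congr rfl fun t _ => e1 t, Finset.sum_congr rfl fun t _ => e2 t, Finset.sum_comm]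
  refine Finset.sum_congr rfl fun y _ => ?_
  -- After this shift, t is the label of the middle strand at the top on both sides.
  rw [sum_add_left (x + y)]
  refine Finset.sum_congr rfl fun t _ => ?_
  have c : (x + y + t = 0 ∨ y = 0 ∨ y = x + (x + y + t)) = (y = 0 ∨ t = 0 ∨ t = y + x) := by
    apply propext; grind
  have e3 : x + (x + y + t) + y = t := by grind
  have e4 : x + y + t = y + x + t := by ring
  have e5 : (x = x + y + t) = (t = y) := by apply propext; grind
  have e6 : crossWeight (if o = true then z else z⁻¹) x (x + y + t) y =
      crossWeight (if (!o) = true then z else z⁻¹) y x t := by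
    cases o <;> simp [crossWeight, e5] <;> ring
  simp only [c, e3, e6]
  rw [e4]

theorem op_capSlide (z : ℝ) {n : ℕ} (o a b c d a' b' : Bool) (φ : List Γ → ℝ) {u₁ : List Γ} (h : u₁.length = n)
    (x y t : Γ) (u : List Γ) (hx : x ≠ 0) (ht : t ≠ 0) :
    opAt z n (.cross o a b) (opAt z (n + 1) (.cap c) φ) (u₁ ++ x :: y :: t :: u) =
    opAt z (n + 1) (.cross (!o) a' b') (opAt z n (.cap d) φ) (u₁ ++ x :: y :: t :: u) := by
  simp only [opAt_append z _ _ _ h, opAt_append_zero z _ _ h, opAt_one, pieceOp_cap, pieceOp_cross]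
  have e5 : (x = y) = (x + y + t = t) := by apply propext; grind
  rw [Finset.sum_eq_single (x + y + t), Finset.sum_eq_single x]
  · have e6 : crossWeight (if o = true then z else z⁻¹) x y (x + y + t) =
      crossWeight (if (!o) = true then z else z⁻¹) y t x := by
      have : (x + y + t = x) = (y = t) := by apply propext; grind
      cases o <;> simp [crossWeight, this] <;> ring
    have c : (x + y + t = 0 ∨ x + y + t = x + y) = (x = 0 ∨ x = y + t) := by
      apply propext; grind
    have e3 : x + y + (x + y + t) = t := by grind
    have e4 : y + t + x = x + y + t := by ring
    simp only [e6, e3, e4, if_true]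
    exact if_congr c.to_iff rfl rfl
  all_goals grind

theorem op_cupTwist (z : ℝ) (hz : z ≠ 0) (hc : (Fintype.card Γ : ℝ) = z + z⁻¹ + 2) {n : ℕ} (o a b c d : Bool)
    (φ : List Γ → ℝ) {u₁ : List Γ} (h : u₁.length = n) (u : List Γ) :
    opAt z n (.cup a) (opAt z n (.cross o b c) φ) (u₁ ++ u) =
      (if o = true then z else z⁻¹)⁻¹ ^ 2 * opAt z n (.cup d) φ (u₁ ++ u) := by
  simp only [opAt_append_zero z _ _ h, pieceOp_cup, pieceOp_cross]
  have e1 : ∀ a : Γ, (if a = 0 then 0 else ∑ y : Γ, if y = 0 ∨ y = a + a then 0 else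
      crossWeight (if o = true then z else z⁻¹) a a y * φ (u₁ ++ y :: (a + a + y) :: u)) =
    ∑ y : Γ, (if y = 0 then 0 else (if a = 0 then 0 else crossWeight (if o = true then z else z⁻¹) a a y)
      * φ (u₁ ++ y :: y :: u)) := by
    intro a
    have : a + a = 0 := by grind
    by_cases h : a = 0 <;> simp [h, this]
  rw [Finset.sum_congr rfl fun t _ => e1 t, Finset.sum_comm, Finset.mul_sum]
  refine Finset.sum_congr rfl fun y _ => ?_
  by_cases hy : y = 0
  · simp [hy]
  · simp only [if_neg hy, ← Finset.sum_mul]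
    rw [(sum_twist _ _ _ hy).1]
    · cases o <;> simp [hz]
    · cases o <;> simp [hc]; ring

theorem op_capTwist (z : ℝ) (hz : z ≠ 0) (hc : (Fintype.card Γ : ℝ) = z + z⁻¹ + 2) {n : ℕ} (o a b c d : Bool)
    (φ : List Γ → ℝ) {u₁ : List Γ} (h : u₁.length = n) (x y : Γ) (hx : x ≠ 0) (u : List Γ) :
    opAt z n (.cross o b c) (opAt z n (.cap a) φ) (u₁ ++ x :: y :: u) =
      (if o = true then z else z⁻¹)⁻¹ ^ 2 * opAt z n (.cap d) φ (u₁ ++ x :: y :: u) := by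
  simp only [opAt_append_zero z _ _ h, pieceOp_cap, pieceOp_cross]
  by_cases hxy : x = y
  · subst hxy
    have e : ∀ t : Γ, (if t = 0 ∨ t = x + x then 0 else crossWeight (if o = true then z else z⁻¹) x x t *
      if t = x + x + t then φ (u₁ ++ u) else 0) =
      (if t = 0 then 0 else crossWeight (if o = true then z else z⁻¹) x x t) * φ (u₁ ++ u) := by
      intro t
      have : x + x = 0 := by grind
      by_cases h : t = 0 <;> simp [h, this]
    rw [Finset.sum_congr rfl fun t _ => e t, ← Finset.sum_mul, (sum_twist _ _ _ hx).2]
    · simp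
    · cases o <;> simp [hz]
    · cases o <;> simp [hc]; ring
  · rw [if_neg hxy, mul_zero]
    refine Finset.sum_eq_zero fun t _ => ?_
    have : t ≠ x + y + t := by grind
    simp [this]

theorem op_two (z : ℝ) (hz : z ≠ 0) (hc : (Fintype.card Γ : ℝ) = z + z⁻¹ + 2) {n : ℕ} (o a b c d : Bool)
    (φ : List Γ → ℝ) {u₁ : List Γ} (h : u₁.length = n) (x y : Γ) (hx : x ≠ 0) (hy : y ≠ 0) (u : List Γ) :
    opAt z n (.cross o a b) (opAt z n (.cross (!o) c d) φ) (u₁ ++ x :: y :: u) =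
      φ (u₁ ++ x :: y :: u) := by
  simp only [opAt_append_zero z _ _ h, pieceOp_cross]
  have := sum_sum_two (if o = true then z else z⁻¹) (by cases o <;> simp [hz])
    (by cases o <;> simp [hc]; ring) hx hy fun x y => φ (u₁ ++ x :: y :: u)
  cases o <;> simpa using this

/-- For nonzero labels the operators at the two positions are `twist₁` and `twist₂`. Values at
triples containing zero are irrelevant by `nonzero₃`, so `braid_mixed` applies. -/
theorem op_three (z : ℝ) (hz : z ≠ 0) (hc : (Fintype.card Γ : ℝ) = z + z⁻¹ + 2) {n : ℕ} (p q r : Bool)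
    (hp : p = r → q = p) (a b c d e f a' b' c' d' e' f' : Bool)
    (φ : List Γ → ℝ) {u₁ : List Γ} (h : u₁.length = n) (x y t : Γ) (hx : x ≠ 0) (hy : y ≠ 0) (ht : t ≠ 0) (u : List Γ) :
    opAt z n (.cross p a b) (opAt z (n + 1) (.cross q c d) (opAt z n (.cross r e f) φ)) (u₁ ++ x :: y :: t :: u) =
    opAt z (n + 1) (.cross r a' b') (opAt z n (.cross q c' d') (opAt z (n + 1) (.cross p e' f') φ)) (u₁ ++ x :: y :: t :: u) := by
  have e1 : ∀ o a b ψ x y t, x ≠ 0 → y ≠ 0 → t ≠ 0 → opAt z n (.cross o a b) ψ (u₁ ++ x :: y :: t :: u) =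
      twist₁ (if o = true then z else z⁻¹) (fun x y t => ψ (u₁ ++ x :: y :: t :: u)) x y t := by
    intro o a b ψ x y t hx hy ht
    rw [opAt_append_zero z _ _ h, pieceOp_cross]; exact (if_neg (by simp [hx, hy, ht])).symm
  have e2 : ∀ o a b ψ x y t, x ≠ 0 → y ≠ 0 → t ≠ 0 → opAt z (n + 1) (.cross o a b) ψ (u₁ ++ x :: y :: t :: u) =
      twist₂ (if o = true then z else z⁻¹) (fun x y t => ψ (u₁ ++ x :: y :: t :: u)) x y t := by
    intro o a b ψ x y t hx hy ht
    rw [opAt_append z _ _ _ h, opAt_one, pieceOp_cross]; exact (if_neg (by simp [hx, hy, ht])).symm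
  have hn : ∀ f g : Γ → Γ → Γ → ℝ, (∀ x y t, x ≠ 0 → y ≠ 0 → t ≠ 0 → f x y t = g x y t) →
      nonzero₃ f = nonzero₃ g := by
    intro f g hfg
    funext x y t
    simp only [nonzero₃]
    split_ifs with h
    · rfl
    · push Not at h; exact hfg _ _ _ h.1 h.2.1 h.2.2
  have c1 : ∀ w : ℝ, ∀ f g : Γ → Γ → Γ → ℝ, (∀ x y t, x ≠ 0 → y ≠ 0 → t ≠ 0 → f x y t = g x y t) → twist₁ w f = twist₁ w g := by
    intro w f g hfg; rw [← twist₁_nonzero₃, hn f g hfg, twist₁_nonzero₃]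
  have c2 : ∀ w : ℝ, ∀ f g : Γ → Γ → Γ → ℝ, (∀ x y t, x ≠ 0 → y ≠ 0 → t ≠ 0 → f x y t = g x y t) → twist₂ w f = twist₂ w g := by
    intro w f g hfg; rw [← twist₂_nonzero₃, hn f g hfg, twist₂_nonzero₃]
  have b := braid_mixed (e := nonzero₃) (s₁ := fun o => twist₁ (if o = true then z else z⁻¹))
    (s₂ := fun o => twist₂ (if o = true then z else z⁻¹)) (fun o f => twist₁_nonzero₃ _ f)
    (fun o f => twist₂_nonzero₃ _ f) (fun o f => nonzero₃_nonzero₃ _) (fun o f => nonzero₃_nonzero₃ _)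
    (fun o f => by
      have := twist₁_twist₁ (if o = true then z else z⁻¹) (by cases o <;> simp [hz])
        (by cases o <;> simp [hc]; ring) f
      cases o <;> simpa using this)
    (fun o f => by
      have := twist₂_twist₂ (if o = true then z else z⁻¹) (by cases o <;> simp [hz])
        (by cases o <;> simp [hc]; ring) f
      cases o <;> simpa using this)
    (fun o f => braid _ (by cases o <;> simp [hz]) (by cases o <;> simp [hc]; ring) f) p q r hp
    (fun x y t => φ (u₁ ++ x :: y :: t :: u))
  have b' := congrFun (congrFun (congrFun b x) y) t
  refine Eq.trans ?_ (b'.trans ?_)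
  · rw [e1 _ _ _ _ _ _ _ hx hy ht]
    refine congrFun (congrFun (congrFun (c1 _ _ _ fun x y t hx hy ht => ?_) x) y) t
    rw [e2 _ _ _ _ _ _ _ hx hy ht]
    exact congrFun (congrFun (congrFun (c2 _ _ _ fun x y t hx hy ht => e1 _ _ _ _ _ _ _ hx hy ht) x) y) t
  · rw [e2 _ _ _ _ _ _ _ hx hy ht]
    refine congrFun (congrFun (congrFun (c2 _ _ _ fun x y t hx hy ht => ?_) x) y) t
    rw [e1 _ _ _ _ _ _ _ hx hy ht]
    exact congrFun (congrFun (congrFun (c1 _ _ _ fun x y t hx hy ht => (e2 _ _ _ _ _ _ _ hx hy ht).symm) x) y) t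

theorem writhe_cons (s : Slice) (W : Word) : writhe (s :: W) = writhe [s] + writhe W :=
  writhe_append [s] W

theorem writhe_nil : writhe [] = 0 := rfl

/-- The contribution of a piece to the writhe. -/
def Piece.sign : Piece → ℤ
  | .cross o a b => if (o != (a == b)) = true then -1 else 1
  | _ => 0

theorem writhe_singleton (s : Slice) : writhe [s] = s.piece.sign := by
  simp only [writhe, c_eq_countP, cNeg, List.countP_singleton]
  cases s.piece <;> simp [Piece.isCrossing, Piece.isNegative, Piece.sign]
  split_ifs <;> simp

omit [Fintype Γ] [DecidableEq Γ] [CharP Γ 2] in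
theorem Good.split {m n : ℕ} {u : List Γ} (h : Good m u) (hn : n ≤ m) :
    ∃ u₁ w, u₁.length = n ∧ Good (m - n) w ∧ u = u₁ ++ w := by
  obtain ⟨hl, hu⟩ := h
  obtain ⟨u₁, w, h1, h2, rfl⟩ := exists_split (n := n) (k := m - n) (l := u) (by omega)
  exact ⟨u₁, w, h1, ⟨h2, fun a ha => hu a (List.mem_append_right _ ha)⟩, rfl⟩

omit [Fintype Γ] [DecidableEq Γ] [CharP Γ 2] in
theorem Good.cons {m : ℕ} {u : List Γ} (h : Good m u) (hm : 0 < m) :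
    ∃ x w, x ≠ 0 ∧ Good (m - 1) w ∧ u = x :: w := by
  obtain ⟨hl, hu⟩ := h
  cases u with
  | nil => simp at hl; omega
  | cons x w =>
    simp only [List.length_cons] at hl
    exact ⟨x, w, hu x (by simp), ⟨by omega, fun a ha => hu a (by simp [ha])⟩, rfl⟩

/-- The operators of the two sides of an elementary move agree up to a power of `z`. -/
theorem Move.wordOp_eq (z : ℝ) (hz : z ≠ 0) (hc : (Fintype.card Γ : ℝ) = z + z⁻¹ + 2) {X Y : Word}
    (h : Move X Y) : ∃ s X', X = s :: X' ∧ ∀ (φ : List Γ → ℝ) (u : List Γ), Good s.source.length u →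
      wordOp z X φ u = z ^ (2 * (writhe X - writhe Y)) * wordOp z Y φ u := by
  have hz0 : ∀ d : ℤ, d = 0 → z ^ (2 * d) = 1 := by rintro d rfl; simp
  cases h with
  | exchange l m r g h =>
    refine ⟨_, _, rfl, fun φ u hu => ?_⟩
    have : writhe [⟨l, g, m ++ h.source ++ r⟩, ⟨l ++ g.target ++ m, h, r⟩] =
        writhe [⟨l ++ g.source ++ m, h, r⟩, ⟨l, g, m ++ h.target ++ r⟩] := by
      rw [writhe_cons, writhe_cons ⟨l ++ g.source ++ m, h, r⟩, writhe_singleton, writhe_singleton,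
        writhe_singleton, writhe_singleton, add_comm]
    rw [this, sub_self, mul_zero, zpow_zero, one_mul]
    have := op_exchange z (l := l) (m := m) (r := r) g h φ (u := u) (by
      rw [hu.1]; simp [Slice.source])
    simpa [wordOp, add_assoc] using this
  | zigzag l r a =>
    refine ⟨_, _, rfl, fun φ u hu => ?_⟩
    obtain ⟨u₁, w, h1, hw, rfl⟩ := hu.split (n := l.length) (by simp [Slice.source]; try omega)
    clear hu
    simp only [Slice.source, Piece.source, List.length_append, List.length_cons, List.length_nil] at hw
    obtain ⟨x, wx, hx, hwx, rfl⟩ := hw.cons (by omega)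
    rw [hz0 _ (by
      simp only [writhe_cons _ (_ :: _), writhe_singleton, writhe_nil]
      rfl), one_mul]
    simpa [wordOp] using op_zigzag z (!a) a φ h1 hx wx
  | zagzig l r a =>
    refine ⟨_, _, rfl, fun φ u hu => ?_⟩
    obtain ⟨u₁, w, h1, hw, rfl⟩ := hu.split (n := l.length) (by simp [Slice.source]; try omega)
    clear hu
    simp only [Slice.source, Piece.source, List.length_append, List.length_cons, List.length_nil] at hw
    obtain ⟨x, wx, hx, hwx, rfl⟩ := hw.cons (by omega)
    rw [hz0 _ (by
      simp only [writhe_cons _ (_ :: _), writhe_singleton, writhe_nil]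
      rfl), one_mul]
    simpa [wordOp] using op_zagzig z a (!a) φ h1 hx wx
  | cupSlide l r o a c =>
    refine ⟨_, _, rfl, fun φ u hu => ?_⟩
    obtain ⟨u₁, w, h1, hw, rfl⟩ := hu.split (n := l.length) (by simp [Slice.source]; try omega)
    clear hu
    simp only [Slice.source, Piece.source, List.length_append, List.length_cons, List.length_nil] at hw
    obtain ⟨x, wx, hx, hwx, rfl⟩ := hw.cons (by omega)
    rw [hz0 _ (by
      simp only [writhe_cons _ (_ :: _), writhe_singleton]
      cases o <;> cases a <;> cases c <;> rfl), one_mul]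
    simpa [wordOp] using op_cupSlide z o c a c c (!c) a φ h1 x wx
  | capSlide l r o a c =>
    refine ⟨_, _, rfl, fun φ u hu => ?_⟩
    obtain ⟨u₁, w, h1, hw, rfl⟩ := hu.split (n := l.length) (by simp [Slice.source]; try omega)
    clear hu
    simp only [Slice.source, Piece.source, List.length_append, List.length_cons, List.length_nil] at hw
    obtain ⟨x, wx, hx, hwx, rfl⟩ := hw.cons (by omega)
    obtain ⟨y, wy, hy, hwy, rfl⟩ := hwx.cons (by omega)
    obtain ⟨t, wt, ht, hwt, rfl⟩ := hwy.cons (by omega)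
    rw [hz0 _ (by
      simp only [writhe_cons _ (_ :: _), writhe_singleton]
      cases o <;> cases a <;> cases c <;> rfl), one_mul]
    simpa [wordOp] using op_capSlide z o c a c c a (!c) φ h1 x y t wt hx ht
  | cupTwist l r o b =>
    refine ⟨_, _, rfl, fun φ u hu => ?_⟩
    obtain ⟨u₁, w, h1, hw, rfl⟩ := hu.split (n := l.length) (by simp [Slice.source]; try omega)
    clear hu
    -- The strands of a kink run in opposite vertical directions, so its sign depends only on `o`:
    -- it is negative for `o = true`.
    have : writhe [⟨l, .cup b, r⟩, ⟨l, .cross o b (!b), r⟩] -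
        writhe [⟨l, .cup (!b), r⟩] = if o = true then -1 else 1 := by
      simp only [writhe_cons _ (_ :: _), writhe_singleton]
      cases o <;> cases b <;> rfl
    rw [this]
    have hs : z ^ (2 * (if o = true then -1 else 1 : ℤ)) = (if o = true then z else z⁻¹)⁻¹ ^ 2 := by
      cases o <;> simp
    rw [hs]
    simpa [wordOp] using op_cupTwist z hz hc o b b (!b) (!b) φ h1 w
  | capTwist l r o b =>
    refine ⟨_, _, rfl, fun φ u hu => ?_⟩
    obtain ⟨u₁, w, h1, hw, rfl⟩ := hu.split (n := l.length) (by simp [Slice.source]; try omega)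
    clear hu
    simp only [Slice.source, Piece.source, List.length_append, List.length_cons, List.length_nil] at hw
    obtain ⟨x, wx, hx, hwx, rfl⟩ := hw.cons (by omega)
    obtain ⟨y, wy, hy, hwy, rfl⟩ := hwx.cons (by omega)
    have : writhe [⟨l, .cross o b (!b), r⟩, ⟨l, .cap (!b), r⟩] -
        writhe [⟨l, .cap b, r⟩] = if o = true then -1 else 1 := by
      simp only [writhe_cons _ (_ :: _), writhe_singleton]
      cases o <;> cases b <;> rfl
    rw [this]
    have hs : z ^ (2 * (if o = true then -1 else 1 : ℤ)) = (if o = true then z else z⁻¹)⁻¹ ^ 2 := by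
      cases o <;> simp
    rw [hs]
    simpa [wordOp] using op_capTwist z hz hc o (!b) b (!b) b φ h1 x y hx wy
  | two l r o a b =>
    refine ⟨_, _, rfl, fun φ u hu => ?_⟩
    obtain ⟨u₁, w, h1, hw, rfl⟩ := hu.split (n := l.length) (by simp [Slice.source]; try omega)
    clear hu
    simp only [Slice.source, Piece.source, List.length_append, List.length_cons, List.length_nil] at hw
    obtain ⟨x, wx, hx, hwx, rfl⟩ := hw.cons (by omega)
    obtain ⟨y, wy, hy, hwy, rfl⟩ := hwx.cons (by omega)
    rw [hz0 _ (by
      simp only [writhe_cons _ (_ :: _), writhe_singleton, writhe_nil]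
      cases o <;> cases a <;> cases b <;> rfl), one_mul]
    simpa [wordOp] using op_two z hz hc o a b b a φ h1 x y hx hy wy
  | three l r a b c ab ac bc h =>
    refine ⟨_, _, rfl, fun φ u hu => ?_⟩
    obtain ⟨u₁, w, h1, hw, rfl⟩ := hu.split (n := l.length) (by simp [Slice.source]; try omega)
    clear hu
    simp only [Slice.source, Piece.source, List.length_append, List.length_cons, List.length_nil] at hw
    obtain ⟨x, wx, hx, hwx, rfl⟩ := hw.cons (by omega)
    obtain ⟨y, wy, hy, hwy, rfl⟩ := hwx.cons (by omega)
    obtain ⟨t, wt, ht, hwt, rfl⟩ := hwy.cons (by omega)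
    rw [hz0 _ (by
      simp only [writhe_cons _ (_ :: _), writhe_singleton]
      ring), one_mul]
    simpa [wordOp] using op_three z hz hc ab ac bc h a b a c b c b c a c a b φ h1 x y t hx hy ht wt

end StateSum

/-! ### Invariance of the normalized state sum, and its slice weights. -/

section StateSum

variable {Γ : Type*} [CommRing Γ] [Fintype Γ] [DecidableEq Γ]

variable (Γ) in
/-- The state sum of a closed word. -/
noncomputable def stateSum (z : ℝ) (W : Word) : ℝ := wordOp z W (fun _ : List Γ => 1) []

theorem IsTangle.append {x y : List Bool} {V W : Word} (h : IsTangle x (V ++ W) y) :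
    ∃ t, IsTangle x V t ∧ IsTangle t W y := by
  induction V generalizing x with
  | nil => exact ⟨x, rfl, h⟩
  | cons s V ih =>
    obtain ⟨rfl, h⟩ := h
    obtain ⟨t, h1, h2⟩ := ih h
    exact ⟨t, ⟨rfl, h1⟩, h2⟩

variable (Γ) in
/-- The state sum, normalized by the writhe, is an invariant of links. -/
theorem stateSum_eq_of_diagrams [CharP Γ 2] (z : ℝ) (hz : z ≠ 0)
    (hc : (Fintype.card Γ : ℝ) = z + z⁻¹ + 2) {K : Link} {D D' : Diagram} (hD : D ∈ diagrams K)
    (hD' : D' ∈ diagrams K) : z ^ (-2 * writhe D.word) * stateSum Γ z D.word =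
      z ^ (-2 * writhe D'.word) * stateSum Γ z D'.word := by
  have step : ∀ D D' : Diagram, Step D D' → z ^ (-2 * writhe D.word) * stateSum Γ z D.word =
      z ^ (-2 * writhe D'.word) * stateSum Γ z D'.word := by
    rintro D D' ⟨P, X, Y, Q, hXY, h1, h2⟩
    obtain ⟨s, X', rfl, h⟩ := hXY.wordOp_eq (Γ := Γ) z hz hc
    have ht := D.closed
    rw [h1, List.append_assoc] at ht
    obtain ⟨t, hP, rfl, -⟩ := ht.append
    have e : stateSum Γ z D.word = z ^ (2 * (writhe (s :: X') - writhe Y)) * stateSum Γ z D'.word := by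
      rw [stateSum, stateSum, h1, h2, List.append_assoc, List.append_assoc, wordOp_append, wordOp_append z P,
        wordOp_append, wordOp_append z Y]
      exact wordOp_smul z hP _ (fun u hu => h _ u hu) ⟨rfl, by simp⟩
    rw [e, ← mul_assoc, ← zpow_add₀ hz, h1, h2]
    congr 2
    simp only [writhe_append]
    ring
  let F : Link → ℝ := Quot.lift (fun D => z ^ (-2 * writhe D.word) * stateSum Γ z D.word) step
  exact (congrArg F hD).trans (congrArg F hD').symm

/-! ### The state sum as a sum over labelings of the points -/

variable (Γ) in
/-- The lists of `n` nonzero labels. -/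
noncomputable def goods : ℕ → Finset (List Γ)
  | 0 => {[]}
  | n + 1 => (Finset.univ.erase (0 : Γ) ×ˢ goods n).image fun p => p.1 :: p.2

theorem mem_goods {n : ℕ} {u : List Γ} : u ∈ goods Γ n ↔ Good n u := by
  induction n generalizing u with
  | zero => cases u <;> simp [goods, Good]
  | succ n ih =>
    cases u with
    | nil => simp [goods, Good]
    | cons a u =>
      simp only [goods, Finset.mem_image, Finset.mem_product, Finset.mem_erase, Finset.mem_univ, and_true, Prod.exists,
        List.cons.injEq, ih, Good, List.length_cons, List.mem_cons, forall_eq_or_imp]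
      constructor
      · rintro ⟨a', u', ⟨h1, h2, h3⟩, rfl, rfl⟩
        exact ⟨by omega, h1, h3⟩
      · rintro ⟨h1, h2, h3⟩
        exact ⟨a, u, ⟨h2, by omega, h3⟩, rfl, rfl⟩

open Classical in
/-- The weight of a slice with labels `u` at the bottom and `v` at the top. -/
noncomputable def sliceWeight (z : ℝ) (s : Slice) (u v : ℕ → Γ) : ℝ :=
  if Outer s u v then
    match s.piece with
    | .cross o _ _ => if u s.left.length + u (s.left.length + 1) = v s.left.length + v (s.left.length + 1)
        then crossWeight (if o = true then z else z⁻¹) (u s.left.length) (u (s.left.length + 1)) (v s.left.length)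
        else 0
    | _ => 1
  else 0

/-- The labels in a list, followed by zeros. -/
def row (u : List Γ) (i : ℕ) : Γ := u.getD i 0

omit [Fintype Γ] [DecidableEq Γ] in
theorem row_append_left {u v : List Γ} {i : ℕ} (h : i < u.length) : row (u ++ v) i = row u i := by
  simp [row, List.getElem?_append_left h]

omit [Fintype Γ] [DecidableEq Γ] in
theorem row_append_right (u v : List Γ) (i : ℕ) : row (u ++ v) (u.length + i) = row v i := by
  simp [row, List.getElem?_append_right]

omit [Fintype Γ] [DecidableEq Γ] in
theorem eq_of_row {u v : List Γ} (h : u.length = v.length) (h' : ∀ i < u.length, row u i = row v i) : u = v := by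
  refine List.ext_getElem h fun i h1 h2 => ?_
  simpa [row, h1, h2] using h' i h1

omit [Fintype Γ] [DecidableEq Γ] in
theorem outer_iff {s : Slice} {u₁ v u₂ w₁ t w₂ : List Γ} (h1 : u₁.length = s.left.length)
    (h2 : v.length = s.piece.source.length) (h3 : u₂.length = s.right.length)
    (k1 : w₁.length = s.left.length) (k2 : t.length = s.piece.target.length) (k3 : w₂.length = s.right.length) :
    Outer s (row (u₁ ++ (v ++ u₂))) (row (w₁ ++ (t ++ w₂))) ↔ u₁ = w₁ ∧ u₂ = w₂ ∧
      (∀ b, s.piece = .cup b → row t 0 = row t 1) ∧ (∀ b, s.piece = .cap b → row v 0 = row v 1) := by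
  have a1 : ∀ i < s.left.length, row (u₁ ++ (v ++ u₂)) i = row u₁ i := fun i hi => row_append_left (by omega)
  have a2 : ∀ i < s.left.length, row (w₁ ++ (t ++ w₂)) i = row w₁ i := fun i hi => row_append_left (by omega)
  have b1 : ∀ i, row (u₁ ++ (v ++ u₂)) (s.left.length + s.piece.source.length + i) = row u₂ i := by
    intro i; rw [← h1, ← h2, add_assoc, row_append_right, row_append_right]
  have b2 : ∀ i, row (w₁ ++ (t ++ w₂)) (s.left.length + s.piece.target.length + i) = row w₂ i := by
    intro i; rw [← k1, ← k2, add_assoc, row_append_right, row_append_right]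
  have c1 : ∀ i < v.length, row (u₁ ++ (v ++ u₂)) (s.left.length + i) = row v i := by
    intro i hi; rw [← h1, row_append_right, row_append_left hi]
  have c2 : ∀ i < t.length, row (w₁ ++ (t ++ w₂)) (s.left.length + i) = row t i := by
    intro i hi; rw [← k1, row_append_right, row_append_left hi]
  have d1 : ∀ b, s.piece = .cap b → 2 = v.length := by intro b hb; rw [h2, hb]; rfl
  have d2 : ∀ b, s.piece = .cup b → 2 = t.length := by intro b hb; rw [k2, hb]; rfl
  constructor
  · intro h
    refine ⟨eq_of_row (by omega) fun i hi => ?_, eq_of_row (by omega) fun i hi => ?_, fun b hb => ?_, fun b hb => ?_⟩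
    · rw [← a1 i (by omega), ← a2 i (by omega)]; exact h.left i (by omega)
    · rw [← b1 i, ← b2 i]; exact h.right i (by omega)
    · have := d2 b hb
      rw [← c2 0 (by omega), ← c2 1 (by omega)]; exact h.cup b hb
    · have := d1 b hb
      rw [← c1 0 (by omega), ← c1 1 (by omega)]; exact h.cap b hb
  · rintro ⟨rfl, rfl, h5, h6⟩
    refine ⟨fun i hi => ?_, fun i hi => ?_, fun b hb => ?_, fun b hb => ?_⟩
    · rw [a1 i hi, a2 i hi]
    · rw [b1 i, b2 i]
    · have := d2 b hb
      have h := h5 b hb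
      rwa [← c2 0 (by omega), ← c2 1 (by omega)] at h
    · have := d1 b hb
      have h := h6 b hb
      rwa [← c1 0 (by omega), ← c1 1 (by omega)] at h

omit [CommRing Γ] [DecidableEq Γ] in
theorem sum_ite_zero_left (p : Γ → Prop) [DecidablePred p] (f : Γ → ℝ) :
    ∑ a, (if p a then 0 else f a) = ∑ a with ¬ p a, f a := by
  rw [Finset.sum_filter]; simp only [ite_not]

/-- `sliceWeight` is the matrix of the operator. A row of nonzero weight agrees with the bottom row
outside the piece, so only the parameter of the piece remains free, and the two sums correspond
injectively. -/
theorem opAt_eq_sum [CharP Γ 2] (z : ℝ) (s : Slice) (φ : List Γ → ℝ) {u : List Γ} (hu : Good s.source.length u) :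
    opAt z s.left.length s.piece φ u =
      ∑ w ∈ goods Γ s.target.length, sliceWeight z s (row u) (row w) * φ w := by
  have split : ∀ {p : List Bool} {u : List Γ}, Good (s.left.length + p.length + s.right.length) u →
      ∃ u₁ v u₂, u₁.length = s.left.length ∧ v.length = p.length ∧ u₂.length = s.right.length ∧
        u = u₁ ++ (v ++ u₂) := by
    intro p u hu
    obtain ⟨u₁, w, h1, h2, rfl⟩ := exists_split (n := s.left.length) (k := p.length + s.right.length) (l := u) (by
      rw [hu.1]; omega)
    obtain ⟨v, u₂, h3, h4, rfl⟩ := exists_split _ h2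
    exact ⟨u₁, v, u₂, h1, h3, h4, rfl⟩
  rw [s.length_source] at hu
  obtain ⟨u₁, v, u₂, h1, h2, h3, rfl⟩ := split hu
  obtain ⟨hl, hu⟩ := hu
  simp only [List.mem_append] at hu
  rw [opAt_append_zero z _ _ h1]
  have key : ∀ w ∈ goods Γ s.target.length, sliceWeight z s (row (u₁ ++ (v ++ u₂))) (row w) ≠ 0 →
      ∃ t, t.length = s.piece.target.length ∧ w = u₁ ++ (t ++ u₂) ∧ (∀ a ∈ t, a ≠ 0) ∧
      (∀ b, s.piece = .cup b → row t 0 = row t 1) ∧ (∀ b, s.piece = .cap b → row v 0 = row v 1) := by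
    intro w hw hne
    rw [mem_goods, s.length_target] at hw
    obtain ⟨w₁, t, w₂, k1, k2, k3, rfl⟩ := split hw
    have ho : Outer s (row (u₁ ++ (v ++ u₂))) (row (w₁ ++ (t ++ w₂))) := by
      by_contra h; exact hne (if_neg h)
    obtain ⟨rfl, rfl, h⟩ := (outer_iff h1 h2 h3 k1 k2 k3).1 ho
    exact ⟨t, k2, rfl, fun a ha => hw.2 a (by simp [ha]), h⟩
  obtain ⟨l, p, r⟩ := s
  have good : ∀ t : List Γ, t.length = p.target.length → (∀ a ∈ t, a ≠ 0) →
      u₁ ++ (t ++ u₂) ∈ goods Γ (Slice.target ⟨l, p, r⟩).length := by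
    intro t ht h
    rw [mem_goods, Slice.length_target]
    refine ⟨?_, fun a ha => ?_⟩
    · simp only [List.length_append] at *; omega
    · simp only [List.mem_append] at ha
      have := hu a
      have := h a
      tauto
  cases p with
  | cup b =>
    obtain rfl : v = [] := List.length_eq_zero_iff.1 h2
    rw [pieceOp_cup, sum_ite_zero_left]
    refine Finset.sum_of_injOn (fun a => u₁ ++ ([a, a] ++ u₂)) (fun a _ b _ h => by simpa using h)
      (fun a ha => good _ rfl (by simpa using ha)) (fun w hw hwi => ?_) (fun a ha => ?_)
    · by_contra hne
      obtain ⟨t, ht, rfl, ht0, htc, -⟩ := key w hw fun h => hne (by rw [h, zero_mul])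
      obtain ⟨a, a', rfl⟩ := List.length_eq_two.1 ht
      obtain rfl : a = a' := htc b rfl
      exact hwi ⟨a, by simpa using ht0, rfl⟩
    · rw [sliceWeight, if_pos ((outer_iff h1 h2 h3 h1 rfl h3).2 ⟨rfl, rfl, fun _ _ => rfl, by simp⟩)]
      simp
  | cap b =>
    obtain ⟨a, a', rfl⟩ := List.length_eq_two.1 h2
    have e : pieceOp z (.cap b) (fun w => φ (u₁ ++ w)) ([a, a'] ++ u₂) =
      sliceWeight z ⟨l, .cap b, r⟩ (row (u₁ ++ ([a, a'] ++ u₂))) (row (u₁ ++ ([] ++ u₂))) * φ (u₁ ++ ([] ++ u₂)) := by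
      simp only [List.cons_append, List.nil_append, pieceOp_cap]
      by_cases h : a = a'
      · have := (outer_iff (s := ⟨l, .cap b, r⟩) (v := [a, a']) (t := []) h1 h2 h3 h1 rfl h3).2 ⟨rfl, rfl, by simp, fun _ _ => h⟩
        simp only [List.cons_append, List.nil_append] at this
        rw [sliceWeight, if_pos this, if_pos h]; simp
      · have : ¬ Outer ⟨l, .cap b, r⟩ (row (u₁ ++ ([a, a'] ++ u₂))) (row (u₁ ++ ([] ++ u₂))) :=
          fun h' => h (((outer_iff (s := ⟨l, .cap b, r⟩) (v := [a, a']) (t := []) h1 h2 h3 h1 rfl h3).1 h').2.2.2 b rfl)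
        simp only [List.cons_append, List.nil_append] at this
        rw [sliceWeight, if_neg this, if_neg h]; simp
    rw [e]
    symm
    refine Finset.sum_eq_single _ (fun w hw hne => ?_) (fun h => absurd (good [] rfl (by simp)) h)
    by_contra hne'
    obtain ⟨t, ht, rfl, -⟩ := key w hw fun h => hne' (by rw [h, zero_mul])
    obtain rfl : t = [] := List.length_eq_zero_iff.1 ht
    exact hne rfl
  | cross o b b' =>
    obtain ⟨a, a', rfl⟩ := List.length_eq_two.1 h2
    simp only [List.cons_append, List.nil_append, pieceOp_cross]
    rw [sum_ite_zero_left]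
    have val : ∀ t t' : Γ, sliceWeight z ⟨l, .cross o b b', r⟩ (row (u₁ ++ ([a, a'] ++ u₂)))
        (row (u₁ ++ ([t, t'] ++ u₂))) = if a + a' = t + t' then
          crossWeight (if o = true then z else z⁻¹) a a' t else 0 := by
      intro t t'
      rw [sliceWeight, if_pos ((outer_iff h1 h2 h3 h1 rfl h3).2 ⟨rfl, rfl, by simp, by simp⟩)]
      have e1 : ∀ x y : Γ, row (u₁ ++ ([x, y] ++ u₂)) l.length = x := by
        intro x y; rw [← h1, ← add_zero u₁.length, row_append_right]; rfl
      have e2 : ∀ x y : Γ, row (u₁ ++ ([x, y] ++ u₂)) (l.length + 1) = y := by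
        intro x y; rw [← h1, row_append_right]; rfl
      simp only [e1, e2]
    simp only [List.cons_append, List.nil_append] at val
    refine Finset.sum_of_injOn (fun x => u₁ ++ ([x, a + a' + x] ++ u₂)) (fun a _ b _ h => ?_)
      (fun x hx => good _ rfl ?_) (fun w hw hwi => ?_) (fun x hx => ?_)
    · simp only [List.append_cancel_left_eq, List.cons_append, List.cons.injEq] at h; exact h.1
    · simp only [Finset.coe_filter, Finset.mem_univ, true_and, Set.mem_ofPred_eq] at hx
      simp only [List.mem_cons, List.not_mem_nil, or_false]
      grind
    · by_contra hne
      obtain ⟨t, ht, rfl, ht0, -, -⟩ := key w hw fun h => hne (by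
        simp only [List.cons_append, List.nil_append] at h; rw [h, zero_mul])
      obtain ⟨x, y, rfl⟩ := List.length_eq_two.1 ht
      have hy : a + a' = x + y := by
        by_contra h
        refine hne ?_
        simp only [List.cons_append, List.nil_append, val, if_neg h, zero_mul]
      simp only [List.mem_cons, List.not_mem_nil, or_false] at ht0
      have h0 := ht0 y (.inr rfl)
      refine hwi ⟨x, ?_, ?_⟩
      · simp only [Finset.coe_filter, Finset.mem_univ, true_and, Set.mem_ofPred_eq]
        have := ht0 x (.inl rfl)
        grind
      · have : a + a' + x = y := by grind
        simp only [this]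
    · simp only [List.cons_append, List.nil_append, val]
      have : a + a' = x + (a + a' + x) := by clear * -; grind
      rw [if_pos this]

end StateSum

/-! ### From products of operators to labelings of points. -/

section StateSum

variable {Γ : Type*} [CommRing Γ] [Fintype Γ] [DecidableEq Γ]

variable (Γ) in
/-- The lists of the labels on the lines above the slices of a word. -/
noncomputable def paths : Word → Finset (List (List Γ))
  | [] => {[]}
  | s :: W => (goods Γ s.target.length ×ˢ paths W).image fun p => p.1 :: p.2

/-- The product of the weights of the slices. -/
noncomputable def pathWeight (z : ℝ) : Word → List Γ → List (List Γ) → ℝ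
  | s :: W, u, w :: p => sliceWeight z s (row u) (row w) * pathWeight z W w p
  | _, _, _ => 1

theorem mem_paths {W : Word} {p : List (List Γ)} : p ∈ paths Γ W ↔ p.length = W.length ∧
    ∀ k s, W[k]? = some s → Good s.target.length (p.getD k []) := by
  induction W generalizing p with
  | nil => cases p <;> simp [paths]
  | cons s W ih =>
    cases p with
    | nil => simp [paths]
    | cons w p =>
      simp only [paths, Finset.mem_image, Finset.mem_product, Prod.exists, List.cons.injEq, ih, mem_goods, List.length_cons]
      constructor
      · rintro ⟨w', p', ⟨h1, h2, h3⟩, rfl, rfl⟩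
        refine ⟨by omega, fun k t ht => ?_⟩
        cases k with
        | zero => obtain rfl : s = t := by simpa using ht
                  simpa using h1
        | succ k => simpa using h3 k t (by simpa using ht)
      · rintro ⟨h1, h2⟩
        refine ⟨w, p, ⟨by simpa using h2 0 s rfl, by omega, fun k t ht => ?_⟩, rfl, rfl⟩
        simpa using h2 (k + 1) t (by simpa using ht)

theorem wordOp_eq_sum [CharP Γ 2] (z : ℝ) {x y : List Bool} {W : Word} (h : IsTangle x W y) {u : List Γ}
    (hu : Good x.length u) : wordOp z W (fun _ => 1) u = ∑ p ∈ paths Γ W, pathWeight z W u p := by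
  induction W generalizing x u with
  | nil => simp [wordOp, paths, pathWeight]
  | cons s W ih =>
    obtain ⟨rfl, h⟩ := h
    rw [wordOp, opAt_eq_sum z s _ hu, paths, Finset.sum_image, Finset.sum_product]
    · refine Finset.sum_congr rfl fun w hw => ?_
      rw [ih h (mem_goods.1 hw), Finset.mul_sum]
      rfl
    · rintro ⟨a, b⟩ - ⟨a', b'⟩ - hab
      simpa using hab

/-- The weight of the slice number `k`, for labels of the points. -/
noncomputable def lineWeight (z : ℝ) (W : Word) (R : ℕ → ℕ → Γ) (k : ℕ) : ℝ :=
  (W[k]?.map fun s => sliceWeight z s (R k) (R (k + 1))).getD 1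

omit [Fintype Γ] in
theorem pathWeight_eq_prod (z : ℝ) {W : Word} {u : List Γ} {p : List (List Γ)} (hp : p.length = W.length) :
    pathWeight z W u p = ∏ k ∈ Finset.range W.length, lineWeight z W (fun k => row ((u :: p).getD k [])) k := by
  induction W generalizing u p with
  | nil => simp [pathWeight]
  | cons s W ih =>
    cases p with
    | nil => simp at hp
    | cons w p =>
      rw [pathWeight, List.length_cons, Finset.prod_range_succ', ih (by simpa using hp), mul_comm]
      congr 1

instance (W : Word) : DecidableEq (Point W) :=
  inferInstanceAs (DecidableEq {x : ℕ × ℕ // x.2 < width W x.1})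

/-- A path lists the labels line by line, so paths correspond to nowhere zero labelings of the
points. -/
theorem stateSum_eq_sum_prod [CharP Γ 2] (z : ℝ) (D : Diagram) : stateSum Γ z D.word =
    ∑ f : Point D.word → Γ with ∀ x, f x ≠ 0,
      ∏ k ∈ Finset.range D.word.length, lineWeight z D.word (ext D.word 0 f) k := by
  obtain ⟨W, -, hT⟩ := D
  have hW : Closed W := Diagram.isClosed ⟨W, by assumption, hT⟩
  rw [stateSum, wordOp_eq_sum z hT (u := ([] : List Γ)) ⟨rfl, by simp⟩]
  have hw : ∀ p ∈ paths Γ W, ∀ k, (([] :: p).getD k []).length = width W k := by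
    intro p hp k
    rw [mem_paths] at hp
    cases k with
    | zero => simp [hW.bottom]
    | succ k =>
      by_cases hk : k < W.length
      · obtain ⟨s, hs⟩ := exists_slice hk
        rw [← hW.next k s hs, ← (hp.2 k s hs).1]; simp
      · rw [width_of_le (by omega)]
        simp [List.getElem?_eq_none (show p.length ≤ k by omega)]
  have hR : ∀ p ∈ paths Γ W, ext W 0 (fun x : Point W => row (([] :: p).getD x.1.1 []) x.1.2) =
      fun k => row (([] :: p).getD k []) := by
    intro p hp
    funext k i
    by_cases h : i < width W k
    · rw [ext_of_lt _ _ h]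
    · rw [← hw p hp k] at h
      rw [ext, dif_neg (by rwa [← hw p hp k]), row, List.getD_eq_default _ _ (by omega)]
  refine Finset.sum_nbij' (fun p x => row (([] :: p).getD x.1.1 []) x.1.2)
    (fun f => (List.range W.length).map fun k => (List.range (width W (k + 1))).map (ext W 0 f (k + 1)))
    (fun p hp => ?_) (fun f hf => ?_) (fun p hp => ?_) (fun f hf => ?_) (fun p hp => ?_)
  · have hp' := mem_paths.1 hp
    simp only [Finset.mem_filter, Finset.mem_univ, true_and]
    rintro ⟨⟨k, i⟩, h⟩
    simp only at h ⊢
    have h' := h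
    rw [← hw p hp k] at h'
    cases k with
    | zero => simp at h'
    | succ k =>
      have hk : k < W.length := by
        by_contra hk
        rw [width_of_le (by omega)] at h; omega
      obtain ⟨s, hs⟩ := exists_slice hk
      have := (hp'.2 k s hs).2
      simp only [List.getD_cons_succ] at h' ⊢
      rw [row, List.getD_eq_getElem _ _ h']
      exact this _ (List.getElem_mem h')
  · rw [mem_paths]
    refine ⟨by simp, fun k s hs => ?_⟩
    have hk := lt_of_slice hs
    simp only [Finset.mem_filter, Finset.mem_univ, true_and] at hf
    rw [List.getD_eq_getElem _ _ (by simpa using hk)]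
    refine ⟨by simp [hW.next k s hs], fun a ha => ?_⟩
    simp only [List.getElem_map, List.getElem_range, List.mem_map, List.mem_range] at ha
    obtain ⟨i, hi, rfl⟩ := ha
    rw [ext_of_lt _ _ hi]
    exact hf _
  · have hp' := mem_paths.1 hp
    rw [hR p hp]
    refine List.ext_getElem (by simp [hp'.1]) fun k h1 h2 => ?_
    have hl := hw p hp (k + 1)
    simp only [List.getD_cons_succ, List.getD_eq_getElem _ _ h2] at hl
    simp only [List.getElem_map, List.getElem_range, List.getD_cons_succ, List.getD_eq_getElem _ _ h2]
    refine List.ext_getElem (by simp [hl]) fun i h3 h4 => ?_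
    simp [row, h4]
  · funext x
    obtain ⟨⟨k, i⟩, h⟩ := x
    cases k with
    | zero => simp [hW.bottom] at h
    | succ k =>
      simp only at h
      have hk : k < W.length := by
        by_contra hk
        rw [width_of_le (by omega)] at h; omega
      simp only [List.getD_cons_succ]
      rw [List.getD_eq_getElem _ _ (by simpa using hk), row, List.getD_eq_getElem _ _ (by simpa using h)]
      simp only [List.getElem_map, List.getElem_range]
      rw [ext_of_lt _ _ h]
  · rw [pathWeight_eq_prod z (mem_paths.1 hp).1, hR p hp]

end StateSum

/-! ### The expansion of the state sum -/

/-- The group of labels. -/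
abbrev Label (m : ℕ) : Type := Fin (m + 1) → ZMod 2

instance (m : ℕ) : CharP (Label m) 2 := by infer_instance

theorem card_label (m : ℕ) : Fintype.card (Label m) = 2 ^ (m + 1) := by simp [ZMod.card]

/-- Each factor offers three choices: the vertex with weight −1 on X, the B-resolution with weight
1/z on `B`, and the A-resolution with weight z elsewhere. -/
theorem prod_expand (C : Finset ℕ) {z : ℝ} (hz : z ≠ 0) (a b : ℕ → Prop) [DecidablePred a] [DecidablePred b] :
    ∏ k ∈ C, (z * (if a k then 1 else 0) + z⁻¹ * (if b k then 1 else 0) - 1) =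
      ∑ X ∈ C.powerset, ∑ B ∈ (C \ X).powerset, (-1) ^ X.card * z ^ ((C.card : ℤ) - X.card - 2 * B.card) *
        if ∀ k ∈ C, k ∉ X → (k ∉ B → a k) ∧ (k ∈ B → b k) then 1 else 0 := by
  have e : ∀ k, z * (if a k then 1 else 0) + z⁻¹ * (if b k then 1 else 0) - 1 =
      -1 + (z⁻¹ * (if b k then 1 else 0) + z * (if a k then 1 else 0)) := fun k => by ring
  rw [Finset.prod_congr rfl fun k _ => e k, Finset.prod_add]
  refine Finset.sum_congr rfl fun X hX => ?_
  rw [Finset.prod_add, Finset.mul_sum]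
  refine Finset.sum_congr rfl fun B hB => ?_
  rw [Finset.mem_powerset] at hX hB
  rw [Finset.prod_mul_distrib, Finset.prod_mul_distrib, Finset.prod_const, Finset.prod_const, Finset.prod_const,
    Finset.prod_boole, Finset.prod_boole, Finset.card_sdiff_of_subset hB, Finset.card_sdiff_of_subset hX]
  have h1 := Finset.card_le_card hX
  have h2 := Finset.card_le_card hB
  rw [Finset.card_sdiff_of_subset hX] at h2
  have hz' : z⁻¹ ^ B.card * z ^ (C.card - X.card - B.card) = z ^ ((C.card : ℤ) - X.card - 2 * B.card) := by
    rw [inv_pow, ← zpow_natCast, ← zpow_natCast, ← zpow_neg, ← zpow_add₀ hz]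
    congr 1
    omega
  have hi : (if ∀ k ∈ C, k ∉ X → (k ∉ B → a k) ∧ (k ∈ B → b k) then (1 : ℝ) else 0) =
      (if ∀ k ∈ B, b k then 1 else 0) * if ∀ k ∈ (C \ X) \ B, a k then 1 else 0 := by
    rw [ite_zero_mul_ite_zero, mul_one]
    refine if_congr ?_ rfl rfl
    constructor
    · intro h
      refine ⟨fun k hk => ?_, fun k hk => ?_⟩
      · have := Finset.mem_sdiff.1 (hB hk)
        exact (h k this.1 this.2).2 hk
      · simp only [Finset.mem_sdiff] at hk
        exact (h k hk.1.1 hk.1.2).1 hk.2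
    · rintro ⟨h1, h2⟩ k hk hkX
      exact ⟨fun hB => h2 k (by simp [hk, hkX, hB]), h1 k⟩
  rw [hi, ← hz']
  ring

/-! ### Vector-valued labels and their coordinates. -/

section

variable {m : ℕ} {W : Word} (f : Point W → Label m)

theorem ext_apply (k i : ℕ) (j : Fin (m + 1)) : ext W 0 f k i j = ext₀ W (fun x => f x j) k i := by
  rw [ext₀_apply, ext, ext]; split_ifs <;> rfl

theorem outer_label_iff (s : Slice) (k : ℕ) : Outer s (ext W 0 f k) (ext W 0 f (k + 1)) ↔
    ∀ j, Outer s (ext₀ W (fun x => f x j) k) (ext₀ W (fun x => f x j) (k + 1)) := by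
  constructor
  · intro h j
    constructor
    · intro i hi; simp only [← ext_apply, h.left i hi]
    · intro i hi; simp only [← ext_apply, h.right i hi]
    · intro b hb; simp only [← ext_apply, h.cup b hb]
    · intro b hb; simp only [← ext_apply, h.cap b hb]
  · intro h
    constructor
    · intro i hi; funext j; simp only [ext_apply, (h j).left i hi]
    · intro i hi; funext j; simp only [ext_apply, (h j).right i hi]
    · intro b hb; funext j; simp only [ext_apply, (h j).cup b hb]
    · intro b hb; funext j; simp only [ext_apply, (h j).cap b hb]

variable {f}

theorem eq_iff_add_eq_zero (a b : ZMod 2) : a = b ↔ b + a = 0 := by revert a b; decide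

/-- The conditions in the weight become the A- and B-equations in every coordinate. When the
A-resolution is horizontal, z and 1/z are interchanged in the weight, and so are the roles of the
two conditions. -/
theorem lineWeight_of_isFlow {z : ℝ} (hf : ∀ j, IsFlow W (ext₀ W fun x => f x j)) {k : ℕ} :
    (k ∈ crossings W → lineWeight z W (ext W 0 f) k =
      z * (if ∀ j, aDiffₗ W k (fun x => f x j) = 0 then 1 else 0) +
        z⁻¹ * (if ∀ j, bDiffₗ W k (fun x => f x j) = 0 then 1 else 0) - 1) ∧
    (k ∉ crossings W → lineWeight z W (ext W 0 f) k = 1) := by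
  constructor
  · intro hk
    obtain ⟨s, o, a, b, hs, hp⟩ := mem_crossings.1 hk
    have hO := (outer_label_iff f s k).2 fun j => (hf j).1 k s hs
    have hpos := pos_eq hs
    have hov := aVert_eq hs hp
    rw [lineWeight, hs, Option.map_some, Option.getD_some, sliceWeight, if_pos hO, hp]
    simp only
    rw [if_pos (by
      funext j
      have := (hf j).2 k hk
      rw [hpos] at this
      simpa only [Pi.add_apply, ext_apply] using this), crossWeight]
    have e1 : ∀ x y : ℕ × ℕ, (ext W 0 f x.1 x.2 = ext W 0 f y.1 y.2) ↔
        ∀ j, ext₀ W (fun x => f x j) y.1 y.2 + ext₀ W (fun x => f x j) x.1 x.2 = 0 := by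
      intro x y
      rw [funext_iff]
      exact forall_congr' fun j => by rw [ext_apply, ext_apply, eq_iff_add_eq_zero]
    have h1 := e1 (k + 1, s.left.length) (k, s.left.length)
    have h2 := e1 (k, s.left.length + 1) (k, s.left.length)
    rw [eq_comm] at h2
    simp only at h1 h2
    simp only [h1, h2, aDiffₗ, bDiffₗ, LinearMap.coe_mk, AddHom.coe_mk, aDiff, bDiff, hov, hpos]
    cases o
    · simp only [Bool.false_eq_true, if_false, inv_inv]; ring
    · simp only [if_true]
  · intro hk
    rw [lineWeight]
    cases hs : W[k]? with
    | none => rfl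
    | some s =>
      have hO := (outer_label_iff f s k).2 fun j => (hf j).1 k s hs
      rw [Option.map_some, Option.getD_some, sliceWeight, if_pos hO]
      cases hp : s.piece with
      | cup b => rfl
      | cap b => rfl
      | cross o a b => exact absurd (mem_crossings.2 ⟨s, o, a, b, hs, hp⟩) hk

theorem exists_lineWeight_eq_zero {z : ℝ} (hf : ¬ ∀ j, IsFlow W (ext₀ W fun x => f x j)) :
    ∃ k ∈ Finset.range W.length, lineWeight z W (ext W 0 f) k = 0 := by
  by_contra! h
  have hO : ∀ k s, W[k]? = some s → Outer s (ext W 0 f k) (ext W 0 f (k + 1)) := by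
    intro k s hs
    by_contra hO
    exact h k (Finset.mem_range.2 (lt_of_slice hs)) (by
      rw [lineWeight, hs, Option.map_some, Option.getD_some, sliceWeight, if_neg hO])
  refine hf fun j => ⟨fun k s hs => (outer_label_iff f s k).1 (hO k s hs) j, fun k hk => ?_⟩
  obtain ⟨s, o, a, b, hs, hp⟩ := mem_crossings.1 hk
  by_contra hj
  refine h k (Finset.mem_range.2 (lt_of_slice hs)) ?_
  rw [lineWeight, hs, Option.map_some, Option.getD_some, sliceWeight, if_pos (hO k s hs), hp]
  refine if_neg fun he => hj ?_
  rw [pos_eq hs]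
  simpa only [Pi.add_apply, ext_apply] using congrFun he j

end

open Classical in
/-- The number of nowhere zero flows. -/
noncomputable def numFlows (m : ℕ) (W : Word) (B X : Finset ℕ) : ℕ :=
  Finset.card {f : Point W → Label m | (∀ x, f x ≠ 0) ∧ ∀ j, (fun x => f x j) ∈ flows W B X}

/-- The labels compatible with outer arcs and flow conditions remain; expanding the crossing weights
counts nowhere zero flows with the vertices X kept and the B-resolution at `B`. -/
theorem stateSum_eq (m : ℕ) {z : ℝ} (hz : z ≠ 0) (D : Diagram) : stateSum (Label m) z D.word =
    ∑ X ∈ (crossings D.word).powerset, ∑ B ∈ (crossings D.word \ X).powerset,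
      (-1) ^ X.card * z ^ ((c D.word : ℤ) - X.card - 2 * B.card) * numFlows m D.word B X := by
  classical
  rw [stateSum_eq_sum_prod]
  have key : ∀ f : Point D.word → Label m,
      ∏ k ∈ Finset.range D.word.length, lineWeight z D.word (ext D.word 0 f) k =
      ∑ X ∈ (crossings D.word).powerset, ∑ B ∈ (crossings D.word \ X).powerset,
      (-1) ^ X.card * z ^ ((c D.word : ℤ) - X.card - 2 * B.card) *
        if ∀ j, (fun x => f x j) ∈ flows D.word B X then 1 else 0 := by
    intro f
    by_cases hf : ∀ j, IsFlow D.word (ext₀ D.word fun x => f x j)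
    · rw [← Finset.prod_subset (s₁ := crossings D.word) (Finset.filter_subset _ _)
        fun k _ hk => (lineWeight_of_isFlow hf).2 hk, Finset.prod_congr rfl fun k hk => (lineWeight_of_isFlow hf).1 hk,
        prod_expand _ hz]
      refine Finset.sum_congr rfl fun X _ => Finset.sum_congr rfl fun B _ => ?_
      congr 1
      refine if_congr ?_ rfl rfl
      simp only [mem_flows, hf, true_and]
      constructor
      · exact fun h j k hk hX => ⟨fun hB => (h k hk hX).1 hB j, fun hB => (h k hk hX).2 hB j⟩
      · exact fun h k hk hX => ⟨fun hB j => (h j k hk hX).1 hB, fun hB j => (h j k hk hX).2 hB⟩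
    · obtain ⟨k, hk, h⟩ := exists_lineWeight_eq_zero (z := z) hf
      rw [Finset.prod_eq_zero hk h]
      symm
      refine Finset.sum_eq_zero fun X _ => Finset.sum_eq_zero fun B _ => ?_
      rw [if_neg, mul_zero]
      exact fun h' => hf fun j => (h' j).1
  rw [Finset.sum_congr rfl fun f _ => key f, Finset.sum_comm]
  refine Finset.sum_congr rfl fun X _ => ?_
  rw [Finset.sum_comm]
  refine Finset.sum_congr rfl fun B _ => ?_
  rw [← Finset.mul_sum, Finset.sum_boole, Finset.filter_filter, numFlows]

/-! ### Counting flows -/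

open Classical in
theorem card_vectors {α : Type*} [Fintype α] [DecidableEq α] (m : ℕ) (V : Submodule (ZMod 2) (α → ZMod 2)) :
    Finset.card {f : α → Label m | ∀ j, (fun x => f x j) ∈ V} = (2 ^ (m + 1)) ^ Module.finrank (ZMod 2) V := by
  let e : {f : α → Label m // ∀ j, (fun x => f x j) ∈ V} ≃ (Fin (m + 1) → V) :=
    { toFun := fun f j => ⟨fun x => f.1 x j, f.2 j⟩
      invFun := fun g => ⟨fun x j => (g j).1 x, fun j => (g j).2⟩
      left_inv := fun f => rfl
      right_inv := fun g => rfl }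
  rw [← Fintype.card_subtype, Fintype.card_congr e, Fintype.card_fun, Fintype.card_fin,
    Module.card_eq_pow_finrank (K := ZMod 2), ZMod.card, ← pow_mul, ← pow_mul, mul_comm]

theorem one_mem_flows (W : Word) (hW : Closed W) (B X : Finset ℕ) : (fun _ => 1) ∈ flows W B X :=
  flows_mono (Finset.empty_subset X) ((mem_flows_empty hW).2 fun _ _ _ => rfl)

theorem numFlows_le (m : ℕ) (W : Word) (B X : Finset ℕ) :
    numFlows m W B X ≤ (2 ^ (m + 1)) ^ flowDim W B X := by
  classical
  rw [flowDim, ← card_vectors, numFlows]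
  refine Finset.card_le_card fun f => ?_
  simp only [Finset.mem_filter, Finset.mem_univ, true_and]
  exact fun h => h.2

/-- A union bound over the points. Vanishing at a given point is one proper equation in each
coordinate, as the constant flow shows, so it removes the fraction 1/2^(m + 1) of all labelings. -/
theorem le_numFlows (m : ℕ) {W : Word} (hW : Closed W) (B X : Finset ℕ) :
    2 ^ (m + 1) * (2 ^ (m + 1)) ^ flowDim W B X ≤
      2 ^ (m + 1) * numFlows m W B X + Fintype.card (Point W) * (2 ^ (m + 1)) ^ flowDim W B X := by
  classical
  let φ : Point W → (Point W → ZMod 2) →ₗ[ZMod 2] ZMod 2 := fun x => LinearMap.proj x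
  have h : ∀ x, 2 ^ (m + 1) * Finset.card {f : Point W → Label m | ∀ j, (fun x => f x j) ∈ flows W B X ⊓ (φ x).ker} =
      (2 ^ (m + 1)) ^ flowDim W B X := by
    intro x
    rw [card_vectors, flowDim, ← finrank_inf_ker (flows W B X) (φ x) ⟨_, one_mem_flows W hW B X, one_ne_zero⟩]
    exact (mul_comm _ _).trans (pow_succ _ _).symm
  have hc : Finset.card {f : Point W → Label m | ∀ j, (fun x => f x j) ∈ flows W B X} ≤ numFlows m W B X +
      ∑ x, Finset.card {f : Point W → Label m | ∀ j, (fun x => f x j) ∈ flows W B X ⊓ (φ x).ker} := by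
    refine (Finset.card_le_card (fun f hf => ?_)).trans ((Finset.card_union_le _ _).trans
      (Nat.add_le_add_left Finset.card_biUnion_le _))
    simp only [Finset.mem_filter, Finset.mem_univ, true_and] at hf
    simp only [Finset.mem_union, Finset.mem_filter, Finset.mem_univ, true_and, Finset.mem_biUnion]
    by_cases h0 : ∀ x, f x ≠ 0
    · exact .inl ⟨h0, hf⟩
    · push Not at h0
      obtain ⟨x, hx⟩ := h0
      exact .inr ⟨x, fun j => ⟨hf j, congrFun hx j⟩⟩
  rw [card_vectors] at hc
  calc _ ≤ 2 ^ (m + 1) * _ := Nat.mul_le_mul_left _ hc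
    _ = _ := by
      rw [mul_add, Finset.mul_sum, Finset.sum_congr rfl fun x _ => h x]
      simp

/-- For the all-A state these are arbitrary functions from the circles to the nonzero labels. The
exact count allows this term to be subtracted before the next order is read off. -/
theorem numFlows_empty (m : ℕ) {W : Word} (hW : Closed W) :
    numFlows m W ∅ ∅ = (2 ^ (m + 1) - 1) ^ vA W := by
  classical
  let e : {f : Point W → Label m // (∀ x, f x ≠ 0) ∧ ∀ j, (fun x => f x j) ∈ flows W ∅ ∅} ≃
      (Curves W (state W ∅) → {a : Label m // a ≠ 0}) :=
    { toFun := fun f => Quot.lift (fun x => ⟨f.1 x, f.2.1 x⟩) fun x y hxy => Subtype.ext (funext fun j =>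
        (mem_flows_empty hW).1 (f.2.2 j) x y hxy)
      invFun := fun g => ⟨fun x => (g (Quot.mk _ x)).1, fun x => (g (Quot.mk _ x)).2, fun j =>
        (mem_flows_empty hW).2 fun x y hxy =>
          congrArg (fun q : Curves W (state W ∅) => (g q).1 j) (Quot.sound hxy)⟩
      left_inv := fun f => rfl
      right_inv := fun g => by funext q; induction q using Quot.ind; rfl }
  rw [numFlows, ← Fintype.card_subtype, Fintype.card_congr e, Fintype.card_fun, vA, circles, Nat.card_eq_fintype_card,
    Fintype.card_subtype_compl, card_label, Fintype.card_subtype_eq]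

theorem flowDim_le {W : Word} (hW : Closed W) {B X : Finset ℕ} (hB : B ⊆ crossings W) (hX : X ⊆ crossings W) :
    flowDim W B X ≤ flowDim W ∅ (X ∪ B) ∧ flowDim W ∅ (X ∪ B) ≤ vA W + (X ∪ B).card := by
  refine ⟨Submodule.finrank_mono mem_flows_union, ?_⟩
  have := flowDim_union_le (W := W) (B := ∅) (X := ∅) (T := X ∪ B) (Finset.union_subset hX hB)
    (Finset.disjoint_empty_right _) (Finset.disjoint_empty_right _)
  rwa [Finset.empty_union, flowDim_empty hW] at this

-- For an adequate diagram only X = ∅ attains the maximal dimension. Otherwise toggling a self-chord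
-- raises the dimension and |X| together, and the terms cancel in pairs.
open Classical in
theorem sum_flowDim {W : Word} (hW : Closed W) : ∑ X ∈ (crossings W).powerset,
    (if flowDim W ∅ X = vA W + X.card then (-1 : ℝ) ^ X.card else 0) = if Adequate W then 1 else 0 := by
  split_ifs with h
  · rw [Finset.sum_eq_single ∅]
    · rw [if_pos ((h.flowDim_eq_iff hW (Finset.empty_subset _)).1.2 rfl)]; simp
    · intro X hX hne
      exact if_neg fun h' => hne ((h.flowDim_eq_iff hW (Finset.mem_powerset.1 hX)).1.1 h')
    · simp
  · simp only [Adequate, not_forall, not_not] at h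
    obtain ⟨x, hx, hxx⟩ := h
    rw [← Finset.insert_erase hx, Finset.sum_powerset_insert (Finset.notMem_erase x _), ← Finset.sum_add_distrib]
    refine Finset.sum_eq_zero fun X hX => ?_
    have hxX : x ∉ X := fun h => Finset.notMem_erase x _ (Finset.mem_powerset.1 hX h)
    rw [flowDim_insert_chord hW hx hxX hxx, Finset.card_insert_of_notMem hxX, pow_succ]
    have : flowDim W ∅ X + 1 = vA W + (X.card + 1) ↔ flowDim W ∅ X = vA W + X.card := by omega
    simp only [this]
    split_ifs <;> ring

/-! ### The leading terms of the state sum -/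

open Filter Topology

/-- The values of the variable at which the state sum is an invariant. -/
theorem exists_variable (m : ℕ) : ∃ z : ℝ, 2 ^ (m + 1) - 1 ≤ z ∧ z + z⁻¹ + 2 = 2 ^ (m + 2) := by
  have h2 : (1 : ℝ) ≤ 2 ^ m := one_le_pow₀ (by norm_num)
  have hS : (2 : ℝ) ≤ 2 ^ (m + 2) - 2 := by rw [pow_add]; linarith
  set S : ℝ := 2 ^ (m + 2) - 2 with hSd
  have hr : 0 ≤ √(S ^ 2 - 4) := Real.sqrt_nonneg _
  have hr2 : √(S ^ 2 - 4) ^ 2 = S ^ 2 - 4 := Real.sq_sqrt (by nlinarith)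
  -- The larger root of z + 1/z = S. It is at least S/2, so it tends to infinity with m.
  refine ⟨(S + √(S ^ 2 - 4)) / 2, ?_, ?_⟩
  · have : (2 : ℝ) ^ (m + 1) - 1 = S / 2 := by rw [hSd, pow_succ, pow_succ, pow_succ]; ring
    rw [this]; linarith
  · have : ((S + √(S ^ 2 - 4)) / 2)⁻¹ = (S - √(S ^ 2 - 4)) / 2 := by
      apply inv_eq_of_mul_eq_one_right
      nlinarith
    rw [this]
    have : (2 : ℝ) ^ (m + 2) = S + 2 := by rw [hSd]; ring
    rw [this]; ring

/-- The order of the group is asymptotic to z, and almost all flows with values in a large group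
vanish nowhere. -/
theorem tendsto_numFlows {z : ℕ → ℝ} (hz : Tendsto z atTop atTop)
    (hc : ∀ m, z m + (z m)⁻¹ + 2 = 2 ^ (m + 2)) {W : Word} (hW : Closed W) (B X : Finset ℕ) :
    Tendsto (fun m => numFlows (m + 1) W B X / z m ^ flowDim W B X) atTop (𝓝 1) := by
  set d := flowDim W B X
  set P := Fintype.card (Point W)
  have hi : Tendsto (fun m => (z m)⁻¹) atTop (𝓝 0) := tendsto_inv_atTop_zero.comp hz
  have hp : ∀ᶠ m in atTop, 0 < z m := hz.eventually_gt_atTop 0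
  have hQ : Tendsto (fun m : ℕ => (2 : ℝ) ^ (m + 2)) atTop atTop :=
    (tendsto_pow_atTop_atTop_of_one_lt one_lt_two).comp (tendsto_add_atTop_nat 2)
  have hratio : Tendsto (fun m => ((2 : ℝ) ^ (m + 2) / z m) ^ d) atTop (𝓝 1) := by
    have : Tendsto (fun m => (1 + (z m)⁻¹ * (z m)⁻¹ + 2 * (z m)⁻¹) ^ d) atTop (𝓝 1) := by
      have := ((tendsto_const_nhds (x := (1 : ℝ))).add (hi.mul hi)).add (hi.const_mul 2)
      simpa using this.pow d
    refine this.congr' ?_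
    filter_upwards [hp] with m hm
    rw [← hc m]
    congr 1
    field_simp
  have hlow : Tendsto (fun m : ℕ => (1 - P * ((2 : ℝ) ^ (m + 2))⁻¹) * ((2 : ℝ) ^ (m + 2) / z m) ^ d) atTop (𝓝 1) := by
    have := ((tendsto_const_nhds (x := (1 : ℝ))).sub ((tendsto_inv_atTop_zero.comp hQ).const_mul (P : ℝ))).mul hratio
    simpa using this
  refine tendsto_of_tendsto_of_tendsto_of_le_of_le' hlow hratio ?_ ?_
  · filter_upwards [hp] with m hm
    have h : (2 : ℝ) ^ (m + 2) * (2 ^ (m + 2)) ^ d ≤ 2 ^ (m + 2) * numFlows (m + 1) W B X + P * (2 ^ (m + 2)) ^ d := by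
      exact_mod_cast le_numFlows (m + 1) hW B X
    have hq : (0 : ℝ) < 2 ^ (m + 2) := by positivity
    rw [div_pow, ← mul_div_assoc]
    gcongr
    rw [← mul_le_mul_iff_right₀ hq]
    have : (2 : ℝ) ^ (m + 2) * ((1 - P * ((2 : ℝ) ^ (m + 2))⁻¹) * (2 ^ (m + 2)) ^ d) =
        (2 : ℝ) ^ (m + 2) * (2 ^ (m + 2)) ^ d - P * (2 ^ (m + 2)) ^ d := by field_simp
    rw [this]; linarith
  · filter_upwards [hp] with m hm
    rw [div_pow]
    gcongr
    exact_mod_cast numFlows_le (m + 1) W B X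

/-- The pairs of disjoint sets of crossings. -/
def disjointPairs (W : Word) : Finset (Σ _ : Finset ℕ, Finset ℕ) :=
  (crossings W).powerset.sigma fun X => (crossings W \ X).powerset

/-- The difference of the degrees of the leading term and of the term of a pair of sets of crossings. -/
noncomputable def defect (W : Word) (p : Σ _ : Finset ℕ, Finset ℕ) : ℕ :=
  vA W + p.1.card + 2 * p.2.card - flowDim W p.2 p.1

/-- A B-resolution lowers the exponent of z by two relative to an A-resolution, but raises the bound
on the dimension by at most one. Every element of `B` thus costs at least one degree. -/
theorem defect_add {W : Word} (hW : Closed W) {p : Σ _ : Finset ℕ, Finset ℕ} (hp : p ∈ disjointPairs W) :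
    defect W p + flowDim W p.2 p.1 = vA W + p.1.card + 2 * p.2.card ∧ p.2.card ≤ defect W p := by
  simp only [disjointPairs, Finset.mem_sigma, Finset.mem_powerset] at hp
  have h := flowDim_le hW (hp.2.trans Finset.sdiff_subset) hp.1
  have := Finset.card_union_le p.1 p.2
  rw [defect]
  omega

theorem stateSum_div (m : ℕ) {z : ℝ} (hz : z ≠ 0) (D : Diagram) :
    stateSum (Label m) z D.word / z ^ (c D.word + vA D.word) = ∑ p ∈ disjointPairs D.word,
      (-1) ^ p.1.card * ((z⁻¹) ^ defect D.word p * (numFlows m D.word p.2 p.1 / z ^ flowDim D.word p.2 p.1)) := by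
  rw [stateSum_eq m hz, Finset.sum_sigma', Finset.sum_div]
  refine Finset.sum_congr rfl fun p hp => ?_
  have h := (defect_add D.isClosed hp).1
  have : z ^ ((c D.word : ℤ) - p.1.card - 2 * p.2.card) / z ^ (c D.word + vA D.word) =
      (z⁻¹) ^ defect D.word p * (z ^ flowDim D.word p.2 p.1)⁻¹ := by
    rw [inv_pow, ← mul_inv, ← pow_add, h, div_eq_iff (pow_ne_zero _ hz), ← zpow_natCast z (_ + _ + _), ← zpow_neg,
      ← zpow_natCast z (_ + _), ← zpow_add₀ hz]
    congr 1
    push_cast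
    ring
  calc _ = (-1) ^ p.1.card * (z ^ ((c D.word : ℤ) - p.1.card - 2 * p.2.card) / z ^ (c D.word + vA D.word)) *
        numFlows m D.word p.2 p.1 := by ring
    _ = _ := by rw [this]; ring

theorem tendsto_term {z : ℕ → ℝ} (hz : Tendsto z atTop atTop)
    (hc : ∀ m, z m + (z m)⁻¹ + 2 = 2 ^ (m + 2)) {W : Word} (hW : Closed W) (B X : Finset ℕ) (e : ℕ) :
    Tendsto (fun m => (-1) ^ X.card * ((z m)⁻¹ ^ e * (numFlows (m + 1) W B X / z m ^ flowDim W B X))) atTop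
      (𝓝 (if e = 0 then (-1) ^ X.card else 0)) := by
  have hi : Tendsto (fun m => (z m)⁻¹) atTop (𝓝 0) := tendsto_inv_atTop_zero.comp hz
  have := ((hi.pow e).mul (tendsto_numFlows hz hc hW B X)).const_mul ((-1 : ℝ) ^ X.card)
  convert this using 2
  split_ifs with h
  · simp [h]
  · simp [h]

-- Only terms of defect zero survive. They have empty B-set and maximal dimension, and `sum_flowDim`
-- adds up their signs.
open Classical in
theorem tendsto_leading {z : ℕ → ℝ} (hz : Tendsto z atTop atTop)
    (hc : ∀ m, z m + (z m)⁻¹ + 2 = 2 ^ (m + 2)) (D : Diagram) :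
    Tendsto (fun m => stateSum (Label (m + 1)) (z m) D.word / z m ^ (c D.word + vA D.word)) atTop
      (𝓝 (if Adequate D.word then 1 else 0)) := by
  have h := tendsto_finsetSum (disjointPairs D.word) fun p _ =>
    tendsto_term hz hc D.isClosed p.2 p.1 (defect D.word p)
  have hs : ∑ p ∈ disjointPairs D.word, (if defect D.word p = 0 then (-1 : ℝ) ^ p.1.card else 0) =
      if Adequate D.word then 1 else 0 := by
    rw [← sum_flowDim D.isClosed, disjointPairs, Finset.sum_sigma]
    refine Finset.sum_congr rfl fun X hX => ?_
    rw [Finset.sum_eq_single ∅]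
    · have hp : (⟨X, ∅⟩ : Σ _ : Finset ℕ, Finset ℕ) ∈ disjointPairs D.word := by
        simpa [disjointPairs] using hX
      have := (defect_add D.isClosed hp).1
      simp only [Finset.card_empty] at this
      refine if_congr ?_ rfl rfl
      omega
    · intro B hB hne
      have hp : (⟨X, B⟩ : Σ _ : Finset ℕ, Finset ℕ) ∈ disjointPairs D.word := by
        simp only [disjointPairs, Finset.mem_sigma]; exact ⟨hX, hB⟩
      have := (defect_add D.isClosed hp).2
      have := Finset.card_pos.2 (Finset.nonempty_iff_ne_empty.2 hne)
      exact if_neg (by simp only at *; omega)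
    · simp
  rw [← hs]
  refine h.congr' ?_
  filter_upwards [hz.eventually_gt_atTop 0] with m hm
  rw [stateSum_div _ hm.ne']

/-- Once the all-A term is subtracted exactly, the terms of defect one dominate. For an adequate
diagram these are the bundles X with empty B-set, whose signs add up to −`numPairs`. -/
theorem tendsto_second {z : ℕ → ℝ} (hz : Tendsto z atTop atTop)
    (hc : ∀ m, z m + (z m)⁻¹ + 2 = 2 ^ (m + 2)) (D : Diagram) (hD : Adequate D.word) :
    Tendsto (fun m => z m * (stateSum (Label (m + 1)) (z m) D.word / z m ^ (c D.word + vA D.word) -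
      ((2 ^ (m + 2) - 1) / z m) ^ vA D.word)) atTop (𝓝 (-numPairs D.word : ℝ)) := by
  classical
  have hW := D.isClosed
  set S := disjointPairs D.word
  have h0 : (⟨∅, ∅⟩ : Σ _ : Finset ℕ, Finset ℕ) ∈ S := by simp [S, disjointPairs]
  have hpos : ∀ p ∈ S.erase ⟨∅, ∅⟩, 1 ≤ defect D.word p := by
    rintro ⟨X, B⟩ hp
    rw [Finset.mem_erase] at hp
    have hp' := hp.2
    simp only [S, disjointPairs, Finset.mem_sigma, Finset.mem_powerset] at hp'
    have h1 := defect_add hW hp.2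
    have h2 := flowDim_le hW (hp'.2.trans Finset.sdiff_subset) hp'.1
    have h3 := Finset.card_union_le X B
    by_contra h
    have hB : B = ∅ := Finset.card_eq_zero.1 (by simp only at h1; omega)
    subst hB
    have hX := (hD.flowDim_eq_iff hW hp'.1).1.1 (by simp only [Finset.card_empty] at h1; omega)
    exact hp.1 (by rw [hX])
  have h := tendsto_finsetSum (S.erase ⟨∅, ∅⟩) fun p _ =>
    tendsto_term hz hc hW p.2 p.1 (defect D.word p - 1)
  have hs : ∑ p ∈ S.erase ⟨∅, ∅⟩, (if defect D.word p - 1 = 0 then (-1 : ℝ) ^ p.1.card else 0) =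
      -numPairs D.word := by
    have := sum_parallel D.word
    have h' : (∑ H ∈ (crossings D.word).powerset with Parallel D.word H, (-1 : ℝ) ^ H.card) = -numPairs D.word := by
      exact_mod_cast congrArg (Int.cast : ℤ → ℝ) this
    rw [← h', Finset.sum_ite, Finset.sum_const_zero, add_zero]
    symm
    refine Finset.sum_bij (fun X _ => ⟨X, ∅⟩) ?_ (by simp) ?_ (by simp)
    · intro X hX
      rw [Finset.mem_filter] at hX
      have hX' := Finset.mem_powerset.1 hX.1
      have h1 := (hD.flowDim_eq_iff hW hX').2.2 hX.2
      have hp : (⟨X, ∅⟩ : Σ _ : Finset ℕ, Finset ℕ) ∈ S := by simpa [S, disjointPairs] using hX'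
      have h2 := (defect_add hW hp).1
      simp only [Finset.card_empty] at h2
      obtain ⟨e, he, -⟩ := hX.2
      rw [Finset.mem_filter, Finset.mem_erase]
      refine ⟨⟨fun h => ?_, hp⟩, by omega⟩
      obtain rfl : X = ∅ := congrArg Sigma.fst h
      exact absurd he (Finset.notMem_empty e)
    · rintro ⟨X, B⟩ hp
      rw [Finset.mem_filter] at hp
      have hd := hpos _ hp.1
      have hp' := (Finset.mem_erase.1 hp.1).2
      have h1 := (defect_add hW hp').1
      simp only [S, disjointPairs, Finset.mem_sigma, Finset.mem_powerset] at hp'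
      have hB' := hp'.2.trans Finset.sdiff_subset
      have h2 := flowDim_le hW hB' hp'.1
      have h3 := Finset.card_union_le X B
      simp only at h1
      -- A nonempty `B` already costs |B|, and adequacy lowers the dimension bound for X ∪ B by at
      -- least one more, so the defect would exceed one.
      obtain rfl : B = ∅ := by
        by_contra hB
        have hB0 := Finset.card_pos.2 (Finset.nonempty_iff_ne_empty.2 hB)
        have h4 := (hD.flowDim_eq_iff hW (Finset.union_subset hp'.1 hB')).1.1
        have h5 : X ∪ B ≠ ∅ := fun h => hB (Finset.union_eq_empty.1 h).2
        have h6 : flowDim D.word ∅ (X ∪ B) ≠ vA D.word + (X ∪ B).card := fun h => h5 (h4 h)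
        omega
      refine ⟨X, ?_, rfl⟩
      rw [Finset.mem_filter]
      refine ⟨Finset.mem_powerset.2 hp'.1, (hD.flowDim_eq_iff hW hp'.1).2.1 ?_⟩
      simp only [Finset.card_empty] at h1
      omega
  rw [← hs]
  refine h.congr' ?_
  filter_upwards [hz.eventually_gt_atTop 0] with m hm
  rw [stateSum_div _ hm.ne', ← Finset.add_sum_erase _ _ h0]
  have e0 : defect D.word ⟨∅, ∅⟩ = 0 := by
    simp [defect, flowDim_empty hW, vA]
  have e1 : flowDim D.word ∅ ∅ = vA D.word := flowDim_empty hW ∅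
  have e2 : (numFlows (m + 1) D.word ∅ ∅ : ℝ) = (2 ^ (m + 2) - 1) ^ vA D.word := by
    rw [numFlows_empty _ hW, Nat.cast_pow, Nat.cast_sub Nat.one_le_two_pow]; norm_cast
  simp only [e0, e1, e2, Finset.card_empty, pow_zero, one_mul, ← div_pow]
  rw [add_sub_cancel_left, Finset.mul_sum]
  refine Finset.sum_congr rfl fun p hp => ?_
  obtain ⟨k, hk⟩ := Nat.exists_eq_add_of_le' (hpos p hp)
  rw [hk, Nat.add_sub_cancel, pow_succ]
  field_simp

/-! ### Minimal diagrams -/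

open Filter Topology

theorem stateSum_eq_of_writhe (m : ℕ) {z : ℝ} (hz : z ≠ 0) (hc : z + z⁻¹ + 2 = 2 ^ (m + 2)) {K : Link}
    {D D' : Diagram} (hD : D ∈ diagrams K) (hD' : D' ∈ diagrams K) (hw : writhe D.word = writhe D'.word) :
    stateSum (Label (m + 1)) z D.word = stateSum (Label (m + 1)) z D'.word := by
  have := stateSum_eq_of_diagrams (Label (m + 1)) z hz (by rw [card_label, hc]; norm_cast) hD hD'
  rw [hw] at this
  exact mul_left_cancel₀ (zpow_ne_zero _ hz) this

/-- Two diagrams of a link with the same numbers of crossings, of negative crossings and of circles of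
the all-`A` state. -/
theorem adequate_iff_of_diagrams {K : Link} {D D' : Diagram} (hD : D ∈ diagrams K) (hD' : D' ∈ diagrams K)
    (hw : writhe D.word = writhe D'.word) (hc : c D.word = c D'.word) (hv : vA D.word = vA D'.word) :
    (Adequate D.word ↔ Adequate D'.word) ∧ (Adequate D.word → numPairs D.word = numPairs D'.word) := by
  choose z hz1 hz2 using exists_variable
  have hz : Tendsto z atTop atTop := by
    refine tendsto_atTop_mono hz1 (tendsto_atTop_add_const_right _ _ ?_)
    exact (tendsto_pow_atTop_atTop_of_one_lt one_lt_two).comp (tendsto_add_atTop_nat 1)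
  have h0 : ∀ᶠ m in atTop, stateSum (Label (m + 1)) (z m) D.word = stateSum (Label (m + 1)) (z m) D'.word := by
    filter_upwards [hz.eventually_gt_atTop 0] with m hm
    exact stateSum_eq_of_writhe m hm.ne' (hz2 m) hD hD' hw
  -- The state sums coincide for large m and are divided by the same power of z, so their limits
  -- agree.
  have hA : Adequate D.word ↔ Adequate D'.word := by
    have h1 := tendsto_leading hz hz2 D
    have h2 := tendsto_leading hz hz2 D'
    rw [← hc, ← hv] at h2
    have := tendsto_nhds_unique (h1.congr' (h0.mono fun m hm => by rw [hm])) h2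
    by_cases a : Adequate D.word <;> by_cases b : Adequate D'.word <;> simp [a, b] at this ⊢
  refine ⟨hA, fun hAD => ?_⟩
  have h1 := tendsto_second hz hz2 D hAD
  have h2 := tendsto_second hz hz2 D' (hA.1 hAD)
  rw [← hc, ← hv] at h2
  have := tendsto_nhds_unique (h1.congr' (h0.mono fun m hm => by rw [hm])) h2
  exact_mod_cast neg_injective this

/-- Lexicographic minima agree in each component. The first two determine the writhe, and then the
third determines v_A. -/
theorem minDiagrams_spec {K : Link} {D D' : Diagram} (hD : D ∈ minDiagrams K) (hD' : D' ∈ minDiagrams K) :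
    D ∈ diagrams K ∧ D' ∈ diagrams K ∧ writhe D.word = writhe D'.word ∧ c D.word = c D'.word ∧
      vA D.word = vA D'.word := by
  have h1 := le_antisymm (hD.1.1.2 D' hD'.1.1.1) (hD'.1.1.2 D hD.1.1.1)
  have h2 := le_antisymm (hD.1.2 D' hD'.1.1) (hD'.1.2 D hD.1.1)
  have h3 := le_antisymm (hD.2 D' hD'.1) (hD'.2 D hD.1)
  have hw : writhe D.word = writhe D'.word := by rw [writhe, writhe, h1, h2]
  exact ⟨hD.1.1.1, hD'.1.1.1, hw, h2, by rw [hw] at h3; omega⟩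

theorem exists_minimizer {α : Type*} {S : Set α} (hS : S.Nonempty) (f : α → ℕ) :
    ∃ x ∈ S, ∀ y ∈ S, f x ≤ f y := by
  obtain ⟨x, hx, h⟩ := (measure f).wf.has_min S hS
  exact ⟨x, hx, fun y hy => not_lt.1 (h y hy)⟩

/-- The third component is an integer and may be negative. Once the first two are minimal the writhe
is fixed, so minimizing the natural number v_A suffices. -/
theorem minDiagrams_nonempty (K : Link) : (minDiagrams K).Nonempty := by
  obtain ⟨D₀, h₀⟩ := Quot.exists_rep K
  obtain ⟨D₁, h₁, m₁⟩ := exists_minimizer (S := diagrams K) ⟨D₀, h₀⟩ fun D => cNeg D.word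
  obtain ⟨D₂, h₂, m₂⟩ := exists_minimizer (S := minNegDiagrams K) ⟨D₁, h₁, m₁⟩ fun D => c D.word
  obtain ⟨D₃, h₃, m₃⟩ := exists_minimizer (S := minCrossingDiagrams K) ⟨D₂, h₂, m₂⟩ fun D => vA D.word
  refine ⟨D₃, h₃, fun D hD => ?_⟩
  have h1 := le_antisymm (h₃.1.2 D hD.1.1) (hD.1.2 D₃ h₃.1.1)
  have h2 := le_antisymm (h₃.2 D hD.1) (hD.2 D₃ h₃.1)
  rw [writhe, writhe, h1, h2]
  have := m₃ D hD
  omega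

theorem existsUnique_value {S : Set Diagram} (hS : S.Nonempty) (F : Diagram → ℕ → ℤ) (g : Diagram → ℤ)
    (hF : ∀ D ∈ S, ∀ n, 2 < n → F D n = g D) (hg : ∀ D ∈ S, ∀ D' ∈ S, g D = g D') :
    ∃! a : ℤ, ∀ D ∈ S, ∀ n : ℕ, 2 < n → F D n = a := by
  obtain ⟨D₀, h₀⟩ := hS
  refine ⟨g D₀, fun D hD n hn => (hF D hD n hn).trans (hg D hD D₀ h₀), fun a ha => ?_⟩
  rw [← ha D₀ h₀ 3 (by norm_num), hF D₀ h₀ 3 (by norm_num)]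

end LinkDiagram

theorem corollary3p4 (K : LinkDiagram.Link) :
    (∃! α : ℤ, ∀ D ∈ LinkDiagram.minDiagrams K, ∀ n : ℕ, 2 < n → LinkDiagram.alpha D n = α) ∧
    ((∀ D ∈ LinkDiagram.minDiagrams K, LinkDiagram.EveryCurveCrosses D.word) →
      ∃! β : ℤ, ∀ D ∈ LinkDiagram.minDiagrams K, ∀ n : ℕ, 2 < n → LinkDiagram.beta D n = β) := by
  classical
  refine ⟨LinkDiagram.existsUnique_value (LinkDiagram.minDiagrams_nonempty K) LinkDiagram.alpha _
      (fun D _ n hn => LinkDiagram.alpha_eq D hn) fun D hD D' hD' => ?_, fun hK =>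
    LinkDiagram.existsUnique_value (LinkDiagram.minDiagrams_nonempty K) LinkDiagram.beta _
      (fun D hD n hn => LinkDiagram.beta_eq D (hK D hD) hn) fun D hD D' hD' => ?_⟩
  · obtain ⟨h1, h2, hw, hc, hv⟩ := LinkDiagram.minDiagrams_spec hD hD'
    exact if_congr (LinkDiagram.adequate_iff_of_diagrams h1 h2 hw hc hv).1 rfl rfl
  · obtain ⟨h1, h2, hw, hc, hv⟩ := LinkDiagram.minDiagrams_spec hD hD'
    obtain ⟨hA, hp⟩ := LinkDiagram.adequate_iff_of_diagrams h1 h2 hw hc hv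
    by_cases h : LinkDiagram.Adequate D.word
    · rw [if_pos h, if_pos (hA.1 h), hp h, hv]
    · rw [if_neg h, if_neg fun h' => h (hA.2 h')]
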